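/- **Calculi.** Fix a countably infinite set of names; *values* $v$ are names, $\mathsf{true}$, $\mathsf{false}$ and $()$. Qualifiers are $q\in\{\mathsf{lin},\mathsf{un}\}$, polarities $\star\in\{!,?\}$, and $\overline{!}={?}$, $\overline{?}={!}$. Terms are taken up to $\alpha$-conversion. $\mathrm{CMV}^+$ (mixed sessions) has the processes $$P ::= q\,x\sum_{i\in I} M_i \mid P|P \mid (\nu yz)P \mid \mathsf{if}\ v\ \mathsf{then}\ P\ \mathsf{else}\ P\mid \mathbf 0,\qquad M ::= \ell!v.P \mid \ell?z.P$$ with $I$ finite and nonempty ($z$ is bound in $\ell?z.P$; a label-polarity pair may occur several times in a sum). $\mathrm{CMV}$ replaces choices by output $x!v.P$, input $q\,x?z.P$, selection $x\triangleleft \ell.P$ and branching $x\triangleright\{\ell:P_\ell\}_{\ell\in L}$. Structural congruence $\equiv$ is the least congruence with $(\nu yz)\mathbf 0\equiv\mathbf 0$, $(\nu wx)(\nu yz)P\equiv(\nu yz)(\nu wx)P$, $P|(\nu yz)Q\equiv(\nu yz)(P|Q)$ for $y,z$ not free in $P$, $(\nu yz)P\equiv(\nu zy)P$, and the commutative monoid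 laws of $(|,\mathbf 0)$. Reduction $\to$ is closed under $|$, $\nu$ and $\equiv$; conditionals on $\mathsf{true}$, $\mathsf{false}$ reduce to the respective branch; in $\mathrm{CMV}^+$, $(\nu yz)(q_1\,y(\ell!v.P+M)\,|\,q_2\,z(\ell?x.Q+N)\,|\,R)\to(\nu yz)(P\,|\,Q\{v/x\}\,|\,R)$, where a choice whose qualifier is $\mathsf{un}$ in addition stays; in $\mathrm{CMV}$, $(\nu yz)(y!v.P\,|\,q\,z?x.Q\,|\,R)\to(\nu yz)(P\,|\,Q\{v/x\}\,|\,R)$, where the input in addition stays if $q=\mathsf{un}$, and $(\nu yz)(y\triangleleft \ell.P\,|\,z\triangleright\{\ell':Q_{\ell'}\}_{\ell'\in L}\,|\,R)\to(\nu yz)(P\,|\,Q_\ell\,|\,R)$ for $\ell\in L$. $\Rightarrow$ is the reflexive transitive closure of $\to$; $P\to^\omega$ means that $P$ has an infinite sequence of steps. $P\downarrow_y$ means that $P$ has an unguarded choice (output, input, selection, branching) on the free name $y$, and $P\Downarrow_y$ that $P\Rightarrow P'\downarrow_y$ for some $P'$. $P$ is *distributable into* $P_1,\dots,P_n$ if $P\equiv(\nu\tilde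 y\tilde z)(P_1|\dots|P_n)$. **Types.** $T::=\mathsf{unit}\mid\mathsf{bool}\mid\mathsf{end}\mid q\,\sharp\{\ell_i\star_iT_i.U_i\}_{i\in I}\mid t\mid\mu t.T$ with $\sharp\in\{\oplus,\&\}$ (internal, external) and pairwise distinct pairs $\ell_i\star_i$; types are equi-recursive. $T$ is unrestricted if its unfolded head is $\mathsf{unit}$, $\mathsf{bool}$, $\mathsf{end}$ or an $\mathsf{un}$ choice, and linear otherwise. Subtyping $<:$ is coinductive: the base types and $\mathsf{end}$ are each below themselves; $q\oplus$ types may lose and $q\&$ types may gain branches, and on the common branches payloads are contravariant for $!$ and covariant for $?$, continuations are covariant. Duality $\perp$ is coinductive: $\mathsf{end}\perp\mathsf{end}$, and $q\sharp\{\ell_i\star_iT_i.U_i\}\perp q\flat\{\ell_i\overline{\star_i}T_i'.U_i'\}$ if $\{\sharp,\flat\}=\{\oplus,\&\}$, $T_i<:T_i'<:T_i$ and $U_i\perp U_i'$. A split $\Gamma=\Gamma_1\circ\Gamma_2$ copies the unrestricted entries and gives each linear entry to exactly one side. The update $\Gamma+x{:}U$ is $\Gamma,x{:}U$ if $x\notin\mathrm{dom}\,\Gamma$,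 and $\Gamma$ if $\Gamma(x)$ is unrestricted and $\Gamma(x)<:U$. Values: $\Gamma\vdash x:U$ if $\Gamma(x)<:U$ and all other entries of $\Gamma$ are unrestricted; constants have their base type if $\Gamma$ is unrestricted. Processes: $\Gamma\vdash\mathbf 0$ if $\Gamma$ is unrestricted; $\Gamma_1\circ\Gamma_2\vdash P|Q$ if $\Gamma_1\vdash P$ and $\Gamma_2\vdash Q$; $\Gamma\vdash(\nu xy)P$ if $\Gamma,x{:}T,y{:}U\vdash P$ with $T\perp U$; $\Gamma_1\circ\Gamma_2\vdash\mathsf{if}\ v\ \mathsf{then}\ P\ \mathsf{else}\ Q$ if $\Gamma_1\vdash v:\mathsf{bool}$, $\Gamma_2\vdash P$ and $\Gamma_2\vdash Q$; $\Gamma_1\circ\Gamma_2\vdash q\,x\sum_jM_j$ if ($q=\mathsf{un}$ only when $\Gamma_1\circ\Gamma_2$ is unrestricted) $\Gamma_1\vdash x:q'\sharp\{\ell_i\star_iT_i.U_i\}_{i}$, the label-polarity pairs of the $M_j$ are exactly the $\ell_i\star_i$, and each branch $M_j$ with pair $\ell_i\star_i$ is well-typed in $\Delta=\Gamma_2+x{:}U_i$: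 $\ell_i!v.P$ if $\Delta=\Delta_1\circ\Delta_2$, $\Delta_1\vdash v:T_i$, $\Delta_2\vdash P$, and $\ell_i?z.P$ if $\Delta,z{:}T_i\vdash P$. **Encoding.** $[\![\cdot]\!]$ maps a typing derivation of $\Gamma\vdash S$ in $\mathrm{CMV}^+$ (also written $S$) to a $\mathrm{CMV}$ process. It is homomorphic on $\mathbf 0$, $|$, $\nu$ and conditionals. For a family of processes put $\mathrm{NDC}\{P_i\}_{i\in I}=(\nu st)(s\triangleright\{\ell_i:P_i\}_{i\in I}\,|\,\prod_{i\in I}t\triangleleft \ell_i.\mathbf 0)$ with distinct labels $\ell_i$ and fresh $s,t$. Consider a choice $q\,x\sum_jM_j$ where $x$ has a type $q'\sharp\{\dots\}$. For an endpoint $c$ and a label-polarity pair $k$ let $D_k(c)=\mathrm{NDC}$ of the processes $c!v.[\![P]\!]$, resp. $\mathsf{lin}\,c?z.[\![P]\!]$, over all branches $\ell!v.P$, resp. $\ell?z.P$, with the pair $k$. The pair $k=\ell\star$ becomes the label $\ell_\star$ if $\sharp=\oplus$ and $\ell_{\overline\star}$ if $\sharp=\&$; write $\hat k$ for it; $k$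 ranges over the pairs that occur in the choice. The translation is - $x\triangleright\{\hat k:D_k(x)\}_k$ if $q'\sharp=\mathsf{lin}\,\&$; - $\mathrm{NDC}\{x\triangleleft\hat k.D_k(x)\}_k$ if $q'\sharp=\mathsf{lin}\oplus$; - $q\,x?c.\,c\triangleright\{\hat k:D_k(c)\}_k$ if $q'\sharp=\mathsf{un}\,\&$; - $N=\mathrm{NDC}\{(\nu cd)\,x!c.\,d\triangleleft\hat k.D_k(d)\}_k$ if $q'\sharp=\mathsf{un}\oplus$ and $q=\mathsf{lin}$; - $(\nu uv)(u!().\mathbf 0\,|\,\mathsf{un}\,v?\_.N')$ if $q'\sharp=\mathsf{un}\oplus$ and $q=\mathsf{un}$, where $N'$ is $N$ with each $[\![P]\!]$ replaced by $[\![P]\!]\,|\,u!().\mathbf 0$, with fresh $c,d,u,v$. **Behaviour.** A relation $\mathcal R$ is a (weak reduction, barbed) *coupled simulation* if for all $(P,Q)\in\mathcal R$: $P\Rightarrow P'$ implies $Q\Rightarrow Q'$ with $(P',Q')\in\mathcal R$ for some $Q'$; $P\Rightarrow P'$ implies $Q\Rightarrow Q'$ with $(Q',P')\in\mathcal R$ for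 some $Q'$; and $P\Downarrow_y$ implies $Q\Downarrow_y$ for all $y$. Two terms are *coupled similar* if a coupled simulation relates them in both directions. $\mathcal R$ is a *bisimulation* if for all $(P,Q)\in\mathcal R$: $P\Rightarrow P'$ implies $Q\Rightarrow Q'$ with $(P',Q')\in\mathcal R$ for some $Q'$; $Q\Rightarrow Q'$ implies $P\Rightarrow P'$ with $(P',Q')\in\mathcal R$ for some $P'$; and $P\Downarrow_y$ iff $Q\Downarrow_y$ for all $y$. Let $\approx$ be bisimilarity on $\mathrm{CMV}$, the union of all bisimulations. **Theorem.** The encoding $[\![\cdot]\!]$ from $\mathrm{CMV}^+$ into $\mathrm{CMV}$ is good with respect to $\approx$, that is, $\approx$ is an equivalence and a bisimulation, and: 1. *(compositionality)* for each operator and each typing context there is a $\mathrm{CMV}$ context such that the translation of the operator applied to typed arguments is this context filled with the translations of the arguments; 2. *(name invariance)* for every $\Gamma\vdash S$ and every substitution $\sigma$ of names that respects types from $\Gamma$ to $\Delta$ (it preserves the type of every name of $\Gamma$, and every linear name of $\Delta$ is the image of exactly one name of $\Gamma$), $\Delta\vdash S\sigma$ with a derivation for which $[\![S\sigma]\!]\approx[\![S]\!]\sigma$;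 3. *(operational completeness)* if $\Gamma\vdash S$ and $S\Rightarrow S'$, then $\Gamma\vdash S'$ with a derivation such that $[\![S]\!]\Rightarrow\approx[\![S']\!]$; 4. *(operational soundness)* if $\Gamma\vdash S$ and $[\![S]\!]\Rightarrow T$, then there is $\Gamma\vdash S'$ such that $S\Rightarrow S'$ and $T\Rightarrow\approx[\![S']\!]$; 5. *(divergence reflection)* $[\![S]\!]\to^\omega$ implies $S\to^\omega$; 6. *(barb sensitivity)* $S\Downarrow_y$ iff $[\![S]\!]\Downarrow_y$, for every name $y$; 7. *(distributability preservation)* if $S$ is distributable into $S_1,\dots,S_n$, then the $S_i$ are typable, with derivations for which $[\![S]\!]$ is distributable into some $T_1,\dots,T_n$ with $T_i\approx[\![S_i]\!]$ for all $i$. Moreover, for every $\Gamma\vdash S$, the terms $S$ and $[\![S]\!]$ are coupled similar (on the disjoint union of the processes of the two calculi). -/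

import Mathlib

/-! ## Behavioural notions, for any reduction relation with barbs on names (names are natural numbers) -/

section Behaviour

variable {α : Type}

/-- `P` reaches the barb `y`. -/
def WeakBarb (step : α → α → Prop) (barb : α → ℕ → Prop) (P : α) (y : ℕ) : Prop :=
  ∃ P', Relation.ReflTransGen step P P' ∧ barb P' y

/-- `P` has an infinite sequence of steps. -/
def Diverges (step : α → α → Prop) (P : α) : Prop :=
  ∃ f : ℕ → α, f 0 = P ∧ ∀ n, step (f n) (f (n + 1))

/-- (Weak reduction, barbed) bisimulation. -/
def IsBisimulation (step : α → α → Prop) (barb : α → ℕ → Prop) (R : α → α → Prop) : Prop :=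
  ∀ P Q, R P Q →
    (∀ P', Relation.ReflTransGen step P P' → ∃ Q', Relation.ReflTransGen step Q Q' ∧ R P' Q') ∧
    (∀ Q', Relation.ReflTransGen step Q Q' → ∃ P', Relation.ReflTransGen step P P' ∧ R P' Q') ∧
    (∀ y, WeakBarb step barb P y ↔ WeakBarb step barb Q y)

/-- Bisimilarity. -/
def Bisimilar (step : α → α → Prop) (barb : α → ℕ → Prop) (P Q : α) : Prop :=
  ∃ R, IsBisimulation step barb R ∧ R P Q

/-- (Weak reduction, barbed) coupled simulation. -/
def IsCoupledSimulation (step : α → α → Prop) (barb : α → ℕ → Prop) (R : α → α → Prop) : Prop :=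
  ∀ P Q, R P Q →
    (∀ P', Relation.ReflTransGen step P P' → ∃ Q', Relation.ReflTransGen step Q Q' ∧ R P' Q') ∧
    (∀ P', Relation.ReflTransGen step P P' → ∃ Q', Relation.ReflTransGen step Q Q' ∧ R Q' P') ∧
    (∀ y, WeakBarb step barb P y → WeakBarb step barb Q y)

/-- Coupled similarity: related in both directions by a coupled simulation. -/
def CoupledSimilar (step : α → α → Prop) (barb : α → ℕ → Prop) (P Q : α) : Prop :=
  ∃ R, IsCoupledSimulation step barb R ∧ R P Q ∧ R Q P

end Behaviour

/-! ## Names, values, substitutions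

Terms are taken up to α-conversion by using de Bruijn indices: a name is a natural number, and
inside a binder of `k` names the indices `0, …, k-1` are the bound names, the free name `n` of the
surrounding scope being `n + k`. -/

inductive Qual : Type
  | lin
  | un

/-- Polarities `!` and `?`. -/
inductive Pol : Type
  | out
  | inp
  deriving DecidableEq

def Pol.dual : Pol → Pol
  | .out => .inp
  | .inp => .out

/-- Values: names (variables), booleans, unit. -/
inductive Val : Type
  | var (n : ℕ)
  | tt
  | ff
  | unit

/-- Simultaneous substitution in a value. -/
def Val.subst (σ : ℕ → Val) : Val → Val
  | .var n => σ n
  | .tt => .tt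
  | .ff => .ff
  | .unit => .unit

/-- The substitution given by a renaming of names. -/
def ren (ρ : ℕ → ℕ) : ℕ → Val := fun n => .var (ρ n)

/-- A substitution carried under the binder of one name. -/
def up (σ : ℕ → Val) : ℕ → Val
  | 0 => .var 0
  | n + 1 => (σ n).subst (ren Nat.succ)

/-- `{v/0}`: index `0` becomes `v`, the other indices are lowered. -/
def inst (v : Val) : ℕ → Val
  | 0 => v
  | n + 1 => .var n

/-- Weakening by `k` names. -/
def wk (k : ℕ) : ℕ → Val := ren (· + k)

/-- The exchange of the two innermost names. -/
def swap01 : ℕ → ℕ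
  | 0 => 1
  | 1 => 0
  | n + 2 => n + 2

/-- The polarity of a branch with its argument: `!v`, or `?z` with `z` bound in the continuation. -/
inductive Act : Type
  | send (v : Val)
  | recv

namespace Act

def pol : Act → Pol
  | send _ => .out
  | recv => .inp

def subst (σ : ℕ → Val) : Act → Act
  | send v => send (v.subst σ)
  | recv => recv

/-- The substitution to be used in the continuation of a branch. -/
def under : Act → (ℕ → Val) → (ℕ → Val)
  | send _, σ => σ
  | recv, σ => up σ

end Act

/-! ## The source calculus: mixed sessions -/

namespace Mix

/-- Processes. `choice q x n l a P` is `q x ∑_{i ≤ n} (l i) (a i).(P i)`: a nonempty sum on the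
single endpoint `x`, whose labels are natural numbers. `res P` is `(ν y z) P` where `y` is index
`0` and `z` is index `1`. A subject is a value so that substitution is total; subjects other than
names are inert and never well-typed. -/
inductive Proc : Type
  | choice (q : Qual) (x : Val) (n : ℕ) (l : Fin (n + 1) → ℕ) (a : Fin (n + 1) → Act)
      (P : Fin (n + 1) → Proc)
  | par (P Q : Proc)
  | res (P : Proc)
  | ite (v : Val) (P Q : Proc)
  | inact

namespace Proc

def subst : (ℕ → Val) → Proc → Proc
  | σ, choice q x n l a P =>
      choice q (x.subst σ) n l (fun i => (a i).subst σ) (fun i => (P i).subst ((a i).under σ))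
  | σ, par P Q => par (P.subst σ) (Q.subst σ)
  | σ, res P => res (P.subst (up (up σ)))
  | σ, ite v P Q => ite (v.subst σ) (P.subst σ) (Q.subst σ)
  | _, inact => inact

def resN : ℕ → Proc → Proc
  | 0, P => P
  | k + 1, P => res (resN k P)

def parList : List Proc → Proc
  | [] => inact
  | P :: Ps => par P (parList Ps)

end Proc

open Proc

/-- Structural congruence. -/
inductive Cong : Proc → Proc → Prop
  | refl (P) : Cong P P
  | symm {P Q} : Cong P Q → Cong Q P
  | trans {P Q R} : Cong P Q → Cong Q R → Cong P R
  | choice {q x n l a P Q} : (∀ i, Cong (P i) (Q i)) → Cong (choice q x n l a P) (choice q x n l a Q)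
  | par {P P' Q Q'} : Cong P P' → Cong Q Q' → Cong (par P Q) (par P' Q')
  | res {P P'} : Cong P P' → Cong (res P) (res P')
  | ite {v P P' Q Q'} : Cong P P' → Cong Q Q' → Cong (ite v P Q) (ite v P' Q')
  | resInact : Cong (res inact) inact
  | resRes (P) : Cong (res (res P))
      (res (res (P.subst (ren fun n => if n < 2 then n + 2 else if n < 4 then n - 2 else n))))
  | resPar (P Q) : Cong (par P (res Q)) (res (par (P.subst (wk 2)) Q))
  | resSwap (P) : Cong (res P) (res (P.subst (ren swap01)))
  | parInact (P) : Cong (par P inact) P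
  | parComm (P Q) : Cong (par P Q) (par Q P)
  | parAssoc (P Q R) : Cong (par P (par Q R)) (par (par P Q) R)

/-- What a communicating choice `C` leaves behind: its continuation, and itself if unrestricted. -/
def persist : Qual → Proc → Proc → Proc
  | .lin, _, P => P
  | .un, C, P => .par P C

/-- Reduction. -/
inductive Red : Proc → Proc → Prop
  | iteTrue (P Q) : Red (ite .tt P Q) P
  | iteFalse (P Q) : Red (ite .ff P Q) Q
  | com {q n l a P q' n' l' a' P'} (R : Proc) (i : Fin (n + 1)) (j : Fin (n' + 1)) (v : Val) :
      a i = .send v → a' j = .recv → l i = l' j →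
      Red (res (par (choice q (.var 0) n l a P) (par (choice q' (.var 1) n' l' a' P') R)))
        (res (par (persist q (choice q (.var 0) n l a P) (P i))
          (par (persist q' (choice q' (.var 1) n' l' a' P') ((P' j).subst (inst v))) R)))
  | par {P P'} (Q) : Red P P' → Red (par P Q) (par P' Q)
  | res {P P'} : Red P P' → Red (res P) (res P')
  | struct {P Q Q' P'} : Cong P Q → Red Q Q' → Cong Q' P' → Red P P'

/-- `P` has an unguarded choice on the free name `y`. -/
inductive Barb : Proc → ℕ → Prop
  | choice (q y n l a P) : Barb (choice q (.var y) n l a P) y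
  | parL {P y} (Q) : Barb P y → Barb (par P Q) y
  | parR {Q y} (P) : Barb Q y → Barb (par P Q) y
  | res {P y} : Barb P (y + 2) → Barb (res P) y

/-- `S` is distributable into `S₁, …, Sₙ`. -/
def Distributable (S : Proc) {n : ℕ} (Ss : Fin n → Proc) : Prop :=
  ∃ k, Cong S (resN k (parList (List.ofFn Ss)))

end Mix

/-! ## The target calculus: sessions with separate branching and selection -/

namespace CMV

/-- Labels of the target: `tag l p` is the label `l` decorated with a polarity, `idx i` is the
`i`-th label of a further family of labels. -/
inductive Label : Type
  | tag (l : ℕ) (p : Pol)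
  | idx (i : ℕ)
  deriving DecidableEq

/-- Processes: output `x!v.P`, input `q x?z.P` (`z` is index `0` in `P`), selection `x ◁ l.P`,
branching `x ▷ {l : P l}_{l ∈ L}`, parallel composition, restriction, conditional, inaction. -/
inductive Proc : Type
  | out (x v : Val) (P : Proc)
  | inp (q : Qual) (x : Val) (P : Proc)
  | sel (x : Val) (l : Label) (P : Proc)
  | bran (x : Val) (L : Finset Label) (P : {l // l ∈ L} → Proc)
  | par (P Q : Proc)
  | res (P : Proc)
  | ite (v : Val) (P Q : Proc)
  | inact

namespace Proc

def subst : (ℕ → Val) → Proc → Proc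
  | σ, out x v P => out (x.subst σ) (v.subst σ) (P.subst σ)
  | σ, inp q x P => inp q (x.subst σ) (P.subst (up σ))
  | σ, sel x l P => sel (x.subst σ) l (P.subst σ)
  | σ, bran x L P => bran (x.subst σ) L (fun l => (P l).subst σ)
  | σ, par P Q => par (P.subst σ) (Q.subst σ)
  | σ, res P => res (P.subst (up (up σ)))
  | σ, ite v P Q => ite (v.subst σ) (P.subst σ) (Q.subst σ)
  | _, inact => inact

def resN : ℕ → Proc → Proc
  | 0, P => P
  | k + 1, P => res (resN k P)

def parList : List Proc → Proc
  | [] => inact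
  | P :: Ps => par P (parList Ps)

end Proc

open Proc

/-- Structural congruence. -/
inductive Cong : Proc → Proc → Prop
  | refl (P) : Cong P P
  | symm {P Q} : Cong P Q → Cong Q P
  | trans {P Q R} : Cong P Q → Cong Q R → Cong P R
  | out {x v P Q} : Cong P Q → Cong (out x v P) (out x v Q)
  | inp {q x P Q} : Cong P Q → Cong (inp q x P) (inp q x Q)
  | sel {x l P Q} : Cong P Q → Cong (sel x l P) (sel x l Q)
  | bran {x L P Q} : (∀ l, Cong (P l) (Q l)) → Cong (bran x L P) (bran x L Q)
  | par {P P' Q Q'} : Cong P P' → Cong Q Q' → Cong (par P Q) (par P' Q')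
  | res {P P'} : Cong P P' → Cong (res P) (res P')
  | ite {v P P' Q Q'} : Cong P P' → Cong Q Q' → Cong (ite v P Q) (ite v P' Q')
  | resInact : Cong (res inact) inact
  | resRes (P) : Cong (res (res P))
      (res (res (P.subst (ren fun n => if n < 2 then n + 2 else if n < 4 then n - 2 else n))))
  | resPar (P Q) : Cong (par P (res Q)) (res (par (P.subst (wk 2)) Q))
  | resSwap (P) : Cong (res P) (res (P.subst (ren swap01)))
  | parInact (P) : Cong (par P inact) P
  | parComm (P Q) : Cong (par P Q) (par Q P)
  | parAssoc (P Q R) : Cong (par P (par Q R)) (par (par P Q) R)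

/-- What an input `C` leaves behind: its continuation, and itself if unrestricted. -/
def persist : Qual → Proc → Proc → Proc
  | .lin, _, P => P
  | .un, C, P => .par P C

/-- Reduction. -/
inductive Red : Proc → Proc → Prop
  | iteTrue (P Q) : Red (ite .tt P Q) P
  | iteFalse (P Q) : Red (ite .ff P Q) Q
  | com (q v P Q R) :
      Red (res (par (out (.var 0) v P) (par (inp q (.var 1) Q) R)))
        (res (par P (par (persist q (inp q (.var 1) Q) (Q.subst (inst v))) R)))
  | case (P) {L Q} (R) (l : {l // l ∈ L}) :
      Red (res (par (sel (.var 0) l.1 P) (par (bran (.var 1) L Q) R)))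
        (res (par P (par (Q l) R)))
  | par {P P'} (Q) : Red P P' → Red (par P Q) (par P' Q)
  | res {P P'} : Red P P' → Red (res P) (res P')
  | struct {P Q Q' P'} : Cong P Q → Red Q Q' → Cong Q' P' → Red P P'

/-- `P` has an unguarded output, input, selection or branching on the free name `y`. -/
inductive Barb : Proc → ℕ → Prop
  | out (y v P) : Barb (out (.var y) v P) y
  | inp (q y P) : Barb (inp q (.var y) P) y
  | sel (y l P) : Barb (sel (.var y) l P) y
  | bran (y L P) : Barb (bran (.var y) L P) y
  | parL {P y} (Q) : Barb P y → Barb (par P Q) y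
  | parR {Q y} (P) : Barb Q y → Barb (par P Q) y
  | res {P y} : Barb P (y + 2) → Barb (res P) y

/-- `T` is distributable into `T₁, …, Tₙ`. -/
def Distributable (T : Proc) {n : ℕ} (Ts : Fin n → Proc) : Prop :=
  ∃ k, Cong T (resN k (parList (List.ofFn Ts)))

/-- Bisimilarity of the target calculus. -/
def Bisim : Proc → Proc → Prop := Bisimilar Red Barb

/-- Contexts with `k` kinds of holes. A hole may stand below binders of the context: its
order-preserving renaming says which of these binders capture names of the argument, all the others
being fresh for it. -/
inductive Context (k : ℕ) : Type
  | hole (i : Fin k) (ρ : ℕ → ℕ) (hρ : StrictMono ρ)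
  | out (x v : Val) (C : Context k)
  | inp (q : Qual) (x : Val) (C : Context k)
  | sel (x : Val) (l : Label) (C : Context k)
  | bran (x : Val) (L : Finset Label) (C : {l // l ∈ L} → Context k)
  | par (C D : Context k)
  | res (C : Context k)
  | ite (v : Val) (C D : Context k)
  | inact

/-- Filling the holes of a context. -/
def Context.fill {k : ℕ} (T : Fin k → Proc) : Context k → Proc
  | .hole i ρ _ => (T i).subst (ren ρ)
  | .out x v C => .out x v (C.fill T)
  | .inp q x C => .inp q x (C.fill T)
  | .sel x l C => .sel x l (C.fill T)
  | .bran x L C => .bran x L (fun l => (C l).fill T)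
  | .par C D => .par (C.fill T) (D.fill T)
  | .res C => .res (C.fill T)
  | .ite v C D => .ite v (C.fill T) (D.fill T)
  | .inact => .inact

end CMV

/-! ## Types of the source calculus -/

namespace Mix

/-- Views: internal choice `⊕`, external choice `&`. -/
inductive View : Type
  | int
  | ext

def View.dual : View → View
  | .int => .ext
  | .ext => .int

/-- Types. `choice q w K pay cont` is `q w {k (pay k).(cont k)}_{k ∈ K}`, where `K` is a finite set
of pairs of a label and a polarity; `done` is the type `end`; `mu` binds type variable `0`. -/
inductive Ty : Type
  | unit
  | bool
  | done
  | choice (q : Qual) (w : View) (K : Finset (ℕ × Pol)) (pay cont : {k // k ∈ K} → Ty)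
  | var (i : ℕ)
  | mu (T : Ty)

namespace Ty

def liftRen (ρ : ℕ → ℕ) : ℕ → ℕ
  | 0 => 0
  | n + 1 => ρ n + 1

def rename : (ℕ → ℕ) → Ty → Ty
  | _, unit => unit
  | _, bool => bool
  | _, done => done
  | ρ, choice q w K pay cont =>
      choice q w K (fun k => (pay k).rename ρ) (fun k => (cont k).rename ρ)
  | ρ, var i => var (ρ i)
  | ρ, mu T => mu (T.rename (liftRen ρ))

def lift (σ : ℕ → Ty) : ℕ → Ty
  | 0 => var 0
  | n + 1 => (σ n).rename Nat.succ

def subst : (ℕ → Ty) → Ty → Ty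
  | _, unit => unit
  | _, bool => bool
  | _, done => done
  | σ, choice q w K pay cont =>
      choice q w K (fun k => (pay k).subst σ) (fun k => (cont k).subst σ)
  | σ, var i => σ i
  | σ, mu T => mu (T.subst (lift σ))

/-- `T[U/0]`. -/
def inst (U : Ty) : ℕ → Ty
  | 0 => U
  | n + 1 => var n

end Ty

/-- `Unf T T'`: unfolding the recursion at the head of `T` ends in `T'`, whose head is a type
constructor. There is no such `T'` if `T` is not contractive or is an open type with a variable as
its head; no relation below holds for such a type. -/
inductive Unf : Ty → Ty → Prop
  | unit : Unf .unit .unit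
  | bool : Unf .bool .bool
  | done : Unf .done .done
  | choice (q w K pay cont) : Unf (.choice q w K pay cont) (.choice q w K pay cont)
  | mu {T T'} : Unf (T.subst (Ty.inst (.mu T))) T' → Unf (.mu T) T'

/-- Unrestricted types; all other types are linear. -/
def Un (T : Ty) : Prop :=
  Unf T .unit ∨ Unf T .bool ∨ Unf T .done ∨ ∃ w K pay cont, Unf T (.choice .un w K pay cont)

/-- One layer of subtyping. Payloads are contravariant for `!` and covariant for `?`,
continuations are covariant; an internal choice may lose branches, an external one gain some. -/
inductive SubHead (R : Ty → Ty → Prop) : Ty → Ty → Prop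
  | unit : SubHead R .unit .unit
  | bool : SubHead R .bool .bool
  | done : SubHead R .done .done
  | choice {q w K pay cont K' pay' cont'} :
      (w = .int → K' ⊆ K) → (w = .ext → K ⊆ K') →
      (∀ k (h : k ∈ K) (h' : k ∈ K'), k.2 = .out → R (pay' ⟨k, h'⟩) (pay ⟨k, h⟩)) →
      (∀ k (h : k ∈ K) (h' : k ∈ K'), k.2 = .inp → R (pay ⟨k, h⟩) (pay' ⟨k, h'⟩)) →
      (∀ k (h : k ∈ K) (h' : k ∈ K'), R (cont ⟨k, h⟩) (cont' ⟨k, h'⟩)) →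
      SubHead R (.choice q w K pay cont) (.choice q w K' pay' cont')

/-- Subtyping, coinductively. -/
def Sub (T U : Ty) : Prop :=
  ∃ R : Ty → Ty → Prop,
    (∀ A B, R A B → ∃ A' B', Unf A A' ∧ Unf B B' ∧ SubHead R A' B') ∧ R T U

/-- One layer of duality. -/
inductive DualHead (R : Ty → Ty → Prop) : Ty → Ty → Prop
  | done : DualHead R .done .done
  | choice {q w K pay cont K' pay' cont'} :
      (∀ l p, (l, p) ∈ K ↔ (l, p.dual) ∈ K') →
      (∀ l p (h : (l, p) ∈ K) (h' : (l, p.dual) ∈ K'),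
        (Sub (pay ⟨_, h⟩) (pay' ⟨_, h'⟩) ∧ Sub (pay' ⟨_, h'⟩) (pay ⟨_, h⟩)) ∧
        R (cont ⟨_, h⟩) (cont' ⟨_, h'⟩)) →
      DualHead R (.choice q w K pay cont) (.choice q w.dual K' pay' cont')

/-- Duality, coinductively. -/
def Dual (T U : Ty) : Prop :=
  ∃ R : Ty → Ty → Prop,
    (∀ A B, R A B → ∃ A' B', Unf A A' ∧ Unf B B' ∧ DualHead R A' B') ∧ R T U

/-! ## Typing -/

/-- Typing contexts. -/
abbrev Ctx : Type := ℕ → Option Ty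

/-- `Γ` extended by a type for a new name `0`. -/
def Ctx.cons (T : Ty) (Γ : Ctx) : Ctx
  | 0 => some T
  | n + 1 => Γ n

/-- All types in `Γ` are unrestricted. -/
def UnCtx (Γ : Ctx) : Prop := ∀ x T, Γ x = some T → Un T

/-- Context split `Γ = Γ₁ ∘ Γ₂`. -/
def Split (Γ Γ₁ Γ₂ : Ctx) : Prop :=
  ∀ x, (Γ x = none ∧ Γ₁ x = none ∧ Γ₂ x = none) ∨
    ∃ T, Γ x = some T ∧
      ((Un T ∧ Γ₁ x = some T ∧ Γ₂ x = some T) ∨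
       (¬ Un T ∧ Γ₁ x = some T ∧ Γ₂ x = none) ∨
       (¬ Un T ∧ Γ₁ x = none ∧ Γ₂ x = some T))

/-- Context update `Γ + x : U = Δ`: a name without a type gets the type `U`, an unrestricted name
keeps its type `T`, which has to be usable as `U`. -/
def Update (Γ : Ctx) (x : ℕ) (U : Ty) (Δ : Ctx) : Prop :=
  (Γ x = none ∧ Δ = Function.update Γ x (some U)) ∨
    (∃ T, Γ x = some T ∧ Un T ∧ Sub T U ∧ Δ = Γ)

/-- Typing of values, with subsumption. -/
inductive ValTy : Ctx → Val → Ty → Prop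
  | unit {Γ T} : UnCtx Γ → Sub .unit T → ValTy Γ .unit T
  | tt {Γ T} : UnCtx Γ → Sub .bool T → ValTy Γ .tt T
  | ff {Γ T} : UnCtx Γ → Sub .bool T → ValTy Γ .ff T
  | var {Γ : Ctx} {x : ℕ} {T U : Ty} : Γ x = some T →
      (∀ y V, y ≠ x → Γ y = some V → Un V) → Sub T U → ValTy Γ (.var x) U

/-- `BranchCtx Δ a T Θ`: in the context `Δ` the prefix `a` has a payload of type `T`, and `Θ` is
the context for its continuation. -/
inductive BranchCtx : Ctx → Act → Ty → Ctx → Prop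
  | send {Δ Δ₁ Θ v T} : Split Δ Δ₁ Θ → ValTy Δ₁ v T → BranchCtx Δ (.send v) T Θ
  | recv {Δ T} : BranchCtx Δ .recv T (Ctx.cons T Δ)

/-- Typing derivations `Γ ⊢ P`, as data: the translation below is a function of the derivation,
since the types of restricted endpoints do not occur in the process. -/
inductive Deriv : Ctx → Proc → Type
  | inact {Γ} (h : UnCtx Γ) : Deriv Γ .inact
  | par {Γ Γ₁ Γ₂ P Q} (h : Split Γ Γ₁ Γ₂) (d : Deriv Γ₁ P) (e : Deriv Γ₂ Q) : Deriv Γ (.par P Q)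
  | res {Γ P} (T U : Ty) (h : Dual T U) (d : Deriv (Ctx.cons T (Ctx.cons U Γ)) P) :
      Deriv Γ (.res P)
  | ite {Γ Γ₁ Γ₂ v P Q} (h : Split Γ Γ₁ Γ₂) (hv : ValTy Γ₁ v .bool)
      (d : Deriv Γ₂ P) (e : Deriv Γ₂ Q) : Deriv Γ (.ite v P Q)
  | choice {Γ Γ₁ Γ₂ q x n l a P} (q' : Qual) (w : View) (K : Finset (ℕ × Pol))
      (pay cont : {k // k ∈ K} → Ty) (key : Fin (n + 1) → {k // k ∈ K})
      (Δ Θ : Fin (n + 1) → Ctx)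
      (h : Split Γ Γ₁ Γ₂) (hq : q = .un → UnCtx Γ)
      (hx : ValTy Γ₁ (.var x) (.choice q' w K pay cont))
      (hkey : ∀ i, (key i).1 = (l i, (a i).pol)) (hsurj : Function.Surjective key)
      (hΔ : ∀ i, Update Γ₂ x (cont (key i)) (Δ i))
      (hΘ : ∀ i, BranchCtx (Δ i) (a i) (pay (key i)) (Θ i))
      (d : ∀ i, Deriv (Θ i) (P i)) : Deriv Γ (.choice q (.var x) n l a P)

end Mix

/-! ## The encoding -/

namespace Encoding

open CMV CMV.Proc Mix

/-- Non-deterministic choice of the processes `P l`, `l ∈ L`: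
`(ν s t)(s ▷ {l : P l}_{l ∈ L} | ∏_{l ∈ L} t ◁ l.0)`. -/
noncomputable def ndc (L : Finset Label) (P : Label → CMV.Proc) : CMV.Proc :=
  res (par (bran (.var 0) L (fun l => (P l.1).subst (wk 2)))
    (parList (L.toList.map fun l => sel (.var 1) l inact)))

/-- The target prefix for `a` on the endpoint `c`, with continuation `E`. -/
def prefixOn (c : Val) (E : CMV.Proc) : Act → CMV.Proc
  | .send v => out c v E
  | .recv => inp .lin c E

section Choice

variable {n : ℕ} (l : Fin (n + 1) → ℕ) (a : Fin (n + 1) → Act) (E : Fin (n + 1) → CMV.Proc)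

/-- The labels with polarities that occur in a choice, the polarities being changed by `f`. -/
def labels (f : Pol → Pol) : Finset Label :=
  Finset.univ.image fun i => Label.tag (l i) (f (a i).pol)

/-- Non-deterministic choice, on endpoint `c`, among the branches that have the label `k` after
their polarities were changed by `f`. -/
noncomputable def duplicates (f : Pol → Pol) (k : Label) (c : Val) : CMV.Proc :=
  ndc ((Finset.univ.filter fun i => Label.tag (l i) (f (a i).pol) = k).image
      fun i => Label.idx i.1)
    (fun
      | .idx j => prefixOn c (E (Fin.ofNat (n + 1) j)) (a (Fin.ofNat (n + 1) j))
      | .tag _ _ => inact)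

/-- Weakening of the prefixes and of the continuations of a choice by `k` names. -/
def wkAct (k : ℕ) : Fin (n + 1) → Act := fun i => (a i).subst (wk k)

def wkCont (k : ℕ) : Fin (n + 1) → CMV.Proc := fun i => (E i).subst ((a i).under (wk k))

/-- External choice on a linear endpoint `c`: `c ▷ {k : …}`. -/
noncomputable def extLin (c : Val) : CMV.Proc :=
  bran c (labels l a Pol.dual) fun k => duplicates l a E Pol.dual k.1 c

/-- Internal choice on a linear endpoint `c`: a non-deterministic choice of `c ◁ k.…`. -/
noncomputable def intLin (c : Val) : CMV.Proc :=
  ndc (labels l a id) fun k => sel c k (duplicates l a E id k c)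

/-- External choice on an unrestricted endpoint `x`: `q x?c.c ▷ {k : …}`. -/
noncomputable def extUn (q : Qual) (x : Val) : CMV.Proc :=
  inp q x (extLin l (wkAct a 1) (wkCont a E 1) (.var 0))

/-- Internal choice on an unrestricted endpoint `x`: a non-deterministic choice of
`(ν c d) x!c.d ◁ k.…`. -/
noncomputable def intUn (x : Val) : CMV.Proc :=
  ndc (labels l a id) fun k =>
    res (out (x.subst (wk 2)) (.var 0)
      (sel (.var 1) k (duplicates l (wkAct a 2) (wkCont a E 2) id k (.var 1))))

/-- The name `u` of `loop` in the continuation of a branch. -/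
def loopName : Act → Val
  | .send _ => .var 1
  | .recv => .var 2

/-- Unrestricted internal choice on an unrestricted endpoint `x`:
`(ν u v)(u!().0 | un v?_. N)`, where `N` is the translation of the linear choice in which every
continuation `E` has become `E | u!().0`. -/
noncomputable def loop (x : Val) : CMV.Proc :=
  res (par (out (.var 0) .unit inact)
    (inp .un (.var 1)
      (intUn l (wkAct a 3)
        (fun i => par (wkCont a E 3 i) (out (loopName (a i)) .unit inact)) (x.subst (wk 3)))))

/-- The translation of a choice with qualifier `q` on an endpoint `x` whose type has qualifier `q'`
and view `w`. (The combination of `q = un` with `q' = lin` is never well-typed.) -/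
noncomputable def encChoice (q q' : Qual) (w : View) (x : Val) : CMV.Proc :=
  match q', w, q with
  | .lin, .ext, _ => extLin l a E x
  | .lin, .int, _ => intLin l a E x
  | .un, .ext, q => extUn l a E q x
  | .un, .int, .lin => intUn l a E x
  | .un, .int, .un => loop l a E x

end Choice

/-- The encoding of typed mixed sessions. -/
noncomputable def enc : {Γ : Ctx} → {P : Mix.Proc} → Deriv Γ P → CMV.Proc
  | _, _, .inact _ => inact
  | _, _, .par _ d e => par (enc d) (enc e)
  | _, _, .res _ _ _ d => res (enc d)
  | _, _, .ite (v := v) _ _ d e => ite v (enc d) (enc e)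
  | _, _, .choice (q := q) (x := x) (l := l) (a := a) q' w _ _ _ _ _ _ _ _ _ _ _ _ _ d =>
      encChoice l a (fun i => enc (d i)) q q' w (.var x)

end Encoding

/-! ## Good encodings -/

namespace Mix

/-- Operators of the source calculus. -/
inductive Op : Type
  | choice (q : Qual) (x : Val) (n : ℕ) (l : Fin (n + 1) → ℕ) (a : Fin (n + 1) → Act)
  | par
  | res
  | ite (v : Val)
  | inact

def Op.arity : Op → ℕ
  | .choice _ _ n _ _ => n + 1
  | .par => 2
  | .res => 1
  | .ite _ => 2
  | .inact => 0

/-- The outermost operator of a process. -/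
def Proc.op : Proc → Op
  | .choice q x n l a _ => .choice q x n l a
  | .par _ _ => .par
  | .res _ => .res
  | .ite v _ _ => .ite v
  | .inact => .inact

/-- Typed processes. -/
abbrev Typed : Type := Σ Γ : Ctx, Σ P : Proc, Deriv Γ P

/-- The typed arguments of the outermost operator of a typed process. -/
def Deriv.args : {Γ : Ctx} → {P : Proc} → Deriv Γ P → Fin P.op.arity → Typed
  | _, _, .inact _ => Fin.elim0
  | _, _, .par _ d e => ![⟨_, _, d⟩, ⟨_, _, e⟩]
  | _, _, .res _ _ _ d => ![⟨_, _, d⟩]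
  | _, _, .ite _ _ d e => ![⟨_, _, d⟩, ⟨_, _, e⟩]
  | _, _, .choice _ _ _ _ _ _ _ _ _ _ _ _ _ _ _ d => fun i => ⟨_, _, d i⟩

/-- `σ` respects types from `Γ` to `Δ`: it preserves the type of every name of `Γ`, and every
linear name of `Δ` comes from exactly one name of `Γ`. -/
def RespectsTypes (σ : ℕ → ℕ) (Γ Δ : Ctx) : Prop :=
  (∀ x T, Γ x = some T → Δ (σ x) = some T) ∧
  (∀ y T, Δ y = some T → ¬ Un T → ∃! x, σ x = y ∧ Γ x ≠ none)

end Mix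

/-- A translation of typed mixed sessions into the target calculus is good with respect to the
relation `r` on target processes. -/
structure GoodEncoding (e : ∀ {Γ : Mix.Ctx} {P : Mix.Proc}, Mix.Deriv Γ P → CMV.Proc)
    (r : CMV.Proc → CMV.Proc → Prop) : Prop where
  equivalence : Equivalence r
  bisimulation : IsBisimulation CMV.Red CMV.Barb r
  /-- An operator is translated by a context that depends only on the operator and the types of
  the free names. -/
  compositional : ∃ C : Mix.Ctx → (o : Mix.Op) → CMV.Context o.arity,
    ∀ {Γ : Mix.Ctx} {S : Mix.Proc} (d : Mix.Deriv Γ S),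
      e d = (C Γ S.op).fill fun i => e (d.args i).2.2
  name_invariant : ∀ {Γ : Mix.Ctx} {S : Mix.Proc} (d : Mix.Deriv Γ S) (σ : ℕ → ℕ) (Δ : Mix.Ctx),
    Mix.RespectsTypes σ Γ Δ →
    ∃ d' : Mix.Deriv Δ (S.subst (ren σ)), r (e d') ((e d).subst (ren σ))
  complete : ∀ {Γ : Mix.Ctx} {S : Mix.Proc} (d : Mix.Deriv Γ S) (S' : Mix.Proc),
    Relation.ReflTransGen Mix.Red S S' →
    ∃ (d' : Mix.Deriv Γ S') (T : CMV.Proc), Relation.ReflTransGen CMV.Red (e d) T ∧ r T (e d')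
  sound : ∀ {Γ : Mix.Ctx} {S : Mix.Proc} (d : Mix.Deriv Γ S) (T : CMV.Proc),
    Relation.ReflTransGen CMV.Red (e d) T →
    ∃ (S' : Mix.Proc) (d' : Mix.Deriv Γ S') (T' : CMV.Proc),
      Relation.ReflTransGen Mix.Red S S' ∧ Relation.ReflTransGen CMV.Red T T' ∧ r T' (e d')
  divergence_reflecting : ∀ {Γ : Mix.Ctx} {S : Mix.Proc} (d : Mix.Deriv Γ S),
    Diverges CMV.Red (e d) → Diverges Mix.Red S
  barb_sensitive : ∀ {Γ : Mix.Ctx} {S : Mix.Proc} (d : Mix.Deriv Γ S) (y : ℕ),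
    WeakBarb Mix.Red Mix.Barb S y ↔ WeakBarb CMV.Red CMV.Barb (e d) y
  distributability_preserving : ∀ {Γ : Mix.Ctx} {S : Mix.Proc} (d : Mix.Deriv Γ S) (n : ℕ)
    (Ss : Fin n → Mix.Proc), Mix.Distributable S Ss →
    ∃ (Δ : Fin n → Mix.Ctx) (ds : ∀ i, Mix.Deriv (Δ i) (Ss i)) (Ts : Fin n → CMV.Proc),
      CMV.Distributable (e d) Ts ∧ ∀ i, r (Ts i) (e (ds i))

/-! ## Source and target side by side -/

/-- Steps on the disjoint union of the source and the target processes. -/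
def SumRed : Mix.Proc ⊕ CMV.Proc → Mix.Proc ⊕ CMV.Proc → Prop := Sum.LiftRel Mix.Red CMV.Red

/-- Barbs on the disjoint union of the source and the target processes. -/
def SumBarb : Mix.Proc ⊕ CMV.Proc → ℕ → Prop := Sum.elim Mix.Barb CMV.Barb

open Relation (ReflTransGen)
open Function (update update_self update_of_ne)
open Multiset (Rel mem_cons cons_add singleton_add mem_add mem_cons_self cons_swap add_cons
  mem_singleton cons_inj_right mem_singleton_self exists_cons_of_mem mem_cons_of_mem mem_bind
  rel_cons_right rel_cons_left cons_zero coe_toList nodup_add)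

theorem Option.exists_some {α : Type*} {o : Option α} (h : o ≠ none) : ∃ a, o = some a :=
  Option.ne_none_iff_exists'.mp h

open Option (exists_some)

/-! ## Substitutions -/

/-- Composition of substitutions: first `τ`, then `σ`. -/
def scomp (σ τ : ℕ → Val) : ℕ → Val := fun n => (τ n).subst σ

theorem Val.subst_subst (σ τ : ℕ → Val) (v : Val) : (v.subst τ).subst σ = v.subst (scomp σ τ) := by
  cases v <;> rfl

theorem Val.subst_var (v : Val) : v.subst Val.var = v := by cases v <;> rfl

theorem up_scomp (σ τ : ℕ → Val) : up (scomp σ τ) = scomp (up σ) (up τ) := by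
  funext n
  cases n with
  | zero => rfl
  | succ n =>
    change ((τ n).subst σ).subst _ = ((τ n).subst _).subst _
    rw [Val.subst_subst, Val.subst_subst]; rfl

theorem up_var : up Val.var = Val.var := by funext n; cases n <;> rfl

theorem ren_id : ren (fun n => n) = Val.var := rfl

theorem scomp_ren (f g : ℕ → ℕ) : scomp (ren f) (ren g) = ren (fun n => f (g n)) := rfl

/-- A renaming carried under the binder of one name. -/
def liftRen (ρ : ℕ → ℕ) : ℕ → ℕ
  | 0 => 0
  | n + 1 => ρ n + 1

theorem up_ren (ρ : ℕ → ℕ) : up (ren ρ) = ren (liftRen ρ) := by funext n; cases n <;> rfl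

/-- `0` and `1` become the names `a` and `b`, the other names are treated by `σ`. -/
def cons2 (a b : ℕ) (σ : ℕ → Val) : ℕ → Val
  | 0 => .var a
  | 1 => .var b
  | n + 2 => σ n

theorem scomp_cons2_upup (a b : ℕ) (σ τ : ℕ → Val) :
    scomp (cons2 a b σ) (up (up τ)) = cons2 a b (scomp σ τ) := by
  funext n
  match n with
  | 0 => rfl
  | 1 => rfl
  | n + 2 =>
    change (((τ n).subst _).subst _).subst _ = (τ n).subst _
    rw [Val.subst_subst, Val.subst_subst]; rfl

theorem scomp_cons2_wk (a b : ℕ) (σ : ℕ → Val) : scomp (cons2 a b σ) (wk 2) = σ := rfl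

theorem scomp_inst_up (v : Val) (σ : ℕ → Val) :
    scomp (inst v) (up σ) = fun n => match n with | 0 => v | n + 1 => σ n := by
  funext n
  cases n with
  | zero => rfl
  | succ n => change ((σ n).subst _).subst _ = σ n; rw [Val.subst_subst]; exact Val.subst_var _

theorem scomp_inst (v : Val) (σ : ℕ → Val) :
    scomp σ (inst v) = scomp (inst (v.subst σ)) (up σ) := by
  rw [scomp_inst_up]; funext n; cases n <;> rfl

theorem scomp_inst_wk (v : Val) : scomp (inst v) (wk 1) = Val.var := rfl

/-- The names `a` and `b` are abstracted to the indices `0` and `1`. -/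
def abs2 (a b : ℕ) : ℕ → Val := fun n => if n = a then .var 0 else if n = b then .var 1 else .var (n + 2)

theorem scomp_cons2_abs2 (a b : ℕ) : scomp (cons2 a b Val.var) (abs2 a b) = Val.var := by
  funext n; simp only [scomp, abs2]
  split_ifs with h1 h2 <;> simp_all [Val.subst, cons2]

theorem upup_wk (σ : ℕ → Val) : scomp (up (up σ)) (wk 2) = scomp (wk 2) σ := by
  funext n; change ((σ n).subst _).subst _ = _; rw [Val.subst_subst]; rfl

theorem up3_wk (σ : ℕ → Val) : scomp (up (up (up σ))) (wk 3) = scomp (wk 3) σ := by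
  funext n; change (((σ n).subst _).subst _).subst _ = _; rw [Val.subst_subst, Val.subst_subst]; rfl

namespace Act

theorem subst_subst (σ τ : ℕ → Val) (a : Act) : (a.subst τ).subst σ = a.subst (scomp σ τ) := by
  cases a with
  | send v => exact congrArg Act.send (Val.subst_subst σ τ v)
  | recv => rfl

theorem subst_var (a : Act) : a.subst Val.var = a := by
  cases a with
  | send v => exact congrArg Act.send (Val.subst_var v)
  | recv => rfl

@[simp] theorem pol_subst (σ : ℕ → Val) (a : Act) : (a.subst σ).pol = a.pol := by cases a <;> rfl

@[simp] theorem under_subst (σ τ : ℕ → Val) (a : Act) : (a.subst σ).under τ = a.under τ := by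
  cases a <;> rfl

theorem under_scomp (σ τ : ℕ → Val) (a : Act) :
    a.under (scomp σ τ) = scomp (a.under σ) (a.under τ) := by
  cases a with
  | send v => rfl
  | recv => exact up_scomp σ τ

theorem under_var (a : Act) : a.under Val.var = Val.var := by
  cases a with
  | send v => rfl
  | recv => exact up_var

end Act

/-! ## Calculi with parallel composition and restriction -/

/-- Parallel composition, restriction and inaction, with substitution and structural congruence. -/
class Calculus (P : Type) where
  par : P → P → P
  res : P → P
  inact : P
  subst : (ℕ → Val) → P → P
  Cong : P → P → Prop
  subst_par (σ : ℕ → Val) (p q : P) : subst σ (par p q) = par (subst σ p) (subst σ q)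
  subst_res (σ : ℕ → Val) (p : P) : subst σ (res p) = res (subst (up (up σ)) p)
  subst_inact (σ : ℕ → Val) : subst σ inact = inact
  subst_subst (σ τ : ℕ → Val) (p : P) : subst σ (subst τ p) = subst (scomp σ τ) p
  refl (p : P) : Cong p p
  symm {p q : P} : Cong p q → Cong q p
  trans {p q r : P} : Cong p q → Cong q r → Cong p r
  cong_par {p p' q q' : P} : Cong p p' → Cong q q' → Cong (par p q) (par p' q')
  cong_res {p p' : P} : Cong p p' → Cong (res p) (res p')
  cong_subst (σ : ℕ → Val) {p q : P} : Cong p q → Cong (subst σ p) (subst σ q)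
  resInact : Cong (res inact) inact
  resRes (p : P) : Cong (res (res p))
    (res (res (subst (ren fun n => if n < 2 then n + 2 else if n < 4 then n - 2 else n) p)))
  resPar (p q : P) : Cong (par p (res q)) (res (par (subst (wk 2) p) q))
  resSwap (p : P) : Cong (res p) (res (subst (ren swap01) p))
  parInact (p : P) : Cong (par p inact) p
  parComm (p q : P) : Cong (par p q) (par q p)
  parAssoc (p q r : P) : Cong (par p (par q r)) (par (par p q) r)

/-! ## Substitution in the target calculus -/

namespace CMV

open Proc

namespace Proc

theorem subst_subst (P : Proc) (σ τ : ℕ → Val) : (P.subst τ).subst σ = P.subst (scomp σ τ) := by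
  induction P generalizing σ τ with
  | out x v P ih => simp [subst, Val.subst_subst, ih]
  | inp q x P ih => simp [subst, Val.subst_subst, ih, up_scomp]
  | sel x l P ih => simp [subst, Val.subst_subst, ih]
  | bran x L P ih => simp [subst, Val.subst_subst, ih]
  | par P Q ihP ihQ => simp [subst, ihP, ihQ]
  | res P ih => simp [subst, ih, up_scomp]
  | ite v P Q ihP ihQ => simp [subst, Val.subst_subst, ihP, ihQ]
  | inact => rfl

theorem subst_var (P : Proc) : P.subst Val.var = P := by
  induction P with
  | out x v P ih => simp [subst, Val.subst_var, ih]
  | inp q x P ih => simp [subst, Val.subst_var, ih, up_var]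
  | sel x l P ih => simp [subst, Val.subst_var, ih]
  | bran x L P ih => simp [subst, Val.subst_var, ih]
  | par P Q ihP ihQ => simp [subst, ihP, ihQ]
  | res P ih => simp [subst, ih, up_var]
  | ite v P Q ihP ihQ => simp [subst, Val.subst_var, ihP, ihQ]
  | inact => rfl

end Proc

theorem scomp_upup_swap (σ : ℕ → Val) :
    scomp (ren swap01) (up (up σ)) = scomp (up (up σ)) (ren swap01) := by
  funext n
  match n with
  | 0 => rfl
  | 1 => rfl
  | n + 2 =>
    change (((σ n).subst _).subst _).subst _ = ((σ n).subst _).subst _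
    rw [Val.subst_subst, Val.subst_subst, Val.subst_subst]; rfl

theorem scomp_up4_exchange (σ : ℕ → Val) :
    scomp (ren fun n => if n < 2 then n + 2 else if n < 4 then n - 2 else n) (up (up (up (up σ)))) =
      scomp (up (up (up (up σ))))
        (ren fun n => if n < 2 then n + 2 else if n < 4 then n - 2 else n) := by
  funext n
  match n with
  | 0 => rfl
  | 1 => rfl
  | 2 => rfl
  | 3 => rfl
  | n + 4 =>
    have h1 : ¬ n + 4 < 2 := by omega
    have h2 : ¬ n + 4 < 4 := by omega
    have h3 : ∀ m : ℕ, ¬ m.succ.succ.succ.succ < 2 := by omega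
    have h4 : ∀ m : ℕ, ¬ m.succ.succ.succ.succ < 4 := by omega
    simp only [scomp, ren, up, h1, h2, if_false, Val.subst]; grind

theorem Cong.subst (σ : ℕ → Val) {P Q : Proc} (h : Cong P Q) : Cong (P.subst σ) (Q.subst σ) := by
  induction h generalizing σ with
  | refl P => exact .refl _
  | symm _ ih => exact .symm (ih σ)
  | trans _ _ ih1 ih2 => exact .trans (ih1 σ) (ih2 σ)
  | out _ ih => exact .out (ih σ)
  | inp _ ih => exact .inp (ih _)
  | sel _ ih => exact .sel (ih _)
  | bran _ ih => exact .bran fun l => ih l σ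
  | par _ _ ih1 ih2 => exact .par (ih1 σ) (ih2 σ)
  | res _ ih => exact .res (ih _)
  | ite _ _ ih1 ih2 => exact .ite (ih1 σ) (ih2 σ)
  | resInact => exact .resInact
  | resRes P =>
    have h := Cong.resRes (P.subst (up (up (up (up σ)))))
    rw [Proc.subst_subst, scomp_up4_exchange, ← Proc.subst_subst] at h; exact h
  | resPar P Q =>
    have h := Cong.resPar (P.subst σ) (Q.subst (up (up σ)))
    rw [Proc.subst_subst, ← upup_wk, ← Proc.subst_subst] at h; exact h
  | resSwap P =>
    have h := Cong.resSwap (P.subst (up (up σ)))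
    rw [Proc.subst_subst, scomp_upup_swap, ← Proc.subst_subst] at h; exact h
  | parInact P => exact .parInact _
  | parComm P Q => exact .parComm _ _
  | parAssoc P Q R => exact .parAssoc _ _ _

theorem subst_inst (P : Proc) (v : Val) (σ : ℕ → Val) :
    (P.subst (inst v)).subst σ = (P.subst (up σ)).subst (inst (v.subst σ)) := by
  rw [Proc.subst_subst, Proc.subst_subst, scomp_inst]

theorem persist_subst (q : Qual) (C P : Proc) (σ : ℕ → Val) :
    (persist q C P).subst σ = persist q (C.subst σ) (P.subst σ) := by cases q <;> rfl

theorem Red.subst (σ : ℕ → Val) {P Q : Proc} (h : Red P Q) : Red (P.subst σ) (Q.subst σ) := by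
  induction h generalizing σ with
  | iteTrue P Q => exact .iteTrue _ _
  | iteFalse P Q => exact .iteFalse _ _
  | com q v P Q R =>
    have h := Red.com q (v.subst (up (up σ))) (P.subst (up (up σ))) (Q.subst (up (up (up σ))))
      (R.subst (up (up σ)))
    rw [← subst_inst] at h; simp only [Proc.subst, persist_subst]; exact h
  | case P R l => exact Red.case _ _ l
  | par Q _ ih => exact .par _ (ih σ)
  | res _ ih => exact .res (ih _)
  | struct h1 _ h2 ih => exact .struct (h1.subst σ) (ih σ) (h2.subst σ)

instance : Calculus Proc where
  par := .par
  res := .res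
  inact := .inact
  subst := Proc.subst
  Cong := Cong
  subst_par _ _ _ := rfl
  subst_res _ _ := rfl
  subst_inact _ := rfl
  subst_subst σ τ p := p.subst_subst σ τ
  refl := .refl
  symm := .symm
  trans := .trans
  cong_par := .par
  cong_res := .res
  cong_subst σ _ _ h := h.subst σ
  resInact := .resInact
  resRes := .resRes
  resPar := .resPar
  resSwap := .resSwap
  parInact := .parInact
  parComm := .parComm
  parAssoc := .parAssoc

end CMV

/-! ## Annotated source processes -/

namespace Mix

/-- Source processes in which every choice carries the qualifier and the view of the type of its
endpoint: all that the encoding needs to know about a typing derivation. -/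
inductive AProc : Type
  | choice (q q' : Qual) (w : View) (x : Val) (n : ℕ) (l : Fin (n + 1) → ℕ) (a : Fin (n + 1) → Act)
      (P : Fin (n + 1) → AProc)
  | par (P Q : AProc)
  | res (P : AProc)
  | ite (v : Val) (P Q : AProc)
  | inact

namespace AProc

/-- Forgetting the annotations. -/
def src : AProc → Proc
  | choice q _ _ x n l a P => .choice q x n l a fun i => (P i).src
  | par P Q => .par P.src Q.src
  | res P => .res P.src
  | ite v P Q => .ite v P.src Q.src
  | inact => .inact

def subst : (ℕ → Val) → AProc → AProc
  | σ, choice q q' w x n l a P =>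
      choice q q' w (x.subst σ) n l (fun i => (a i).subst σ) (fun i => (P i).subst ((a i).under σ))
  | σ, par P Q => par (P.subst σ) (Q.subst σ)
  | σ, res P => res (P.subst (up (up σ)))
  | σ, ite v P Q => ite (v.subst σ) (P.subst σ) (Q.subst σ)
  | _, inact => inact

/-- The encoding of annotated processes. -/
noncomputable def enc : AProc → CMV.Proc
  | choice q q' w x _ l a P => Encoding.encChoice l a (fun i => (P i).enc) q q' w x
  | par P Q => .par P.enc Q.enc
  | res P => .res P.enc
  | ite v P Q => .ite v P.enc Q.enc
  | inact => .inact

theorem subst_subst (P : AProc) (σ τ : ℕ → Val) : (P.subst τ).subst σ = P.subst (scomp σ τ) := by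
  induction P generalizing σ τ with
  | choice q q' w x n l a P ih =>
    simp [subst, Val.subst_subst, ih, Act.subst_subst, Act.under_scomp]
  | par P Q ihP ihQ => simp [subst, ihP, ihQ]
  | res P ih => simp [subst, ih, up_scomp]
  | ite v P Q ihP ihQ => simp [subst, Val.subst_subst, ihP, ihQ]
  | inact => rfl

theorem subst_var (P : AProc) : P.subst Val.var = P := by
  induction P with
  | choice q q' w x n l a P ih => simp [subst, Val.subst_var, ih, Act.subst_var, Act.under_var]
  | par P Q ihP ihQ => simp [subst, ihP, ihQ]
  | res P ih => simp [subst, ih, up_var]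
  | ite v P Q ihP ihQ => simp [subst, Val.subst_var, ihP, ihQ]
  | inact => rfl

theorem src_subst (P : AProc) (σ : ℕ → Val) : (P.subst σ).src = P.src.subst σ := by
  induction P generalizing σ with
  | choice q q' w x n l a P ih => simp [subst, src, Proc.subst, ih]
  | par P Q ihP ihQ => simp [subst, src, Proc.subst, ihP, ihQ]
  | res P ih => simp [subst, src, Proc.subst, ih]
  | ite v P Q ihP ihQ => simp [subst, src, Proc.subst, ihP, ihQ]
  | inact => rfl

/-- An annotation of an instance of `P` comes from an annotation of `P`. -/
theorem exists_of_src_eq_subst (P : Proc) (σ : ℕ → Val) (p : AProc) (h : p.src = P.subst σ) :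
    ∃ p₀ : AProc, p₀.src = P ∧ p₀.subst σ = p := by
  induction P generalizing σ p with
  | choice q x n l a P ih =>
    cases p with
    | choice q₁ q' w x₁ n₁ l₁ a₁ P₁ =>
      simp only [src, Proc.subst, Proc.choice.injEq] at h; obtain ⟨rfl, rfl, rfl, h⟩ := h
      simp only [heq_eq_eq] at h; obtain ⟨rfl, rfl, h⟩ := h
      choose p₀ hp hs using fun i => ih i _ (P₁ i) (congrFun h i)
      exact ⟨.choice q₁ q' w x n₁ l₁ a p₀, by simp [src, hp], by simp [subst, hs]⟩
    | _ => simp [src, Proc.subst] at h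
  | par P Q ihP ihQ =>
    cases p with
    | par P₁ Q₁ =>
      simp only [src, Proc.subst, Proc.par.injEq] at h; obtain ⟨p, hp, rfl⟩ := ihP _ _ h.1
      obtain ⟨q, hq, rfl⟩ := ihQ _ _ h.2; exact ⟨.par p q, by simp [src, hp, hq], rfl⟩
    | _ => simp [src, Proc.subst] at h
  | res P ih =>
    cases p with
    | res P₁ =>
      simp only [src, Proc.subst, Proc.res.injEq] at h; obtain ⟨p, hp, rfl⟩ := ih _ _ h
      exact ⟨.res p, by simp [src, hp], rfl⟩
    | _ => simp [src, Proc.subst] at h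
  | ite v P Q ihP ihQ =>
    cases p with
    | ite v₁ P₁ Q₁ =>
      simp only [src, Proc.subst, Proc.ite.injEq] at h; obtain ⟨rfl, h1, h2⟩ := h
      obtain ⟨p, hp, rfl⟩ := ihP _ _ h1; obtain ⟨q, hq, rfl⟩ := ihQ _ _ h2
      exact ⟨.ite v p q, by simp [src, hp, hq], rfl⟩
    | _ => simp [src, Proc.subst] at h
  | inact =>
    cases p with
    | inact => exact ⟨.inact, rfl, rfl⟩
    | _ => simp [src, Proc.subst] at h

end AProc

theorem Proc.subst_subst (P : Proc) (σ τ : ℕ → Val) : (P.subst τ).subst σ = P.subst (scomp σ τ) := by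
  induction P generalizing σ τ with
  | choice q x n l a P ih => simp [subst, Val.subst_subst, ih, Act.subst_subst, Act.under_scomp]
  | par P Q ihP ihQ => simp [subst, ihP, ihQ]
  | res P ih => simp [subst, ih, up_scomp]
  | ite v P Q ihP ihQ => simp [subst, Val.subst_subst, ihP, ihQ]
  | inact => rfl

theorem Cong.subst (σ : ℕ → Val) {P Q : Proc} (h : Cong P Q) : Cong (P.subst σ) (Q.subst σ) := by
  induction h generalizing σ with
  | refl P => exact .refl _
  | symm _ ih => exact .symm (ih σ)
  | trans _ _ ih1 ih2 => exact .trans (ih1 σ) (ih2 σ)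
  | choice _ ih => exact .choice fun i => ih i _
  | par _ _ ih1 ih2 => exact .par (ih1 σ) (ih2 σ)
  | res _ ih => exact .res (ih _)
  | ite _ _ ih1 ih2 => exact .ite (ih1 σ) (ih2 σ)
  | resInact => exact .resInact
  | resRes P =>
    have h := Cong.resRes (P.subst (up (up (up (up σ)))))
    rw [Proc.subst_subst, CMV.scomp_up4_exchange, ← Proc.subst_subst] at h; exact h
  | resPar P Q =>
    have h := Cong.resPar (P.subst σ) (Q.subst (up (up σ)))
    rw [Proc.subst_subst, ← upup_wk, ← Proc.subst_subst] at h; exact h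
  | resSwap P =>
    have h := Cong.resSwap (P.subst (up (up σ)))
    rw [Proc.subst_subst, CMV.scomp_upup_swap, ← Proc.subst_subst] at h; exact h
  | parInact P => exact .parInact _
  | parComm P Q => exact .parComm _ _
  | parAssoc P Q R => exact .parAssoc _ _ _

theorem persist_subst (q : Qual) (C P : Proc) (σ : ℕ → Val) :
    (persist q C P).subst σ = persist q (C.subst σ) (P.subst σ) := by cases q <;> rfl

theorem Red.subst (σ : ℕ → Val) {P Q : Proc} (h : Red P Q) : Red (P.subst σ) (Q.subst σ) := by
  induction h generalizing σ with
  | iteTrue P Q => exact .iteTrue _ _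
  | iteFalse P Q => exact .iteFalse _ _
  | @com q n l a P q' n' l' a' P' R i j v hi hj hl =>
    have h := Red.com (q := q) (q' := q') (l := l) (l' := l')
      (a := fun i => (a i).subst (up (up σ))) (a' := fun i => (a' i).subst (up (up σ)))
      (P := fun i => (P i).subst ((a i).under (up (up σ))))
      (P' := fun i => (P' i).subst ((a' i).under (up (up σ))))
      (R.subst (up (up σ))) i j (v.subst (up (up σ))) (by rw [hi]; rfl) (by rw [hj]; rfl) hl
    rw [hi, hj] at h
    have e : ((P' j).subst (up (up (up σ)))).subst (inst (v.subst (up (up σ)))) =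
        ((P' j).subst (inst v)).subst (up (up σ)) := by
      rw [Proc.subst_subst, Proc.subst_subst, scomp_inst]
    change Red _ (Proc.res (Proc.par (persist q _ ((P i).subst (up (up σ)))) (Proc.par
      (persist q' _ (((P' j).subst (up (up (up σ)))).subst (inst (v.subst (up (up σ)))))) _))) at h
    rw [e] at h; simp only [Proc.subst, persist_subst]; exact h
  | par Q _ ih => exact .par _ (ih σ)
  | res _ ih => exact .res (ih _)
  | struct h1 _ h2 ih => exact .struct (h1.subst σ) (ih σ) (h2.subst σ)

instance : Calculus AProc where
  par := .par
  res := .res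
  inact := .inact
  subst := AProc.subst
  Cong p q := Cong p.src q.src
  subst_par _ _ _ := rfl
  subst_res _ _ := rfl
  subst_inact _ := rfl
  subst_subst σ τ p := p.subst_subst σ τ
  refl _ := .refl _
  symm := .symm
  trans := .trans
  cong_par := .par
  cong_res := .res
  cong_subst σ p q h := by rw [AProc.src_subst, AProc.src_subst]; exact h.subst σ
  resInact := .resInact
  resRes p := by simp only [AProc.src, AProc.src_subst]; exact .resRes _
  resPar p q := by simp only [AProc.src, AProc.src_subst]; exact .resPar _ _
  resSwap p := by simp only [AProc.src, AProc.src_subst]; exact .resSwap _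
  parInact _ := .parInact _
  parComm _ _ := .parComm _ _
  parAssoc _ _ _ := .parAssoc _ _ _

end Mix

/-! ## The encoding commutes with substitution and respects structural congruence -/

namespace Encoding

open CMV CMV.Proc Mix

theorem parList_map_subst (σ : ℕ → Val) (l : List CMV.Proc) :
    (parList l).subst σ = parList (l.map (CMV.Proc.subst σ)) := by
  induction l with
  | nil => rfl
  | cons P l ih => simp [parList, CMV.Proc.subst, ih]

theorem ndc_subst (L : Finset Label) (P : Label → CMV.Proc) (σ : ℕ → Val) :
    (ndc L P).subst σ = ndc L (fun l => (P l).subst σ) := by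
  simp only [ndc, CMV.Proc.subst, parList_map_subst, List.map_map]
  congr 3
  funext l; rw [CMV.Proc.subst_subst, CMV.Proc.subst_subst, upup_wk]

theorem prefixOn_subst (c : Val) (E : CMV.Proc) (a : Act) (σ : ℕ → Val) :
    (prefixOn c E a).subst σ = prefixOn (c.subst σ) (E.subst (a.under σ)) (a.subst σ) := by
  cases a <;> rfl

section

variable {n : ℕ} (l : Fin (n + 1) → ℕ) (a : Fin (n + 1) → Act) (E : Fin (n + 1) → CMV.Proc)

theorem labels_subst (f : Pol → Pol) (σ : ℕ → Val) :
    labels l (fun i => (a i).subst σ) f = labels l a f := by simp [labels]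

theorem duplicates_subst (f : Pol → Pol) (k : Label) (c : Val) (σ : ℕ → Val) :
    (duplicates l a E f k c).subst σ =
      duplicates l (fun i => (a i).subst σ) (fun i => (E i).subst ((a i).under σ)) f k
        (c.subst σ) := by
  simp only [duplicates, ndc_subst, Act.pol_subst]
  congr 1
  funext k
  cases k with
  | tag _ _ => rfl
  | idx j => exact prefixOn_subst _ _ _ _

theorem bran_congr (x : Val) {L L' : Finset Label} (h : L = L') (F : Label → CMV.Proc) :
    bran x L (fun k => F k.1) = bran x L' (fun k => F k.1) := by subst h; rfl

theorem extLin_subst (c : Val) (σ : ℕ → Val) :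
    (extLin l a E c).subst σ =
      extLin l (fun i => (a i).subst σ) (fun i => (E i).subst ((a i).under σ)) (c.subst σ) := by
  simp only [extLin, CMV.Proc.subst, duplicates_subst]
  exact bran_congr _ (labels_subst l a Pol.dual σ).symm fun k =>
    duplicates l (fun i => (a i).subst σ) (fun i => (E i).subst ((a i).under σ)) Pol.dual k
      (c.subst σ)

theorem intLin_subst (c : Val) (σ : ℕ → Val) :
    (intLin l a E c).subst σ =
      intLin l (fun i => (a i).subst σ) (fun i => (E i).subst ((a i).under σ)) (c.subst σ) := by
  simp only [intLin, ndc_subst, CMV.Proc.subst, duplicates_subst, labels_subst]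

theorem wkAct_subst (k : ℕ) (σ τ : ℕ → Val) (h : scomp τ (wk k) = scomp (wk k) σ) :
    (fun i => (wkAct a k i).subst τ) = wkAct (fun i => (a i).subst σ) k := by
  funext i; simp only [wkAct, Act.subst_subst, h]

theorem wkCont_subst (k : ℕ) (σ τ : ℕ → Val) (h : scomp τ (wk k) = scomp (wk k) σ) :
    (fun i => (wkCont a E k i).subst ((wkAct a k i).under τ)) =
      wkCont (fun i => (a i).subst σ) (fun i => (E i).subst ((a i).under σ)) k := by
  funext i; simp only [wkCont, wkAct, CMV.Proc.subst_subst, Act.under_subst, ← Act.under_scomp, h]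

theorem extUn_subst (q : Qual) (x : Val) (σ : ℕ → Val) :
    (extUn l a E q x).subst σ =
      extUn l (fun i => (a i).subst σ) (fun i => (E i).subst ((a i).under σ)) q (x.subst σ) := by
  simp only [extUn, CMV.Proc.subst, extLin_subst, wkAct_subst a 1 σ (up σ) rfl,
    wkCont_subst a E 1 σ (up σ) rfl]
  rfl

theorem Val.subst_wk (x : Val) (k : ℕ) (σ τ : ℕ → Val) (h : scomp τ (wk k) = scomp (wk k) σ) :
    (x.subst (wk k)).subst τ = (x.subst σ).subst (wk k) := by
  rw [Val.subst_subst, Val.subst_subst, h]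

theorem intUn_subst (x : Val) (σ : ℕ → Val) :
    (intUn l a E x).subst σ =
      intUn l (fun i => (a i).subst σ) (fun i => (E i).subst ((a i).under σ)) (x.subst σ) := by
  simp only [intUn, ndc_subst, CMV.Proc.subst, duplicates_subst, labels_subst,
    wkAct_subst a 2 σ _ (upup_wk σ), wkCont_subst a E 2 σ _ (upup_wk σ),
    Val.subst_wk x 2 σ _ (upup_wk σ)]
  rfl

theorem loopName_subst (a : Act) (σ : ℕ → Val) : loopName (a.subst σ) = loopName a := by
  cases a <;> rfl

theorem loop_subst (x : Val) (σ : ℕ → Val) :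
    (loop l a E x).subst σ =
      loop l (fun i => (a i).subst σ) (fun i => (E i).subst ((a i).under σ)) (x.subst σ) := by
  simp only [loop, CMV.Proc.subst, intUn_subst, wkAct_subst a 3 σ _ (up3_wk σ),
    Val.subst_wk x 3 σ _ (up3_wk σ)]
  have h := wkCont_subst a E 3 σ _ (up3_wk σ)
  have e : (fun i => CMV.Proc.par
      ((wkCont a E 3 i).subst ((wkAct a 3 i).under (up (up (up σ)))))
      (.out ((loopName (a i)).subst ((wkAct a 3 i).under (up (up (up σ)))))
        (Val.unit.subst ((wkAct a 3 i).under (up (up (up σ))))) .inact)) =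
      fun i => CMV.Proc.par
        (wkCont (fun i => (a i).subst σ) (fun i => (E i).subst ((a i).under σ)) 3 i)
        (.out (loopName ((a i).subst σ)) .unit .inact) := by
    funext i; rw [← congrFun h i]
    congr 2
    rw [loopName_subst]; simp only [wkAct, Act.under_subst]; cases a i <;> rfl
  rw [e]; rfl

theorem encChoice_subst (q q' : Qual) (w : View) (x : Val) (σ : ℕ → Val) :
    (encChoice l a E q q' w x).subst σ =
      encChoice l (fun i => (a i).subst σ) (fun i => (E i).subst ((a i).under σ)) q q' w
        (x.subst σ) := by
  cases q' <;> cases w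
  · exact intLin_subst l a E x σ
  · exact extLin_subst l a E x σ
  · cases q
    · exact intUn_subst l a E x σ
    · exact loop_subst l a E x σ
  · exact extUn_subst l a E q x σ

end

theorem _root_.Mix.AProc.enc_subst (P : AProc) (σ : ℕ → Val) :
    (P.subst σ).enc = P.enc.subst σ := by
  induction P generalizing σ with
  | choice q q' w x n l a P ih => simp [AProc.subst, AProc.enc, encChoice_subst, ih]
  | par P Q ihP ihQ => simp [AProc.subst, AProc.enc, CMV.Proc.subst, ihP, ihQ]
  | res P ih => simp [AProc.subst, AProc.enc, CMV.Proc.subst, ih]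
  | ite v P Q ihP ihQ => simp [AProc.subst, AProc.enc, CMV.Proc.subst, ihP, ihQ]
  | inact => rfl

theorem ndc_cong {L : Finset Label} {P Q : Label → CMV.Proc} (h : ∀ l, CMV.Cong (P l) (Q l)) :
    CMV.Cong (ndc L P) (ndc L Q) :=
  .res (.par (.bran fun l => (h l.1).subst _) (.refl _))

section

variable {n : ℕ} {l : Fin (n + 1) → ℕ} {a : Fin (n + 1) → Act} {E F : Fin (n + 1) → CMV.Proc}

theorem duplicates_cong (h : ∀ i, CMV.Cong (E i) (F i)) (f : Pol → Pol) (k : Label) (c : Val) :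
    CMV.Cong (duplicates l a E f k c) (duplicates l a F f k c) := by
  refine ndc_cong fun k => ?_
  cases k with
  | tag _ _ => exact .refl _
  | idx j =>
    change CMV.Cong (prefixOn _ _ (a (Fin.ofNat (n + 1) j))) (prefixOn _ _ (a (Fin.ofNat (n + 1) j)))
    cases a (Fin.ofNat (n + 1) j) with
    | send v => exact .out (h _)
    | recv => exact .inp (h _)

theorem wkCont_cong (h : ∀ i, CMV.Cong (E i) (F i)) (k : ℕ) (i : Fin (n + 1)) :
    CMV.Cong (wkCont a E k i) (wkCont a F k i) := (h i).subst _

theorem extLin_cong (h : ∀ i, CMV.Cong (E i) (F i)) (c : Val) :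
    CMV.Cong (extLin l a E c) (extLin l a F c) :=
  .bran fun _ => duplicates_cong h _ _ _

theorem intLin_cong (h : ∀ i, CMV.Cong (E i) (F i)) (c : Val) :
    CMV.Cong (intLin l a E c) (intLin l a F c) :=
  ndc_cong fun _ => .sel (duplicates_cong h _ _ _)

theorem intUn_cong (h : ∀ i, CMV.Cong (E i) (F i)) (x : Val) :
    CMV.Cong (intUn l a E x) (intUn l a F x) :=
  ndc_cong fun _ => .res (.out (.sel (duplicates_cong (wkCont_cong h 2) _ _ _)))

theorem encChoice_cong (h : ∀ i, CMV.Cong (E i) (F i)) (q q' : Qual) (w : View) (x : Val) :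
    CMV.Cong (encChoice l a E q q' w x) (encChoice l a F q q' w x) := by
  cases q' <;> cases w
  · exact intLin_cong h x
  · exact extLin_cong h x
  · cases q
    · exact intUn_cong h x
    · exact .res (.par (.refl _) (.inp (intUn_cong (fun i => .par (wkCont_cong h 3 i) (.refl _)) _)))
  · exact .inp (extLin_cong (wkCont_cong h 1) _)

end

end Encoding

/-! ## Subtyping and duality -/

namespace Mix

theorem Unf.det {T A B : Ty} (h : Unf T A) (h' : Unf T B) : A = B := by
  induction h with
  | mu _ ih => cases h' with | mu h' => grind
  | _ => cases h'; rfl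

theorem SubHead.mono {R R' : Ty → Ty → Prop} (h : ∀ A B, R A B → R' A B) {A B : Ty}
    (hs : SubHead R A B) : SubHead R' A B := by
  cases hs with
  | unit => exact .unit
  | bool => exact .bool
  | done => exact .done
  | choice h1 h2 h3 h4 h5 =>
    exact .choice h1 h2 (fun k a b c => h _ _ (h3 k a b c)) (fun k a b c => h _ _ (h4 k a b c))
      (fun k a b => h _ _ (h5 k a b))

theorem Sub.unfold {A B : Ty} (h : Sub A B) :
    ∃ A' B', Unf A A' ∧ Unf B B' ∧ SubHead Sub A' B' := by
  obtain ⟨R, hR, hAB⟩ := h; obtain ⟨A', B', h1, h2, h3⟩ := hR A B hAB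
  exact ⟨A', B', h1, h2, h3.mono fun X Y hXY => ⟨R, hR, hXY⟩⟩

theorem Sub.trans {A B C : Ty} (h : Sub A B) (h' : Sub B C) : Sub A C := by
  refine ⟨fun A C => ∃ B, Sub A B ∧ Sub B C, ?_, B, h, h'⟩; rintro A C ⟨B, h, h'⟩
  obtain ⟨A₁, B₁, hA, hB, hs⟩ := h.unfold; obtain ⟨B₂, C₁, hB', hC, hs'⟩ := h'.unfold
  obtain rfl := hB.det hB'; refine ⟨A₁, C₁, hA, hC, ?_⟩
  cases hs with
  | unit => cases hs'; exact .unit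
  | bool => cases hs'; exact .bool
  | done => cases hs'; exact .done
  | choice h1 h2 h3 h4 h5 =>
    rename_i q w K pay cont K' pay' cont'; have .choice g1 g2 g3 g4 g5 := hs'
    rename_i K'' pay'' cont''
    have key : ∀ k, k ∈ K → k ∈ K'' → k ∈ K' := by
      intro k hk hk''
      cases w with
      | int => grind
      | ext => grind
    exact .choice (fun hw => (g1 hw).trans (h1 hw)) (fun hw => (h2 hw).trans (g2 hw))
      (fun k a b c => ⟨_, g3 k (key k a b) b c, h3 k a (key k a b) c⟩)
      (fun k a b c => ⟨_, h4 k a (key k a b) c, g4 k (key k a b) b c⟩)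
      (fun k a b => ⟨_, h5 k a (key k a b), g5 k (key k a b) b⟩)

/-- Equality or subtyping. -/
def Le (T U : Ty) : Prop := T = U ∨ Sub T U

theorem Le.refl (T : Ty) : Le T T := .inl rfl

theorem Le.sub {A B C : Ty} (h : Le A B) (h' : Sub B C) : Sub A C := by
  rcases h with rfl | h
  · exact h'
  · exact h.trans h'

theorem un_iff_of_unf {T A : Ty} (h : Unf T A) : Un T ↔
    (A = .unit ∨ A = .bool ∨ A = .done ∨ ∃ w K pay cont, A = .choice .un w K pay cont) := by
  constructor
  · rintro (h' | h' | h' | ⟨w, K, pay, cont, h'⟩)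
    · exact .inl (h.det h')
    · exact .inr (.inl (h.det h'))
    · exact .inr (.inr (.inl (h.det h')))
    · exact .inr (.inr (.inr ⟨w, K, pay, cont, h.det h'⟩))
  · rintro (rfl | rfl | rfl | ⟨w, K, pay, cont, rfl⟩)
    · exact .inl h
    · exact .inr (.inl h)
    · exact .inr (.inr (.inl h))
    · exact .inr (.inr (.inr ⟨w, K, pay, cont, h⟩))

theorem Sub.un_iff {A B : Ty} (h : Sub A B) : Un A ↔ Un B := by
  obtain ⟨A', B', hA, hB, hs⟩ := h.unfold; rw [un_iff_of_unf hA, un_iff_of_unf hB]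
  cases hs <;> simp

theorem Le.un_iff {A B : Ty} (h : Le A B) : Un A ↔ Un B := by
  rcases h with rfl | h
  · rfl
  · exact h.un_iff

theorem DualHead.mono {R R' : Ty → Ty → Prop} (h : ∀ A B, R A B → R' A B) {A B : Ty}
    (hs : DualHead R A B) : DualHead R' A B := by
  cases hs with
  | done => exact .done
  | choice h1 h2 => exact .choice h1 fun l p a b => ⟨(h2 l p a b).1, h _ _ (h2 l p a b).2⟩

theorem Dual.unfold {A B : Ty} (h : Dual A B) :
    ∃ A' B', Unf A A' ∧ Unf B B' ∧ DualHead Dual A' B' := by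
  obtain ⟨R, hR, hAB⟩ := h; obtain ⟨A', B', h1, h2, h3⟩ := hR A B hAB
  exact ⟨A', B', h1, h2, h3.mono fun X Y hXY => ⟨R, hR, hXY⟩⟩

theorem Dual.symm {A B : Ty} (h : Dual A B) : Dual B A := by
  refine ⟨fun A B => Dual B A, ?_, h⟩; intro B A h; obtain ⟨A', B', hA, hB, hs⟩ := h.unfold
  refine ⟨B', A', hB, hA, ?_⟩
  cases hs with
  | done => exact .done
  | choice h1 h2 =>
    rename_i q w K pay cont K' pay' cont'; have hw : w = w.dual.dual := by cases w <;> rfl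
    have key : DualHead (fun A B => Dual B A) (.choice q w.dual K' pay' cont')
        (.choice q w.dual.dual K pay cont) := by
      refine .choice (fun l p => ?_) (fun l p h h' => ?_)
      · have := h1 l p.dual; cases p <;> exact this.symm
      · have h' := h'; cases p
        · exact ⟨(h2 l .inp h' h).1.symm, (h2 l .inp h' h).2⟩
        · exact ⟨(h2 l .out h' h).1.symm, (h2 l .out h' h).2⟩
    grind

theorem Dual.un_iff {A B : Ty} (h : Dual A B) : Un A ↔ Un B := by
  obtain ⟨A', B', hA, hB, hs⟩ := h.unfold; rw [un_iff_of_unf hA, un_iff_of_unf hB]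
  cases hs <;> simp

theorem dual_done : Dual .done .done :=
  ⟨fun A B => A = .done ∧ B = .done, by
    rintro A B ⟨rfl, rfl⟩; exact ⟨_, _, .done, .done, .done⟩, rfl, rfl⟩

theorem un_done : Un .done := .inr (.inr (.inl .done))

theorem Sub.of_choice {T : Ty} {q w K pay cont} (h : Sub T (.choice q w K pay cont)) :
    ∃ K' pay' cont', Unf T (.choice q w K' pay' cont') ∧
      SubHead Sub (.choice q w K' pay' cont') (.choice q w K pay cont) := by
  obtain ⟨A', B', hA, hB, hs⟩ := h.unfold; cases hB; cases hs
  exact ⟨_, _, _, hA, .choice (by grind) (by grind) (by grind) (by grind) (by grind)⟩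

/-! ## Context splitting -/

theorem Split.symm {Γ Γ₁ Γ₂ : Ctx} (h : Split Γ Γ₁ Γ₂) : Split Γ Γ₂ Γ₁ := by
  intro x; rcases h x with ⟨a, b, c⟩ | ⟨T, hT, ⟨a, b, c⟩ | ⟨a, b, c⟩ | ⟨a, b, c⟩⟩
  · grind
  · grind
  · grind
  grind

theorem Split.left {Γ Γ₁ Γ₂ : Ctx} (h : Split Γ Γ₁ Γ₂) {x T} (hx : Γ₁ x = some T) :
    Γ x = some T := by
  rcases h x with ⟨a, b, c⟩ | ⟨T, hT, ⟨a, b, c⟩ | ⟨a, b, c⟩ | ⟨a, b, c⟩⟩ <;> simp_all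

theorem Split.right {Γ Γ₁ Γ₂ : Ctx} (h : Split Γ Γ₁ Γ₂) {x T} (hx : Γ₂ x = some T) :
    Γ x = some T := h.symm.left hx

open Classical in
/-- The unrestricted part of `Δ` with those linear names that belong to `S`. -/
noncomputable def Ctx.restr (Δ : Ctx) (S : ℕ → Prop) : Ctx := fun y =>
  match Δ y with
  | none => none
  | some T => if Un T ∨ S y then some T else none

theorem Ctx.restr_eq_some {Δ : Ctx} {S : ℕ → Prop} {y : ℕ} {T : Ty} :
    Δ.restr S y = some T ↔ Δ y = some T ∧ (Un T ∨ S y) := by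
  unfold Ctx.restr; grind

theorem split_restr {Δ : Ctx} {S₁ S₂ : ℕ → Prop}
    (h : ∀ y T, Δ y = some T → ¬ Un T → (S₁ y ∧ ¬ S₂ y) ∨ (¬ S₁ y ∧ S₂ y)) :
    Split Δ (Δ.restr S₁) (Δ.restr S₂) := by
  intro y; rcases hy : Δ y with _ | T
  · left; simp [Ctx.restr, hy]
  · right; refine ⟨T, rfl, ?_⟩
    by_cases hu : Un T
    · left; simp [Ctx.restr, hy, hu]
    · right; rcases h y T hy hu with ⟨a, b⟩ | ⟨a, b⟩
      · left; simp [Ctx.restr, hy, hu, a, b]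
      · right; simp [Ctx.restr, hy, hu, a, b]

theorem Split.assoc {Γ Γ₁ Δ Γ₂ Γ₃ : Ctx} (h : Split Γ Γ₁ Δ) (h' : Split Δ Γ₂ Γ₃) :
    ∃ Θ, Split Γ Θ Γ₃ ∧ Split Θ Γ₁ Γ₂ := by
  refine ⟨Γ.restr fun x => Γ₁ x ≠ none ∨ Γ₂ x ≠ none, fun x => ?_, fun x => ?_⟩ <;>
  · have h2 := h' x
    rcases h x with ⟨a, b, c⟩ | ⟨T, hT, ⟨a, b, c⟩ | ⟨a, b, c⟩ | ⟨a, b, c⟩⟩ <;>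
    rw [c] at h2 <;> simp_all [Ctx.restr] <;> grind

theorem split_unit (Γ : Ctx) : Split Γ Γ (Γ.restr fun _ => False) := by
  have h := split_restr (Δ := Γ) (S₁ := fun _ => True) (S₂ := fun _ => False)
    fun _ _ _ _ => .inl ⟨trivial, id⟩
  have e : Γ.restr (fun _ => True) = Γ := by
    funext x; rcases hx : Γ x with _ | T <;> simp [Ctx.restr, hx]
  grind

theorem unCtx_restr_false (Γ : Ctx) : UnCtx (Γ.restr fun _ => False) := by
  intro x T h; rw [Ctx.restr_eq_some] at h; grind

theorem Split.eq_left {Γ Γ₁ Γ₂ : Ctx} (h : Split Γ Γ₁ Γ₂) (hu : UnCtx Γ₂) : Γ = Γ₁ := by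
  funext x; rcases h x with ⟨a, b, c⟩ | ⟨T, hT, ⟨a, b, c⟩ | ⟨a, b, c⟩ | ⟨a, b, c⟩⟩
  · grind
  · grind
  · grind
  · exact absurd (hu x T c) a

/-! ## Typing of annotated processes -/

/-- Typing of annotated processes. -/
inductive Typing : Ctx → AProc → Prop
  | inact {Γ} : UnCtx Γ → Typing Γ .inact
  | par {Γ Γ₁ Γ₂ P Q} : Split Γ Γ₁ Γ₂ → Typing Γ₁ P → Typing Γ₂ Q → Typing Γ (.par P Q)
  | res {Γ P} (T U : Ty) : Dual T U → Typing (Ctx.cons T (Ctx.cons U Γ)) P → Typing Γ (.res P)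
  | ite {Γ Γ₁ Γ₂ v P Q} : Split Γ Γ₁ Γ₂ → ValTy Γ₁ v .bool → Typing Γ₂ P → Typing Γ₂ Q →
      Typing Γ (.ite v P Q)
  | choice {Γ Γ₁ Γ₂ q x n l a P} (q' : Qual) (w : View) (K : Finset (ℕ × Pol))
      (pay cont : {k // k ∈ K} → Ty) (key : Fin (n + 1) → {k // k ∈ K})
      (Δ Θ : Fin (n + 1) → Ctx) :
      Split Γ Γ₁ Γ₂ → (q = .un → UnCtx Γ) →
      ValTy Γ₁ (.var x) (.choice q' w K pay cont) →
      (∀ i, (key i).1 = (l i, (a i).pol)) → Function.Surjective key →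
      (∀ i, Update Γ₂ x (cont (key i)) (Δ i)) →
      (∀ i, BranchCtx (Δ i) (a i) (pay (key i)) (Θ i)) →
      (∀ i, Typing (Θ i) (P i)) → Typing Γ (.choice q q' w (.var x) n l a P)

theorem exists_annotation {Γ : Ctx} {S : Proc} (d : Deriv Γ S) :
    ∃ p : AProc, p.src = S ∧ Typing Γ p ∧ p.enc = Encoding.enc d := by
  induction d with
  | inact h => exact ⟨.inact, rfl, .inact h, rfl⟩
  | par h d e ihd ihe =>
    obtain ⟨p, rfl, hp, ep⟩ := ihd; obtain ⟨r, rfl, hr, er⟩ := ihe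
    exact ⟨.par p r, rfl, .par h hp hr, by simp [AProc.enc, Encoding.enc, ep, er]⟩
  | res T U h d ih =>
    obtain ⟨p, rfl, hp, ep⟩ := ih
    exact ⟨.res p, rfl, .res T U h hp, by simp [AProc.enc, Encoding.enc, ep]⟩
  | ite h hv d e ihd ihe =>
    obtain ⟨p, rfl, hp, ep⟩ := ihd; obtain ⟨r, rfl, hr, er⟩ := ihe
    exact ⟨.ite _ p r, rfl, .ite h hv hp hr, by simp [AProc.enc, Encoding.enc, ep, er]⟩
  | choice q' w K pay cont key Δ Θ h hq hx hkey hsurj hΔ hΘ d ih =>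
    choose p hp ht he using ih
    refine ⟨.choice _ q' w _ _ _ _ p, by simp [AProc.src, hp],
      .choice q' w K pay cont key Δ Θ h hq hx hkey hsurj hΔ hΘ ht, ?_⟩
    simp [AProc.enc, Encoding.enc, he]

theorem Typing.exists_deriv {Γ : Ctx} {p : AProc} (h : Typing Γ p) :
    ∃ d : Deriv Γ p.src, Encoding.enc d = p.enc := by
  induction h with
  | inact h => exact ⟨.inact h, rfl⟩
  | par h _ _ ih1 ih2 =>
    obtain ⟨d, hd⟩ := ih1; obtain ⟨e, he⟩ := ih2
    exact ⟨.par h d e, by simp [AProc.enc, Encoding.enc, hd, he]⟩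
  | res T U h _ ih =>
    obtain ⟨d, hd⟩ := ih; exact ⟨.res T U h d, by simp [AProc.enc, Encoding.enc, hd]⟩
  | ite h hv _ _ ih1 ih2 =>
    obtain ⟨d, hd⟩ := ih1; obtain ⟨e, he⟩ := ih2
    exact ⟨.ite h hv d e, by simp [AProc.enc, Encoding.enc, hd, he]⟩
  | choice q' w K pay cont key Δ Θ h hq hx hkey hsurj hΔ hΘ _ ih =>
    choose d hd using ih
    exact ⟨.choice q' w K pay cont key Δ Θ h hq hx hkey hsurj hΔ hΘ d, by
      simp [AProc.enc, Encoding.enc, hd]⟩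

/-! ### Typed substitutions -/

/-- The value `v` can be used at the type `T`. -/
def ValLe (Δ : Ctx) (v : Val) (T : Ty) : Prop :=
  match v with
  | .var y => ∃ T', Δ y = some T' ∧ Le T' T
  | .unit => Sub .unit T
  | .tt => Sub .bool T
  | .ff => Sub .bool T

/-- `σ` maps the names of `Γ` to values of `Δ` that can be used at their types, and every linear
name of `Δ` comes from exactly one name of `Γ`. -/
def RespSub (σ : ℕ → Val) (Γ Δ : Ctx) : Prop :=
  (∀ x T, Γ x = some T → ValLe Δ (σ x) T) ∧
  (∀ y T, Δ y = some T → ¬ Un T → ∃! x, σ x = .var y ∧ Γ x ≠ none)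



namespace RespSub

variable {σ : ℕ → Val} {Γ Δ : Ctx}

theorem var (h : RespSub σ Γ Δ) {x T y} (hx : Γ x = some T) (hy : σ x = .var y) :
    ∃ T', Δ y = some T' ∧ Le T' T := by
  have := h.1 x T hx; rwa [hy] at this

theorem unCtx (h : RespSub σ Γ Δ) (hu : UnCtx Γ) : UnCtx Δ := by
  intro y T hy; by_contra hn; obtain ⟨x, ⟨hx, hne⟩, -⟩ := h.2 y T hy hn
  obtain ⟨T₀, hT₀⟩ := exists_some hne; obtain ⟨T', hT', hle⟩ := h.var hT₀ hx
  rw [hy] at hT'; cases hT'; exact hn (hle.un_iff.mpr (hu x _ hT₀))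

theorem valTy (h : RespSub σ Γ Δ) {v T} (hv : ValTy Γ v T) : ValTy Δ (v.subst σ) T := by
  cases hv with
  | unit hu hs => exact .unit (h.unCtx hu) hs
  | tt hu hs => exact .tt (h.unCtx hu) hs
  | ff hu hs => exact .ff (h.unCtx hu) hs
  | @var x T₁ _ hx ho hs =>
    have key : ∀ y V, σ x ≠ .var y → Δ y = some V → Un V := by
      intro y V hxy hy; by_contra hn; obtain ⟨z, ⟨hz, hne⟩, -⟩ := h.2 y V hy hn
      obtain ⟨T₀, hT₀⟩ := exists_some hne; obtain ⟨T', hT', hle⟩ := h.var hT₀ hz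
      rw [hy] at hT'; cases hT'; refine hn (hle.un_iff.mpr (ho z _ ?_ hT₀)); grind
    have hv := h.1 x T₁ hx; change ValTy Δ (σ x) T
    cases hσ : σ x with
    | var y =>
      rw [hσ] at hv; obtain ⟨T', hT', hle⟩ := hv
      exact .var hT' (fun z V hz hzV => key z V (by grind) hzV) (hle.sub hs)
    | unit => rw [hσ] at hv; exact .unit (fun y V hy => key y V (by grind) hy) (Sub.trans hv hs)
    | tt => rw [hσ] at hv; exact .tt (fun y V hy => key y V (by grind) hy) (Sub.trans hv hs)
    | ff => rw [hσ] at hv; exact .ff (fun y V hy => key y V (by grind) hy) (Sub.trans hv hs)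

theorem split (h : RespSub σ Γ Δ) {Γ₁ Γ₂} (hs : Split Γ Γ₁ Γ₂) :
    ∃ Δ₁ Δ₂, Split Δ Δ₁ Δ₂ ∧ RespSub σ Γ₁ Δ₁ ∧ RespSub σ Γ₂ Δ₂ := by
  have half : ∀ {Γ₁ Γ₂ : Ctx}, Split Γ Γ₁ Γ₂ →
      RespSub σ Γ₁ (Δ.restr fun y => ∃ x, σ x = .var y ∧ Γ₁ x ≠ none) := by
    intro Γ₁ Γ₂ hs; refine ⟨fun x T hx => ?_, fun y T hy hn => ?_⟩
    · have hv := h.1 x T (hs.left hx)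
      cases hσ : σ x with
      | var y =>
        rw [hσ] at hv; obtain ⟨T', hT', hle⟩ := hv
        exact ⟨T', Ctx.restr_eq_some.mpr ⟨hT', .inr ⟨x, hσ, by grind⟩⟩, hle⟩
      | _ => rw [hσ] at hv; exact hv
    · rw [Ctx.restr_eq_some] at hy; obtain ⟨x, hx, hne⟩ := hy.2.resolve_left hn
      refine ⟨x, ⟨hx, hne⟩, fun z hz => ?_⟩
      have mem : ∀ z, Γ₁ z ≠ none → Γ z ≠ none := by
        intro z hz; obtain ⟨T, hT⟩ := exists_some hz; simp [hs.left hT]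
      exact (h.2 y T hy.1 hn).unique ⟨hz.1, mem z hz.2⟩ ⟨hx, mem x hne⟩
  refine ⟨_, _, ?_, half hs, half hs.symm⟩; refine split_restr fun y T hy hn => ?_
  obtain ⟨x, ⟨hx, hne⟩, huniq⟩ := h.2 y T hy hn; obtain ⟨T₀, hT₀⟩ := exists_some hne
  obtain ⟨T', hT', hle⟩ := h.var hT₀ hx; rw [hy] at hT'; cases hT'
  have hn₀ : ¬ Un T₀ := fun hu => hn (hle.un_iff.mpr hu)
  rcases hs x with ⟨a, b, c⟩ | ⟨T, hT, ⟨a, b, c⟩ | ⟨a, b, c⟩ | ⟨a, b, c⟩⟩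
  · grind
  · grind
  · refine .inl ⟨⟨x, hx, by simp [b]⟩, ?_⟩; rintro ⟨z, hz, hzn⟩; obtain ⟨V, hV⟩ := exists_some hzn
    have := huniq z ⟨hz, by simp [hs.right hV]⟩; grind
  · refine .inr ⟨?_, ⟨x, hx, by simp [c]⟩⟩; rintro ⟨z, hz, hzn⟩; obtain ⟨V, hV⟩ := exists_some hzn
    have := huniq z ⟨hz, by simp [hs.left hV]⟩; grind

theorem update (h : RespSub σ Γ Δ) {x y U Γ'} (hy : σ x = .var y)
    (hfree : Γ x = none → Δ y = none) (hu : Update Γ x U Γ') :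
    ∃ Δ', Update Δ y U Δ' ∧ RespSub σ Γ' Δ' := by
  rcases hu with ⟨hx, rfl⟩ | ⟨T, hx, hT, hs, rfl⟩
  · have hΔ := hfree hx; refine ⟨_, .inl ⟨hΔ, rfl⟩, fun z T hz => ?_, fun z T hz hn => ?_⟩
    · by_cases hzx : z = x
      · subst hzx; simp only [update_self, Option.some.injEq] at hz; rw [hy]
        exact ⟨U, by simp, hz ▸ .refl _⟩
      · rw [update_of_ne hzx] at hz; have hv := h.1 z T hz
        cases hσ : σ z with
        | var y' => rw [hσ] at hv; obtain ⟨T', hT', hle⟩ := hv; refine ⟨T', ?_, hle⟩; grind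
        | _ => rw [hσ] at hv; exact hv
    · by_cases hzy : z = y
      · subst hzy; refine ⟨x, ⟨hy, by simp⟩, fun z' hz' => ?_⟩; by_contra hne
        simp only [update_of_ne hne] at hz'; obtain ⟨T₀, hT₀⟩ := exists_some hz'.2
        obtain ⟨T', hT', -⟩ := h.var hT₀ hz'.1; grind
      · rw [update_of_ne hzy] at hz
        have hiff : ∀ z', (σ z' = .var z ∧ Function.update Γ x (some U) z' ≠ none) ↔
            (σ z' = .var z ∧ Γ z' ≠ none) := by
          grind
        simp only [hiff]; exact h.2 z T hz hn
  · obtain ⟨T', hT', hle⟩ := h.var hx hy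
    exact ⟨Δ, .inr ⟨T', hT', hle.un_iff.mpr hT, hle.sub hs, rfl⟩, h⟩

theorem cons (h : RespSub σ Γ Δ) (T : Ty) : RespSub (up σ) (Ctx.cons T Γ) (Ctx.cons T Δ) := by
  refine ⟨fun x U hx => ?_, fun y U hy hn => ?_⟩
  · cases x with
    | zero => exact ⟨T, rfl, by cases hx; exact .refl _⟩
    | succ x =>
      have hv := h.1 x U hx; change ValLe _ ((σ x).subst _) U
      cases hσ : σ x with
      | var y => rw [hσ] at hv; exact hv
      | _ => rw [hσ] at hv; exact hv
  · cases y with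
    | zero =>
      refine ⟨0, ⟨rfl, by simp [Ctx.cons]⟩, fun z hz => ?_⟩
      cases z with
      | zero => rfl
      | succ z =>
        have hz := hz.1; simp only [up] at hz
        cases hσ : σ z <;> rw [hσ] at hz <;> simp [Val.subst, ren] at hz
    | succ y =>
      obtain ⟨x, ⟨hx, hne⟩, hu⟩ := h.2 y U hy hn
      refine ⟨x + 1, ⟨by simp [up, hx, Val.subst, ren], hne⟩, fun z hz => ?_⟩
      cases z with
      | zero => simp [up] at hz
      | succ z =>
        obtain ⟨hz, hzn⟩ := hz
        congr 1
        refine hu z ⟨?_, hzn⟩; simp only [up] at hz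
        cases hσ : σ z <;> rw [hσ] at hz <;> simp [Val.subst, ren] at hz; rw [hz]

theorem branch (h : RespSub σ Γ Δ) {a T Θ} (hb : BranchCtx Γ a T Θ) :
    ∃ Θ', BranchCtx Δ (a.subst σ) T Θ' ∧ RespSub (a.under σ) Θ Θ' := by
  cases hb with
  | send hs hv =>
    obtain ⟨Δ₁, Δ₂, hs', h1, h2⟩ := h.split hs; exact ⟨Δ₂, .send hs' (h1.valTy hv), h2⟩
  | recv => exact ⟨_, .recv, h.cons T⟩

end RespSub

theorem ValTy.choice_var {Γ : Ctx} {v q w K pay cont} (h : ValTy Γ v (.choice q w K pay cont)) :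
    ∃ y, v = .var y := by
  cases h with
  | var => grind
  | _ => rename_i hs; obtain ⟨_, _, _, h, _⟩ := hs.of_choice; cases h

theorem Split.none_of_update {Γ Γ₁ Γ₂ : Ctx} (hs : Split Γ Γ₁ Γ₂) {x T} (hx : Γ₁ x = some T)
    (hn : Γ₂ x = none) : ¬ Un T := by
  rcases hs x with ⟨a, b, c⟩ | ⟨T, hT, ⟨a, b, c⟩ | ⟨a, b, c⟩ | ⟨a, b, c⟩⟩ <;> simp_all

theorem Split.right_none {Γ Γ₁ Γ₂ : Ctx} (hs : Split Γ Γ₁ Γ₂) {x T} (hx : Γ₁ x = some T)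
    (hn : ¬ Un T) : Γ₂ x = none := by
  rcases hs x with ⟨a, b, c⟩ | ⟨T, hT, ⟨a, b, c⟩ | ⟨a, b, c⟩ | ⟨a, b, c⟩⟩ <;> simp_all

theorem Typing.subst {Γ : Ctx} {p : AProc} (hp : Typing Γ p) {σ : ℕ → Val} {Δ : Ctx}
    (h : RespSub σ Γ Δ) : Typing Δ (p.subst σ) := by
  induction hp generalizing σ Δ with
  | inact hu => exact .inact (h.unCtx hu)
  | par hs _ _ ih1 ih2 =>
    obtain ⟨Δ₁, Δ₂, hs', h1, h2⟩ := h.split hs; exact .par hs' (ih1 h1) (ih2 h2)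
  | res T U hd _ ih => exact .res T U hd (ih ((h.cons U).cons T))
  | ite hs hv _ _ ih1 ih2 =>
    obtain ⟨Δ₁, Δ₂, hs', h1, h2⟩ := h.split hs; exact .ite hs' (h1.valTy hv) (ih1 h2) (ih2 h2)
  | @choice Γ Γ₁ Γ₂ q x n l a P q' w K pay cont key Δ₀ Θ hs hq hx hkey hsurj hΔ hΘ _ ih =>
    obtain ⟨Δ₁, Δ₂, hs', h1, h2⟩ := h.split hs; have hx' := h1.valTy hx
    obtain ⟨y, hy⟩ := hx'.choice_var
    have hfree : Γ₂ x = none → Δ₂ y = none := by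
      intro hn; have .var hxT _ _ := hx; have hnu := hs.none_of_update hxT hn
      obtain ⟨T', hT', hle⟩ := h1.var hxT hy
      exact hs'.right_none hT' fun hu => hnu (hle.un_iff.mp hu)
    choose Δ' hΔ' hr using fun i => h2.update hy hfree (hΔ i)
    choose Θ' hΘ' hr' using fun i => (hr i).branch (hΘ i)
    have := Typing.choice (l := l) (q := q) q' w K pay cont key Δ' Θ' hs'
      (fun hqu => h.unCtx (hq hqu)) (hy ▸ hx') (by simpa using hkey) hsurj hΔ' hΘ'
      fun i => ih i (hr' i)
    rw [← hy] at this; exact this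

/-- A typed process depends only on the names of its context. -/
theorem Typing.subst_congr {Γ : Ctx} {p : AProc} (hp : Typing Γ p) {σ τ : ℕ → Val}
    (h : ∀ x, Γ x ≠ none → σ x = τ x) : p.subst σ = p.subst τ := by
  have hval : ∀ {Γ : Ctx} {v T} {σ τ : ℕ → Val}, ValTy Γ v T → (∀ x, Γ x ≠ none → σ x = τ x) →
      v.subst σ = v.subst τ := by
    intro Γ v T σ τ hv h
    cases hv with
    | var hx _ _ => exact h _ (by grind)
    | _ => rfl
  have hcons : ∀ {Γ : Ctx} {T} {σ τ : ℕ → Val}, (∀ x, Γ x ≠ none → σ x = τ x) →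
      ∀ x, Ctx.cons T Γ x ≠ none → up σ x = up τ x := by
    intro Γ T σ τ h x hx
    cases x with
    | zero => rfl
    | succ x => simp only [up, h x hx]
  have hsplit : ∀ {Γ Γ₁ Γ₂ : Ctx}, Split Γ Γ₁ Γ₂ → ∀ x, Γ₁ x ≠ none → Γ x ≠ none := by
    intro Γ Γ₁ Γ₂ hs x hx; obtain ⟨T, hT⟩ := exists_some hx; simp [hs.left hT]
  induction hp generalizing σ τ with
  | inact hu => rfl
  | par hs _ _ ih1 ih2 =>
    simp only [AProc.subst, ih1 fun x hx => h x (hsplit hs x hx),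
      ih2 fun x hx => h x (hsplit hs.symm x hx)]
  | res T U hd _ ih => simp only [AProc.subst, ih (hcons (hcons h))]
  | ite hs hv _ _ ih1 ih2 =>
    simp only [AProc.subst, hval hv fun x hx => h x (hsplit hs x hx),
      ih1 fun x hx => h x (hsplit hs.symm x hx), ih2 fun x hx => h x (hsplit hs.symm x hx)]
  | @choice Γ Γ₁ Γ₂ q x n l a P q' w K pay cont key Δ₀ Θ hs hq hx hkey hsurj hΔ hΘ _ ih =>
    have hxx : σ x = τ x := by have .var hxT _ _ := hx; exact h x (hsplit hs x (by grind))
    have h2 : ∀ i y, Δ₀ i y ≠ none → σ y = τ y := by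
      intro i y hy; rcases hΔ i with ⟨-, e⟩ | ⟨-, -, -, -, e⟩
      · by_cases hyx : y = x
        · grind
        · rw [e, update_of_ne hyx] at hy; exact h y (hsplit hs.symm y hy)
      · rw [e] at hy; exact h y (hsplit hs.symm y hy)
    have h3 : ∀ i, (a i).subst σ = (a i).subst τ ∧
        ∀ y, Θ i y ≠ none → (a i).under σ y = (a i).under τ y := by
      intro i; have hb := hΘ i
      cases ha : a i with
      | send v =>
        rw [ha] at hb; have .send hs' hv := hb
        exact ⟨congrArg Act.send (hval hv fun y hy => h2 i y (hsplit hs' y hy)),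
          fun y hy => h2 i y (hsplit hs'.symm y hy)⟩
      | recv =>
        rw [ha] at hb; generalize hΘi : Θ i = Θi at hb; have .recv := hb; exact ⟨rfl, hcons (h2 i)⟩
    simp only [AProc.subst, Val.subst, hxx, fun i => (h3 i).1, fun i => ih i (h3 i).2]

/-- Strengthening along an injective renaming: all linear names are in its range. -/
theorem Typing.strengthen {p : AProc} {f : ℕ → ℕ} (hf : Function.Injective f) {Δ : Ctx}
    (h : Typing Δ (p.subst (ren f))) :
    Typing (fun x => Δ (f x)) p ∧ ∀ y T, Δ y = some T → ¬ Un T → ∃ x, f x = y := by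
  have hlift : ∀ {f : ℕ → ℕ}, Function.Injective f → Function.Injective (liftRen f) := by
    intro f hf a b hab; cases a <;> cases b <;> simp_all [liftRen]; grind
  have hcons : ∀ (f : ℕ → ℕ) (Δ : Ctx) T,
      (fun x => Ctx.cons T Δ (liftRen f x)) = Ctx.cons T fun x => Δ (f x) := by
    intro f Δ T; funext x; cases x <;> rfl
  have hval : ∀ {f : ℕ → ℕ}, Function.Injective f → ∀ {Δ : Ctx} {v T},
      ValTy Δ (v.subst (ren f)) T → ValTy (fun x => Δ (f x)) v T ∧
        ∀ y T, Δ y = some T → ¬ Un T → ∃ x, f x = y := by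
    intro f hf Δ v T h
    cases v with
    | var x =>
      change ValTy Δ (.var (f x)) T at h; have .var hx ho hs := h
      refine ⟨.var hx (fun y V hy hV => ho _ V (hf.ne hy) hV) hs, fun y V hy hn => ?_⟩; grind
    | unit =>
      have .unit hu hs := h
      exact ⟨.unit (fun y V hy => hu _ V hy) hs, fun y V hy hn => absurd (hu y V hy) hn⟩
    | tt =>
      cases h with
      | tt hu hs => exact ⟨.tt (fun y V hy => hu _ V hy) hs, fun y V hy hn => absurd (hu y V hy) hn⟩
    | ff =>
      cases h with
      | ff hu hs => exact ⟨.ff (fun y V hy => hu _ V hy) hs, fun y V hy hn => absurd (hu y V hy) hn⟩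
  have hsplit : ∀ {f : ℕ → ℕ} {Γ Γ₁ Γ₂ : Ctx}, Split Γ Γ₁ Γ₂ →
      (∀ y T, Γ₁ y = some T → ¬ Un T → ∃ x, f x = y) →
      (∀ y T, Γ₂ y = some T → ¬ Un T → ∃ x, f x = y) →
      ∀ y T, Γ y = some T → ¬ Un T → ∃ x, f x = y := by
    intro f Γ Γ₁ Γ₂ hs h1 h2 y T hy hn
    rcases hs y with ⟨a, b, c⟩ | ⟨T, hT, ⟨a, b, c⟩ | ⟨a, b, c⟩ | ⟨a, b, c⟩⟩
    · simp_all
    · grind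
    · grind
    grind
  have hun : ∀ {f : ℕ → ℕ} {T} {Δ : Ctx},
      (∀ y V, Ctx.cons T Δ y = some V → ¬ Un V → ∃ x, liftRen f x = y) →
      ∀ y V, Δ y = some V → ¬ Un V → ∃ x, f x = y := by
    intro f T Δ h y V hy hn; obtain ⟨x, hx⟩ := h (y + 1) V hy hn
    cases x with
    | zero => simp [liftRen] at hx
    | succ x => exact ⟨x, by simpa [liftRen] using hx⟩
  induction p generalizing f Δ with
  | inact =>
    have .inact hu := h
    exact ⟨.inact fun x T hx => hu _ T hx, fun y T hy hn => absurd (hu y T hy) hn⟩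
  | par P Q ih1 ih2 =>
    have .par hs h1 h2 := h; obtain ⟨t1, r1⟩ := ih1 hf h1; obtain ⟨t2, r2⟩ := ih2 hf h2
    exact ⟨.par (fun x => hs (f x)) t1 t2, hsplit hs r1 r2⟩
  | res P ih =>
    have .res T U hd h := h
    rw [up_ren, up_ren] at h; obtain ⟨t, r⟩ := ih (hlift (hlift hf)) h; rw [hcons, hcons] at t
    exact ⟨.res T U hd t, hun (hun r)⟩
  | ite v P Q ih1 ih2 =>
    have .ite hs hv h1 h2 := h
    obtain ⟨t0, r0⟩ := hval hf hv; obtain ⟨t1, r1⟩ := ih1 hf h1; obtain ⟨t2, r2⟩ := ih2 hf h2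
    exact ⟨.ite (fun x => hs (f x)) t0 t1 t2, hsplit hs r0 r1⟩
  | choice q q' w x n l a P ih =>
    simp only [AProc.subst] at h; generalize hX : x.subst (ren f) = X at h
    cases h with
    | @choice Γ Γ₁ Γ₂ q x₁ n l a P q' w K pay cont key Δ₀ Θ hs hq hx hkey hsurj hΔ hΘ ht =>
      cases x with
      | var x =>
        simp only [Val.subst, ren, Val.var.injEq] at hX; subst hX
        obtain ⟨t0, r0⟩ := hval (v := .var x) hf hx
        have hb : ∀ i, ∃ Θ' : Ctx, BranchCtx (fun x => Δ₀ i (f x)) (a i) (pay (key i)) Θ' ∧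
            Typing Θ' (P i) ∧ ∀ y T, Δ₀ i y = some T → ¬ Un T → ∃ x, f x = y := by
          intro i; have hb := hΘ i; have hti := ht i
          cases ha : a i with
          | send v =>
            simp only [ha] at hb hti; generalize Θ i = Θi at hb hti; have .send hs' hv := hb
            obtain ⟨t1, r1⟩ := hval hf hv; obtain ⟨t2, r2⟩ := ih i hf hti
            exact ⟨_, .send (fun x => hs' (f x)) t1, t2, hsplit hs' r1 r2⟩
          | recv =>
            simp only [ha] at hb hti; generalize Θ i = Θi at hb hti; have .recv := hb
            simp only [Act.under, up_ren] at hti; obtain ⟨t2, r2⟩ := ih i (hlift hf) hti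
            rw [hcons] at t2; exact ⟨_, .recv, t2, hun r2⟩
        choose Θ' hΘ' ht' hr' using hb
        refine ⟨.choice q' w K pay cont key (fun i x => Δ₀ i (f x)) Θ' (fun x => hs (f x))
          (fun hqu y T hy => hq hqu _ T hy) t0 (by simpa using hkey) hsurj (fun i => ?_) hΘ' ht',
          hsplit hs r0 ?_⟩
        · rcases hΔ i with ⟨hn, e⟩ | ⟨T, hT, hu, hsub, e⟩
          · refine .inl ⟨hn, ?_⟩; rw [e]; grind
          · exact .inr ⟨T, hT, hu, hsub, by rw [e]⟩
        · intro y T hy hn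
          by_cases hyx : y = f x
          · grind
          · refine hr' 0 y T ?_ hn; rcases hΔ 0 with ⟨-, e⟩ | ⟨-, -, -, -, e⟩
            · rw [e, update_of_ne hyx]; exact hy
            grind
      | _ => simp [Val.subst] at hX

end Mix

/-! ## Bisimilarity -/

section Behaviour

variable {α : Type} {step : α → α → Prop} {barb : α → ℕ → Prop}

theorem IsBisimulation.converse {R : α → α → Prop} (h : IsBisimulation step barb R) :
    IsBisimulation step barb fun P Q => R Q P := by
  intro P Q hPQ; obtain ⟨h1, h2, h3⟩ := h Q P hPQ; grind

theorem IsBisimulation.comp {R R' : α → α → Prop} (h : IsBisimulation step barb R)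
    (h' : IsBisimulation step barb R') :
    IsBisimulation step barb fun P Q => ∃ M, R P M ∧ R' M Q := by
  rintro P Q ⟨M, hPM, hMQ⟩; obtain ⟨h1, h2, h3⟩ := h P M hPM; obtain ⟨g1, g2, g3⟩ := h' M Q hMQ
  grind

theorem bisimilar_equivalence : Equivalence (Bisimilar step barb) where
  refl P := ⟨Eq, by
    rintro P _ rfl
    grind, rfl⟩
  symm := fun ⟨_, h, hPQ⟩ => ⟨_, h.converse, hPQ⟩
  trans := fun ⟨_, h, hPM⟩ ⟨_, h', hMQ⟩ => ⟨_, h.comp h', _, hPM, hMQ⟩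

theorem bisimilar_isBisimulation : IsBisimulation step barb (Bisimilar step barb) := by
  rintro P Q ⟨R, hR, hPQ⟩; obtain ⟨h1, h2, h3⟩ := hR P Q hPQ
  refine ⟨fun P' hP => ?_, fun Q' hQ => ?_, h3⟩
  · obtain ⟨Q', hQ, r⟩ := h1 P' hP; exact ⟨Q', hQ, R, hR, r⟩
  · obtain ⟨P', hP, r⟩ := h2 Q' hQ; exact ⟨P', hP, R, hR, r⟩

/-- It is enough to check single steps and strong barbs of a symmetric relation. -/
theorem isBisimulation_of_step {R : α → α → Prop} (hsymm : ∀ P Q, R P Q → R Q P)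
    (hstep : ∀ P Q P', R P Q → step P P' → ∃ Q', ReflTransGen step Q Q' ∧ R P' Q')
    (hbarb : ∀ P Q y, R P Q → barb P y → WeakBarb step barb Q y) :
    IsBisimulation step barb R := by
  have key : ∀ P Q, R P Q → ∀ P', ReflTransGen step P P' →
      ∃ Q', ReflTransGen step Q Q' ∧ R P' Q' := by
    intro P Q hPQ P' hP
    induction hP with
    | refl => grind
    | tail _ hs ih =>
      obtain ⟨Q₁, hQ₁, r⟩ := ih; obtain ⟨Q₂, hQ₂, r'⟩ := hstep _ _ _ r hs
      exact ⟨Q₂, hQ₁.trans hQ₂, r'⟩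
  have wb : ∀ P Q, R P Q → ∀ y, WeakBarb step barb P y → WeakBarb step barb Q y := by
    rintro P Q hPQ y ⟨P', hP, hb⟩; obtain ⟨Q', hQ, r⟩ := key P Q hPQ P' hP
    obtain ⟨Q'', hQ', hb'⟩ := hbarb P' Q' y r hb; exact ⟨Q'', hQ.trans hQ', hb'⟩
  intro P Q hPQ; grind

end Behaviour

/-! ## Structural congruence preserves typing and is respected by the encoding -/

namespace Mix

theorem AProc.src_eq_par {p : AProc} {P Q : Proc} (h : p.src = .par P Q) :
    ∃ p₁ p₂, p = .par p₁ p₂ ∧ p₁.src = P ∧ p₂.src = Q := by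
  cases p <;> simp [src] at h; grind

theorem AProc.src_eq_res {p : AProc} {P : Proc} (h : p.src = .res P) :
    ∃ p₁, p = .res p₁ ∧ p₁.src = P := by
  cases p <;> simp [src] at h; grind

theorem AProc.src_eq_ite {p : AProc} {v : Val} {P Q : Proc} (h : p.src = .ite v P Q) :
    ∃ p₁ p₂, p = .ite v p₁ p₂ ∧ p₁.src = P ∧ p₂.src = Q := by
  cases p <;> simp [src] at h; grind

theorem AProc.src_eq_inact {p : AProc} (h : p.src = .inact) : p = .inact := by
  cases p <;> simp [src] at h; rfl

theorem AProc.src_eq_choice {p : AProc} {q x n l a P} (h : p.src = .choice q x n l a P) :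
    ∃ q' w P₁, p = .choice q q' w x n l a P₁ ∧ ∀ i, (P₁ i).src = P i := by
  cases p with
  | choice q₁ q' w x₁ n₁ l₁ a₁ P₁ =>
    simp only [src, Proc.choice.injEq] at h; obtain ⟨rfl, rfl, rfl, h⟩ := h
    simp only [heq_eq_eq] at h; obtain ⟨rfl, rfl, h⟩ := h; grind
  | _ => simp [src] at h

theorem RespSub.of_bijective {Γ Δ : Ctx} {f : ℕ → ℕ} (hf : Function.Bijective f)
    (h : ∀ x, Δ (f x) = Γ x) : RespSub (ren f) Γ Δ := by
  refine ⟨fun x T hx => ⟨T, by grind, .refl T⟩, fun y T hy hn => ?_⟩; obtain ⟨x, rfl⟩ := hf.2 y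
  refine ⟨x, ⟨rfl, by grind⟩, fun z hz => hf.1 ?_⟩; simpa [ren] using hz.1

/-- The exchange of the two innermost pairs of names. -/
def exchange : ℕ → ℕ := fun n => if n < 2 then n + 2 else if n < 4 then n - 2 else n

theorem exchange_involutive : Function.Involutive exchange := by intro n; unfold exchange; grind

theorem swap01_involutive : Function.Involutive swap01 := by
  intro n
  match n with
  | 0 => rfl
  | 1 => rfl
  | n + 2 => rfl

theorem cons_exchange (A B C D : Ty) (Γ : Ctx) (x : ℕ) :
    Ctx.cons A (Ctx.cons B (Ctx.cons C (Ctx.cons D Γ))) (exchange x) =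
      Ctx.cons C (Ctx.cons D (Ctx.cons A (Ctx.cons B Γ))) x := by
  match x with
  | 0 => rfl
  | 1 => rfl
  | 2 => rfl
  | 3 => rfl
  | x + 4 =>
    have : exchange (x + 4) = x + 4 := by unfold exchange; grind
    rw [this]; rfl

theorem cons_swap01 (A B : Ty) (Γ : Ctx) (x : ℕ) :
    Ctx.cons A (Ctx.cons B Γ) (swap01 x) = Ctx.cons B (Ctx.cons A Γ) x := by
  match x with
  | 0 => rfl
  | 1 => rfl
  | x + 2 => rfl

open Classical in
theorem Typing.par_res {Γ : Ctx} {p r : AProc} (h : Typing Γ (.par p (.res r))) :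
    Typing Γ (.res (.par (p.subst (wk 2)) r)) := by
  have @Typing.par _ Γ₁ Γ₂ _ _ hs h1 h2 := h; have .res T U hd h2 := h2
  refine .res T U hd (.par (Γ₁ := fun n => match n with
    | 0 => if Un T then some T else none
    | 1 => if Un U then some U else none
    | n + 2 => Γ₁ n) ?_ (h1.subst ⟨fun x V hx => ⟨V, hx, .refl V⟩, ?_⟩) h2)
  · intro x
    match x with
    | 0 => by_cases hu : Un T <;> simp [Ctx.cons, hu]
    | 1 => by_cases hu : Un U <;> simp [Ctx.cons, hu]
    | x + 2 => exact hs x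
  · intro y V hy hn
    match y with
    | 0 => grind
    | 1 => grind
    | y + 2 => refine ⟨y, ⟨rfl, by grind⟩, fun z hz => ?_⟩; simpa [wk, ren] using hz.1

theorem Typing.res_par {Γ : Ctx} {p r : AProc} (h : Typing Γ (.res (.par (p.subst (wk 2)) r))) :
    Typing Γ (.par p (.res r)) := by
  have .res T U hd h := h; have @Typing.par _ Γ₁ Γ₂ _ _ hs h1 h2 := h
  obtain ⟨t, hr⟩ := Typing.strengthen (f := (· + 2)) (add_left_injective 2) h1
  have key : ∀ y V, y < 2 → Ctx.cons T (Ctx.cons U Γ) y = some V → Γ₂ y = some V := by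
    intro y V hy hV; rcases hs y with ⟨a, b, c⟩ | ⟨T', hT, ⟨a, b, c⟩ | ⟨a, b, c⟩ | ⟨a, b, c⟩⟩
    · grind
    · grind
    · grind
    grind
  have e : Γ₂ = Ctx.cons T (Ctx.cons U fun x => Γ₂ (x + 2)) := by
    funext x
    match x with
    | 0 => exact key 0 T (by omega) rfl
    | 1 => exact key 1 U (by omega) rfl
    | x + 2 => rfl
  rw [e] at h2; exact .par (fun x => hs (x + 2)) t (.res T U hd h2)

/-- A typed annotation of `P` can be turned into one of `Q`, with a congruent encoding. -/
def Lifts (P Q : Proc) : Prop :=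
  ∀ Γ (p : AProc), p.src = P → Typing Γ p →
    ∃ p' : AProc, p'.src = Q ∧ Typing Γ p' ∧ CMV.Cong p.enc p'.enc

theorem Cong.lifts {P Q : Proc} (h : Cong P Q) : Lifts P Q ∧ Lifts Q P := by
  induction h with
  | refl P => exact ⟨fun Γ p e t => ⟨p, e, t, .refl _⟩, fun Γ p e t => ⟨p, e, t, .refl _⟩⟩
  | symm _ ih => grind
  | trans _ _ ih1 ih2 =>
    have comp : ∀ {P Q R}, Lifts P Q → Lifts Q R → Lifts P R := by
      intro P Q R h1 h2 Γ p e t; obtain ⟨p', e', t', c⟩ := h1 Γ p e t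
      obtain ⟨p'', e'', t'', c'⟩ := h2 Γ p' e' t'; exact ⟨p'', e'', t'', c.trans c'⟩
    grind
  | @choice q x n l a P Q _ ih =>
    have key : ∀ {P Q : Fin (n + 1) → Proc}, (∀ i, Lifts (P i) (Q i)) →
        Lifts (.choice q x n l a P) (.choice q x n l a Q) := by
      intro P Q ih Γ p e t; obtain ⟨q', w, P₁, rfl, hP⟩ := AProc.src_eq_choice e
      have .choice q' w K pay cont key Δ Θ h hq hx hkey hsurj hΔ hΘ ht := t
      choose p' e' t' c using fun i => ih i _ _ (hP i) (ht i)
      exact ⟨.choice q q' w _ n l a p', by simp [AProc.src, e'],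
        .choice q' w K pay cont key Δ Θ h hq hx hkey hsurj hΔ hΘ t',
        Encoding.encChoice_cong c _ _ _ _⟩
    grind
  | par _ _ ih1 ih2 =>
    have key : ∀ {P P' Q Q'}, Lifts P P' → Lifts Q Q' → Lifts (.par P Q) (.par P' Q') := by
      intro P P' Q Q' h1 h2 Γ p e t; obtain ⟨p₁, p₂, rfl, e1, e2⟩ := AProc.src_eq_par e
      have .par hs t1 t2 := t; obtain ⟨p₁', e1', t1', c1⟩ := h1 _ _ e1 t1
      obtain ⟨p₂', e2', t2', c2⟩ := h2 _ _ e2 t2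
      exact ⟨.par p₁' p₂', by simp [AProc.src, e1', e2'], .par hs t1' t2', .par c1 c2⟩
    grind
  | res _ ih =>
    have key : ∀ {P P'}, Lifts P P' → Lifts (.res P) (.res P') := by
      intro P P' h Γ p e t; obtain ⟨p₁, rfl, e1⟩ := AProc.src_eq_res e; have .res T U hd t := t
      obtain ⟨p₁', e1', t1', c1⟩ := h _ _ e1 t
      exact ⟨.res p₁', by simp [AProc.src, e1'], .res T U hd t1', .res c1⟩
    grind
  | @ite v _ _ _ _ _ _ ih1 ih2 =>
    have key : ∀ {P P' Q Q'}, Lifts P P' → Lifts Q Q' → Lifts (.ite v P Q) (.ite v P' Q') := by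
      intro P P' Q Q' h1 h2 Γ p e t; obtain ⟨p₁, p₂, rfl, e1, e2⟩ := AProc.src_eq_ite e
      have .ite hs hv t1 t2 := t; obtain ⟨p₁', e1', t1', c1⟩ := h1 _ _ e1 t1
      obtain ⟨p₂', e2', t2', c2⟩ := h2 _ _ e2 t2
      exact ⟨.ite v p₁' p₂', by simp [AProc.src, e1', e2'], .ite hs hv t1' t2', .ite c1 c2⟩
    grind
  | resInact =>
    constructor
    · intro Γ p e t; obtain ⟨p₁, rfl, e1⟩ := AProc.src_eq_res e; obtain rfl := AProc.src_eq_inact e1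
      have .res T U hd t := t; have .inact hu := t
      exact ⟨.inact, rfl, .inact fun x V hx => hu (x + 2) V hx, .resInact⟩
    · intro Γ p e t; obtain rfl := AProc.src_eq_inact e; have .inact hu := t
      refine ⟨.res .inact, rfl, .res .done .done dual_done (.inact fun x V hx => ?_),
        .symm .resInact⟩
      match x with
      | 0 => cases hx; exact un_done
      | 1 => cases hx; exact un_done
      | x + 2 => exact hu x V hx
  | resRes P =>
    constructor
    · intro Γ p e t; obtain ⟨p₁, rfl, e1⟩ := AProc.src_eq_res e
      obtain ⟨p₂, rfl, rfl⟩ := AProc.src_eq_res e1; have .res T U hd t := t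
      have .res T' U' hd' t := t
      refine ⟨.res (.res (p₂.subst (ren exchange))), by simp only [AProc.src, AProc.src_subst]; rfl,
        .res T' U' hd' (.res T U hd (t.subst (.of_bijective exchange_involutive.bijective ?_))), ?_⟩
      · exact cons_exchange _ _ _ _ _
      · simp only [AProc.enc, AProc.enc_subst]; exact .resRes _
    · intro Γ p e t; obtain ⟨p₁, rfl, e1⟩ := AProc.src_eq_res e
      obtain ⟨p₂, rfl, e2⟩ := AProc.src_eq_res e1
      obtain ⟨p₃, rfl, rfl⟩ := AProc.exists_of_src_eq_subst _ _ _ e2; have .res T U hd t := t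
      have .res T' U' hd' t := t
      have t' := (Typing.strengthen (f := exchange) exchange_involutive.injective t).1
      simp only [cons_exchange] at t'
      refine ⟨.res (.res p₃), rfl, .res T' U' hd' (.res T U hd t'), ?_⟩
      simp only [AProc.enc, AProc.enc_subst]; exact .symm (.resRes _)
  | resPar P Q =>
    constructor
    · intro Γ p e t; obtain ⟨p₁, p₂, rfl, rfl, e2⟩ := AProc.src_eq_par e
      obtain ⟨p₃, rfl, rfl⟩ := AProc.src_eq_res e2
      refine ⟨.res (.par (p₁.subst (wk 2)) p₃), by simp [AProc.src, AProc.src_subst], t.par_res, ?_⟩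
      simp only [AProc.enc, AProc.enc_subst]; exact .resPar _ _
    · intro Γ p e t; obtain ⟨p₁, rfl, e1⟩ := AProc.src_eq_res e
      obtain ⟨p₂, p₃, rfl, e2, rfl⟩ := AProc.src_eq_par e1
      obtain ⟨p₄, rfl, rfl⟩ := AProc.exists_of_src_eq_subst _ _ _ e2
      refine ⟨.par p₄ (.res p₃), rfl, t.res_par, ?_⟩
      simp only [AProc.enc, AProc.enc_subst]; exact .symm (.resPar _ _)
  | resSwap P =>
    constructor
    · intro Γ p e t; obtain ⟨p₁, rfl, rfl⟩ := AProc.src_eq_res e; have .res T U hd t := t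
      refine ⟨.res (p₁.subst (ren swap01)), by simp [AProc.src, AProc.src_subst],
        .res U T hd.symm (t.subst (.of_bijective swap01_involutive.bijective ?_)), ?_⟩
      · exact cons_swap01 _ _ _
      · simp only [AProc.enc, AProc.enc_subst]; exact .resSwap _
    · intro Γ p e t; obtain ⟨p₁, rfl, e1⟩ := AProc.src_eq_res e
      obtain ⟨p₂, rfl, rfl⟩ := AProc.exists_of_src_eq_subst _ _ _ e1; have .res T U hd t := t
      have t' := (Typing.strengthen (f := swap01) swap01_involutive.injective t).1
      simp only [cons_swap01] at t'; refine ⟨.res p₂, rfl, .res U T hd.symm t', ?_⟩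
      simp only [AProc.enc, AProc.enc_subst]; exact .symm (.resSwap _)
  | parInact P =>
    constructor
    · intro Γ p e t; obtain ⟨p₁, p₂, rfl, rfl, e2⟩ := AProc.src_eq_par e
      obtain rfl := AProc.src_eq_inact e2; have .par hs t1 t2 := t; have .inact hu := t2
      obtain rfl := hs.eq_left hu; exact ⟨p₁, rfl, t1, .parInact _⟩
    · intro Γ p e t
      exact ⟨.par p .inact, by simp [AProc.src, e],
        .par (split_unit Γ) t (.inact (unCtx_restr_false Γ)), .symm (.parInact _)⟩
  | parComm P Q =>
    have key : ∀ P Q, Lifts (.par P Q) (.par Q P) := by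
      intro P Q Γ p e t; obtain ⟨p₁, p₂, rfl, e1, e2⟩ := AProc.src_eq_par e; have .par hs t1 t2 := t
      exact ⟨.par p₂ p₁, by simp [AProc.src, e1, e2], .par hs.symm t2 t1, .parComm _ _⟩
    grind
  | parAssoc P Q R =>
    constructor
    · intro Γ p e t; obtain ⟨p₁, p₂, rfl, e1, e2⟩ := AProc.src_eq_par e
      obtain ⟨p₃, p₄, rfl, e3, e4⟩ := AProc.src_eq_par e2; have .par hs t1 t2 := t
      have .par hs' t2 t3 := t2; obtain ⟨Θ, h1, h2⟩ := hs.assoc hs'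
      exact ⟨.par (.par p₁ p₃) p₄, by simp [AProc.src, e1, e3, e4],
        .par h1 (.par h2 t1 t2) t3, .parAssoc _ _ _⟩
    · intro Γ p e t; obtain ⟨p₁, p₂, rfl, e1, e2⟩ := AProc.src_eq_par e
      obtain ⟨p₃, p₄, rfl, e3, e4⟩ := AProc.src_eq_par e1; have .par hs t1 t2 := t
      have .par hs' t1 t3 := t1; obtain ⟨Θ, h1, h2⟩ := hs.symm.assoc hs'.symm
      exact ⟨.par p₃ (.par p₄ p₂), by simp [AProc.src, e3, e4, e2],
        .par h1.symm t1 (.par h2.symm t3 t2), .symm (.parAssoc _ _ _)⟩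

theorem Distributable.enc {Γ : Ctx} {p : AProc} (t : Typing Γ p) {n : ℕ} {Ss : Fin n → Proc}
    (h : Distributable p.src Ss) :
    ∃ (Δ : Fin n → Ctx) (ps : Fin n → AProc), (∀ i, (ps i).src = Ss i ∧ Typing (Δ i) (ps i)) ∧
      CMV.Distributable p.enc fun i => (ps i).enc := by
  obtain ⟨k, hc⟩ := h; obtain ⟨p', e, t', c⟩ := hc.lifts.1 Γ p rfl t
  have hpar : ∀ {n : ℕ} (Ss : Fin n → Proc) (Γ : Ctx) (p : AProc),
      p.src = Proc.parList (List.ofFn Ss) → Typing Γ p →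
      ∃ (Δ : Fin n → Ctx) (ps : Fin n → AProc), (∀ i, (ps i).src = Ss i ∧ Typing (Δ i) (ps i)) ∧
        p.enc = CMV.Proc.parList (List.ofFn fun i => (ps i).enc) := by
    intro n
    induction n with
    | zero =>
      intro Ss Γ p e t; simp only [List.ofFn_zero, Proc.parList] at e
      obtain rfl := AProc.src_eq_inact e
      exact ⟨Fin.elim0, Fin.elim0, fun i => i.elim0, by simp [CMV.Proc.parList, AProc.enc]⟩
    | succ n ih =>
      intro Ss Γ p e t; simp only [List.ofFn_succ, Proc.parList] at e
      obtain ⟨p₁, p₂, rfl, e1, e2⟩ := AProc.src_eq_par e; have @Typing.par _ Γ₁ Γ₂ _ _ hs t1 t2 := t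
      obtain ⟨Δ, ps, h, he⟩ := ih _ _ _ e2 t2
      refine ⟨Fin.cons Γ₁ Δ, Fin.cons p₁ ps, fun i => ?_, ?_⟩
      · refine Fin.cases ⟨e1, t1⟩ (fun i => ?_) i; simpa using h i
      · simp [List.ofFn_succ, CMV.Proc.parList, AProc.enc, he]
  have hres : ∀ (k : ℕ) (R : Proc) (Γ : Ctx) (p : AProc), p.src = Proc.resN k R → Typing Γ p →
      ∃ Γ' r, r.src = R ∧ Typing Γ' r ∧ p.enc = CMV.Proc.resN k r.enc := by
    intro k
    induction k with
    | zero => intro R Γ p e t; exact ⟨Γ, p, e, t, rfl⟩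
    | succ k ih =>
      intro R Γ p e t; obtain ⟨p₁, rfl, e1⟩ := AProc.src_eq_res e; have .res T U hd t := t
      obtain ⟨Γ', r, h1, h2, h3⟩ := ih _ _ _ e1 t
      exact ⟨Γ', r, h1, h2, by simp [AProc.enc, CMV.Proc.resN, h3]⟩
  obtain ⟨Γ', r, e1, t1, h1⟩ := hres k _ _ _ e t'; obtain ⟨Δ, ps, h2, h3⟩ := hpar Ss _ _ e1 t1
  exact ⟨Δ, ps, h2, k, by grind⟩

theorem RespectsTypes.respSub {σ : ℕ → ℕ} {Γ Δ : Ctx} (h : RespectsTypes σ Γ Δ) :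
    RespSub (ren σ) Γ Δ := by
  refine ⟨fun x T hx => ⟨T, h.1 x T hx, .refl T⟩, fun y T hy hn => ?_⟩
  simpa [ren] using h.2 y T hy hn

end Mix

/-! ## Compositionality -/

namespace CMV

/-- The function `F` of the arguments is given by a context. -/
def Representable {k : ℕ} (F : (Fin k → Proc) → Proc) : Prop :=
  ∃ C : Context k, ∀ T, C.fill T = F T

/-- Renaming of contexts. -/
def Context.rename {k : ℕ} : {ρ : ℕ → ℕ // StrictMono ρ} → Context k → Context k
  | ρ, .hole i τ hτ => .hole i (fun n => ρ.1 (τ n)) (ρ.2.comp hτ)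
  | ρ, .out x v C => .out (x.subst (ren ρ.1)) (v.subst (ren ρ.1)) (C.rename ρ)
  | ρ, .inp q x C => .inp q (x.subst (ren ρ.1)) (C.rename ⟨liftRen ρ.1, by
      intro a b hab; cases a <;> cases b <;> simp_all [liftRen]
      exact ρ.2 hab⟩)
  | ρ, .sel x l C => .sel (x.subst (ren ρ.1)) l (C.rename ρ)
  | ρ, .bran x L C => .bran (x.subst (ren ρ.1)) L (fun l => (C l).rename ρ)
  | ρ, .par C D => .par (C.rename ρ) (D.rename ρ)
  | ρ, .res C => .res (C.rename ⟨liftRen (liftRen ρ.1), by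
      intro a b hab
      match a, b with
      | 0, 0 => omega
      | 0, 1 => simp [liftRen]
      | 0, b + 2 => simp [liftRen]
      | 1, 0 => omega
      | 1, 1 => omega
      | 1, b + 2 => simp [liftRen]
      | a + 2, 0 => omega
      | a + 2, 1 => omega
      | a + 2, b + 2 => simpa [liftRen] using ρ.2 (by omega)⟩)
  | ρ, .ite v C D => .ite (v.subst (ren ρ.1)) (C.rename ρ) (D.rename ρ)
  | _, .inact => .inact

theorem Context.fill_rename {k : ℕ} (T : Fin k → Proc) (C : Context k)
    (ρ : {ρ : ℕ → ℕ // StrictMono ρ}) : (C.rename ρ).fill T = (C.fill T).subst (ren ρ.1) := by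
  induction C generalizing ρ with
  | hole i τ hτ => simp [rename, fill, Proc.subst_subst, scomp_ren]
  | out x v C ih => simp [rename, fill, Proc.subst, ih]
  | inp q x C ih => simp [rename, fill, Proc.subst, ih, up_ren]
  | sel x l C ih => simp [rename, fill, Proc.subst, ih]
  | bran x L C ih => simp [rename, fill, Proc.subst, ih]
  | par C D ih1 ih2 => simp [rename, fill, Proc.subst, ih1, ih2]
  | res C ih => simp [rename, fill, Proc.subst, ih, up_ren]
  | ite v C D ih1 ih2 => simp [rename, fill, Proc.subst, ih1, ih2]
  | inact => rfl

namespace Representable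

variable {k : ℕ} {F G : (Fin k → Proc) → Proc}

theorem arg (i : Fin k) : Representable fun T => T i :=
  ⟨.hole i (fun n => n) (fun _ _ h => h), fun T => Proc.subst_var (T i)⟩

theorem out (x v : Val) (h : Representable F) : Representable fun T => .out x v (F T) :=
  let ⟨C, hC⟩ := h; ⟨.out x v C, fun T => by simp [Context.fill, hC]⟩

theorem inp (q : Qual) (x : Val) (h : Representable F) : Representable fun T => .inp q x (F T) :=
  let ⟨C, hC⟩ := h; ⟨.inp q x C, fun T => by simp [Context.fill, hC]⟩

theorem sel (x : Val) (l : Label) (h : Representable F) : Representable fun T => .sel x l (F T) :=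
  let ⟨C, hC⟩ := h; ⟨.sel x l C, fun T => by simp [Context.fill, hC]⟩

theorem bran (x : Val) (L : Finset Label) {F : {l // l ∈ L} → (Fin k → Proc) → Proc}
    (h : ∀ l, Representable (F l)) : Representable fun T => .bran x L fun l => F l T := by
  choose C hC using h
  exact ⟨.bran x L C, fun T => by simp [Context.fill, hC]⟩

theorem par (h : Representable F) (h' : Representable G) :
    Representable fun T => .par (F T) (G T) :=
  let ⟨C, hC⟩ := h; let ⟨D, hD⟩ := h'; ⟨.par C D, fun T => by simp [Context.fill, hC, hD]⟩

theorem res (h : Representable F) : Representable fun T => .res (F T) :=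
  let ⟨C, hC⟩ := h; ⟨.res C, fun T => by simp [Context.fill, hC]⟩

theorem inact : Representable fun _ : Fin k → Proc => .inact := ⟨.inact, fun _ => rfl⟩

theorem rename (h : Representable F) {ρ : ℕ → ℕ} (hρ : StrictMono ρ) :
    Representable fun T => (F T).subst (ren ρ) :=
  let ⟨C, hC⟩ := h; ⟨C.rename ⟨ρ, hρ⟩, fun T => by rw [Context.fill_rename, hC]⟩

theorem wk (h : Representable F) (j : ℕ) : Representable fun T => (F T).subst (wk j) :=
  h.rename fun _ _ hab => Nat.add_lt_add_right hab j

theorem under (h : Representable F) (a : Act) (j : ℕ) :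
    Representable fun T => (F T).subst (a.under (_root_.wk j)) := by
  cases a with
  | send v => exact h.wk j
  | recv =>
    simp only [Act.under, _root_.wk, up_ren]; refine h.rename fun a b hab => ?_
    cases a <;> cases b <;> simp_all [liftRen]

theorem sels (x : Val) (l : List Label) :
    Representable fun _ : Fin k → Proc => Proc.parList (l.map fun j => .sel x j .inact) := by
  induction l with
  | nil => exact inact
  | cons j l ih => exact par (sel x j inact) ih

theorem ndc (L : Finset Label) {F : Label → (Fin k → Proc) → Proc} (h : ∀ l, Representable (F l)) :
    Representable fun T => Encoding.ndc L fun l => F l T :=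
  res (par (bran _ _ fun l => (h l.1).wk 2) (sels _ _))

section

variable {n : ℕ} {l : Fin (n + 1) → ℕ} {a : Fin (n + 1) → Act}
  {E : Fin (n + 1) → (Fin k → Proc) → Proc}

theorem duplicates (h : ∀ i, Representable (E i)) (f : Pol → Pol) (j : Label) (c : Val) :
    Representable fun T => Encoding.duplicates l a (fun i => E i T) f j c := by
  refine (ndc _ (F := fun m T => match m with
    | .idx j => Encoding.prefixOn c (E (Fin.ofNat (n + 1) j) T) (a (Fin.ofNat (n + 1) j))
    | .tag _ _ => .inact) fun m => ?_)
  cases m with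
  | tag _ _ => exact inact
  | idx j =>
    dsimp only
    cases a (Fin.ofNat (n + 1) j) with
    | send v => exact out c v (h _)
    | recv => exact inp .lin c (h _)

theorem wkCont (h : ∀ i, Representable (E i)) (j : ℕ) (i : Fin (n + 1)) :
    Representable fun T => Encoding.wkCont a (fun i => E i T) j i := (h i).under (a i) j

theorem intUn (h : ∀ i, Representable (E i)) (x : Val) :
    Representable fun T => Encoding.intUn l a (fun i => E i T) x :=
  ndc _ fun _ => res (out _ _ (sel _ _ (duplicates (wkCont h 2) _ _ _)))

theorem extLin (h : ∀ i, Representable (E i)) (x : Val) :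
    Representable fun T => Encoding.extLin l a (fun i => E i T) x :=
  bran _ _ fun _ => duplicates h _ _ _

theorem encChoice (h : ∀ i, Representable (E i)) (q q' : Qual) (w : Mix.View) (x : Val) :
    Representable fun T => Encoding.encChoice l a (fun i => E i T) q q' w x := by
  cases q' <;> cases w
  · exact ndc _ fun k => sel x k (duplicates (l := l) (a := a) h id k x)
  · exact extLin h x
  · cases q
    · exact intUn h x
    · exact res (par (out _ _ inact) (inp _ _ (intUn (fun i => par (wkCont h 3 i) (out _ _ inact)) _)))
  · exact inp _ _ (extLin (wkCont h 1) _)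

end

end Representable

end CMV

namespace Mix

theorem choice_type_unique {T : Ty} {q w K pay cont q₁ w₁ K₁ pay₁ cont₁}
    (h : Sub T (.choice q w K pay cont)) (h' : Sub T (.choice q₁ w₁ K₁ pay₁ cont₁)) :
    q = q₁ ∧ w = w₁ := by
  obtain ⟨_, _, _, h, -⟩ := h.of_choice; obtain ⟨_, _, _, h', -⟩ := h'.of_choice; have := h.det h'
  grind

/-- The name `x` has a choice type with qualifier `q'` and view `w`. -/
def HasChoiceType (Γ : Ctx) (x : Val) (r : Qual × View) : Prop :=
  ∃ y T K pay cont, x = .var y ∧ Γ y = some T ∧ Sub T (.choice r.1 r.2 K pay cont)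

open Classical in
/-- The translation of an operator in a typing context. -/
noncomputable def opContext (Γ : Ctx) : (o : Op) → CMV.Context o.arity
  | .choice q x n l a =>
    let r : Qual × View := if h : ∃ r, HasChoiceType Γ x r then h.choose else (.lin, .int)
    (CMV.Representable.encChoice (k := n + 1) (l := l) (a := a) (E := fun i T => T i)
      CMV.Representable.arg q r.1 r.2 x).choose
  | .par => .par (.hole (0 : Fin 2) (fun n => n) fun _ _ h => h) (.hole (1 : Fin 2) (fun n => n) fun _ _ h => h)
  | .res => .res (.hole (0 : Fin 1) (fun n => n) fun _ _ h => h)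
  | .ite v => .ite v (.hole (0 : Fin 2) (fun n => n) fun _ _ h => h) (.hole (1 : Fin 2) (fun n => n) fun _ _ h => h)
  | .inact => .inact

theorem enc_eq_fill {Γ : Ctx} {S : Proc} (d : Deriv Γ S) :
    Encoding.enc d = (opContext Γ S.op).fill fun i => Encoding.enc (d.args i).2.2 := by
  cases d with
  | inact h => rfl
  | par h d e => simp only [opContext, Proc.op, CMV.Context.fill, ren_id, CMV.Proc.subst_var]; rfl
  | res T U h d => simp only [opContext, Proc.op, CMV.Context.fill, ren_id, CMV.Proc.subst_var]; rfl
  | ite h hv d e =>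
    simp only [opContext, Proc.op, CMV.Context.fill, ren_id, CMV.Proc.subst_var]; rfl
  | @choice _ Γ₁ Γ₂ q x n l a P q' w K pay cont key Δ Θ h hq hx hkey hsurj hΔ hΘ d =>
    have hr : HasChoiceType Γ (.var x) (q', w) := by
      have .var hxT _ hs := hx; exact ⟨x, _, K, pay, cont, rfl, h.left hxT, hs⟩
    have hex : ∃ r, HasChoiceType Γ (.var x) r := ⟨_, hr⟩
    have heq : hex.choose = (q', w) := by
      obtain ⟨y, T, K₁, p₁, c₁, e1, e2, e3⟩ := hex.choose_spec
      obtain ⟨y', T', K₂, p₂, c₂, e1', e2', e3'⟩ := hr; cases e1; cases e1'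
      rw [e2] at e2'; cases e2'
      exact Prod.ext (choice_type_unique e3 e3').1 (choice_type_unique e3 e3').2
    have hspec := (CMV.Representable.encChoice (k := n + 1) (l := l) (a := a) (E := fun i T => T i)
      CMV.Representable.arg q q' w (.var x)).choose_spec
    simp only [opContext, Proc.op, dif_pos hex, heq]; exact (hspec fun i => Encoding.enc (d i)).symm

end Mix

/-! ## Coupled similarity from operational correspondence -/

theorem sumRed_inl {S : Mix.Proc} {X : Mix.Proc ⊕ CMV.Proc}
    (h : ReflTransGen SumRed (.inl S) X) :
    ∃ S', X = .inl S' ∧ ReflTransGen Mix.Red S S' := by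
  induction h with
  | refl => grind
  | tail _ hs ih =>
    obtain ⟨S', rfl, hS⟩ := ih
    cases hs with
    | inl h => grind

theorem sumRed_inr {T : CMV.Proc} {X : Mix.Proc ⊕ CMV.Proc}
    (h : ReflTransGen SumRed (.inr T) X) :
    ∃ T', X = .inr T' ∧ ReflTransGen CMV.Red T T' := by
  induction h with
  | refl => grind
  | tail _ hs ih =>
    obtain ⟨T', rfl, hT⟩ := ih
    cases hs with
    | inr h => grind

theorem sumRed_lift_inl {S S' : Mix.Proc} (h : ReflTransGen Mix.Red S S') :
    ReflTransGen SumRed (.inl S) (.inl S') := h.lift _ fun _ _ h => .inl h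

theorem sumRed_lift_inr {T T' : CMV.Proc} (h : ReflTransGen CMV.Red T T') :
    ReflTransGen SumRed (.inr T) (.inr T') := h.lift _ fun _ _ h => .inr h

theorem weakBarb_inl {S : Mix.Proc} {y : ℕ} :
    WeakBarb SumRed SumBarb (.inl S) y ↔ WeakBarb Mix.Red Mix.Barb S y := by
  constructor
  · rintro ⟨X, hX, hb⟩; obtain ⟨S', rfl, h⟩ := sumRed_inl hX; exact ⟨S', h, hb⟩
  · rintro ⟨S', h, hb⟩; exact ⟨_, sumRed_lift_inl h, hb⟩

theorem weakBarb_inr {T : CMV.Proc} {y : ℕ} :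
    WeakBarb SumRed SumBarb (.inr T) y ↔ WeakBarb CMV.Red CMV.Barb T y := by
  constructor
  · rintro ⟨X, hX, hb⟩; obtain ⟨T', rfl, h⟩ := sumRed_inr hX; exact ⟨T', h, hb⟩
  · rintro ⟨T', h, hb⟩; exact ⟨_, sumRed_lift_inr h, hb⟩

theorem GoodEncoding.coupledSimilar
    {e : ∀ {Γ : Mix.Ctx} {P : Mix.Proc}, Mix.Deriv Γ P → CMV.Proc}
    (h : GoodEncoding e CMV.Bisim) {Γ : Mix.Ctx} {S : Mix.Proc} (d : Mix.Deriv Γ S) :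
    CoupledSimilar SumRed SumBarb (Sum.inl S) (Sum.inr (e d)) := by
  have symm := fun {P Q} => h.equivalence.symm (x := P) (y := Q)
  have trans := fun {P Q R} => h.equivalence.trans (x := P) (y := Q) (z := R)
  have bis := h.bisimulation
  have weak : ∀ {P P' : CMV.Proc} {y}, ReflTransGen CMV.Red P P' →
      WeakBarb CMV.Red CMV.Barb P' y → WeakBarb CMV.Red CMV.Barb P y := by
    rintro P P' y hP ⟨P'', hP', hb⟩; exact ⟨P'', hP.trans hP', hb⟩
  let R : Mix.Proc ⊕ CMV.Proc → Mix.Proc ⊕ CMV.Proc → Prop := fun X Y =>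
    match X, Y with
    | .inl S, .inr T => ∃ (Γ : Mix.Ctx) (d : Mix.Deriv Γ S) (U : CMV.Proc),
        ReflTransGen CMV.Red T U ∧ CMV.Bisim U (e d)
    | .inr T, .inl S => ∃ (Γ : Mix.Ctx) (d : Mix.Deriv Γ S) (U : CMV.Proc),
        ReflTransGen CMV.Red (e d) U ∧ CMV.Bisim U T
    | _, _ => False
  have hbwd : ∀ {S T}, R (.inr T) (.inl S) → ∀ {T'}, ReflTransGen CMV.Red T T' →
      R (.inr T') (.inl S) := by
    rintro S T ⟨Γ, d, U, hU, hUT⟩ T' hT; obtain ⟨U', hU', hUT'⟩ := (bis U T hUT).2.1 T' hT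
    exact ⟨Γ, d, U', hU.trans hU', hUT'⟩
  refine ⟨R, ?_, ⟨Γ, d, e d, .refl, h.equivalence.refl _⟩, ⟨Γ, d, e d, .refl, h.equivalence.refl _⟩⟩
  rintro (S | T) (S₁ | T₁) hR
  · grind
  · obtain ⟨Γ, d, U, hU, hUe⟩ := hR
    have key : ∀ S', ReflTransGen Mix.Red S S' → ∃ (d' : Mix.Deriv Γ S') (V : CMV.Proc),
        ReflTransGen CMV.Red T₁ V ∧ CMV.Bisim V (e d') := by
      intro S' hS; obtain ⟨d', V, hV, hVe⟩ := h.complete d S' hS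
      obtain ⟨U', hU', hUV⟩ := (bis U (e d) hUe).2.1 V hV
      exact ⟨d', U', hU.trans hU', trans hUV hVe⟩
    refine ⟨fun X hX => ?_, fun X hX => ?_, fun y hy => ?_⟩
    · obtain ⟨S', rfl, hS⟩ := sumRed_inl hX; obtain ⟨d', V, hV, hVe⟩ := key S' hS
      exact ⟨.inr T₁, .refl, Γ, d', V, hV, hVe⟩
    · obtain ⟨S', rfl, hS⟩ := sumRed_inl hX; obtain ⟨d', V, hV, hVe⟩ := key S' hS
      exact ⟨.inr V, sumRed_lift_inr hV, Γ, d', e d', .refl, symm hVe⟩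
    · rw [weakBarb_inl, h.barb_sensitive d] at hy; rw [weakBarb_inr]
      exact weak hU (((bis U (e d) hUe).2.2 y).mpr hy)
  · refine ⟨fun X hX => ?_, fun X hX => ?_, fun y hy => ?_⟩
    · obtain ⟨T', rfl, hT⟩ := sumRed_inr hX; exact ⟨.inl S₁, .refl, hbwd hR hT⟩
    · obtain ⟨T', rfl, hT⟩ := sumRed_inr hX; obtain ⟨Γ, d, U, hU, hUT⟩ := hbwd hR hT
      obtain ⟨S', d', V, hS, hV, hVe⟩ := h.sound d U hU
      obtain ⟨W, hW, hWV⟩ := (bis U T' hUT).1 V hV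
      exact ⟨.inl S', sumRed_lift_inl hS, Γ, d', W, hW, trans (symm hWV) hVe⟩
    · obtain ⟨Γ, d, U, hU, hUT⟩ := hR; rw [weakBarb_inr] at hy
      rw [weakBarb_inl, h.barb_sensitive d]; exact weak hU (((bis U T hUT).2.2 y).mpr hy)
  grind

/-! ## Named restriction

Inside a configuration all names are natural numbers: `3 * n` stands for the free name `n`, and
`3 * m + 1`, `3 * m + 2` are the two endpoints of the `m`-th restriction. -/

/-- `a` is an endpoint of a restriction. -/
def Bnd (a : ℕ) : Prop := a % 3 ≠ 0

/-- The other endpoint of a restriction. -/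
def co (a : ℕ) : ℕ := if a % 3 = 1 then a + 1 else a - 1

/-- The number of the restriction an endpoint belongs to. -/
def pid (a : ℕ) : ℕ := a / 3

theorem co_co {a : ℕ} (h : Bnd a) : co (co a) = a := by unfold co Bnd at *; grind

theorem bnd_co {a : ℕ} (h : Bnd a) : Bnd (co a) := by unfold co Bnd at *; grind

theorem pid_co {a : ℕ} (h : Bnd a) : pid (co a) = pid a := by unfold co Bnd pid at *; grind

theorem co_ne {a : ℕ} (h : Bnd a) : co a ≠ a := by unfold co Bnd at *; grind

theorem eq_or_eq_co {a b : ℕ} (ha : Bnd a) (hb : Bnd b) (h : pid a = pid b) : b = a ∨ b = co a := by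
  unfold co Bnd pid at *; grind

/-- Restrictions with different numbers. -/
def Good (X : List ℕ) : Prop := (X.map pid).Nodup ∧ ∀ a ∈ X, Bnd a

/-- `n` is an endpoint of one of the restrictions in `X`. -/
def Hit (X : List ℕ) (n : ℕ) : Prop := Bnd n ∧ pid n ∈ X.map pid

theorem good_nil : Good [] := ⟨List.nodup_nil, by simp⟩

theorem good_cons {a : ℕ} {X : List ℕ} : Good (a :: X) ↔ Bnd a ∧ pid a ∉ X.map pid ∧ Good X := by
  simp only [Good, List.map_cons, List.nodup_cons, List.mem_cons, forall_eq_or_imp]; tauto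

theorem good_append {X Y : List ℕ} :
    Good (X ++ Y) ↔ Good X ∧ Good Y ∧ ∀ n, Hit X n → ¬ Hit Y n := by
  simp only [Good, List.map_append, List.nodup_append, List.mem_append]; constructor
  · rintro ⟨⟨h1, h2, h3⟩, h4⟩
    refine ⟨⟨h1, fun a ha => h4 a (.inl ha)⟩, ⟨h2, fun a ha => h4 a (.inr ha)⟩, ?_⟩
    rintro n ⟨-, hX⟩ ⟨-, hY⟩; grind
  · rintro ⟨⟨h1, h2⟩, ⟨h3, h4⟩, h5⟩; refine ⟨⟨h1, h3, ?_⟩, fun a ha => ha.elim (h2 a) (h4 a)⟩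
    rintro n hX m hY rfl; obtain ⟨a, ha, rfl⟩ := List.mem_map.mp hX
    exact h5 a ⟨h2 a ha, hX⟩ ⟨h2 a ha, hY⟩

theorem hit_cons {a n : ℕ} {X : List ℕ} (ha : Bnd a) :
    Hit (a :: X) n ↔ n = a ∨ n = co a ∨ Hit X n := by
  simp only [Hit, List.map_cons, List.mem_cons]; constructor
  · rintro ⟨hb, h | h⟩
    · rcases eq_or_eq_co ha hb h.symm with h | h <;> simp [h]
    grind
  · rintro (rfl | rfl | h)
    · grind
    · exact ⟨bnd_co ha, .inl (pid_co ha)⟩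
    grind

theorem hit_append {X Y : List ℕ} {n : ℕ} : Hit (X ++ Y) n ↔ Hit X n ∨ Hit Y n := by
  simp only [Hit, List.map_append, List.mem_append]; tauto

theorem not_hit_nil {n : ℕ} : ¬ Hit [] n := fun h => by simpa using h.2

theorem hit_co {X : List ℕ} {n : ℕ} (h : Hit X n) : Hit X (co n) :=
  ⟨bnd_co h.1, by rw [pid_co h.1]; exact h.2⟩

theorem hit_co_iff {X : List ℕ} {n : ℕ} (hn : Bnd n) : Hit X (co n) ↔ Hit X n :=
  ⟨fun h => by have := hit_co h; rwa [co_co hn] at this, hit_co⟩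

theorem Good.perm {X Y : List ℕ} (h : X.Perm Y) (hX : Good X) : Good Y :=
  ⟨(h.map pid).nodup_iff.mp hX.1, fun a ha => hX.2 a (h.mem_iff.mpr ha)⟩

theorem hit_perm {X Y : List ℕ} (h : X.Perm Y) {n : ℕ} : Hit X n ↔ Hit Y n := by
  simp only [Hit, (h.map pid).mem_iff]

theorem exists_fresh (N : ℕ) : ∃ a, Bnd a ∧ N ≤ pid a :=
  ⟨3 * N + 1, by unfold Bnd; omega, by unfold pid; omega⟩

namespace Calculus

variable {P : Type} [Calculus P]

theorem rfl' {p : P} : Cong p p := refl p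

theorem congOfEq {p q : P} (h : p = q) : Cong p q := h ▸ refl p

/-- Restriction of the endpoints `a` and `co a`. -/
def nu (a : ℕ) (p : P) : P := res (subst (abs2 a (co a)) p)

def nuL : List ℕ → P → P
  | [], p => p
  | a :: X, p => nu a (nuL X p)

/-- The restriction of `a` has no effect on `p`. -/
def Fresh (a : ℕ) (p : P) : Prop := subst (abs2 a (co a)) p = subst (wk 2) p

theorem nu_cong (a : ℕ) {p q : P} (h : Cong p q) : Cong (nu a p) (nu a q) :=
  cong_res (cong_subst _ h)

theorem nuL_cong (X : List ℕ) {p q : P} (h : Cong p q) : Cong (nuL X p) (nuL X q) := by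
  induction X with
  | nil => exact h
  | cons a X ih => exact nu_cong a ih

theorem nuL_append (X Y : List ℕ) (p : P) : nuL (X ++ Y) p = nuL X (nuL Y p) := by
  induction X with
  | nil => rfl
  | cons a X ih => exact congrArg (nu a) ih

theorem nu_co {a : ℕ} (ha : Bnd a) (p : P) : Cong (nu a p) (nu (co a) p) := by
  refine trans (resSwap _) (congOfEq ?_); rw [subst_subst, nu, co_co ha]
  congr 2
  funext n; simp only [scomp, abs2]; have := co_ne ha
  split_ifs <;> first | rfl | omega

theorem nu_comm {a b : ℕ} (ha : Bnd a) (hb : Bnd b) (h : pid a ≠ pid b) (p : P) :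
    Cong (nu a (nu b p)) (nu b (nu a p)) := by
  have h1 : a ≠ b := fun e => h (e ▸ rfl); have h2 : a ≠ co b := fun e => h (by rw [e, pid_co hb])
  have h3 : co a ≠ b := fun e => h (by rw [← e, pid_co ha])
  have h4 : co a ≠ co b := fun e => h (by rw [← pid_co ha, e, pid_co hb]); have h5 := co_ne ha
  have h6 := co_ne hb; unfold nu; rw [subst_res, subst_res, subst_subst, subst_subst]
  refine trans (resRes _) (congOfEq ?_); rw [subst_subst]
  congr 3
  funext n
  have e : ∀ a b : ℕ, b ≠ a → scomp (up (up (abs2 a (co a)))) (abs2 b (co b)) n =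
      if n = b then .var 0 else if n = co b then .var 1 else
        (if n = a then .var 2 else if n = co a then .var 3 else .var (n + 4)) := by
    intro a b hab; simp only [scomp, abs2]
    split_ifs <;> simp_all [Val.subst, up, ren, abs2]
  change ((scomp (up (up (abs2 a (co a)))) (abs2 b (co b)) n).subst _) = _
  rw [e a b h1.symm, e b a h1]
  split_ifs <;> simp_all [Val.subst, ren]

theorem par_nu {a : ℕ} {p : P} (h : Fresh a p) (q : P) : Cong (par p (nu a q)) (nu a (par p q)) := by
  refine trans (resPar _ _) (congOfEq ?_); rw [nu, subst_par, h]

theorem nu_drop {a : ℕ} {p : P} (h : Fresh a p) : Cong (nu a p) p := by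
  have h0 : Cong (nu a p) (par p (res inact)) := by
    refine trans ?_ (symm (resPar _ _)); rw [nu, h]; exact cong_res (symm (parInact _))
  exact trans h0 (trans (cong_par rfl' resInact) (parInact _))

theorem parInact' (p : P) : Cong (par inact p) p := trans (parComm _ _) (parInact p)

theorem par_left_comm (p q r : P) : Cong (par p (par q r)) (par q (par p r)) :=
  trans (parAssoc _ _ _) (trans (cong_par (parComm _ _) rfl') (symm (parAssoc _ _ _)))

def parL : List P → P
  | [] => inact
  | p :: l => par p (parL l)

theorem parL_perm {l l' : List P} (h : l.Perm l') : Cong (parL l) (parL l') := by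
  induction h with
  | nil => exact rfl'
  | cons p _ ih => exact cong_par rfl' ih
  | swap p q l => exact par_left_comm _ _ _
  | trans _ _ ih1 ih2 => exact trans ih1 ih2

/-- Parallel composition of a multiset of processes. -/
noncomputable def parM (M : Multiset P) : P := parL M.toList

theorem parM_coe (l : List P) : Cong (parM (l : Multiset P)) (parL l) :=
  parL_perm (Multiset.coe_eq_coe.mp (coe_toList _))

theorem parM_zero : parM (0 : Multiset P) = inact := by simp [parM, parL]

theorem parM_cons (p : P) (M : Multiset P) : Cong (parM (p ::ₘ M)) (par p (parM M)) := by
  refine Quot.inductionOn M fun l => ?_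
  exact trans (parM_coe (p :: l)) (cong_par rfl' (symm (parM_coe l)))

theorem parM_singleton (p : P) : Cong (parM {p}) p := by
  refine trans (parM_cons p 0) ?_; rw [parM_zero]; exact parInact p

theorem parM_add (M N : Multiset P) : Cong (parM (M + N)) (par (parM M) (parM N)) := by
  induction M using Multiset.induction with
  | empty => rw [zero_add, parM_zero]; exact symm (parInact' _)
  | cons p M ih =>
    rw [cons_add]
    exact trans (parM_cons _ _) (trans (cong_par rfl' ih) (trans (parAssoc _ _ _)
      (cong_par (symm (parM_cons _ _)) rfl')))

theorem parM_rel {M N : Multiset P} (h : Rel Cong M N) : Cong (parM M) (parM N) := by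
  induction h with
  | zero => exact rfl'
  | cons h _ ih => exact trans (parM_cons _ _) (trans (cong_par h ih) (symm (parM_cons _ _)))

theorem parM_subst (σ : ℕ → Val) (M : Multiset P) :
    Cong (subst σ (parM M)) (parM (M.map (subst σ))) := by
  induction M using Multiset.induction with
  | empty => rw [parM_zero, subst_inact, Multiset.map_zero, parM_zero]; exact rfl'
  | cons p M ih =>
    rw [Multiset.map_cons]; refine trans (cong_subst σ (parM_cons p M)) ?_; rw [subst_par]
    exact trans (cong_par rfl' ih) (symm (parM_cons _ _))

theorem nuL_perm {X Y : List ℕ} (h : X.Perm Y) (hX : Good X) (p : P) :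
    Cong (nuL X p) (nuL Y p) := by
  induction h with
  | nil => exact rfl'
  | cons a _ ih => exact nu_cong a (ih (good_cons.mp hX).2.2)
  | swap a b l =>
    rw [good_cons, good_cons] at hX; refine nu_comm hX.1 hX.2.2.1 (fun e => hX.2.1 ?_) _; simp [e]
  | trans h _ ih1 ih2 => exact trans (ih1 hX) (ih2 (hX.perm h))

theorem nuL_last {Z : List ℕ} (hZ : Good Z) {a : ℕ} (ha : Hit Z a) :
    ∃ Y, ∀ p : P, Cong (nuL Z p) (nuL Y (nu a p)) := by
  obtain ⟨b, hb, e⟩ := List.mem_map.mp ha.2; refine ⟨Z.erase b, fun p => ?_⟩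
  have hp : Z.Perm (Z.erase b ++ [b]) :=
    (List.perm_cons_erase hb).trans (List.perm_append_comm (l₁ := [b]))
  refine trans (nuL_perm hp hZ p) ?_; rw [nuL_append]; refine nuL_cong _ ?_
  rcases eq_or_eq_co ha.1 (hZ.2 b hb) e.symm with e | e
  · rw [e]; exact rfl'
  · rw [e]; exact symm (nu_co ha.1 p)

theorem parM_par (p q : P) (M : Multiset P) :
    Cong (parM (par p q ::ₘ M)) (parM (p ::ₘ q ::ₘ M)) :=
  trans (parM_cons _ _) (trans (symm (parAssoc _ _ _)) (symm
    (trans (parM_cons _ _) (cong_par rfl' (parM_cons _ _)))))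

theorem parM_inact (M : Multiset P) : Cong (parM (inact ::ₘ M)) (parM M) :=
  trans (parM_cons _ _) (parInact' _)

/-- A restriction is a named restriction of any endpoint that does not occur. -/
theorem res_eq_nu {a : ℕ} (p : P)
    (h : subst (scomp (abs2 a (co a)) (cons2 a (co a) Val.var)) p = p) :
    res p = nu a (subst (cons2 a (co a) Val.var) p) := by
  rw [nu, subst_subst, h]

end Calculus

/-! ## Free names of target processes -/

namespace CMV

namespace Proc

/-- The name `n` occurs free. -/
def Occ : ℕ → Proc → Prop
  | n, out x v P => x = .var n ∨ v = .var n ∨ Occ n P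
  | n, inp _ x P => x = .var n ∨ Occ (n + 1) P
  | n, sel x _ P => x = .var n ∨ Occ n P
  | n, bran x _ P => x = .var n ∨ ∃ l, Occ n (P l)
  | n, par P Q => Occ n P ∨ Occ n Q
  | n, res P => Occ (n + 2) P
  | n, ite v P Q => v = .var n ∨ Occ n P ∨ Occ n Q
  | _, inact => False

theorem Val.subst_congr {v : Val} {σ τ : ℕ → Val} (h : ∀ n, v = .var n → σ n = τ n) :
    v.subst σ = v.subst τ := by
  cases v with
  | var n => exact h n rfl
  | _ => rfl

theorem subst_congr (P : Proc) {σ τ : ℕ → Val} (h : ∀ n, P.Occ n → σ n = τ n) :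
    P.subst σ = P.subst τ := by
  have hup : ∀ {P : Proc} {σ τ : ℕ → Val}, (∀ n, P.Occ (n + 1) → σ n = τ n) →
      ∀ n, P.Occ n → up σ n = up τ n := by
    intro P σ τ h n hn
    cases n with
    | zero => rfl
    | succ n => simp only [up, h n hn]
  induction P generalizing σ τ with
  | out x v P ih =>
    simp only [subst, ih fun n hn => h n (.inr (.inr hn)),
      Val.subst_congr fun n hn => h n (.inl hn), Val.subst_congr fun n hn => h n (.inr (.inl hn))]
  | inp q x P ih =>
    simp only [subst, ih (hup fun n hn => h n (.inr hn)), Val.subst_congr fun n hn => h n (.inl hn)]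
  | sel x l P ih =>
    simp only [subst, ih fun n hn => h n (.inr hn), Val.subst_congr fun n hn => h n (.inl hn)]
  | bran x L P ih =>
    simp only [subst, fun l => ih l fun n hn => h n (.inr ⟨l, hn⟩),
      Val.subst_congr fun n hn => h n (.inl hn)]
  | par P Q ih1 ih2 =>
    simp only [subst, ih1 fun n hn => h n (.inl hn), ih2 fun n hn => h n (.inr hn)]
  | res P ih =>
    simp only [subst]; rw [ih]
    exact hup fun n hn => by
      cases n with
      | zero => rfl
      | succ n => simp only [up, h n hn]
  | ite v P Q ih1 ih2 =>
    simp only [subst, ih1 fun n hn => h n (.inr (.inl hn)), ih2 fun n hn => h n (.inr (.inr hn)),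
      Val.subst_congr fun n hn => h n (.inl hn)]
  | inact => rfl

theorem Val.subst_eq_var {v : Val} {σ : ℕ → Val} {m : ℕ} :
    v.subst σ = .var m ↔ ∃ n, v = .var n ∧ σ n = .var m := by
  cases v <;> simp [Val.subst]

theorem up_eq_var {σ : ℕ → Val} {n m : ℕ} :
    up σ n = .var (m + 1) ↔ ∃ k, n = k + 1 ∧ σ k = .var m := by
  cases n with
  | zero => simp [up]
  | succ n => cases h : σ n <;> simp [up, h, Val.subst, ren]

theorem occ_subst (P : Proc) {σ : ℕ → Val} {m : ℕ} :
    (P.subst σ).Occ m ↔ ∃ n, P.Occ n ∧ σ n = .var m := by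
  induction P generalizing σ m with
  | out x v P ih => simp only [subst, Occ, ih, Val.subst_eq_var]; aesop
  | inp q x P ih => simp only [subst, Occ, ih, Val.subst_eq_var, up_eq_var]; aesop
  | sel x l P ih => simp only [subst, Occ, ih, Val.subst_eq_var]; aesop
  | bran x L P ih => simp only [subst, Occ, ih, Val.subst_eq_var]; grind
  | par P Q ih1 ih2 => simp only [subst, Occ, ih1, ih2]; aesop
  | res P ih =>
    simp only [subst, Occ, ih]; constructor
    · rintro ⟨n, h1, h2⟩; obtain ⟨k, rfl, h3⟩ := up_eq_var.mp h2
      obtain ⟨j, rfl, h4⟩ := up_eq_var.mp h3; grind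
    · rintro ⟨n, h1, h2⟩; exact ⟨n + 2, h1, up_eq_var.mpr ⟨n + 1, rfl, up_eq_var.mpr ⟨n, rfl, h2⟩⟩⟩
  | ite v P Q ih1 ih2 => simp only [subst, Occ, ih1, ih2, Val.subst_eq_var]; aesop
  | inact => simp [subst, Occ]

theorem occ_bounded (P : Proc) : ∃ N, ∀ n, P.Occ n → n < N := by
  have hv : ∀ v : Val, ∃ N, ∀ n, v = .var n → n < N := by
    intro v
    cases v with
    | var m => exact ⟨m + 1, fun n h => by grind⟩
    | _ => exact ⟨0, fun n h => by cases h⟩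
  induction P with
  | out x v P ih =>
    obtain ⟨A, hA⟩ := hv x; obtain ⟨B, hB⟩ := hv v; obtain ⟨C, hC⟩ := ih
    refine ⟨A + B + C, fun n h => ?_⟩; rcases h with h | h | h <;> grind
  | inp q x P ih =>
    obtain ⟨A, hA⟩ := hv x; obtain ⟨C, hC⟩ := ih; refine ⟨A + C, fun n h => ?_⟩; rcases h with h | h
    all_goals grind
  | sel x l P ih =>
    obtain ⟨A, hA⟩ := hv x; obtain ⟨C, hC⟩ := ih; refine ⟨A + C, fun n h => ?_⟩; rcases h with h | h
    all_goals grind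
  | bran x L P ih =>
    obtain ⟨A, hA⟩ := hv x
    choose C hC using ih
    refine ⟨A + ∑ l, C l, fun n h => ?_⟩; rcases h with h | ⟨l, h⟩
    · grind
    · have := hC l n h
      have := Finset.single_le_sum (f := C) (fun _ _ => Nat.zero_le _) (Finset.mem_univ l); omega
  | par P Q ih1 ih2 =>
    obtain ⟨A, hA⟩ := ih1; obtain ⟨C, hC⟩ := ih2; refine ⟨A + C, fun n h => ?_⟩; rcases h with h | h
    all_goals grind
  | res P ih => obtain ⟨C, hC⟩ := ih; exact ⟨C, fun n h => by have := hC _ h; omega⟩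
  | ite v P Q ih1 ih2 =>
    obtain ⟨A, hA⟩ := hv v; obtain ⟨B, hB⟩ := ih1; obtain ⟨C, hC⟩ := ih2
    refine ⟨A + B + C, fun n h => ?_⟩; rcases h with h | h | h <;> grind
  | inact => exact ⟨0, fun n h => h.elim⟩

end Proc

open Proc Calculus

theorem occ_ren {P : Proc} {f : ℕ → ℕ} {m : ℕ} :
    (P.subst (ren f)).Occ m ↔ ∃ n, P.Occ n ∧ f n = m := by simp [occ_subst, ren]

theorem occ_ren_of_involutive {P : Proc} {f : ℕ → ℕ} (hf : Function.Involutive f) {m : ℕ} :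
    (P.subst (ren f)).Occ m ↔ P.Occ (f m) := by
  rw [occ_ren]; constructor
  · rintro ⟨n, h, rfl⟩; rwa [hf n]
  · intro h; exact ⟨f m, h, hf m⟩

theorem Cong.occ {P Q : Proc} (h : Cong P Q) (n : ℕ) : P.Occ n ↔ Q.Occ n := by
  induction h generalizing n with
  | refl P => rfl
  | symm _ ih => grind
  | trans _ _ ih1 ih2 => grind
  | out _ ih => simp only [Occ, ih]
  | inp _ ih => simp only [Occ, ih]
  | sel _ ih => simp only [Occ, ih]
  | bran _ ih => simp only [Occ, ih]
  | par _ _ ih1 ih2 => simp only [Occ, ih1, ih2]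
  | res _ ih => simp only [Occ, ih]
  | ite _ _ ih1 ih2 => simp only [Occ, ih1, ih2]
  | resInact => simp [Occ]
  | resRes P =>
    simp only [Occ]
    rw [show (ren fun n => if n < 2 then n + 2 else if n < 4 then n - 2 else n) = ren Mix.exchange
      from rfl, occ_ren_of_involutive Mix.exchange_involutive]
    have : Mix.exchange (n + 2 + 2) = n + 2 + 2 := by unfold Mix.exchange; grind
    grind
  | resPar P Q => simp [Occ, wk, occ_ren]
  | resSwap P => simp only [Occ]; rw [occ_ren_of_involutive Mix.swap01_involutive]; rfl
  | parInact P => simp [Occ]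
  | parComm P Q => simp only [Occ]; tauto
  | parAssoc P Q R => simp only [Occ]; tauto

theorem fresh_of_not_occ {a : ℕ} {P : Proc} (h : ¬ P.Occ a) (h' : ¬ P.Occ (co a)) :
    Fresh a P := by
  refine Proc.subst_congr P fun n hn => ?_; have h1 : n ≠ a := fun e => h (e ▸ hn)
  have h2 : n ≠ co a := fun e => h' (e ▸ hn); simp [abs2, h1, h2, wk, ren]

theorem occ_nu {a n : ℕ} {P : Proc} : Occ n (nu a P) ↔ P.Occ n ∧ n ≠ a ∧ n ≠ co a := by
  change Occ (n + 2) (P.subst _) ↔ _; rw [occ_subst]; constructor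
  · rintro ⟨m, hm, h⟩; simp only [abs2] at h; grind
  · rintro ⟨h, h1, h2⟩; exact ⟨n, h, by simp [abs2, h1, h2]⟩

theorem occ_nuL {X : List ℕ} (hX : ∀ a ∈ X, Bnd a) {n : ℕ} {P : Proc} :
    Occ n (nuL X P) ↔ P.Occ n ∧ ¬ Hit X n := by
  induction X with
  | nil => simp [nuL, not_hit_nil]
  | cons a X ih =>
    rw [nuL, occ_nu, ih fun b hb => hX b (by grind), hit_cons (hX a (by simp))]; tauto

theorem occ_parM {M : Multiset Proc} {n : ℕ} : Occ n (parM M) ↔ ∃ p ∈ M, p.Occ n := by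
  induction M using Multiset.induction with
  | empty => rw [parM_zero]; simp [Calculus.inact, Occ]
  | cons p M ih => rw [Cong.occ (parM_cons p M)]; simp only [Calculus.par, Occ, ih, mem_cons]; grind

theorem cong_nu (a : ℕ) {p q : Proc} (h : Cong p q) : Cong (nu a p) (nu a q) :=
  nu_cong (P := Proc) a h

theorem cong_nuL (X : List ℕ) {p q : Proc} (h : Cong p q) : Cong (nuL X p) (nuL X q) :=
  nuL_cong (P := Proc) X h

theorem par_nuL {X : List ℕ} (hX : ∀ a ∈ X, Bnd a) {p : Proc} (h : ∀ n, Hit X n → ¬ p.Occ n)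
    (q : Proc) : Cong (.par p (nuL X q)) (nuL X (.par p q)) := by
  induction X with
  | nil => exact .refl _
  | cons a X ih =>
    have ha := hX a (by simp)
    have hf : Fresh a p := fresh_of_not_occ (h a ((hit_cons ha).mpr (.inl rfl)))
      (h _ ((hit_cons ha).mpr (.inr (.inl rfl))))
    exact (par_nu hf _).trans (cong_nu a (ih (fun b hb => hX b (by grind))
      fun n hn => h n ((hit_cons ha).mpr (.inr (.inr hn)))))

theorem nuL_drop {X : List ℕ} (hX : ∀ a ∈ X, Bnd a) {p : Proc} (h : ∀ n, Hit X n → ¬ p.Occ n) :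
    Cong (nuL X p) p := by
  induction X with
  | nil => exact .refl _
  | cons a X ih =>
    have ha := hX a (by simp)
    have h1 : Cong (nuL X p) p := ih (fun b hb => hX b (by grind))
      fun n hn => h n ((hit_cons ha).mpr (.inr (.inr hn)))
    refine (cong_nu a h1).trans (nu_drop (fresh_of_not_occ ?_ ?_))
    · exact h a ((hit_cons ha).mpr (.inl rfl))
    · exact h _ ((hit_cons ha).mpr (.inr (.inl rfl)))

/-- Lists of restrictions that bind the same free names have the same effect. -/
theorem nuL_eq {X Y : List ℕ} (hX : Good X) (hY : Good Y) {p : Proc}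
    (h : ∀ n, p.Occ n → (Hit X n ↔ Hit Y n)) : Cong (nuL X p) (nuL Y p) := by
  induction X generalizing Y with
  | nil => exact .symm (nuL_drop hY.2 fun n hn ho => not_hit_nil ((h n ho).mpr hn))
  | cons a X ih =>
    have hX' := good_cons.mp hX
    by_cases hocc : p.Occ a ∨ p.Occ (co a)
    · have hYa : Hit Y a := by
        rcases hocc with ho | ho
        · exact (h a ho).mp ((hit_cons hX'.1).mpr (.inl rfl))
        · have := (h _ ho).mp ((hit_cons hX'.1).mpr (.inr (.inl rfl)))
          rwa [hit_co_iff hX'.1] at this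
      obtain ⟨b, hb, hab⟩ := List.mem_map.mp hYa.2; have hperm := List.perm_cons_erase hb
      have hY' := good_cons.mp (hY.perm hperm); have hbB := hY'.1
      have h1 : Cong (nu a (nuL (Y.erase b) p)) (nuL Y p) := by
        refine Cong.trans ?_ (.symm (nuL_perm hperm hY p))
        rcases eq_or_eq_co hX'.1 hbB hab.symm with e | e
        · rw [e]; exact .refl _
        · have := nu_co hX'.1 (nuL (Y.erase b) p); rw [← e] at this; exact this
      refine Cong.trans (cong_nu a (ih hX'.2.2 hY'.2.2 fun n ho => ?_)) h1; have h2 := h n ho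
      rw [hit_perm hperm, hit_cons hX'.1, hit_cons hbB] at h2
      have h3 : ∀ Z : List ℕ, pid a ∉ Z.map pid → n = a ∨ n = co a → ¬ Hit Z n := by
        rintro Z hZ (rfl | rfl) hh
        · exact hZ hh.2
        · exact hZ (pid_co hX'.1 ▸ hh.2)
      by_cases hn : n = a ∨ n = co a
      · grind
      · have hn' : ¬ (n = b ∨ n = co b) := by
          rcases eq_or_eq_co hX'.1 hbB hab.symm with e | e
          · rwa [e]
          · rw [e, co_co hX'.1]; tauto
        tauto
    · have hf : Fresh a (nuL X p) := fresh_of_not_occ (fun ho => hocc (.inl ((occ_nuL hX'.2.2.2).mp ho).1))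
        fun ho => hocc (.inr ((occ_nuL hX'.2.2.2).mp ho).1)
      refine (nu_drop hf).trans (ih hX'.2.2 hY fun n ho => ?_); rw [← h n ho, hit_cons hX'.1]; grind

/-! ## Flattening -/

/-- Prefixed processes and conditionals. -/
def IsThread : Proc → Prop
  | .par _ _ => False
  | .res _ => False
  | .inact => False
  | _ => True

/-- `Fl P σ X M`: the process `P`, under the substitution `σ` and with the names `X` for its
unguarded restrictions, consists of the threads `M`. -/
inductive Fl : Proc → (ℕ → Val) → List ℕ → Multiset Proc → Prop
  | inact (σ) : Fl .inact σ [] 0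
  | par {P Q σ X Y M N} : Fl P σ X M → Fl Q σ Y N → Fl (.par P Q) σ (X ++ Y) (M + N)
  | res {P σ a X M} : Fl P (cons2 a (co a) σ) X M → Fl (.res P) σ (a :: X) M
  | thread {P} (σ) : IsThread P → Fl P σ [] {P.subst σ}

theorem isThread_subst {P : Proc} {σ : ℕ → Val} : IsThread (P.subst σ) ↔ IsThread P := by
  cases P <;> simp [IsThread, Proc.subst]

theorem Fl.thread_iff {P : Proc} (hP : IsThread P) {σ : ℕ → Val} {X M} :
    Fl P σ X M ↔ X = [] ∧ M = {P.subst σ} := by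
  constructor
  · intro h
    cases h with
    | thread _ _ => grind
    | _ => exact hP.elim
  · rintro ⟨rfl, rfl⟩; exact .thread _ hP

theorem Fl.inact_iff {σ : ℕ → Val} {X M} : Fl .inact σ X M ↔ X = [] ∧ M = 0 := by
  constructor
  · intro h
    cases h with
    | inact => grind
    | thread _ h => exact h.elim
  · rintro ⟨rfl, rfl⟩; exact .inact _

theorem Fl.par_iff {P Q : Proc} {σ : ℕ → Val} {X M} :
    Fl (.par P Q) σ X M ↔ ∃ Y Z N O, X = Y ++ Z ∧ M = N + O ∧ Fl P σ Y N ∧ Fl Q σ Z O := by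
  constructor
  · intro h
    cases h with
    | par h1 h2 => grind
    | thread _ h => exact h.elim
  · rintro ⟨Y, Z, N, O, rfl, rfl, h1, h2⟩; exact .par h1 h2

theorem Fl.res_iff {P : Proc} {σ : ℕ → Val} {X M} :
    Fl (.res P) σ X M ↔ ∃ a Y, X = a :: Y ∧ Fl P (cons2 a (co a) σ) Y M := by
  constructor
  · intro h
    cases h with
    | res h1 => grind
    | thread _ h => exact h.elim
  · rintro ⟨a, Y, rfl, h1⟩; exact .res h1

theorem Fl.subst_iff {P : Proc} {τ σ : ℕ → Val} {X M} :
    Fl (P.subst τ) σ X M ↔ Fl P (scomp σ τ) X M := by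
  induction P generalizing τ σ X M with
  | par P Q ih1 ih2 => simp only [Proc.subst, Fl.par_iff, ih1, ih2]
  | res P ih => simp only [Proc.subst, Fl.res_iff, ih, scomp_cons2_upup]
  | inact => simp only [Proc.subst, Fl.inact_iff]
  | _ => rw [Fl.thread_iff (by exact trivial), Fl.thread_iff (by exact trivial), Proc.subst_subst]

/-- Threads with the same prefix and congruent continuations. -/
inductive TC : Proc → Proc → Prop
  | out {x v P Q} : Cong P Q → TC (.out x v P) (.out x v Q)
  | inp {q x P Q} : Cong P Q → TC (.inp q x P) (.inp q x Q)
  | sel {x l P Q} : Cong P Q → TC (.sel x l P) (.sel x l Q)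
  | bran {x L P Q} : (∀ l, Cong (P l) (Q l)) → TC (.bran x L P) (.bran x L Q)
  | ite {v P P' Q Q'} : Cong P P' → Cong Q Q' → TC (.ite v P Q) (.ite v P' Q')

theorem TC.refl {P : Proc} (h : IsThread P) : TC P P := by
  cases P with
  | par => exact h.elim
  | res => exact h.elim
  | inact => exact h.elim
  | out => exact .out (.refl _)
  | inp => exact .inp (.refl _)
  | sel => exact .sel (.refl _)
  | bran => exact .bran fun _ => .refl _
  | ite => exact .ite (.refl _) (.refl _)

theorem TC.cong {P Q : Proc} (h : TC P Q) : Cong P Q := by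
  cases h with
  | out h => exact .out h
  | inp h => exact .inp h
  | sel h => exact .sel h
  | bran h => exact .bran h
  | ite h h' => exact .ite h h'

theorem TC.trans {P Q R : Proc} (h : TC P Q) (h' : TC Q R) : TC P R := by
  cases h with
  | out h => cases h' with | out h' => exact .out (h.trans h')
  | inp h => cases h' with | inp h' => exact .inp (h.trans h')
  | sel h => cases h' with | sel h' => exact .sel (h.trans h')
  | bran h => cases h' with | bran h' => exact .bran fun l => (h l).trans (h' l)
  | ite h1 h2 => cases h' with | ite h3 h4 => exact .ite (h1.trans h3) (h2.trans h4)

theorem Fl.isThread {P : Proc} {σ : ℕ → Val} {X M} (h : Fl P σ X M) : ∀ m ∈ M, IsThread m := by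
  induction h with
  | inact => simp
  | par _ _ ih1 ih2 => grind
  | res _ ih => exact ih
  | thread σ h => intro m hm; rw [mem_singleton.mp hm]; exact isThread_subst.mpr h

/-- Partial flattening: as `Fl`, but the items need not be threads. -/
inductive PFl : Proc → (ℕ → Val) → List ℕ → Multiset Proc → Prop
  | inact (σ) : PFl .inact σ [] 0
  | par {P Q σ X Y M N} : PFl P σ X M → PFl Q σ Y N → PFl (.par P Q) σ (X ++ Y) (M + N)
  | res {P σ a X M} : PFl P (cons2 a (co a) σ) X M → PFl (.res P) σ (a :: X) M
  | item (P σ) : PFl P σ [] {P.subst σ}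

theorem Fl.pfl {P : Proc} {σ : ℕ → Val} {X M} (h : Fl P σ X M) : PFl P σ X M := by
  induction h with
  | inact => exact .inact _
  | par _ _ ih1 ih2 => exact .par ih1 ih2
  | res _ ih => exact .res ih
  | thread σ h => exact .item _ _

theorem PFl.occ {P : Proc} {σ : ℕ → Val} {X M} (h : PFl P σ X M) (hX : ∀ a ∈ X, Bnd a) :
    ∀ m ∈ M, ∀ n, m.Occ n → Hit X n ∨ ∃ k, P.Occ k ∧ σ k = .var n := by
  induction h with
  | inact => simp
  | par _ _ ih1 ih2 => intro m hm n hn; simp only [hit_append, Occ]; grind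
  | res _ ih =>
    intro m hm n hn; rw [hit_cons (hX _ (by simp))]
    rcases ih (fun b hb => hX b (by grind)) m hm n hn with h | ⟨k, h1, h2⟩
    · grind
    · match k, h1, h2 with
      | 0, _, h2 => cases h2; grind
      | 1, _, h2 => cases h2; grind
      | k + 2, h1, h2 => exact .inr ⟨k, h1, h2⟩
  | item P σ => intro m hm n hn; rw [mem_singleton.mp hm, occ_subst] at hn; grind

/-- Names free in `P` become names that are not in `X`. -/
def Avoids (P : Proc) (σ : ℕ → Val) (X : List ℕ) : Prop :=
  ∀ k, P.Occ k → ∀ n, σ k = .var n → ¬ Hit X n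

theorem par_nuL_nuL {X Y : List ℕ} (h : Good (X ++ Y)) {p q : Proc} (hp : ∀ n, Hit Y n → ¬ p.Occ n)
    (hq : ∀ n, Hit X n → ¬ q.Occ n) :
    Cong (.par (nuL X p) (nuL Y q)) (nuL (X ++ Y) (.par p q)) := by
  obtain ⟨hX, hY, hXY⟩ := good_append.mp h; rw [nuL_append]
  have h1 : Cong (.par (nuL X p) (nuL Y q)) (nuL X (.par (nuL Y q) p)) :=
    (Cong.parComm _ _).trans (par_nuL hX.2 (fun n hn ho => hq n hn ((occ_nuL hY.2).mp ho).1) p)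
  refine h1.trans (cong_nuL X ((Cong.parComm _ _).trans (par_nuL hY.2 hp q)))

theorem Avoids.cons {P : Proc} {σ : ℕ → Val} {a : ℕ} {X : List ℕ}
    (hσ : Avoids (.res P) σ (a :: X)) (hX : Good (a :: X)) : Avoids P (cons2 a (co a) σ) X := by
  obtain ⟨ha, hX1, hX2⟩ := good_cons.mp hX; intro k hk n hn hh
  match k, hk, hn with
  | 0, _, hn => cases hn; exact hX1 hh.2
  | 1, _, hn => cases hn; exact hX1 (pid_co ha ▸ hh.2)
  | k + 2, hk, hn => exact hσ k hk n hn ((hit_cons ha).mpr (.inr (.inr hh)))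

theorem subst_res_eq_nu {P : Proc} {σ : ℕ → Val} {a : ℕ} {X : List ℕ} (ha : Bnd a)
    (hσ : Avoids (.res P) σ (a :: X)) :
    Proc.subst σ (.res P) = nu a (P.subst (cons2 a (co a) σ)) := by
  change Proc.res _ = Proc.res ((P.subst _).subst _); rw [Proc.subst_subst]
  congr 1
  refine Proc.subst_congr P fun k hk => ?_
  match k, hk with
  | 0, _ => simp [up, scomp, cons2, Val.subst, abs2]
  | 1, _ => simp [up, scomp, cons2, Val.subst, abs2, co_ne ha, ren]
  | k + 2, hk =>
    have := hσ k hk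
    cases hs : σ k with
    | var n =>
      have h1 := this n hs; rw [hit_cons ha] at h1; simp only [not_or] at h1
      simp [up, scomp, cons2, Val.subst, abs2, hs, ren, h1.1, h1.2.1]
    | _ => simp [up, scomp, cons2, Val.subst, hs]

theorem PFl.cong {P : Proc} {σ : ℕ → Val} {X M} (h : PFl P σ X M) (hX : Good X)
    (hσ : Avoids P σ X) : Cong (P.subst σ) (nuL X (parM M)) := by
  induction h with
  | inact => rw [parM_zero]; exact .refl _
  | @par P Q σ X Y M N h1 h2 ih1 ih2 =>
    obtain ⟨hX1, hX2, hX3⟩ := good_append.mp hX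
    have a1 : Avoids P σ X := fun k hk n hn hh => hσ k (.inl hk) n hn (hit_append.mpr (.inl hh))
    have a2 : Avoids Q σ Y := fun k hk n hn hh => hσ k (.inr hk) n hn (hit_append.mpr (.inr hh))
    refine (Cong.par (ih1 hX1 a1) (ih2 hX2 a2)).trans ((par_nuL_nuL hX ?_ ?_).trans
      (cong_nuL _ (Cong.symm (parM_add M N))))
    · intro n hn ho; obtain ⟨m, hm, ho⟩ := occ_parM.mp ho
      rcases h1.occ hX1.2 m hm n ho with h | ⟨k, h3, h4⟩
      · grind
      · exact hσ k (.inl h3) n h4 (hit_append.mpr (.inr hn))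
    · intro n hn ho; obtain ⟨m, hm, ho⟩ := occ_parM.mp ho
      rcases h2.occ hX2.2 m hm n ho with h | ⟨k, h3, h4⟩
      · grind
      · exact hσ k (.inr h3) n h4 (hit_append.mpr (.inl hn))
  | @res P σ a X M h ih =>
    obtain ⟨ha, hX1, hX2⟩ := good_cons.mp hX; rw [subst_res_eq_nu ha hσ]
    exact cong_nu a (ih hX2 (hσ.cons hX))
  | item P σ => exact Cong.symm (parM_singleton (P := Proc) _)

/-- The restrictions `Y` are taken from `X`, or have numbers at least `N`. -/
def Extends (N : ℕ) (X Y : List ℕ) : Prop :=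
  (Good X → Good Y) ∧ ∀ b ∈ Y, pid b ∈ X.map pid ∨ N ≤ pid b

theorem Extends.refl (N : ℕ) (X : List ℕ) : Extends N X X :=
  ⟨id, fun _ hb => .inl (List.mem_map_of_mem hb)⟩

theorem Extends.trans {N : ℕ} {X Y Z : List ℕ} (h : Extends N X Y) (h' : Extends N Y Z) :
    Extends N X Z := by
  refine ⟨h'.1 ∘ h.1, fun b hb => ?_⟩; rcases h'.2 b hb with h1 | h1
  · obtain ⟨c, hc, e⟩ := List.mem_map.mp h1; rw [← e]; exact h.2 c hc
  grind

theorem Extends.of_perm {N : ℕ} {X Y : List ℕ} (h : X.Perm Y) : Extends N X Y :=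
  ⟨fun hX => hX.perm h, fun b hb => .inl (List.mem_map_of_mem (h.mem_iff.mpr hb))⟩

theorem exists_pid_bound (X : List ℕ) : ∃ N, ∀ a ∈ X, pid a < N := by
  induction X with
  | nil => exact ⟨0, by simp⟩
  | cons a X ih => obtain ⟨N, hN⟩ := ih; refine ⟨N + pid a + 1, fun b hb => ?_⟩; grind

theorem Extends.append {X X' Y Y' : List ℕ} {N N1 N2 : ℕ} (h1 : N ≤ N1) (h2 : N ≤ N2)
    (hX : ∀ a ∈ X', pid a < N1) (hY : ∀ a ∈ Y, pid a < N2)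
    (h : Extends N1 X Y) (h' : Extends N2 X' Y') : Extends N (X ++ X') (Y ++ Y') := by
  constructor
  · intro hg; obtain ⟨g1, g2, g3⟩ := good_append.mp hg; refine good_append.mpr ⟨h.1 g1, h'.1 g2, ?_⟩
    rintro n ⟨hn, hY1⟩ ⟨-, hY2⟩; obtain ⟨b, hb, e⟩ := List.mem_map.mp hY1
    obtain ⟨b', hb', e'⟩ := List.mem_map.mp hY2; rcases h'.2 b' hb' with i' | i'
    · rcases h.2 b hb with i | i
      · exact g3 n ⟨hn, e ▸ i⟩ ⟨hn, e' ▸ i'⟩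
      grind
    grind
  · intro b hb; rw [List.map_append, List.mem_append]; rcases List.mem_append.mp hb with hb | hb
    · rcases h.2 b hb with i | i <;> grind
    · rcases h'.2 b hb with i | i <;> grind

theorem Extends.cons {a N N' : ℕ} {X Y : List ℕ} (h : Extends N' X Y) (hN : N ≤ N')
    (ha : pid a < N') : Extends N (a :: X) (a :: Y) := by
  constructor
  · intro hg; obtain ⟨g1, g2, g3⟩ := good_cons.mp hg
    refine good_cons.mpr ⟨g1, fun hm => ?_, h.1 g3⟩; obtain ⟨b, hb, e⟩ := List.mem_map.mp hm
    rcases h.2 b hb with i | i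
    · grind
    · omega
  · intro b hb; rcases List.mem_cons.mp hb with rfl | hb
    · simp
    · rcases h.2 b hb with i | i <;> grind

/-- The threads of `P` are those of `Q` up to the congruence of threads. -/
def FlTo (P Q : Proc) : Prop := ∀ σ X M, Fl P σ X M → Good X → ∀ N, ∃ Y M', Fl Q σ Y M' ∧
  Rel TC M M' ∧ Extends N X Y

theorem Fl.relTC {P : Proc} {σ : ℕ → Val} {X M} (h : Fl P σ X M) : Rel TC M M :=
  Multiset.rel_refl_of_refl_on fun m hm => .refl (h.isThread m hm)

instance : IsTrans Proc TC := ⟨fun _ _ _ => TC.trans⟩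

theorem FlTo.refl (P : Proc) : FlTo P P := fun _ X _ h _ N => ⟨X, _, h, h.relTC, .refl N X⟩

theorem FlTo.trans {P Q R : Proc} (h : FlTo P Q) (h' : FlTo Q R) : FlTo P R := by
  intro σ X M hP hX N; obtain ⟨Y, M1, h1, h2, h3⟩ := h σ X M hP hX N
  obtain ⟨Z, M2, h4, h5, h6⟩ := h' σ Y M1 h1 (h3.1 hX) N
  exact ⟨Z, M2, h4, h2.trans TC h5, h3.trans h6⟩

theorem FlTo.par {P P' Q Q' : Proc} (h : FlTo P P') (h' : FlTo Q Q') :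
    FlTo (.par P Q) (.par P' Q') := by
  intro σ X M hP hX N; obtain ⟨X1, X2, M1, M2, rfl, rfl, hP1, hP2⟩ := Fl.par_iff.mp hP
  obtain ⟨g1, g2, -⟩ := good_append.mp hX; obtain ⟨N1, hN1⟩ := exists_pid_bound X2
  obtain ⟨Y1, M1', f1, r1, e1⟩ := h σ X1 M1 hP1 g1 (N + N1); obtain ⟨N2, hN2⟩ := exists_pid_bound Y1
  obtain ⟨Y2, M2', f2, r2, e2⟩ := h' σ X2 M2 hP2 g2 (N + N2)
  refine ⟨_, _, .par f1 f2, Rel.add r1 r2, ?_⟩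
  refine Extends.append (N1 := N + N1) (N2 := N + N2) (by omega) (by omega) (fun a ha => ?_)
    (fun a ha => ?_) e1 e2
  · grind
  grind

theorem FlTo.res {P P' : Proc} (h : FlTo P P') : FlTo (.res P) (.res P') := by
  intro σ X M hP hX N; obtain ⟨a, X', rfl, hP'⟩ := Fl.res_iff.mp hP
  obtain ⟨Y, M', f, r, e⟩ := h _ _ _ hP' (good_cons.mp hX).2.2 (N + pid a + 1)
  exact ⟨_, _, .res f, r, e.cons (by omega) (by omega)⟩

theorem FlTo.of_tc {P Q : Proc} (hP : IsThread P) (hQ : IsThread Q)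
    (h : ∀ σ, TC (P.subst σ) (Q.subst σ)) : FlTo P Q := by
  intro σ X M hf _ N; obtain ⟨rfl, rfl⟩ := (Fl.thread_iff hP).mp hf
  exact ⟨_, _, .thread _ hQ, Rel.cons (h σ) .zero, .refl _ _⟩

theorem FlTo.of_perm {P Q : Proc} (h : ∀ σ X M, Fl P σ X M → ∃ Y, X.Perm Y ∧ Fl Q σ Y M) :
    FlTo P Q := by
  intro σ X M hf _ N; obtain ⟨Y, hp, hf'⟩ := h σ X M hf; exact ⟨Y, M, hf', hf.relTC, .of_perm hp⟩

theorem Fl.res_res {P : Proc} {σ : ℕ → Val} {X M} (h : Fl (.res (.res P)) σ X M) :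
    ∃ Y, X.Perm Y ∧ Fl (.res (.res (P.subst (ren Mix.exchange)))) σ Y M := by
  obtain ⟨a, X, rfl, h1⟩ := Fl.res_iff.mp h; obtain ⟨b, X, rfl, h2⟩ := Fl.res_iff.mp h1
  refine ⟨b :: a :: X, .swap _ _ _, .res (.res (Fl.subst_iff.mpr ?_))⟩; convert h2 using 1; funext n
  match n with
  | 0 => rfl
  | 1 => rfl
  | 2 => rfl
  | 3 => rfl
  | n + 4 => simp [scomp, ren, Mix.exchange, Val.subst, cons2]

theorem FlTo.res_swap (P : Proc) : FlTo (.res P) (.res (P.subst (ren swap01))) := by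
  intro σ X M h hX N; obtain ⟨a, X', rfl, h'⟩ := Fl.res_iff.mp h
  obtain ⟨ha, h1, h2⟩ := good_cons.mp hX
  refine ⟨co a :: X', M, .res (Fl.subst_iff.mpr ?_), h.relTC, fun _ => ?_, fun b hb => ?_⟩
  · convert h' using 1; funext n
    match n with
    | 0 => simp [scomp, ren, swap01, Val.subst, cons2, co_co ha]
    | 1 => rfl
    | n + 2 => rfl
  · exact good_cons.mpr ⟨bnd_co ha, by rwa [pid_co ha], h2⟩
  · rcases List.mem_cons.mp hb with rfl | hb
    · rw [pid_co ha]; simp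
    grind

theorem Cong.flTo {P Q : Proc} (h : Cong P Q) : FlTo P Q ∧ FlTo Q P := by
  induction h with
  | refl P => exact ⟨.refl P, .refl P⟩
  | symm _ ih => grind
  | trans _ _ ih1 ih2 => exact ⟨ih1.1.trans ih2.1, ih2.2.trans ih1.2⟩
  | par _ _ ih1 ih2 => exact ⟨ih1.1.par ih2.1, ih1.2.par ih2.2⟩
  | res _ ih => exact ⟨ih.1.res, ih.2.res⟩
  | out h => exact ⟨.of_tc trivial trivial fun σ => .out (h.subst σ),
      .of_tc trivial trivial fun σ => .out (h.symm.subst σ)⟩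
  | inp h => exact ⟨.of_tc trivial trivial fun σ => .inp (h.subst _),
      .of_tc trivial trivial fun σ => .inp (h.symm.subst _)⟩
  | sel h => exact ⟨.of_tc trivial trivial fun σ => .sel (h.subst σ),
      .of_tc trivial trivial fun σ => .sel (h.symm.subst σ)⟩
  | bran h => exact ⟨.of_tc trivial trivial fun σ => .bran fun l => (h l).subst σ,
      .of_tc trivial trivial fun σ => .bran fun l => (h l).symm.subst σ⟩
  | ite h h' => exact ⟨.of_tc trivial trivial fun σ => .ite (h.subst σ) (h'.subst σ),
      .of_tc trivial trivial fun σ => .ite (h.symm.subst σ) (h'.symm.subst σ)⟩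
  | resInact =>
    constructor
    · intro σ X M h _ N; obtain ⟨a, X, rfl, h'⟩ := Fl.res_iff.mp h
      obtain ⟨rfl, rfl⟩ := Fl.inact_iff.mp h'
      exact ⟨[], 0, .inact _, .zero, fun _ => good_nil, by simp⟩
    · intro σ X M h _ N; obtain ⟨rfl, rfl⟩ := Fl.inact_iff.mp h
      obtain ⟨a, ha, hN⟩ := exists_fresh N
      refine ⟨[a], 0, .res (.inact _), .zero, fun _ => ?_, by grind⟩
      exact good_cons.mpr ⟨ha, by simp, good_nil⟩
  | resRes P =>
    refine ⟨.of_perm fun σ X M h => h.res_res, .of_perm fun σ X M h => ?_⟩; have := h.res_res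
    rw [Proc.subst_subst] at this
    have e : scomp (ren Mix.exchange) (ren fun n => if n < 2 then n + 2 else if n < 4 then n - 2
        else n) = Val.var := by
      funext n; exact congrArg Val.var (Mix.exchange_involutive n)
    rwa [e, Proc.subst_var] at this
  | resPar P Q =>
    refine ⟨.of_perm fun σ X M h => ?_, .of_perm fun σ X M h => ?_⟩
    · obtain ⟨X, Y, M, N, rfl, rfl, h1, h2⟩ := Fl.par_iff.mp h
      obtain ⟨a, Y, rfl, h3⟩ := Fl.res_iff.mp h2
      refine ⟨a :: (X ++ Y), List.perm_middle, .res (.par (Fl.subst_iff.mpr ?_) h3)⟩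
      rwa [scomp_cons2_wk]
    · obtain ⟨a, X, rfl, h'⟩ := Fl.res_iff.mp h
      obtain ⟨X, Y, M, N, rfl, rfl, h1, h2⟩ := Fl.par_iff.mp h'
      rw [Fl.subst_iff, scomp_cons2_wk] at h1
      exact ⟨X ++ a :: Y, List.perm_middle.symm, .par h1 (.res h2)⟩
  | resSwap P =>
    refine ⟨.res_swap P, ?_⟩; have := FlTo.res_swap (P.subst (ren swap01))
    rw [Proc.subst_subst] at this
    have e : scomp (ren swap01) (ren swap01) = Val.var := by
      funext n; exact congrArg Val.var (Mix.swap01_involutive n)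
    rwa [e, Proc.subst_var] at this
  | parInact P =>
    refine ⟨.of_perm fun σ X M h => ?_, .of_perm fun σ X M h => ?_⟩
    · obtain ⟨X, Y, M, N, rfl, rfl, h1, h2⟩ := Fl.par_iff.mp h
      obtain ⟨rfl, rfl⟩ := Fl.inact_iff.mp h2; grind
    · exact ⟨X ++ [], by simp, by simpa using Fl.par h (.inact σ)⟩
  | parComm P Q =>
    refine ⟨.of_perm fun σ X M h => ?_, .of_perm fun σ X M h => ?_⟩ <;>
    · obtain ⟨X, Y, M, N, rfl, rfl, h1, h2⟩ := Fl.par_iff.mp h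
      exact ⟨Y ++ X, List.perm_append_comm, add_comm M N ▸ .par h2 h1⟩
  | parAssoc P Q R =>
    refine ⟨.of_perm fun σ X M h => ?_, .of_perm fun σ X M h => ?_⟩
    · obtain ⟨X, Y, M, N, rfl, rfl, h1, h2⟩ := Fl.par_iff.mp h
      obtain ⟨Y, Z, N, O, rfl, rfl, h2, h3⟩ := Fl.par_iff.mp h2
      exact ⟨X ++ Y ++ Z, by simp, add_assoc M N O ▸ .par (.par h1 h2) h3⟩
    · obtain ⟨X, Y, M, N, rfl, rfl, h1, h2⟩ := Fl.par_iff.mp h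
      obtain ⟨X, Z, M, O, rfl, rfl, h1, h3⟩ := Fl.par_iff.mp h1
      exact ⟨X ++ (Z ++ Y), by simp, (add_assoc M O N).symm ▸ .par h1 (.par h3 h2)⟩

end CMV

/-! ## Steps of configurations -/

namespace CMV

open Proc Calculus

/-- Steps of a multiset of processes whose names are those of configurations. -/
inductive Pre : Multiset Proc → Multiset Proc → Prop
  | iteTrue (P Q R) : Pre (.ite .tt P Q ::ₘ R) (P ::ₘ R)
  | iteFalse (P Q R) : Pre (.ite .ff P Q ::ₘ R) (Q ::ₘ R)
  | com {a} (q v P Q R) : Bnd a → Pre (.out (.var a) v P ::ₘ .inp q (.var (co a)) Q ::ₘ R)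
      (P ::ₘ persist q (.inp q (.var (co a)) Q) (Q.subst (inst v)) ::ₘ R)
  | case {a} (P) {L} (Q R) (l : {l // l ∈ L}) : Bnd a →
      Pre (.sel (.var a) l.1 P ::ₘ .bran (.var (co a)) L Q ::ₘ R) (P ::ₘ Q l ::ₘ R)

theorem Pre.add {M N : Multiset Proc} (h : Pre M N) (R : Multiset Proc) : Pre (M + R) (N + R) := by
  cases h with
  | iteTrue P Q S => simp only [cons_add]; exact .iteTrue _ _ _
  | iteFalse P Q S => simp only [cons_add]; exact .iteFalse _ _ _
  | com q v P Q S h => simp only [cons_add]; exact .com _ _ _ _ _ h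
  | case P Q S l h => simp only [cons_add]; exact .case _ _ _ l h

theorem occ_persist {q : Qual} {P Q : Proc} {n : ℕ} (h : (persist q P Q).Occ n) :
    Q.Occ n ∨ P.Occ n := by
  cases q with
  | lin => exact .inl h
  | un => exact h

theorem occ_inst {P : Proc} {v : Val} {n : ℕ} (h : (P.subst (inst v)).Occ n) :
    P.Occ (n + 1) ∨ v = .var n := by
  rw [occ_subst] at h; obtain ⟨k, h1, h2⟩ := h
  cases k with
  | zero => exact .inr h2
  | succ k => cases h2; grind

theorem Pre.occ {M N : Multiset Proc} (h : Pre M N) {n : ℕ} (hn : ∃ p ∈ N, p.Occ n) :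
    ∃ p ∈ M, p.Occ n := by
  cases h with
  | iteTrue P Q R => simp only [mem_cons, exists_eq_or_imp, Occ] at hn ⊢; tauto
  | iteFalse P Q R => simp only [mem_cons, exists_eq_or_imp, Occ] at hn ⊢; tauto
  | com q v P Q R _ =>
    simp only [mem_cons, exists_eq_or_imp, Occ] at hn ⊢; rcases hn with h | h | h
    · grind
    · rcases occ_persist h with h | h
      · rcases occ_inst h with h | h <;> grind
      · exact .inr (.inl h)
    grind
  | case P Q R l _ => simp only [mem_cons, exists_eq_or_imp, Occ] at hn ⊢; grind

theorem cong_persist {q : Qual} {P P' Q Q' : Proc} (h : Cong P P') (h' : Cong Q Q') :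
    Cong (persist q P Q) (persist q P' Q') := by
  cases q with
  | lin => exact h'
  | un => exact .par h' h

theorem Pre.tc {M M' N' : Multiset Proc} (h : Rel TC M M') (hp : Pre M' N') :
    ∃ N, Pre M N ∧ Rel Cong N N' := by
  have hrel : ∀ {R R'}, Rel TC R R' → Rel Cong R R' :=
    fun h => h.mono fun _ _ _ _ h => h.cong
  cases hp with
  | iteTrue P Q R =>
    obtain ⟨m, R0, h1, h2, rfl⟩ := rel_cons_right.mp h; have .ite h3 h4 := h1
    exact ⟨_, .iteTrue _ _ _, .cons h3 (hrel h2)⟩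
  | iteFalse P Q R =>
    obtain ⟨m, R0, h1, h2, rfl⟩ := rel_cons_right.mp h; have .ite h3 h4 := h1
    exact ⟨_, .iteFalse _ _ _, .cons h4 (hrel h2)⟩
  | com q v P Q R ha =>
    obtain ⟨m, R0, h1, h2, rfl⟩ := rel_cons_right.mp h
    obtain ⟨m', R1, h3, h4, rfl⟩ := rel_cons_right.mp h2
    cases h1 with
    | out h5 =>
      cases h3 with
      | inp h6 =>
        exact ⟨_, .com _ _ _ _ _ ha, .cons h5 (.cons (cong_persist (.inp h6) (h6.subst _))
          (hrel h4))⟩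
  | case P Q R l ha =>
    obtain ⟨m, R0, h1, h2, rfl⟩ := rel_cons_right.mp h
    obtain ⟨m', R1, h3, h4, rfl⟩ := rel_cons_right.mp h2
    cases h1 with
    | sel h5 =>
      cases h3 with
      | bran h6 => exact ⟨_, .case _ _ _ l ha, .cons h5 (.cons (h6 l) (hrel h4))⟩

theorem Red.occ {P Q : Proc} (h : Red P Q) {n : ℕ} (hn : Q.Occ n) : P.Occ n := by
  induction h generalizing n with
  | iteTrue P Q => exact .inr (.inl hn)
  | iteFalse P Q => exact .inr (.inr hn)
  | com q v P Q R =>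
    simp only [Occ] at hn ⊢; rcases hn with h | h | h
    · grind
    · rcases occ_persist h with h | h
      · rcases occ_inst h with h | h <;> grind
      · exact .inr (.inl h)
    grind
  | case P R l => simp only [Occ] at hn ⊢; grind
  | par Q _ ih => exact hn.imp ih id
  | res _ ih => exact ih hn
  | struct h1 _ h3 ih => exact (h1.occ n).mpr (ih ((h3.occ n).mpr hn))

theorem Avoids.mono {P Q : Proc} {σ : ℕ → Val} {X : List ℕ} (h : Avoids P σ X)
    (hPQ : ∀ n, Q.Occ n → P.Occ n) : Avoids Q σ X := fun k hk => h k (hPQ k hk)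

theorem exists_image_bound (P : Proc) (σ : ℕ → Val) :
    ∃ N, ∀ k, P.Occ k → ∀ n, σ k = .var n → pid n < N := by
  obtain ⟨N, hN⟩ := occ_bounded (P.subst σ); refine ⟨N, fun k hk n hn => ?_⟩
  have := hN n ((occ_subst P).mpr ⟨k, hk, hn⟩); unfold pid; omega

theorem Extends.avoids {P : Proc} {σ : ℕ → Val} {X Y : List ℕ} {N : ℕ} (h : Extends N X Y)
    (hP : Avoids P σ X) (hN : ∀ k, P.Occ k → ∀ n, σ k = .var n → pid n < N) : Avoids P σ Y := by
  rintro k hk n hn ⟨h1, h2⟩; obtain ⟨b, hb, e⟩ := List.mem_map.mp h2; rcases h.2 b hb with i | i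
  · exact hP k hk n hn ⟨h1, e ▸ i⟩
  grind

/-- A reduction of a process is a step of its threads. -/
theorem Red.flat {P P' : Proc} (h : Red P P') : ∀ {σ X M}, Fl P σ X M → Good X → Avoids P σ X →
    ∃ N, Pre M N ∧ Cong (P'.subst σ) (nuL X (parM N)) := by
  induction h with
  | iteTrue P Q =>
    intro σ X M hf _ _; obtain ⟨rfl, rfl⟩ := (Fl.thread_iff (by exact trivial)).mp hf
    exact ⟨_, .iteTrue _ _ 0, .symm (parM_singleton (P := Proc) _)⟩
  | iteFalse P Q =>
    intro σ X M hf _ _; obtain ⟨rfl, rfl⟩ := (Fl.thread_iff (by exact trivial)).mp hf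
    exact ⟨_, .iteFalse _ _ 0, .symm (parM_singleton (P := Proc) _)⟩
  | com q v P Q R =>
    intro σ X M hf hX hσ; obtain ⟨a, X, rfl, h1⟩ := Fl.res_iff.mp hf
    obtain ⟨X1, X2, M1, M2, rfl, rfl, h2, h3⟩ := Fl.par_iff.mp h1
    obtain ⟨X3, X4, M3, M4, rfl, rfl, h4, h5⟩ := Fl.par_iff.mp h3
    obtain ⟨rfl, rfl⟩ := (Fl.thread_iff (by exact trivial)).mp h2
    obtain ⟨rfl, rfl⟩ := (Fl.thread_iff (by exact trivial)).mp h4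
    refine ⟨_, .com q _ _ _ M4 (good_cons.mp hX).1, ?_⟩
    refine PFl.cong ?_ hX (hσ.mono fun n hn => (Red.com q v P Q R).occ hn)
    have := PFl.par (PFl.item P (cons2 a (co a) σ)) (PFl.par (PFl.item
      (persist q (.inp q (.var 1) Q) (Q.subst (inst v))) (cons2 a (co a) σ)) h5.pfl)
    rw [persist_subst, subst_inst] at this; exact .res this
  | case P R l =>
    intro σ X M hf hX hσ; obtain ⟨a, X, rfl, h1⟩ := Fl.res_iff.mp hf
    obtain ⟨X1, X2, M1, M2, rfl, rfl, h2, h3⟩ := Fl.par_iff.mp h1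
    obtain ⟨X3, X4, M3, M4, rfl, rfl, h4, h5⟩ := Fl.par_iff.mp h3
    obtain ⟨rfl, rfl⟩ := (Fl.thread_iff (by exact trivial)).mp h2
    obtain ⟨rfl, rfl⟩ := (Fl.thread_iff (by exact trivial)).mp h4
    refine ⟨_, .case _ _ M4 l (good_cons.mp hX).1, ?_⟩
    refine PFl.cong ?_ hX (hσ.mono fun n hn => (Red.case P R l).occ hn)
    exact .res (PFl.par (PFl.item _ _) (PFl.par (PFl.item _ _) h5.pfl))
  | @par P P' Q hr ih =>
    intro σ X M hf hX hσ; obtain ⟨X1, X2, M1, M2, rfl, rfl, h1, h2⟩ := Fl.par_iff.mp hf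
    obtain ⟨g1, g2, g3⟩ := good_append.mp hX
    have a1 : Avoids P σ X1 := fun k hk n hn hh => hσ k (.inl hk) n hn (hit_append.mpr (.inl hh))
    have a2 : Avoids Q σ X2 := fun k hk n hn hh => hσ k (.inr hk) n hn (hit_append.mpr (.inr hh))
    obtain ⟨N, hp, hc⟩ := ih h1 g1 a1; refine ⟨N + M2, hp.add M2, ?_⟩
    refine (Cong.par hc (h2.pfl.cong g2 a2)).trans ((par_nuL_nuL hX ?_ ?_).trans
      (cong_nuL _ (Cong.symm (parM_add N M2))))
    · intro n hn ho; obtain ⟨m, hm, ho⟩ := hp.occ (occ_parM.mp ho)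
      rcases h1.pfl.occ g1.2 m hm n ho with h | ⟨k, h3, h4⟩
      · grind
      · exact hσ k (.inl h3) n h4 (hit_append.mpr (.inr hn))
    · intro n hn ho; obtain ⟨m, hm, ho⟩ := occ_parM.mp ho
      rcases h2.pfl.occ g2.2 m hm n ho with h | ⟨k, h3, h4⟩
      · grind
      · exact hσ k (.inr h3) n h4 (hit_append.mpr (.inl hn))
  | @res P P' hr ih =>
    intro σ X M hf hX hσ; obtain ⟨a, X, rfl, h1⟩ := Fl.res_iff.mp hf
    obtain ⟨ha, g1, g2⟩ := good_cons.mp hX; obtain ⟨N, hp, hc⟩ := ih h1 g2 (hσ.cons hX)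
    refine ⟨N, hp, ?_⟩; rw [subst_res_eq_nu ha (hσ.mono fun n hn => hr.occ (n := n + 2) hn)]
    exact cong_nu a hc
  | @struct P Q Q' P' h1 hr h2 ih =>
    intro σ X M hf hX hσ; obtain ⟨B, hB⟩ := exists_image_bound P σ
    obtain ⟨Y, M', f, r, e⟩ := h1.flTo.1 σ X M hf hX B; have hY := e.1 hX; have aY := e.avoids hσ hB
    obtain ⟨N', hp, hc⟩ := ih f hY (aY.mono fun n hn => (h1.occ n).mpr hn)
    obtain ⟨N, hp', hr'⟩ := hp.tc r
    refine ⟨N, hp', (h2.symm.subst σ).trans (hc.trans ((cong_nuL Y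
      (Cong.symm (parM_rel hr'))).trans (nuL_eq hY hX fun n hn => ?_)))⟩
    constructor
    · intro hn1; by_contra hn2; obtain ⟨m, hm, ho⟩ := hp'.occ (occ_parM.mp hn)
      have := ((hf.pfl.cong hX hσ).occ n).mpr
        ((occ_nuL hX.2).mpr ⟨occ_parM.mpr ⟨m, hm, ho⟩, hn2⟩)
      obtain ⟨k, hk, hs⟩ := (occ_subst P).mp this; exact aY k hk n hs hn1
    · intro hn1; by_contra hn2
      have := ((hc.trans (cong_nuL Y (Cong.symm (parM_rel hr')))).occ n).mpr
        ((occ_nuL hY.2).mpr ⟨hn, hn2⟩)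
      obtain ⟨k, hk, hs⟩ := (occ_subst Q').mp this; exact hσ k ((h1.occ k).mpr (hr.occ hk)) n hs hn1

/-! ## Configurations -/

theorem Fl.parL {l : List Proc} (h : ∀ m ∈ l, IsThread m) : Fl (parL l) Val.var [] (l : Multiset Proc) := by
  induction l with
  | nil => exact .inact _
  | cons p l ih =>
    have h1 := Fl.thread Val.var (h p (by simp)); rw [Proc.subst_var] at h1
    exact Fl.par h1 (ih fun m hm => h m (by grind))

theorem Fl.nuL {p : Proc} {M : Multiset Proc} (h : Fl p Val.var [] M) (X : List ℕ) :
    Fl (nuL X p) Val.var X M := by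
  induction X with
  | nil => exact h
  | cons a X ih => refine .res (Fl.subst_iff.mpr ?_); rw [scomp_cons2_abs2]; exact ih

/-- The process `T`, with its free names renamed, consists of the processes `M` below the
restrictions `Z`. -/
def Conf (T : Proc) (Z : List ℕ) (M : Multiset Proc) : Prop :=
  Good Z ∧ Cong (T.subst (ren (3 * ·))) (nuL Z (parM M))

theorem Conf.hit {T : Proc} {Z M} (h : Conf T Z M) {m : Proc} (hm : m ∈ M) {n : ℕ} (hn : m.Occ n)
    (hb : Bnd n) : Hit Z n := by
  by_contra hh; have := (h.2.occ n).mpr ((occ_nuL h.1.2).mpr ⟨occ_parM.mpr ⟨m, hm, hn⟩, hh⟩)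
  obtain ⟨k, -, rfl⟩ := occ_ren.mp this; exact hb (by omega)

theorem Conf.congM {T : Proc} {Z M N} (h : Conf T Z M) (hc : Cong (parM M) (parM N)) : Conf T Z N :=
  ⟨h.1, h.2.trans (cong_nuL Z hc)⟩

theorem Conf.relist {T : Proc} {Z Z' M} (h : Conf T Z M) (hZ : Good Z')
    (hh : ∀ m ∈ M, ∀ n, m.Occ n → Hit Z n → Hit Z' n) : Conf T Z' M := by
  refine ⟨hZ, h.2.trans (nuL_eq h.1 hZ fun n hn => ?_)⟩; obtain ⟨m, hm, ho⟩ := occ_parM.mp hn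
  exact ⟨hh m hm n ho, fun hz => h.hit hm ho hz.1⟩

theorem cong_parM_cons (p : Proc) (M : Multiset Proc) :
    Cong (parM (p ::ₘ M)) (.par p (parM M)) := parM_cons p M

theorem conf_par {T P Q : Proc} {Z M} :
    Conf T Z (.par P Q ::ₘ M) ↔ Conf T Z (P ::ₘ Q ::ₘ M) :=
  ⟨fun h => h.congM (parM_par P Q M), fun h => h.congM (Cong.symm (parM_par P Q M))⟩

theorem conf_inact {T : Proc} {Z M} : Conf T Z (.inact ::ₘ M) ↔ Conf T Z M :=
  ⟨fun h => h.congM (parM_inact (P := Proc) M),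
    fun h => h.congM (Cong.symm (parM_inact (P := Proc) M))⟩

/-- The body of a restriction with the endpoints `a` and `co a` for the restricted names. -/
def openWith (a : ℕ) (P : Proc) : Proc := P.subst (cons2 a (co a) Val.var)

theorem nu_openWith {a : ℕ} (ha : Bnd a) {P : Proc} (h1 : ¬ Occ a (.res P))
    (h2 : ¬ Occ (co a) (.res P)) : nu a (openWith a P) = .res P := by
  have h : Avoids (.res P) Val.var [a] := by
    intro k hk n hn hh; cases hn; rcases (hit_cons ha).mp hh with rfl | rfl | h
    · grind
    · grind
    · exact not_hit_nil h
  have := subst_res_eq_nu ha h; rw [Proc.subst_var] at this; exact this.symm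

theorem nu_parM_openWith {a : ℕ} (ha : Bnd a) {P : Proc} {M : Multiset Proc}
    (h1 : ∀ m ∈ .res P ::ₘ M, ¬ m.Occ a) (h2 : ∀ m ∈ .res P ::ₘ M, ¬ m.Occ (co a)) :
    Cong (parM (.res P ::ₘ M)) (nu a (parM (openWith a P ::ₘ M))) := by
  have hf : Fresh a (parM M) := fresh_of_not_occ
    (fun ho => by obtain ⟨m, hm, ho⟩ := occ_parM.mp ho; grind)
    (fun ho => by obtain ⟨m, hm, ho⟩ := occ_parM.mp ho; grind)
  have h3 : Cong (parM (.res P ::ₘ M)) (.par (parM M) (nu a (openWith a P))) := by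
    rw [nu_openWith ha (h1 _ (by simp)) (h2 _ (by simp))]
    exact Cong.trans (cong_parM_cons _ _) (.parComm _ _)
  refine h3.trans (Cong.trans (par_nu hf _) (cong_nu a (.trans (.parComm _ _)
    (.symm (cong_parM_cons _ _)))))

theorem Conf.open {T P : Proc} {Z M} (h : Conf T Z (.res P ::ₘ M)) {a : ℕ} (ha : Bnd a)
    (hZ : ¬ Hit Z a) : Conf T (a :: Z) (openWith a P ::ₘ M) := by
  have hg : Good (a :: Z) := good_cons.mpr ⟨ha, fun hm => hZ ⟨ha, hm⟩, h.1⟩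
  have hp : Good (Z ++ [a]) := hg.perm (List.perm_append_comm (l₁ := [a]))
  refine ⟨hg, h.2.trans ?_⟩
  refine Cong.trans ?_ (nuL_perm (P := Proc) (List.perm_append_comm (l₁ := Z) (l₂ := [a])) hp _)
  rw [nuL_append]
  refine cong_nuL Z (nu_parM_openWith ha (fun m hm ho => hZ (h.hit hm ho ha)) fun m hm ho => ?_)
  have := h.hit hm ho (bnd_co ha); rw [hit_co_iff ha] at this; grind

theorem Conf.close {T P : Proc} {Z M} {a : ℕ} (h : Conf T Z (openWith a P ::ₘ M)) (ha : Bnd a)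
    (h1 : ∀ m ∈ .res P ::ₘ M, ¬ m.Occ a) (h2 : ∀ m ∈ .res P ::ₘ M, ¬ m.Occ (co a)) :
    Conf T Z (.res P ::ₘ M) := by
  have hg : Good (Z.filter (fun b => pid b ≠ pid a) ++ [a]) := by
    refine good_append.mpr ⟨⟨?_, fun b hb => h.1.2 b (List.mem_filter.mp hb).1⟩,
      good_cons.mpr ⟨ha, by simp, good_nil⟩, ?_⟩
    · exact h.1.1.sublist (List.filter_sublist.map pid)
    · rintro n ⟨hn, hm⟩ ⟨-, hm'⟩; grind
  have h3 : Conf T (Z.filter (fun b => pid b ≠ pid a) ++ [a]) (openWith a P ::ₘ M) := by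
    refine h.relist hg fun m _ n _ hz => ⟨hz.1, ?_⟩; obtain ⟨b, hb, e⟩ := List.mem_map.mp hz.2
    grind
  have h4 : Conf T (Z.filter (fun b => pid b ≠ pid a)) (.res P ::ₘ M) := by
    refine ⟨(good_append.mp hg).1, h3.2.trans ?_⟩; rw [nuL_append]
    exact cong_nuL _ (nu_parM_openWith ha h1 h2).symm
  refine h4.relist h.1 fun m _ n _ hz => ⟨hz.1, ?_⟩; obtain ⟨b, hb, e⟩ := List.mem_map.mp hz.2
  grind

/-- Reductions of a process are steps of its configurations. -/
theorem Conf.red {T T' : Proc} {Z M} (h : Conf T Z M) (hM : ∀ m ∈ M, IsThread m) (hr : Red T T') :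
    ∃ N, Pre M N ∧ Conf T' Z N := by
  have h1 : Red (nuL Z (parM M)) (T'.subst (ren (3 * ·))) :=
    .struct h.2.symm (hr.subst _) (.refl _)
  have h2 : Fl (nuL Z (parM M)) Val.var Z M := by
    have := Fl.parL (l := M.toList) fun m hm => hM m (by simpa using hm); rw [coe_toList] at this
    exact this.nuL Z
  obtain ⟨N, hp, hc⟩ := h1.flat h2 h.1 fun k hk n hn hh => by
    cases hn; exact ((occ_nuL h.1.2).mp hk).2 hh
  rw [Proc.subst_var] at hc; exact ⟨N, hp, h.1, hc⟩

theorem Red.nuL (X : List ℕ) {p q : Proc} (h : Red p q) : Red (nuL X p) (nuL X q) := by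
  induction X with
  | nil => exact h
  | cons a X ih => exact .res (ih.subst _)

theorem parM_cons_cons (p q : Proc) (M : Multiset Proc) :
    Cong (parM (p ::ₘ q ::ₘ M)) (.par p (.par q (parM M))) :=
  Cong.trans (cong_parM_cons _ _) (.par (.refl _) (cong_parM_cons _ _))

theorem Pre.red {Z : List ℕ} (hZ : Good Z) {M N : Multiset Proc} (h : Pre M N)
    (hM : ∀ m ∈ M, ∀ n, m.Occ n → Bnd n → Hit Z n) : Red (nuL Z (parM M)) (nuL Z (parM N)) := by
  cases h with
  | iteTrue P Q R =>
    exact .nuL Z (.struct (cong_parM_cons _ _) (.par _ (.iteTrue _ _)) (.symm (cong_parM_cons _ _)))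
  | iteFalse P Q R =>
    exact .nuL Z (.struct (cong_parM_cons _ _) (.par _ (.iteFalse _ _)) (.symm (cong_parM_cons _ _)))
  | @com a q v P Q R ha =>
    obtain ⟨Y, hY⟩ := nuL_last (P := Proc) hZ (hM _ (mem_cons_self _ _) a (Or.inl rfl) ha)
    refine .struct (Cong.trans (hY _) (cong_nuL Y (cong_nu a (parM_cons_cons _ _ _)))) ?_
      (.symm (Cong.trans (hY _) (cong_nuL Y (cong_nu a (parM_cons_cons _ _ _)))))
    refine .nuL Y ?_
    have := Red.com q (v.subst (abs2 a (co a))) (P.subst (abs2 a (co a)))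
      (Q.subst (up (abs2 a (co a)))) ((parM R).subst (abs2 a (co a)))
    rw [← subst_inst] at this
    have h0 : Val.subst (abs2 a (co a)) (.var a) = .var 0 := by simp [Val.subst, abs2]
    have h1 : Val.subst (abs2 a (co a)) (.var (co a)) = .var 1 := by
      simp [Val.subst, abs2, co_ne ha]
    simp only [nu, Calculus.res, Calculus.subst, Proc.subst, persist_subst, h0, h1]; grind
  | @case a P L Q R l ha =>
    obtain ⟨Y, hY⟩ := nuL_last (P := Proc) hZ (hM _ (mem_cons_self _ _) a (Or.inl rfl) ha)
    refine .struct (Cong.trans (hY _) (cong_nuL Y (cong_nu a (parM_cons_cons _ _ _)))) ?_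
      (.symm (Cong.trans (hY _) (cong_nuL Y (cong_nu a (parM_cons_cons _ _ _)))))
    refine .nuL Y ?_
    have := Red.case (P.subst (abs2 a (co a))) (Q := fun l => (Q l).subst (abs2 a (co a)))
      ((parM R).subst (abs2 a (co a))) l
    have h0 : Val.subst (abs2 a (co a)) (.var a) = .var 0 := by simp [Val.subst, abs2]
    have h1 : Val.subst (abs2 a (co a)) (.var (co a)) = .var 1 := by
      simp [Val.subst, abs2, co_ne ha]
    simp only [nu, Calculus.res, Calculus.subst, Proc.subst, h0, h1]; grind

/-- Steps of configurations are reductions. -/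
theorem Conf.step {T : Proc} {Z M N} (h : Conf T Z M) (hp : Pre M N) :
    ∃ T', Red T T' ∧ Conf T' Z N := by
  have h1 : Red (T.subst (ren (3 * ·))) (Calculus.nuL Z (parM N)) :=
    .struct h.2 (hp.red h.1 fun m hm n hn hb => h.hit hm hn hb) (.refl _)
  refine ⟨(Calculus.nuL Z (parM N) : Proc).subst (ren (· / 3)), ?_, h.1, ?_⟩
  · have := h1.subst (ren (· / 3))
    rw [Proc.subst_subst, Proc.subst_congr (τ := Val.var), Proc.subst_var] at this
    · grind
    · intro n _; simp [scomp, ren, Val.subst]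
  · rw [Proc.subst_subst, Proc.subst_congr (τ := Val.var), Proc.subst_var]
    · exact .refl _
    · intro n hn; obtain ⟨k, -, rfl⟩ := occ_ren.mp (h1.occ hn); simp [scomp, ren, Val.subst]

/-! ## Barbs of configurations -/

theorem barb_out {x v : Val} {P : Proc} {m : ℕ} : Barb (.out x v P) m ↔ x = .var m :=
  ⟨fun h => by cases h; rfl, fun h => h ▸ .out _ _ _⟩

theorem barb_inp {q : Qual} {x : Val} {P : Proc} {m : ℕ} : Barb (.inp q x P) m ↔ x = .var m :=
  ⟨fun h => by cases h; rfl, fun h => h ▸ .inp _ _ _⟩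

theorem barb_sel {x : Val} {l : Label} {P : Proc} {m : ℕ} : Barb (.sel x l P) m ↔ x = .var m :=
  ⟨fun h => by cases h; rfl, fun h => h ▸ .sel _ _ _⟩

theorem barb_bran {x : Val} {L : Finset Label} {P : {l // l ∈ L} → Proc} {m : ℕ} :
    Barb (.bran x L P) m ↔ x = .var m :=
  ⟨fun h => by cases h; rfl, fun h => h ▸ .bran _ _ _⟩

theorem not_barb_ite {v : Val} {P Q : Proc} {m : ℕ} : ¬ Barb (.ite v P Q) m := fun h => by cases h

theorem not_barb_inact {m : ℕ} : ¬ Barb .inact m := fun h => by cases h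

theorem barb_par {P Q : Proc} {y : ℕ} : Barb (.par P Q) y ↔ Barb P y ∨ Barb Q y := by
  constructor
  · intro h
    cases h with
    | parL _ h => grind
    | parR _ h => grind
  · rintro (h | h)
    · exact .parL _ h
    · exact .parR _ h

theorem barb_res {P : Proc} {y : ℕ} : Barb (.res P) y ↔ Barb P (y + 2) :=
  ⟨fun h => by cases h with | res h => exact h, .res⟩

theorem barb_subst {P : Proc} {σ : ℕ → Val} {m : ℕ} :
    Barb (P.subst σ) m ↔ ∃ n, Barb P n ∧ σ n = .var m := by
  induction P generalizing σ m with
  | out x v P _ => simp only [Proc.subst, barb_out, Val.subst_eq_var]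
  | inp q x P _ => simp only [Proc.subst, barb_inp, Val.subst_eq_var]
  | sel x l P _ => simp only [Proc.subst, barb_sel, Val.subst_eq_var]
  | bran x L P _ => simp only [Proc.subst, barb_bran, Val.subst_eq_var]
  | par P Q ih1 ih2 => simp only [Proc.subst, barb_par, ih1, ih2, or_and_right, exists_or]
  | res P ih =>
    simp only [Proc.subst, barb_res, ih]; constructor
    · rintro ⟨n, h1, h2⟩; obtain ⟨k, rfl, h3⟩ := up_eq_var.mp h2
      obtain ⟨j, rfl, h4⟩ := up_eq_var.mp h3; grind
    · rintro ⟨n, h1, h2⟩; exact ⟨n + 2, h1, up_eq_var.mpr ⟨n + 1, rfl, up_eq_var.mpr ⟨n, rfl, h2⟩⟩⟩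
  | ite v P Q _ _ => simp [Proc.subst, not_barb_ite]
  | inact => simp [Proc.subst, not_barb_inact]

theorem barb_ren_of_involutive {P : Proc} {f : ℕ → ℕ} (hf : Function.Involutive f) {m : ℕ} :
    Barb (P.subst (ren f)) m ↔ Barb P (f m) := by
  rw [barb_subst]; constructor
  · rintro ⟨n, h, e⟩; cases e; rwa [hf n]
  · intro h; exact ⟨f m, h, by rw [ren, hf m]⟩

theorem Cong.barb {P Q : Proc} (h : Cong P Q) (y : ℕ) : Barb P y ↔ Barb Q y := by
  induction h generalizing y with
  | refl P => rfl
  | symm _ ih => grind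
  | trans _ _ ih1 ih2 => grind
  | out _ => simp only [barb_out]
  | inp _ => simp only [barb_inp]
  | sel _ => simp only [barb_sel]
  | bran _ => simp only [barb_bran]
  | par _ _ ih1 ih2 => simp only [barb_par, ih1, ih2]
  | res _ ih => simp only [barb_res, ih]
  | ite _ _ => simp only [not_barb_ite]
  | resInact => simp only [barb_res, not_barb_inact]
  | resRes P =>
    simp only [barb_res]
    rw [show (ren fun n => if n < 2 then n + 2 else if n < 4 then n - 2 else n) = ren Mix.exchange
      from rfl, barb_ren_of_involutive Mix.exchange_involutive]
    have : Mix.exchange (y + 2 + 2) = y + 2 + 2 := by unfold Mix.exchange; grind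
    grind
  | resPar P Q => simp only [barb_par, barb_res, barb_subst]; simp [wk, ren]
  | resSwap P => simp only [barb_res]; rw [barb_ren_of_involutive Mix.swap01_involutive]; rfl
  | parInact P => simp only [barb_par, not_barb_inact, or_false]
  | parComm P Q => simp only [barb_par]; tauto
  | parAssoc P Q R => simp only [barb_par]; tauto

theorem barb_parM {M : Multiset Proc} {n : ℕ} : Barb (parM M) n ↔ ∃ p ∈ M, Barb p n := by
  induction M using Multiset.induction with
  | empty => rw [parM_zero]; exact iff_of_false not_barb_inact (by simp)
  | cons p M ih =>
    rw [Cong.barb (parM_cons p M)]; change Barb (.par p (parM M)) n ↔ _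
    simp only [barb_par, ih, mem_cons, exists_eq_or_imp]

theorem barb_nuL {X : List ℕ} (hX : ∀ a ∈ X, Bnd a) {n : ℕ} (hn : ¬ Bnd n) {P : Proc} :
    Barb (nuL X P) n ↔ Barb P n := by
  induction X with
  | nil => rfl
  | cons a X ih =>
    rw [← ih fun b hb => hX b (by grind)]; have ha := hX a (by simp)
    have h1 : n ≠ a := fun e => hn (e ▸ ha); have h2 : n ≠ co a := fun e => hn (e ▸ bnd_co ha)
    change Barb (.res (Proc.subst _ _)) n ↔ _; rw [barb_res, barb_subst]; constructor
    · rintro ⟨m, hm, h⟩; simp only [abs2] at h; grind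
    · intro h; exact ⟨n, h, by simp [abs2, h1, h2]⟩

theorem Conf.barb {T : Proc} {Z M} (h : Conf T Z M) (y : ℕ) :
    Barb T y ↔ ∃ m ∈ M, Barb m (3 * y) := by
  rw [← barb_parM, ← barb_nuL h.1.2 (n := 3 * y) (by unfold Bnd; omega), ← h.2.barb, barb_subst]
  constructor
  · intro hb; exact ⟨y, hb, rfl⟩
  · rintro ⟨n, hb, e⟩; simp only [ren, Val.var.injEq] at e; grind

end CMV

/-! ## Non-deterministic choices in configurations -/

namespace CMV

open Proc Calculus

theorem exists_not_hit (Z : List ℕ) : ∃ a, Bnd a ∧ ¬ Hit Z a := by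
  obtain ⟨N, hN⟩ := exists_pid_bound Z; obtain ⟨a, ha, h⟩ := exists_fresh N
  refine ⟨a, ha, fun hh => ?_⟩; obtain ⟨b, hb, e⟩ := List.mem_map.mp hh.2; grind

theorem Conf.close' {T P : Proc} {Z M} {a : ℕ} (h : Conf T (a :: Z) (openWith a P ::ₘ M))
    (h1 : ∀ m ∈ .res P ::ₘ M, ¬ m.Occ a) (h2 : ∀ m ∈ .res P ::ₘ M, ¬ m.Occ (co a)) :
    Conf T Z (.res P ::ₘ M) := by
  have ha := (good_cons.mp h.1).1
  refine (h.close ha h1 h2).relist (good_cons.mp h.1).2.2 fun m hm n hn hh => ?_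
  rcases (hit_cons ha).mp hh with rfl | rfl | hh <;> grind

theorem conf_parList {T : Proc} {Z M} {l : List Proc} :
    Conf T Z (parList l ::ₘ M) ↔ Conf T Z (l + M) := by
  induction l generalizing M with
  | nil => simpa [parList] using conf_inact
  | cons p l ih => rw [parList, conf_par, cons_swap, ih, ← Multiset.cons_coe, cons_add, add_cons]

/-- Selections of the labels in `ls` at the endpoint `c`. -/
def sels (c : ℕ) (ls : List Label) : List Proc := ls.map fun l => .sel (.var c) l .inact

/-- What a non-deterministic choice leaves behind. -/
def garbage (ls : List Label) : Proc := .res (parList (sels 1 ls))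

theorem mem_sels {c : ℕ} {ls : List Label} {p : Proc} :
    p ∈ sels c ls ↔ ∃ l ∈ ls, p = .sel (.var c) l .inact := by
  simp [sels, eq_comm]

theorem occ_parList {l : List Proc} {n : ℕ} : (parList l).Occ n ↔ ∃ p ∈ l, p.Occ n := by
  induction l with
  | nil => simp [parList, Occ]
  | cons p l ih => simp only [parList, Occ, ih, List.mem_cons, exists_eq_or_imp]

theorem occ_sels {c : ℕ} {ls : List Label} {p : Proc} (hp : p ∈ sels c ls) {n : ℕ}
    (hn : p.Occ n) : n = c := by
  obtain ⟨l, -, rfl⟩ := mem_sels.mp hp; simpa [Occ, eq_comm] using hn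

theorem not_occ_garbage (ls : List Label) (n : ℕ) : ¬ (garbage ls).Occ n := by
  intro h; obtain ⟨p, hp, h⟩ := occ_parList.mp h; have := occ_sels hp h; omega

theorem openWith_garbage (a : ℕ) (ls : List Label) :
    openWith a (parList (sels 1 ls)) = parList (sels (co a) ls) := by
  rw [openWith, sels, Encoding.parList_map_subst, List.map_map]; rfl

theorem openWith_ndc (a : ℕ) (L : Finset Label) (P : Label → Proc) :
    openWith a (.par (.bran (.var 0) L fun l => (P l.1).subst (wk 2)) (parList (sels 1 L.toList))) =
      .par (.bran (.var a) L fun l => P l.1) (parList (sels (co a) L.toList)) := by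
  have h := openWith_garbage a L.toList; simp only [openWith] at h
  simp only [openWith, Proc.subst, h, Proc.subst_subst, scomp_cons2_wk, Proc.subst_var]; rfl

theorem occ_ndc {L : Finset Label} {P : Label → Proc} {n : ℕ} :
    (Encoding.ndc L P).Occ n ↔ ∃ l ∈ L, (P l).Occ n := by
  have h : ¬ (parList (L.toList.map fun l => Proc.sel (.var 1) l .inact)).Occ (n + 2) :=
    not_occ_garbage L.toList n
  simp only [Encoding.ndc, Occ, wk, occ_ren, h]; simp

theorem not_barb_garbage {ls : List Label} {n : ℕ} : ¬ Barb (garbage ls) n := by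
  rw [garbage, barb_res]
  induction ls with
  | nil => exact not_barb_inact
  | cons l ls ih =>
    rw [sels, List.map_cons, parList, barb_par, barb_sel]; rintro (h | h)
    · grind
    · exact ih h

/-- Items of configurations. -/
def IsItem (m : Proc) : Prop := IsThread m ∨ ∃ L P, m = Encoding.ndc L P

/-- Steps of configurations in which non-deterministic choices are items. -/
inductive GStep : Multiset Proc → Multiset Proc → Prop
  | pre {M N} : Pre M N → GStep M N
  | ndc {L} (P R) {l} : l ∈ L → GStep (Encoding.ndc L P ::ₘ R) (P l ::ₘ R)

/-- As `GStep`, with the garbage. -/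
inductive GStep' : Multiset Proc → Multiset Proc → Prop
  | pre {M N} : Pre M N → GStep' M N
  | ndc {L} (P R) {l} (ls) : l ∈ L → GStep' (Encoding.ndc L P ::ₘ R) (P l ::ₘ garbage ls ::ₘ R)

theorem GStep'.occ {M N : Multiset Proc} (h : GStep' M N) {n : ℕ} (hn : ∃ p ∈ N, p.Occ n) :
    ∃ p ∈ M, p.Occ n := by
  cases h with
  | pre h => exact h.occ hn
  | @ndc L P R l ls hl =>
    simp only [mem_cons, exists_eq_or_imp, not_occ_garbage, false_or] at hn ⊢
    exact hn.imp (fun h => occ_ndc.mpr ⟨l, hl, h⟩) id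

theorem GStep'.cons (x : Proc) {M N : Multiset Proc} (h : GStep' M N) :
    GStep' (x ::ₘ M) (x ::ₘ N) := by
  cases h with
  | pre hp =>
    have := hp.add {x}; rw [add_comm M, add_comm N, singleton_add, singleton_add] at this
    exact .pre this
  | ndc P R ls hl =>
    have := GStep'.ndc P (x ::ₘ R) ls hl
    rw [cons_swap, cons_swap (garbage ls), cons_swap (P _)] at this; grind

theorem cons_eq_add {α : Type*} {x : α} {R S M : Multiset α} (h : x ::ₘ R = S + M) :
    (∃ S', S = x ::ₘ S' ∧ R = S' + M) ∨ (∃ M', M = x ::ₘ M' ∧ R = S + M') := by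
  have hx : x ∈ S + M := h ▸ mem_cons_self _ _; rcases mem_add.mp hx with hx | hx
  · obtain ⟨S', rfl⟩ := exists_cons_of_mem hx; rw [cons_add] at h
    exact .inl ⟨S', rfl, (cons_inj_right x).mp h⟩
  · obtain ⟨M', rfl⟩ := exists_cons_of_mem hx; rw [add_cons] at h
    exact .inr ⟨M', rfl, (cons_inj_right x).mp h⟩

/-- A step of threads that select and branch on a private restriction together with processes that
do not know it. -/
theorem GStep'.split {a : ℕ} (ha : Bnd a) {S R N : Multiset Proc} {ls : List Label}
    (hS : S = sels (co a) ls ∨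
      ∃ (L : Finset Label) (P : Label → Proc), S = .bran (.var a) L (fun l => P l.1) ::ₘ (sels (co a) ls : Multiset Proc) ∧
        ls = L.toList)
    (h1 : ∀ m ∈ R, ¬ m.Occ a) (h2 : ∀ m ∈ R, ¬ m.Occ (co a)) (h : GStep' (S + R) N) :
    (∃ R', GStep' R R' ∧ N = S + R') ∨
      ∃ (L : Finset Label) (P : Label → Proc) (l : Label), S = .bran (.var a) L (fun l => P l.1) ::ₘ (sels (co a) ls : Multiset Proc) ∧
        l ∈ L ∧ N = .inact ::ₘ P l ::ₘ ((sels (co a) (ls.erase l) : Multiset Proc) + R) := by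
  have mS : ∀ m ∈ S, (∃ l, m = .sel (.var (co a)) l .inact) ∨
      ∃ (L : Finset Label) (P : Label → Proc), m = .bran (.var a) L (fun l => P l.1) ∧ S = m ::ₘ (sels (co a) ls : Multiset Proc) ∧
        ls = L.toList := by
    intro m hm; rcases hS with rfl | ⟨L, P, rfl, rfl⟩
    · obtain ⟨l, -, rfl⟩ := mem_sels.mp (Multiset.mem_coe.mp hm); grind
    · rcases mem_cons.mp hm with rfl | hm
      · grind
      · obtain ⟨l, -, rfl⟩ := mem_sels.mp (Multiset.mem_coe.mp hm); grind
  have out : ∀ {x Q}, x ::ₘ Q = S + R → (∀ l, x ≠ .sel (.var (co a)) l .inact) →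
      (∀ L P, x ≠ .bran (.var a) L P) → ∃ R', R = x ::ₘ R' ∧ Q = S + R' := by
    intro x Q e n1 n2; rcases cons_eq_add e with ⟨S', rfl, -⟩ | h
    · rcases mS x (by simp) with ⟨l, hl⟩ | ⟨L, P, hL, -⟩ <;> grind
    grind
  generalize hM : S + R = M at h
  have sw : ∀ (x : Proc) (A B : Multiset Proc), x ::ₘ (A + B) = A + x ::ₘ B :=
    fun x A B => (add_cons x A B).symm
  cases h with
  | pre h =>
    cases h with
    | iteTrue P Q R0 =>
      obtain ⟨R', rfl, rfl⟩ := out hM.symm (by simp) (by simp)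
      exact .inl ⟨_, .pre (.iteTrue P Q R'), by simp⟩
    | iteFalse P Q R0 =>
      obtain ⟨R', rfl, rfl⟩ := out hM.symm (by simp) (by simp)
      exact .inl ⟨_, .pre (.iteFalse P Q R'), by simp⟩
    | com q v P Q R0 hb =>
      obtain ⟨R', rfl, e⟩ := out hM.symm (by simp) (by simp)
      rcases cons_eq_add e with ⟨S', e', -⟩ | ⟨R'', rfl, rfl⟩
      · rcases mS _ (e' ▸ mem_cons_self _ _) with ⟨l, hl⟩ | ⟨L, P, hL, -⟩
        · cases hl
        grind
      · exact .inl ⟨_, .pre (.com q v P Q R'' hb), by simp⟩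
    | @case b P L Q R0 l hb =>
      rcases cons_eq_add hM.symm with ⟨S', rfl, e⟩ | ⟨R', rfl, e⟩
      · have hbc : b = co a ∧ P = .inact := by
          rcases mS (.sel (.var b) l P) (by simp) with ⟨l', hl⟩ | ⟨L, P, hL, -⟩ <;> grind
        obtain ⟨rfl, rfl⟩ := hbc; rw [co_co ha] at e
        rcases cons_eq_add e with ⟨S'', rfl, rfl⟩ | ⟨R', rfl, -⟩
        · right; rcases mS (.bran (.var a) L Q) (by simp) with ⟨l', hl⟩ | ⟨L', P', hL, hS', hls⟩
          · cases hl
          · cases hL; refine ⟨L, P', l, hS', l.2, ?_⟩; rw [cons_swap] at hS'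
            have h3 := (cons_inj_right _).mp hS'
            have h4 : (sels (co a) ls : Multiset Proc) =
                .sel (.var (co a)) l .inact ::ₘ (sels (co a) (ls.erase l.1) : Multiset Proc) := by
              rw [Multiset.cons_coe, Multiset.coe_eq_coe]
              exact (List.perm_cons_erase (a := l.1) (by rw [hls]; simp [l.2])).map _
            rw [h4] at h3; rw [(cons_inj_right _).mp h3]
        · exact (h1 _ (mem_cons_self _ _) (Or.inl rfl)).elim
      · rcases cons_eq_add e with ⟨S', e', -⟩ | ⟨R'', rfl, rfl⟩
        · rcases mS _ (e' ▸ mem_cons_self _ _) with ⟨l, hl⟩ | ⟨L, P, hL, -⟩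
          · cases hl
          · simp only [bran.injEq, Val.var.injEq] at hL; have : b = co a := by rw [← hL.1, co_co hb]
            exact (h2 _ (mem_cons_self _ _) (Or.inl (by grind))).elim
        · exact .inl ⟨_, .pre (.case P Q R'' l hb), by simp⟩
  | @ndc L P R0 l ls' hl =>
    obtain ⟨R', rfl, rfl⟩ := out hM.symm (by simp [Encoding.ndc]) (by simp [Encoding.ndc])
    exact .inl ⟨_, .ndc P R' ls' hl, by simp⟩

theorem conf_garbage {T : Proc} {Z M} {a : ℕ} {ls : List Label}
    (h : Conf T (a :: Z) (sels (co a) ls + M)) (h1 : ∀ m ∈ M, ¬ m.Occ a)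
    (h2 : ∀ m ∈ M, ¬ m.Occ (co a)) : Conf T Z (garbage ls ::ₘ M) := by
  rw [← conf_parList, ← openWith_garbage] at h
  refine h.close' ?_ ?_ <;> intro m hm <;> rcases mem_cons.mp hm with rfl | hm
  · exact not_occ_garbage ls _
  · grind
  · exact not_occ_garbage ls _
  grind

theorem Conf.red_items {T T' : Proc} (hr : Red T T') {C : Multiset Proc}
    (hC : ∀ c ∈ C, (∃ L P, c = Encoding.ndc L P) ∨ ∃ ls, c = garbage ls) :
    ∀ {Z R}, (∀ m ∈ R, IsThread m) → Conf T Z (C + R) → ∃ N, GStep' (C + R) N ∧ Conf T' Z N := by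
  induction C using Multiset.induction with
  | empty =>
    intro Z R hR h; rw [zero_add] at h ⊢; obtain ⟨N, hp, hc⟩ := h.red hR hr; exact ⟨N, .pre hp, hc⟩
  | cons c C ih =>
    intro Z R hR h; obtain ⟨a, ha, hZ⟩ := exists_not_hit Z
    have hZ' : ¬ Hit Z (co a) := by rwa [hit_co_iff ha]
    have n1 : ∀ m ∈ c ::ₘ (C + R), ¬ m.Occ a := fun m hm ho => hZ (h.hit (by grind) ho ha)
    have n2 : ∀ m ∈ c ::ₘ (C + R), ¬ m.Occ (co a) := fun m hm ho =>
      hZ' (h.hit (by grind) ho (bnd_co ha))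
    have n1' := fun m (hm : m ∈ C + R) => n1 m (mem_cons_of_mem hm)
    have n2' := fun m (hm : m ∈ C + R) => n2 m (mem_cons_of_mem hm)
    have gocc : ∀ {N n}, (∀ m ∈ C + R, ¬ m.Occ n) → GStep' (C + R) N → ∀ m ∈ N, ¬ m.Occ n := by
      intro N n hn hg m hm ho; obtain ⟨p, hp, ho⟩ := hg.occ ⟨m, hm, ho⟩; grind
    rw [cons_add] at h ⊢; have ih' := @ih fun d hd => hC d (by grind)
    have perm : ∀ S : Multiset Proc, S + (C + R) = C + (S + R) := fun S => by grind
    rcases hC c (by simp) with ⟨L, P, rfl⟩ | ⟨ls, rfl⟩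
    · have h' := h.open ha hZ; have e := openWith_ndc a L P; simp only [sels] at e
      rw [e, conf_par, cons_swap, ← sels, conf_parList, add_cons, ← cons_add, perm] at h'
      obtain ⟨N, hg, hc⟩ := ih' (R := _ + R) (by
        intro m hm; rcases mem_add.mp hm with hm | hm
        · rcases mem_cons.mp hm with rfl | hm
          · trivial
          · obtain ⟨l, -, rfl⟩ := mem_sels.mp (Multiset.mem_coe.mp hm); trivial
        grind) h'
      rw [← perm] at hg
      rcases hg.split ha (.inr ⟨L, P, rfl, rfl⟩) n1' n2' with ⟨R', hg', rfl⟩ | ⟨L', P', l, e1, hl, rfl⟩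
      · refine ⟨Encoding.ndc L P ::ₘ R', hg'.cons _, ?_⟩
        · have hc' : Conf T' (a :: Z) (openWith a (.par (.bran (.var 0) L fun l =>
              (P l.1).subst (wk 2)) (parList (sels 1 L.toList))) ::ₘ R') := by
            rw [openWith_ndc, conf_par, cons_swap, conf_parList, add_cons, ← cons_add]; exact hc
          refine hc'.close' ?_ ?_ <;> intro m hm <;> rcases mem_cons.mp hm with rfl | hm
          · exact n1 _ (mem_cons_self _ _)
          · grind
          · exact n2 _ (mem_cons_self _ _)
          grind
      · have e2 : L' = L ∧ ∀ l : {l // l ∈ L}, P' l.1 = P l.1 := by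
          have hm : Proc.bran (.var a) L' (fun l => P' l.1) ∈
              Proc.bran (.var a) L (fun l => P l.1) ::ₘ (sels (co a) L.toList : Multiset Proc) :=
            e1 ▸ mem_cons_self _ _
          rcases mem_cons.mp hm with hm | hm
          · simp only [bran.injEq, true_and] at hm; obtain ⟨rfl, hm⟩ := hm
            exact ⟨rfl, fun l => congrFun (eq_of_heq hm) l⟩
          · obtain ⟨l, -, hl⟩ := mem_sels.mp (Multiset.mem_coe.mp hm); cases hl
        obtain ⟨rfl, e2⟩ := e2; rw [e2 ⟨l, hl⟩, conf_inact, ← add_cons] at hc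
        refine ⟨_, .ndc P (C + R) (L'.toList.erase l) hl, ?_⟩; rw [cons_swap]
        refine conf_garbage hc ?_ ?_ <;> intro m hm <;> rcases mem_cons.mp hm with rfl | hm
        · exact fun ho => n1 _ (mem_cons_self _ _) (occ_ndc.mpr ⟨l, hl, ho⟩)
        · grind
        · exact fun ho => n2 _ (mem_cons_self _ _) (occ_ndc.mpr ⟨l, hl, ho⟩)
        grind
    · have h' := h.open ha hZ; rw [openWith_garbage, conf_parList, perm] at h'
      obtain ⟨N, hg, hc⟩ := ih' (R := _ + R) (by
        intro m hm; rcases mem_add.mp hm with hm | hm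
        · obtain ⟨l, -, rfl⟩ := mem_sels.mp (Multiset.mem_coe.mp hm); trivial
        grind) h'
      rw [← perm] at hg
      rcases hg.split ha (.inl rfl) n1' n2' with ⟨R', hg', rfl⟩ | ⟨L', P', l, e1, -⟩
      · exact ⟨garbage ls ::ₘ R', hg'.cons _, conf_garbage hc (gocc n1' hg') (gocc n2' hg')⟩
      · have hm : Proc.bran (.var a) L' (fun l => P' l.1) ∈ (sels (co a) ls : Multiset Proc) :=
          e1 ▸ mem_cons_self _ _
        obtain ⟨l, -, hl⟩ := mem_sels.mp (Multiset.mem_coe.mp hm); cases hl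

/-- `Conf` up to garbage. -/
def ConfG (T : Proc) (Z : List ℕ) (M : Multiset Proc) : Prop :=
  ∃ G : Multiset Proc, (∀ g ∈ G, ∃ ls, g = garbage ls) ∧ Conf T Z (M + G)

theorem garbage_ne_ndc {ls : List Label} {L : Finset Label} {P : Label → Proc} :
    garbage ls ≠ Encoding.ndc L P := by
  cases ls <;> simp [garbage, Encoding.ndc, sels, parList]

theorem ConfG.red {T T' : Proc} {Z M} (h : ConfG T Z M) (hM : ∀ m ∈ M, IsItem m) (hr : Red T T') :
    ∃ N, GStep M N ∧ ConfG T' Z N := by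
  classical
  obtain ⟨G, hG, hc⟩ := h
  have e : M.filter (fun m => ¬ IsThread m) + M.filter IsThread = M := by
    rw [add_comm]; exact Multiset.filter_add_not _ _
  have e' : M + G = (M.filter (fun m => ¬ IsThread m) + G) + M.filter IsThread := by grind
  rw [e'] at hc
  obtain ⟨N, hg, hc⟩ := hc.red_items hr (by
    intro c hc; rcases mem_add.mp hc with hc | hc
    · obtain ⟨h1, h2⟩ := Multiset.mem_filter.mp hc; exact .inl ((hM c h1).resolve_left h2)
    grind) (fun m hm => (Multiset.mem_filter.mp hm).2)
  rw [← e', add_comm] at hg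
  have out : ∀ {x Q R}, x ::ₘ Q = G + R → (∀ ls, x ≠ garbage ls) → ∃ R', R = x ::ₘ R' ∧ Q = G + R' := by
    intro x Q R e n1; rcases cons_eq_add e with ⟨S', rfl, -⟩ | h
    · obtain ⟨ls, hl⟩ := hG x (by simp); grind
    grind
  generalize hK : G + M = K at hg
  cases hg with
  | pre hp =>
    suffices ∃ R, Pre M R ∧ N = R + G by obtain ⟨R, hR, rfl⟩ := this; exact ⟨R, .pre hR, G, hG, hc⟩
    cases hp with
    | iteTrue P Q R0 =>
      obtain ⟨R', rfl, rfl⟩ := out hK.symm (by simp [garbage])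
      exact ⟨_, .iteTrue P Q R', by rw [cons_add, add_comm]⟩
    | iteFalse P Q R0 =>
      obtain ⟨R', rfl, rfl⟩ := out hK.symm (by simp [garbage])
      exact ⟨_, .iteFalse P Q R', by rw [cons_add, add_comm]⟩
    | com q v P Q R0 hb =>
      obtain ⟨R', rfl, e2⟩ := out hK.symm (by simp [garbage])
      obtain ⟨R'', rfl, rfl⟩ := out e2 (by simp [garbage])
      exact ⟨_, .com q v P Q R'' hb, by rw [cons_add, cons_add, add_comm]⟩
    | case P Q R0 l hb =>
      obtain ⟨R', rfl, e2⟩ := out hK.symm (by simp [garbage])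
      obtain ⟨R'', rfl, rfl⟩ := out e2 (by simp [garbage])
      exact ⟨_, .case P Q R'' l hb, by rw [cons_add, cons_add, add_comm]⟩
  | ndc P R ls hl =>
    obtain ⟨R', rfl, rfl⟩ := out hK.symm fun ls => garbage_ne_ndc.symm
    refine ⟨_, .ndc P R' hl, garbage ls ::ₘ G, ?_, ?_⟩
    · grind
    · rw [cons_add, add_cons, add_comm R']; exact hc

theorem ConfG.step {T : Proc} {Z M N} (h : ConfG T Z M) (hs : GStep M N) :
    ∃ T', Red T T' ∧ ConfG T' Z N := by
  obtain ⟨G, hG, hc⟩ := h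
  cases hs with
  | pre hp => obtain ⟨T', hr, hc'⟩ := hc.step (hp.add G); exact ⟨T', hr, G, hG, hc'⟩
  | @ndc L P R l hl =>
    obtain ⟨a, ha, hZ⟩ := exists_not_hit Z; have hZ' : ¬ Hit Z (co a) := by rwa [hit_co_iff ha]
    rw [cons_add] at hc
    have n1 : ∀ m ∈ Encoding.ndc L P ::ₘ (R + G), ¬ m.Occ a := fun m hm ho => hZ (hc.hit hm ho ha)
    have n2 : ∀ m ∈ Encoding.ndc L P ::ₘ (R + G), ¬ m.Occ (co a) :=
      fun m hm ho => hZ' (hc.hit hm ho (bnd_co ha))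
    have h' := hc.open ha hZ; have e := openWith_ndc a L P; simp only [sels] at e
    have h4 : (sels (co a) L.toList : Multiset Proc) =
        .sel (.var (co a)) l .inact ::ₘ (sels (co a) (L.toList.erase l) : Multiset Proc) := by
      rw [Multiset.cons_coe, Multiset.coe_eq_coe]
      exact (List.perm_cons_erase (a := l) (by simp [hl])).map _
    rw [e, conf_par, cons_swap, ← sels, conf_parList, add_cons, h4, cons_add, cons_swap] at h'
    have hp := Pre.case .inact (L := L) (fun l => P l.1)
      ((sels (co a) (L.toList.erase l) : Multiset Proc) + (R + G)) ⟨l, hl⟩ (bnd_co ha)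
    rw [co_co ha] at hp; obtain ⟨T', hr, hc'⟩ := h'.step hp; rw [conf_inact, ← add_cons] at hc'
    refine ⟨T', hr, garbage (L.toList.erase l) ::ₘ G, ?_, ?_⟩
    · grind
    · rw [add_cons, cons_add]
      refine conf_garbage hc' ?_ ?_ <;> intro m hm <;> rcases mem_cons.mp hm with rfl | hm
      · exact fun ho => n1 _ (mem_cons_self _ _) (occ_ndc.mpr ⟨l, hl, ho⟩)
      · grind
      · exact fun ho => n2 _ (mem_cons_self _ _) (occ_ndc.mpr ⟨l, hl, ho⟩)
      grind

theorem ConfG.barb {T : Proc} {Z M} (h : ConfG T Z M) (y : ℕ) :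
    Barb T y ↔ ∃ m ∈ M, Barb m (3 * y) := by
  obtain ⟨G, hG, hc⟩ := h; rw [hc.barb]; constructor
  · rintro ⟨m, hm, hb⟩; rcases mem_add.mp hm with hm | hm
    · grind
    · obtain ⟨ls, rfl⟩ := hG m hm; exact (not_barb_garbage hb).elim
  grind

end CMV

namespace Mix

/-! ## Subject reduction for communications -/

theorem Typing.mono {Θ Δ : Ctx} {p : AProc} (h : Typing Θ p)
    (h1 : ∀ z T, Θ z = some T → ∃ T', Δ z = some T' ∧ Le T' T)
    (h2 : ∀ z T, Δ z = some T → ¬ Un T → Θ z ≠ none) : Typing Δ p := by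
  have := h.subst (σ := Val.var) (Δ := Δ) ⟨fun x T hx => h1 x T hx, fun y T hy hn =>
    ⟨y, ⟨rfl, h2 y T hy hn⟩, fun z hz => by grind⟩⟩
  rwa [AProc.subst_var] at this

theorem Typing.restr {Θ Ξ : Ctx} {p : AProc} (h : Typing Θ p)
    (h1 : ∀ z T, Θ z = some T → ∃ T', Ξ z = some T' ∧ Le T' T) :
    Typing (Ξ.restr fun z => Θ z ≠ none) p := by
  refine h.mono (fun z T hz => ?_) fun z T hz hn => ?_
  · obtain ⟨T', h2, h3⟩ := h1 z T hz; exact ⟨T', Ctx.restr_eq_some.mpr ⟨h2, .inr (by grind)⟩, h3⟩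
  · exact (Ctx.restr_eq_some.mp hz).2.resolve_left hn

theorem Split.lin {Γ Γ₁ Γ₂ : Ctx} (h : Split Γ Γ₁ Γ₂) {z T} (hz : Γ z = some T) (hn : ¬ Un T) :
    (Γ₁ z ≠ none ∧ Γ₂ z = none) ∨ (Γ₁ z = none ∧ Γ₂ z ≠ none) := by
  rcases h z with ⟨a, b, c⟩ | ⟨T', hT, ⟨a, b, c⟩ | ⟨a, b, c⟩ | ⟨a, b, c⟩⟩ <;> simp_all

theorem Split.un {Γ Γ₁ Γ₂ : Ctx} (h : Split Γ Γ₁ Γ₂) {z T} (hz : Γ z = some T) (hn : Un T) :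
    Γ₁ z = some T ∧ Γ₂ z = some T := by
  rcases h z with ⟨a, b, c⟩ | ⟨T', hT, ⟨a, b, c⟩ | ⟨a, b, c⟩ | ⟨a, b, c⟩⟩ <;> simp_all

theorem ValTy.var_inv {Γ : Ctx} {x : ℕ} {U : Ty} (h : ValTy Γ (.var x) U) :
    ∃ T, Γ x = some T ∧ (∀ y V, y ≠ x → Γ y = some V → Un V) ∧ Sub T U := by
  have .var h1 h2 h3 := h; grind

/-- The continuations of a communication, when their contexts fit together. -/
theorem typing_com {Ξ D E F D₁ Θ : Ctx} {p r k : AProc} {v : Val} {S S' : Ty}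
    (hD : ∀ z T, D z = some T → ∃ T', Ξ z = some T' ∧ Le T' T)
    (hE : ∀ z T, E z = some T → ∃ T', Ξ z = some T' ∧ Le T' T)
    (hF : ∀ z T, F z = some T → ∃ T', Ξ z = some T' ∧ Le T' T)
    (hlin : ∀ z T, Ξ z = some T → ¬ Un T → (D z ≠ none ∧ E z = none ∧ F z = none) ∨
      (D z = none ∧ E z ≠ none ∧ F z = none) ∨ (D z = none ∧ E z = none ∧ F z ≠ none))
    (hs : Split D D₁ Θ) (hv : ValTy D₁ v S) (hSS : Sub S S')
    (hp : Typing Θ p) (hr : Typing (Ctx.cons S' E) r) (hk : Typing F k) :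
    Typing Ξ (.par p (.par (r.subst (inst v)) k)) := by
  have hD1 : ∀ z T, D₁ z = some T → ∃ T', Ξ z = some T' ∧ Le T' T :=
    fun z T h => hD z T (hs.left h)
  have hΘ : ∀ z T, Θ z = some T → ∃ T', Ξ z = some T' ∧ Le T' T :=
    fun z T h => hD z T (hs.right h)
  have hDl : ∀ z T, Ξ z = some T → ¬ Un T → D z ≠ none →
      (D₁ z ≠ none ∧ Θ z = none) ∨ (D₁ z = none ∧ Θ z ≠ none) := by
    intro z T hz hn hne; obtain ⟨V, hV⟩ := exists_some hne; obtain ⟨T', h1, h2⟩ := hD z V hV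
    rw [hz] at h1; cases h1; exact hs.lin hV (fun h => hn (h2.un_iff.mpr h))
  have hDn : ∀ z, D z = none → D₁ z = none ∧ Θ z = none := by
    intro z hz; rcases hs z with ⟨a, b, c⟩ | ⟨T', hT, _⟩
    · grind
    grind
  set SQ : ℕ → Prop := fun z => E z ≠ none ∨ D₁ z ≠ none
  set SR : ℕ → Prop := fun z => SQ z ∨ F z ≠ none
  have hsp1 : Split Ξ (Ξ.restr fun z => Θ z ≠ none) (Ξ.restr SR) := by
    refine split_restr fun z T hz hn => ?_; grind
  have hR : ∀ {P : ℕ → Prop} {z T}, (∀ z, P z → SR z) → Ξ z = some T → (Un T ∨ P z) →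
      (Ξ.restr SR).restr P z = some T := by
    intro P z T hP hz hu
    exact Ctx.restr_eq_some.mpr ⟨Ctx.restr_eq_some.mpr ⟨hz, hu.imp id (hP z)⟩, hu⟩
  have hsp2 : Split (Ξ.restr SR) ((Ξ.restr SR).restr SQ) ((Ξ.restr SR).restr fun z => F z ≠ none) := by
    refine split_restr fun z T hz hn => ?_; obtain ⟨hz, hS⟩ := Ctx.restr_eq_some.mp hz; grind
  refine .par hsp1 (hp.restr hΘ) (.par hsp2 ?_ ?_)
  · refine hr.subst ⟨fun x T hx => ?_, fun y T hy hn => ?_⟩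
    · cases x with
      | zero =>
        cases hx
        cases hv with
        | unit _ h => exact h.trans hSS
        | tt _ h => exact h.trans hSS
        | ff _ h => exact h.trans hSS
        | @var z T _ h1 h2 h3 =>
          obtain ⟨T', h4, h5⟩ := hD1 z T h1
          exact ⟨T', hR (fun z h => .inl h) h4 (.inr (.inr (by grind))),
            .inr (h5.sub (h3.trans hSS))⟩
      | succ x =>
        obtain ⟨T', h4, h5⟩ := hE x T hx
        exact ⟨T', hR (fun z h => .inl h) h4 (.inr (.inl (by
          change E x = _ at hx; grind))), h5⟩
    · obtain ⟨hy, hS⟩ := Ctx.restr_eq_some.mp hy; have hy := (Ctx.restr_eq_some.mp hy).1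
      have hS := hS.resolve_left hn
      have hv' : D₁ y ≠ none → v = .var y := by
        intro hne; obtain ⟨V, hV⟩ := exists_some hne; obtain ⟨T', h1, h2⟩ := hD1 y V hV
        rw [hy] at h1; cases h1; have hnV : ¬ Un V := fun h => hn (h2.un_iff.mpr h)
        cases hv with
        | unit hu _ => exact (hnV (hu y V hV)).elim
        | tt hu _ => exact (hnV (hu y V hV)).elim
        | ff hu _ => exact (hnV (hu y V hV)).elim
        | @var z T _ h1 h2 h3 => grind
      have hexcl : E y ≠ none → D₁ y = none := by grind
      rcases hS with hS | hS
      · refine ⟨y + 1, ⟨rfl, hS⟩, ?_⟩; rintro (_ | m) ⟨e, hm⟩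
        · cases hv with
          | unit => cases e
          | tt => cases e
          | ff => cases e
          | var h1 => cases e; grind
        · cases e; rfl
      · refine ⟨0, ⟨hv' hS, by simp [Ctx.cons]⟩, ?_⟩; rintro (_ | m) ⟨e, hm⟩
        · rfl
        · cases e; exact (hS (hexcl hm)).elim
  · refine hk.mono (fun z T hz => ?_) fun z T hz hn => ?_
    · grind
    · exact (Ctx.restr_eq_some.mp hz).2.resolve_left hn

/-- What the typing of a choice says about one of its branches. -/
theorem Typing.choice_inv {Γ : Ctx} {q q' w x n l a P}
    (h : Typing Γ (.choice q q' w x n l a P)) :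
    ∃ y T K pay cont, x = .var y ∧ Γ y = some T ∧ Sub T (.choice q' w K pay cont) ∧
      (q = .un → UnCtx Γ) ∧ (∀ k, k ∈ K ↔ ∃ i, (l i, (a i).pol) = k) ∧
      ∀ i (hi : (l i, (a i).pol) ∈ K), ∃ Δ Θ, BranchCtx Δ (a i) (pay ⟨_, hi⟩) Θ ∧ Typing Θ (P i) ∧
        (¬ Un T → Δ y = some (cont ⟨_, hi⟩)) ∧
        (Un T → Δ y = some T ∧ Sub T (cont ⟨_, hi⟩)) ∧
        (∀ z V, z ≠ y → Δ z = some V → Γ z = some V) ∧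
        (∀ z V, z ≠ y → Γ z = some V → ¬ Un V → Δ z = some V) := by
  have @Typing.choice _ Γ₁ Γ₂ _ y _ _ _ _ _ _ K pay cont key Δ Θ hs hq hx hkey hsurj hΔ hΘ ht := h
  obtain ⟨T, h1, h2, h3⟩ := hx.var_inv; have hT := hs.left h1
  refine ⟨y, T, K, pay, cont, rfl, hT, h3, hq, fun k => ?_, fun i hi => ?_⟩
  · constructor
    · intro hk; obtain ⟨i, hi⟩ := hsurj ⟨k, hk⟩; grind
    grind
  · have hk : key i = ⟨_, hi⟩ := Subtype.ext (hkey i); have hΔi := hΔ i; have hΘi := hΘ i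
    rw [hk] at hΔi hΘi
    refine ⟨Δ i, Θ i, hΘi, ht i, fun hn => ?_, fun hu => ?_, fun z V hzy hz => ?_,
      fun z V hzy hz hn => ?_⟩
    · have : Γ₂ y = none := hs.right_none h1 hn; rcases hΔi with ⟨-, e⟩ | ⟨T', e, -⟩
      · rw [e]; simp
      grind
    · have h2y := (hs.un hT hu).2; rcases hΔi with ⟨e, -⟩ | ⟨T', e, -, e2, e3⟩
      · grind
      grind
    · have : Γ₂ z = some V := by
        rcases hΔi with ⟨-, e⟩ | ⟨T', e, -, e2, e3⟩
        · rwa [e, update_of_ne hzy] at hz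
        grind
      exact hs.right this
    · have : Γ₂ z = some V := by
        rcases hs.lin hz hn with ⟨e1, e2⟩ | ⟨e1, e2⟩
        · obtain ⟨V', hV⟩ := exists_some e1; have := hs.left hV; grind
        · obtain ⟨V', hV⟩ := exists_some e2; have := hs.right hV; grind
      rcases hΔi with ⟨-, e⟩ | ⟨T', e, -, e2, e3⟩
      · rwa [e, update_of_ne hzy]
      grind

/-- The types of the two endpoints of a session and of two choices on them. -/
theorem Dual.choices {T U : Ty} (h : Dual T U) {q w K pay cont q₁ w₁ K₁ pay₁ cont₁}
    (hT : Sub T (.choice q w K pay cont)) (hU : Sub U (.choice q₁ w₁ K₁ pay₁ cont₁)) :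
    q₁ = q ∧ w₁ = w.dual ∧ (w = .int → ∀ l p, (l, p) ∈ K → (l, p.dual) ∈ K₁) ∧
      (w = .ext → ∀ l p, (l, p) ∈ K₁ → (l, p.dual) ∈ K) ∧
      ∀ l p (hk : (l, p) ∈ K) (hk' : (l, p.dual) ∈ K₁), ∃ A B, Dual A B ∧ Sub A (cont ⟨_, hk⟩) ∧
        Sub B (cont₁ ⟨_, hk'⟩) ∧ (p = .out → Sub (pay ⟨_, hk⟩) (pay₁ ⟨_, hk'⟩)) ∧
        (p = .inp → Sub (pay₁ ⟨_, hk'⟩) (pay ⟨_, hk⟩)) := by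
  obtain ⟨K0, pay0, cont0, u1, s1⟩ := hT.of_choice
  obtain ⟨K0', pay0', cont0', u2, s2⟩ := hU.of_choice; obtain ⟨A', B', u3, u4, hd⟩ := h.unfold
  cases u1.det u3; cases u2.det u4
  have dd : ∀ p : Pol, p.dual.dual = p := fun p => by cases p <;> rfl
  have .choice h1 h2 := hd; have .choice a1 a2 a3 a4 a5 := s1; have .choice b1 b2 b3 b4 b5 := s2
  refine ⟨rfl, rfl, ?_, ?_, ?_⟩
  · rintro rfl l p hk; exact b2 rfl ((h1 l p).mp (a1 rfl hk))
  · rintro rfl l p hk; have := b1 rfl hk; grind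
  · intro l p hk hk'
    have h3 : (l, p) ∈ K0 ∧ (l, p.dual) ∈ K0' := by
      cases w with
      | int => grind
      | ext => exact ⟨(h1 l p).mpr (b1 rfl hk'), b1 rfl hk'⟩
    obtain ⟨⟨c1, c2⟩, c3⟩ := h2 l p h3.1 h3.2
    refine ⟨_, _, c3, a5 _ h3.1 hk, b5 _ h3.2 hk', ?_, ?_⟩
    · rintro rfl; exact (a3 _ h3.1 hk rfl).trans (c1.trans (b4 _ h3.2 hk' rfl))
    · rintro rfl; exact (b3 _ h3.2 hk' rfl).trans (c2.trans (a4 _ h3.1 hk rfl))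

theorem typing_par_un {Ξ : Ctx} {p r : AProc} (h : Typing Ξ (.par p r))
    (hp : ∀ Γ, Typing Γ p → UnCtx Γ) : Typing Ξ (.par p (.par p r)) := by
  have @Typing.par _ Ξ₁ Ξ₂ _ _ hs h1 h2 := h; have hu := hp _ h1
  have hs' : Split Ξ₂ Ξ₁ Ξ₂ := by
    intro x; rcases hs x with ⟨a, b, c⟩ | ⟨T, hT, ⟨a, b, c⟩ | ⟨a, b, c⟩ | ⟨a, b, c⟩⟩
    · grind
    · grind
    · exact (a (hu x T b)).elim
    grind
  exact .par hs h1 (.par hs' h1 h2)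

theorem typing_par_com {Ξ : Ctx} {x y : ℕ} {T U : Ty} (hxy : x ≠ y) (hx : Ξ x = some T)
    (hy : Ξ y = some U) (hd : Dual T U) {q q₁ w n l a P q' q₁' w' n' l' a' P'} {r : AProc}
    (h : Typing Ξ (.par (.choice q q₁ w (.var x) n l a P)
      (.par (.choice q' q₁' w' (.var y) n' l' a' P') r)))
    {i j v} (hi : a i = .send v) (hj : a' j = .recv) (hl : l i = l' j) :
    ∃ Ξ' T' U', Dual T' U' ∧ Ξ' x = some T' ∧ Ξ' y = some U' ∧
      (∀ z, z ≠ x → z ≠ y → Ξ' z = Ξ z) ∧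
      Typing Ξ' (.par (P i) (.par ((P' j).subst (inst v)) r)) := by
  have @Typing.par _ ΞA Ξ₁ _ _ hs h1 h2 := h; have @Typing.par _ ΞB ΞR _ _ hs' h2 h3 := h2
  obtain ⟨_, T₁, K, pay, cont, e, hT, hsub, -, hK, hbr⟩ := h1.choice_inv; cases e
  have e := hs.left hT; rw [hx] at e; cases e
  obtain ⟨_, U₁, K₁, pay₁, cont₁, e, hU, hsub', -, hK', hbr'⟩ := h2.choice_inv; cases e
  have e := hs.right (hs'.left hU); rw [hy] at e; cases e
  obtain ⟨-, -, -, -, hdk⟩ := hd.choices hsub hsub'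
  have hk : (l i, (a i).pol) ∈ K := (hK _).mpr ⟨i, rfl⟩
  have hk' : (l' j, (a' j).pol) ∈ K₁ := (hK' _).mpr ⟨j, rfl⟩
  obtain ⟨Δ, Θ, b1, t1, d1, d2, d3, d4⟩ := hbr i hk
  obtain ⟨Δ', Θ', b1', t1', d1', d2', d3', d4'⟩ := hbr' j hk'
  have k1 : (l i, (a i).pol) = (l i, .out) := by rw [hi]; rfl
  have k2 : (l' j, (a' j).pol) = (l i, Pol.out.dual) := by rw [hj, hl]; rfl
  have hk2 : (l i, .out) ∈ K := k1 ▸ hk; have hk2' : (l i, Pol.out.dual) ∈ K₁ := k2 ▸ hk'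
  obtain ⟨A, B, hAB, hA, hB, hpay, -⟩ := hdk (l i) .out hk2 hk2'; have hpay := hpay rfl
  have eA : cont ⟨_, hk⟩ = cont ⟨_, hk2⟩ := congrArg cont (Subtype.ext k1)
  have eP : pay ⟨_, hk⟩ = pay ⟨_, hk2⟩ := congrArg pay (Subtype.ext k1)
  have eB : cont₁ ⟨_, hk'⟩ = cont₁ ⟨_, hk2'⟩ := congrArg cont₁ (Subtype.ext k2)
  have eP' : pay₁ ⟨_, hk'⟩ = pay₁ ⟨_, hk2'⟩ := congrArg pay₁ (Subtype.ext k2); rw [eA] at d1 d2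
  rw [eB] at d1' d2'; rw [eP] at b1; rw [eP'] at b1'; rw [hj] at b1'; cases b1'; rw [hi] at b1
  obtain ⟨D₁, hsD, hvD⟩ : ∃ D₁, Split Δ D₁ Θ ∧ ValTy D₁ v _ := by
    have .send hs hv := b1; exact ⟨_, hs, hv⟩
  have key : ∀ z V, z ≠ x → z ≠ y → Ξ z = some V → ¬ Un V →
      Δ z ≠ none ∧ Δ' z = none ∧ ΞR z = none ∨ Δ z = none ∧ Δ' z ≠ none ∧ ΞR z = none ∨
        Δ z = none ∧ Δ' z = none ∧ ΞR z ≠ none := by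
    intro z V hzx hzy hz hn
    have n1 : ΞA z = none → Δ z = none := by
      intro h; by_contra hne; obtain ⟨V, hV⟩ := exists_some hne; grind
    have n2 : ΞB z = none → Δ' z = none := by
      intro h; by_contra hne; obtain ⟨V, hV⟩ := exists_some hne; grind
    have m1 : ΞA z ≠ none → Δ z ≠ none := by
      intro h; obtain ⟨V', hV⟩ := exists_some h; have := hs.left hV; grind
    have m2 : ΞB z ≠ none → Δ' z ≠ none := by
      intro h; obtain ⟨V', hV⟩ := exists_some h; have := hs.right (hs'.left hV); grind
    rcases hs.lin hz hn with ⟨a1, a2⟩ | ⟨a1, a2⟩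
    · rcases hs' z with ⟨c1, c2, c3⟩ | ⟨V', c1, -⟩ <;> grind
    · obtain ⟨V', hV⟩ := exists_some a2; have := hs.right hV; rw [hz] at this; cases this
      rcases hs'.lin hV hn with ⟨c1, c2⟩ | ⟨c1, c2⟩ <;> grind
  by_cases hun : Un T
  · have hunU := hd.un_iff.mp hun; refine ⟨Ξ, T, U, hd, hx, hy, fun _ _ _ => rfl, ?_⟩
    refine typing_com (D := Δ) (E := Δ') (F := ΞR) ?_ ?_ ?_ ?_ hsD hvD hpay t1 t1' h3
    · intro z V hz
      by_cases hzx : z = x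
      · subst hzx; rw [(d2 hun).1] at hz; cases hz; exact ⟨T, hx, .refl _⟩
      · exact ⟨V, hs.left (d3 z V hzx hz), .refl _⟩
    · intro z V hz
      by_cases hzx : z = y
      · subst hzx; rw [(d2' hunU).1] at hz; cases hz; exact ⟨U, hy, .refl _⟩
      · exact ⟨V, hs.right (hs'.left (d3' z V hzx hz)), .refl _⟩
    · intro z V hz; exact ⟨V, hs.right (hs'.right hz), .refl _⟩
    grind
  · have hunU : ¬ Un U := fun h => hun (hd.un_iff.mpr h)
    have x1 : Ξ₁ x = none := hs.right_none hT hun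
    have xn : ΞB x = none ∧ ΞR x = none := by rcases hs' x with ⟨c1, c2, c3⟩ | ⟨V', c1, -⟩ <;> grind
    have yA : ΞA y = none := hs.symm.right_none (hs'.left hU) hunU
    have yR : ΞR y = none := hs'.right_none hU hunU
    have xΔ' : Δ' x = none := by by_contra hne; obtain ⟨V, hV⟩ := exists_some hne; grind
    have yΔ : Δ y = none := by by_contra hne; obtain ⟨V, hV⟩ := exists_some hne; grind
    have ox : update (update Ξ x (some A)) y (some B) x = some A := by grind
    have oy : update (update Ξ x (some A)) y (some B) y = some B := by grind
    have oz : ∀ z, z ≠ x → z ≠ y → update (update Ξ x (some A)) y (some B) z = Ξ z := by grind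
    refine ⟨_, A, B, hAB, ox, oy, oz, ?_⟩
    generalize update (update Ξ x (some A)) y (some B) = Ξ' at ox oy oz
    refine typing_com (D := Δ) (E := Δ') (F := ΞR) ?_ ?_ ?_ ?_ hsD hvD hpay t1 t1' h3
    · intro z V hz
      by_cases hzx : z = x
      · subst hzx; rw [d1 hun] at hz; cases hz; exact ⟨A, ox, .inr hA⟩
      · have hzy : z ≠ y := by rintro rfl; rw [yΔ] at hz; cases hz
        exact ⟨V, (oz z hzx hzy).trans (hs.left (d3 z V hzx hz)), .refl _⟩
    · intro z V hz
      by_cases hzy : z = y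
      · subst hzy; rw [d1' hunU] at hz; cases hz; exact ⟨B, oy, .inr hB⟩
      · have hzx : z ≠ x := by rintro rfl; rw [xΔ'] at hz; cases hz
        exact ⟨V, (oz z hzx hzy).trans (hs.right (hs'.left (d3' z V hzy hz))), .refl _⟩
    · intro z V hz; have hzx : z ≠ x := by rintro rfl; rw [xn.2] at hz; cases hz
      have hzy : z ≠ y := by grind
      exact ⟨V, (oz z hzx hzy).trans (hs.right (hs'.right hz)), .refl _⟩
    · intro z V hz hn
      by_cases hzx : z = x
      · grind
      by_cases hzy : z = y
      · grind
      grind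

end Mix

/-! ## Source configurations -/

namespace Mix

open Calculus (nu nuL parM parL)

/-- The process with the threads `C` and the restrictions `X`. -/
noncomputable def term (X : List ℕ) (C : Multiset AProc) : AProc :=
  (nuL X (parM C)).subst (ren (· / 3))

theorem Typing.par_left_comm {Γ : Ctx} {p q r : AProc} (h : Typing Γ (.par p (.par q r))) :
    Typing Γ (.par q (.par p r)) := by
  have .par hs h1 h2 := h; have .par hs' h2 h3 := h2; obtain ⟨Θ, s1, s2⟩ := hs.assoc hs'
  obtain ⟨Θ', s3, s4⟩ := s1.symm.assoc s2; exact .par s3.symm h2 (.par s4.symm h1 h3)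

theorem Typing.parL_perm {l l' : List AProc} (h : l.Perm l') {Γ : Ctx} (ht : Typing Γ (parL l)) :
    Typing Γ (parL l') := by
  induction h generalizing Γ with
  | nil => exact ht
  | cons p _ ih => have .par hs h1 h2 := ht; exact .par hs h1 (ih h2)
  | swap p q l => exact Typing.par_left_comm ht
  | trans _ _ ih1 ih2 => grind

theorem typing_parM_cons {Γ : Ctx} {p : AProc} {C : Multiset AProc} :
    Typing Γ (parM (p ::ₘ C)) ↔ Typing Γ (.par p (parM C)) := by
  have h : (p ::ₘ C).toList.Perm (p :: C.toList) := by
    rw [← Multiset.coe_eq_coe, coe_toList, ← Multiset.cons_coe, coe_toList]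
  exact ⟨fun ht => ht.parL_perm h, fun ht => Typing.parL_perm h.symm ht⟩

theorem typing_parM_cons_cons {Γ : Ctx} {p r : AProc} {C : Multiset AProc} :
    Typing Γ (parM (p ::ₘ r ::ₘ C)) ↔ Typing Γ (.par p (.par r (parM C))) := by
  rw [typing_parM_cons]
  constructor <;> intro h <;> cases h with
  | par hs h1 h2 => exact .par hs h1 (by first | exact typing_parM_cons.mp h2 | exact typing_parM_cons.mpr h2)

/-- The body of a restriction with the endpoints `a` and `co a` for the restricted names. -/
def openWith (a : ℕ) (p : AProc) : AProc := p.subst (cons2 a (co a) Val.var)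

theorem typing_open {Ξ : Ctx} {p r : AProc} (h : Typing Ξ (.par (.res p) r)) {a : ℕ} (hb : Bnd a)
    (ha : Ξ a = none) (ha' : Ξ (co a) = none) :
    ∃ T U, Dual T U ∧ Typing (update (update Ξ a (some T)) (co a) (some U))
      (.par (openWith a p) r) := by
  have @Typing.par _ Ξ₁ Ξ₂ _ _ hs h1 h2 := h; have .res T U hd h1 := h1; refine ⟨T, U, hd, ?_⟩
  have hne := co_ne hb
  have oa : update (update Ξ a (some T)) (co a) (some U) a = some T := by grind
  have oc : update (update Ξ a (some T)) (co a) (some U) (co a) = some U := by grind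
  have oz : ∀ z, z ≠ a → z ≠ co a →
      update (update Ξ a (some T)) (co a) (some U) z = Ξ z := by
    grind
  generalize update (update Ξ a (some T)) (co a) (some U) = Ξ' at oa oc oz
  have nA : ∀ {Θ : Ctx}, (∀ z T, Θ z = some T → Ξ z = some T) → Θ a = none ∧ Θ (co a) = none := by
    intro Θ hΘ; constructor
    · by_contra hn; obtain ⟨V, hV⟩ := exists_some hn; grind
    · by_contra hn; obtain ⟨V, hV⟩ := exists_some hn; grind
  obtain ⟨n1, n1'⟩ := nA fun z T h => hs.left h; obtain ⟨n2, n2'⟩ := nA fun z T h => hs.right h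
  have lift : ∀ {Θ : Ctx}, (∀ z T, Θ z = some T → Ξ z = some T) → ∀ z V, Θ z = some V →
      Ξ' z = some V := by
    grind
  refine .par (Γ₁ := Ctx.restr Ξ' fun z => z = a ∨ z = co a ∨ Ξ₁ z ≠ none)
    (Γ₂ := Ctx.restr Ξ' fun z => Ξ₂ z ≠ none) (split_restr fun z V hz hn => ?_) ?_ ?_
  · by_cases hza : z = a
    · grind
    by_cases hzc : z = co a
    · grind
    rw [oz z hza hzc] at hz; rcases hs.lin hz hn with ⟨e1, e2⟩ | ⟨e1, e2⟩
    · grind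
    grind
  · refine h1.subst ⟨fun x V hx => ?_, fun y V hy hn => ?_⟩
    · match x, hx with
      | 0, hx => cases hx; exact ⟨_, Ctx.restr_eq_some.mpr ⟨oa, .inr (.inl rfl)⟩, .refl _⟩
      | 1, hx => cases hx; exact ⟨_, Ctx.restr_eq_some.mpr ⟨oc, .inr (.inr (.inl rfl))⟩, .refl _⟩
      | x + 2, hx =>
        exact ⟨V, Ctx.restr_eq_some.mpr ⟨lift (fun z T h => hs.left h) x V hx,
          .inr (.inr (.inr (by change Ξ₁ x = _ at hx; grind)))⟩, .refl _⟩
    · obtain ⟨hy, hS⟩ := Ctx.restr_eq_some.mp hy; rcases hS.resolve_left hn with rfl | rfl | hS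
      · refine ⟨0, ⟨rfl, by simp [Ctx.cons]⟩, ?_⟩; rintro (_ | _ | m) ⟨e, hm⟩
        · rfl
        · simp only [cons2, Val.var.injEq] at e; grind
        · simp only [cons2, Val.var.injEq] at e; exact (hm (by rw [e]; exact n1)).elim
      · refine ⟨1, ⟨rfl, by simp [Ctx.cons]⟩, ?_⟩; rintro (_ | _ | m) ⟨e, hm⟩
        · simp only [cons2, Val.var.injEq] at e; grind
        · rfl
        · simp only [cons2, Val.var.injEq] at e; exact (hm (by rw [e]; exact n1')).elim
      · refine ⟨y + 2, ⟨rfl, hS⟩, ?_⟩; rintro (_ | _ | m) ⟨e, hm⟩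
        · simp only [cons2, Val.var.injEq] at e; grind
        · simp only [cons2, Val.var.injEq] at e; grind
        · simp only [cons2, Val.var.injEq] at e; rw [e]
  · exact h2.restr fun z V hz => ⟨V, lift (fun z T h => hs.right h) z V hz, .refl _⟩

/-- `Ξ` types the free names as `Γ` and the restrictions `X` with dual types. -/
structure CfgCtx (Γ : Ctx) (X : List ℕ) (Ξ : Ctx) : Prop where
  good : Good X
  free : ∀ k, Ξ (3 * k) = Γ k
  dom : ∀ z, Bnd z → Ξ z ≠ none → Hit X z
  dual : ∀ a, Hit X a → ∃ T U, Ξ a = some T ∧ Ξ (co a) = some U ∧ Dual T U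

/-- Well-typed configurations. -/
def WT (Γ : Ctx) (X : List ℕ) (C : Multiset AProc) : Prop :=
  ∃ Ξ, CfgCtx Γ X Ξ ∧ Typing Ξ (parM C)

theorem CfgCtx.congr {Γ : Ctx} {X : List ℕ} {Ξ Ξ' : Ctx} (h : CfgCtx Γ X Ξ) {a : ℕ} (ha : Hit X a)
    {T U : Ty} (hd : Dual T U) (h1 : Ξ' a = some T) (h2 : Ξ' (co a) = some U)
    (h3 : ∀ z, z ≠ a → z ≠ co a → Ξ' z = Ξ z) : CfgCtx Γ X Ξ' where
  good := h.good
  free k := by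
    rw [h3, h.free]
    · rintro rfl; exact ha.1 (by omega)
    · intro e; exact bnd_co ha.1 (by omega)
  dom z hb hz := by
    by_cases hza : z = a
    · grind
    by_cases hzc : z = co a
    · rw [hzc]; exact hit_co ha
    rw [h3 z hza hzc] at hz; exact h.dom z hb hz
  dual b hb := by
    by_cases hba : b = a
    · grind
    by_cases hbc : b = co a
    · rw [hbc, co_co ha.1]; exact ⟨U, T, h2, h1, hd.symm⟩
    obtain ⟨T', U', e1, e2, e3⟩ := h.dual b hb; refine ⟨T', U', by grind, ?_, e3⟩; rw [h3, e2]
    · intro e; exact hbc (by rw [← e, co_co hb.1])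
    · intro e; exact hba (by rw [← co_co hb.1, e, co_co ha.1])

theorem CfgCtx.none {Γ : Ctx} {X : List ℕ} {Ξ : Ctx} (h : CfgCtx Γ X Ξ) {a : ℕ} (hb : Bnd a)
    (ha : ¬ Hit X a) : Ξ a = none ∧ Ξ (co a) = none := by
  constructor
  · by_contra hn; exact ha (h.dom a hb hn)
  · by_contra hn; exact ha ((hit_co_iff hb).mp (h.dom _ (bnd_co hb) hn))

theorem CfgCtx.cons {Γ : Ctx} {X : List ℕ} {Ξ : Ctx} (h : CfgCtx Γ X Ξ) {a : ℕ} (hb : Bnd a)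
    (ha : ¬ Hit X a) {T U : Ty} (hd : Dual T U) :
    CfgCtx Γ (a :: X) (update (update Ξ a (some T)) (co a) (some U)) where
  good := good_cons.mpr ⟨hb, fun hm => ha ⟨hb, hm⟩, h.good⟩
  free k := by
    rw [update_of_ne, update_of_ne, h.free]
    · rintro rfl; exact hb (by omega)
    · intro e; exact bnd_co hb (by omega)
  dom z hbz hz := by
    rw [hit_cons hb]
    by_cases hza : z = a
    · grind
    by_cases hzc : z = co a
    · grind
    rw [update_of_ne hzc, update_of_ne hza] at hz; exact .inr (.inr (h.dom z hbz hz))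
  dual b hbh := by
    have hne := co_ne hb; rcases (hit_cons hb).mp hbh with rfl | rfl | hbX
    · grind
    · exact ⟨U, T, by grind, by rw [co_co hb, update_of_ne hne.symm, update_self], hd.symm⟩
    · obtain ⟨T', U', e1, e2, e3⟩ := h.dual b hbX; obtain ⟨n1, n2⟩ := h.none hb ha; grind

/-- The instances of a choice that remain after it was used. -/
def pers : Qual → AProc → Multiset AProc
  | .lin, _ => 0
  | .un, p => {p}

/-- Steps that only decompose the processes of a configuration. -/
inductive CFlat : List ℕ → Multiset AProc → List ℕ → Multiset AProc → Prop
  | par (X p r C) : CFlat X (.par p r ::ₘ C) X (p ::ₘ r ::ₘ C)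
  | inact (X C) : CFlat X (.inact ::ₘ C) X C
  | res {X a} (p C) : Bnd a → pid a % 2 = 0 → ¬ Hit X a →
      CFlat X (.res p ::ₘ C) (a :: X) (openWith a p ::ₘ C)

/-- Reductions of configurations. -/
inductive CAct : Multiset AProc → Multiset AProc → Prop
  | iteTrue (p r C) : CAct (.ite .tt p r ::ₘ C) (p ::ₘ C)
  | iteFalse (p r C) : CAct (.ite .ff p r ::ₘ C) (r ::ₘ C)
  | com {x q q₁ w n l a P q' q₁' w' n' l' a' P' i j v} (C) : Bnd x → a i = .send v →
      a' j = .recv → l i = l' j →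
      CAct (.choice q q₁ w (.var x) n l a P ::ₘ .choice q' q₁' w' (.var (co x)) n' l' a' P' ::ₘ C)
        (P i ::ₘ (P' j).subst (inst v) ::ₘ (pers q (.choice q q₁ w (.var x) n l a P) +
          (pers q' (.choice q' q₁' w' (.var (co x)) n' l' a' P') + C)))

theorem CFlat.wt {Γ : Ctx} {X X' : List ℕ} {C C' : Multiset AProc} (h : CFlat X C X' C')
    (hw : WT Γ X C) : WT Γ X' C' := by
  obtain ⟨Ξ, hc, ht⟩ := hw
  cases h with
  | par p r C =>
    refine ⟨Ξ, hc, typing_parM_cons_cons.mpr ?_⟩; have ht := typing_parM_cons.mp ht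
    have .par hs h1 h2 := ht; have .par hs' h1 h3 := h1
    obtain ⟨Θ, s1, s2⟩ := hs.symm.assoc hs'.symm; exact .par s1.symm h1 (.par s2.symm h3 h2)
  | inact C =>
    refine ⟨Ξ, hc, ?_⟩; have ht := typing_parM_cons.mp ht; have .par hs h1 h2 := ht
    have .inact hu := h1; rw [hs.symm.eq_left hu]; exact h2
  | res p C hb _ ha =>
    obtain ⟨n1, n2⟩ := hc.none hb ha
    obtain ⟨T, U, hd, h⟩ := typing_open (typing_parM_cons.mp ht) hb n1 n2
    exact ⟨_, hc.cons hb ha hd, typing_parM_cons.mpr h⟩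

theorem Typing.unCtx_of_choice {Γ : Ctx} {q' w x n l a P}
    (h : Typing Γ (.choice .un q' w x n l a P)) : UnCtx Γ := by
  obtain ⟨_, _, _, _, _, _, _, _, hu, _⟩ := h.choice_inv; grind

theorem typing_parM_pers {Ξ : Ctx} {q q' w x n l a P} {C : Multiset AProc}
    (h : Typing Ξ (parM (.choice q q' w x n l a P ::ₘ C))) :
    Typing Ξ (parM (.choice q q' w x n l a P ::ₘ (pers q (.choice q q' w x n l a P) + C))) := by
  cases q with
  | lin => simpa [pers] using h
  | un =>
    simp only [pers, singleton_add]
    exact typing_parM_cons_cons.mpr (typing_par_un (typing_parM_cons.mp h)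
      fun _ h => h.unCtx_of_choice)

theorem CAct.wt {Γ : Ctx} {X : List ℕ} {C C' : Multiset AProc} (h : CAct C C')
    (hw : WT Γ X C) : WT Γ X C' := by
  obtain ⟨Ξ, hc, ht⟩ := hw
  have hite : ∀ {v p r C}, Typing Ξ (parM (.ite v p r ::ₘ C)) →
      ∀ s, s = p ∨ s = r → v = .tt ∨ v = .ff → Typing Ξ (parM (s ::ₘ C)) := by
    intro v p r C ht s hs hv; rw [typing_parM_cons] at ht ⊢; have .par hs0 h1 h2 := ht
    have @Typing.ite _ Γ₁ Γ₂ _ _ _ hs1 hvt h3 h4 := h1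
    have hu : UnCtx Γ₁ := by rcases hv with rfl | rfl <;> cases hvt <;> grind
    rw [hs1.symm.eq_left hu] at hs0; rcases hs with rfl | rfl
    · exact .par hs0 h3 h2
    · exact .par hs0 h4 h2
  cases h with
  | iteTrue p r C => exact ⟨Ξ, hc, hite ht p (.inl rfl) (.inl rfl)⟩
  | iteFalse p r C => exact ⟨Ξ, hc, hite ht r (.inr rfl) (.inr rfl)⟩
  | @com x q q₁ w n l a P q' q₁' w' n' l' a' P' i j v C hb hi hj hl =>
    have h1 := typing_parM_pers ht; rw [add_cons, cons_swap] at h1; have h2 := typing_parM_pers h1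
    rw [add_cons, cons_swap] at h2; have h3 := typing_parM_cons_cons.mp h2
    have hx : Ξ x ≠ none := by
      have .par hs h1 h2 := h3; obtain ⟨_, T, _, _, _, e, hT, _⟩ := h1.choice_inv; cases e
      rw [hs.left hT]; simp
    have hX := hc.dom x hb hx; obtain ⟨T, U, e1, e2, hd⟩ := hc.dual x hX
    obtain ⟨Ξ', T', U', hd', f1, f2, f3, h4⟩ :=
      typing_par_com (co_ne hb).symm e1 e2 hd h3 hi hj hl
    refine ⟨Ξ', hc.congr hX hd' f1 f2 f3, ?_⟩; rw [← typing_parM_cons_cons] at h4; grind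

/-! ### Configurations and processes -/

open Classical in
theorem typing_nuL {Γ : Ctx} (X : List ℕ) {Ξ : Ctx} {p : AProc} (hg : Good X)
    (hd : ∀ a, Hit X a → ∃ T U, Ξ a = some T ∧ Ξ (co a) = some U ∧ Dual T U)
    (h : Typing Ξ p) (hΓ : ∀ z, Γ z = if Hit X z then none else Ξ z) : Typing Γ (nuL X p) := by
  induction X generalizing Γ with
  | nil =>
    have : Γ = Ξ := by funext z; rw [hΓ, if_neg not_hit_nil]
    rw [this]; exact h
  | cons a X ih =>
    obtain ⟨ha, g1, g2⟩ := good_cons.mp hg; have hn : ¬ Hit X a := fun hh => g1 hh.2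
    have hn' : ¬ Hit X (co a) := by rwa [hit_co_iff ha]
    have h1 := ih (Γ := fun z => if Hit X z then none else Ξ z) g2
      (fun b hb => hd b ((hit_cons ha).mpr (.inr (.inr hb)))) fun z => rfl
    obtain ⟨T, U, e1, e2, hdual⟩ := hd a ((hit_cons ha).mpr (.inl rfl))
    have o : ∀ z, z ≠ a → z ≠ co a → Γ z = if Hit X z then none else Ξ z := by
      intro z h1 h2; rw [hΓ, hit_cons ha]; grind
    refine .res T U hdual (h1.subst ⟨fun x V hx => ?_, fun y V hy hu => ?_⟩)
    · simp only [abs2]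
      by_cases hxa : x = a
      · subst hxa; dsimp only at hx; rw [if_neg hn, e1] at hx; cases hx
        rw [if_pos rfl]; exact ⟨T, rfl, .refl _⟩
      by_cases hxc : x = co a
      · subst hxc; dsimp only at hx; rw [if_neg hn', e2] at hx; cases hx
        rw [if_neg hxa, if_pos rfl]; exact ⟨U, rfl, .refl _⟩
      rw [if_neg hxa, if_neg hxc]; exact ⟨V, (o x hxa hxc).trans hx, .refl _⟩
    · match y, hy with
      | 0, hy =>
        refine ⟨a, ⟨by simp [abs2], by grind⟩, ?_⟩; rintro x ⟨e, -⟩; simp only [abs2] at e; grind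
      | 1, hy =>
        refine ⟨co a, ⟨by simp [abs2, co_ne ha], by grind⟩, ?_⟩; rintro x ⟨e, -⟩
        simp only [abs2] at e; grind
      | y + 2, hy =>
        change Γ y = _ at hy
        have hya : y ≠ a := by
          rintro rfl; rw [hΓ, if_pos ((hit_cons ha).mpr (.inl rfl))] at hy; cases hy
        have hyc : y ≠ co a := by
          rintro rfl; rw [hΓ, if_pos ((hit_cons ha).mpr (.inr (.inl rfl)))] at hy; cases hy
        refine ⟨y, ⟨by simp [abs2, hya, hyc], ?_⟩, ?_⟩
        · grind
        · rintro x ⟨e, -⟩; simp only [abs2] at e; grind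

theorem WT.typing_nuL {Γ : Ctx} {X : List ℕ} {C : Multiset AProc} (h : WT Γ X C) :
    ∃ Γ', Typing Γ' (nuL X (parM C)) ∧ (∀ z V, Γ' z = some V → z = 3 * (z / 3) ∧ Γ (z / 3) = some V) ∧
      ∀ y, Γ' (3 * y) = Γ y := by
  classical
  obtain ⟨Ξ, hc, ht⟩ := h
  refine ⟨fun z => if Hit X z then none else Ξ z, Mix.typing_nuL X hc.good hc.dual ht fun z => rfl,
    fun z V hz => ?_, fun y => ?_⟩
  · dsimp only at hz
    split_ifs at hz with hh
    have hb : ¬ Bnd z := fun hb => hh (hc.dom z hb (by grind))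
    have e : z = 3 * (z / 3) := by unfold Bnd at hb; omega
    refine ⟨e, ?_⟩; rw [← hc.free, ← e, hz]
  · have hnh : ¬ Hit X (3 * y) := fun hh => hh.1 (by omega); simp [hnh, hc.free]

theorem WT.typing {Γ : Ctx} {X : List ℕ} {C : Multiset AProc} (h : WT Γ X C) :
    Typing Γ (term X C) := by
  obtain ⟨Γ', h1, h3, h4⟩ := h.typing_nuL
  refine h1.subst ⟨fun x V hx => ⟨V, (h3 x V hx).2, .refl _⟩, fun y V hy hn => ?_⟩
  refine ⟨3 * y, ⟨by simp [ren], by grind⟩, ?_⟩; rintro x ⟨e, hx⟩; obtain ⟨V', hV⟩ := exists_some hx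
  have := (h3 x V' hV).1; simp only [ren, Val.var.injEq] at e; omega

theorem WT.start {Γ : Ctx} {p : AProc} (h : Typing Γ p) : WT Γ [] {p.subst (ren (3 * ·))} := by
  refine ⟨fun z => if z % 3 = 0 then Γ (z / 3) else none, ⟨good_nil, fun k => ?_, fun z hb hz => ?_,
    fun a ha => (not_hit_nil ha).elim⟩, ?_⟩
  · simp
  · exact (hz (if_neg hb)).elim
  · refine typing_parM_cons.mpr (.par (split_unit _) (h.subst ⟨fun x T hx => ?_, fun y T hy _ => ?_⟩) ?_)
    · exact ⟨T, by grind, .refl _⟩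
    · dsimp only at hy
      split_ifs at hy with h3
      refine ⟨y / 3, ⟨by simp only [ren, Val.var.injEq]; omega, by grind⟩, ?_⟩; rintro x ⟨e, -⟩
      simp only [ren, Val.var.injEq] at e; omega
    · rw [Calculus.parM_zero]; exact .inact (unCtx_restr_false _)

theorem term_cong {X : List ℕ} {C D : Multiset AProc}
    (h : Calculus.Cong (parM C) (parM D)) : Cong (term X C).src (term X D).src :=
  Calculus.cong_subst (P := AProc) _ (Calculus.nuL_cong X h)

theorem CFlat.cong {Γ : Ctx} {X X' : List ℕ} {C C' : Multiset AProc} (h : CFlat X C X' C')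
    (hw : WT Γ X C) : Cong (term X C).src (term X' C').src := by
  obtain ⟨Ξ, hc, ht⟩ := hw
  cases h with
  | par p r C => exact term_cong (Calculus.parM_par p r C)
  | inact => exact term_cong (Calculus.parM_inact (P := AProc) _)
  | @res a p C hb _ ha =>
    obtain ⟨n1, n2⟩ := hc.none hb ha; have ht := typing_parM_cons.mp ht
    have hg : Good (a :: X) := good_cons.mpr ⟨hb, fun hm => ha ⟨hb, hm⟩, hc.good⟩
    refine Calculus.cong_subst (P := AProc) _ ?_
    refine Calculus.trans ?_ (Calculus.nuL_perm (P := AProc)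
      (List.perm_append_comm (l₁ := X) (l₂ := [a]))
      (hg.perm (List.perm_append_comm (l₁ := [a]) (l₂ := X))) _)
    rw [Calculus.nuL_append]; refine Calculus.nuL_cong X ?_; change Calculus.Cong _ (nu a _)
    have @Typing.par _ Ξ₁ Ξ₂ _ _ hs h1 h2 := ht; have .res T U hd h1 := h1
    have e : AProc.res p = nu a (openWith a p) := by
      refine Calculus.res_eq_nu (P := AProc) p ?_; change AProc.subst _ p = p
      rw [h1.subst_congr (τ := Val.var), AProc.subst_var]; intro x hx
      match x, hx with
      | 0, _ => simp [scomp, cons2, Val.subst, abs2]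
      | 1, _ => simp [scomp, cons2, Val.subst, abs2, co_ne hb]
      | x + 2, hx =>
        have e1 : x ≠ a := by
          rintro rfl; obtain ⟨V, hV⟩ := exists_some hx; rw [hs.left hV] at n1; cases n1
        have e2 : x ≠ co a := by
          rintro rfl; obtain ⟨V, hV⟩ := exists_some hx; rw [hs.left hV] at n2; cases n2
        simp [scomp, cons2, Val.subst, abs2, e1, e2]
    have hf : Calculus.Fresh a (parM C) := by
      refine h2.subst_congr fun x hx => ?_
      have e1 : x ≠ a := by
        rintro rfl; obtain ⟨V, hV⟩ := exists_some hx; rw [hs.right hV] at n1; cases n1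
      have e2 : x ≠ co a := by
        rintro rfl; obtain ⟨V, hV⟩ := exists_some hx; rw [hs.right hV] at n2; cases n2
      simp [abs2, e1, e2, wk, ren]
    refine Calculus.trans (Calculus.parM_cons _ _) ?_; rw [e]
    refine Calculus.trans (Calculus.parComm _ _) (Calculus.trans (Calculus.par_nu hf _) ?_)
    exact Calculus.nu_cong a (Calculus.trans (Calculus.parComm _ _)
      (Calculus.symm (Calculus.parM_cons _ _)))

theorem Red.nuL (X : List ℕ) {p r : AProc} (h : Red p.src r.src) :
    Red (nuL X p).src (nuL X r).src := by
  induction X with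
  | nil => exact h
  | cons a X ih =>
    change Red (.res (AProc.subst _ _).src) (.res (AProc.subst _ _).src)
    rw [AProc.src_subst, AProc.src_subst]; exact .res (ih.subst _)

theorem cong_parM_cons (p : AProc) (C : Multiset AProc) :
    Cong (parM (p ::ₘ C)).src (.par p.src (parM C).src) :=
  Calculus.parM_cons p C

theorem parM_pers (q : Qual) (A p : AProc) (C : Multiset AProc) :
    Cong (parM (p ::ₘ (pers q A + C))).src (.par (persist q A.src p.src) (parM C).src) := by
  cases q with
  | lin => simp only [pers, zero_add]; exact cong_parM_cons p C
  | un =>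
    simp only [pers, singleton_add]
    exact Cong.trans (cong_parM_cons p _) (.trans (.par (.refl _) (cong_parM_cons A C))
      (.parAssoc _ _ _))

theorem CAct.red {Γ : Ctx} {X : List ℕ} {C C' : Multiset AProc} (h : CAct C C')
    (hw : WT Γ X C) : Red (term X C).src (term X C').src := by
  obtain ⟨Ξ, hc, ht⟩ := hw; unfold term; rw [AProc.src_subst, AProc.src_subst]
  refine Red.subst _ ?_
  cases h with
  | iteTrue p r C =>
    exact .nuL X (.struct (cong_parM_cons _ _) (.par _ (.iteTrue _ _)) (.symm (cong_parM_cons _ _)))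
  | iteFalse p r C =>
    exact .nuL X (.struct (cong_parM_cons _ _) (.par _ (.iteFalse _ _))
      (.symm (cong_parM_cons _ _)))
  | @com x q q₁ w n l a P q' q₁' w' n' l' a' P' i j v C hb hi hj hl =>
    have hx : Hit X x := by
      refine hc.dom x hb ?_; have .par hs h1 h2 := typing_parM_cons.mp ht
      obtain ⟨_, T, _, _, _, e, hT, _⟩ := h1.choice_inv; cases e; rw [hs.left hT]; simp
    obtain ⟨Y, hY⟩ := Calculus.nuL_last (P := AProc) hc.good hx
    refine .struct (hY _) (.nuL Y (r := nu x _) ?_) (.symm (hY _))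
    change Red (.res (AProc.subst _ _).src) (.res (AProc.subst _ _).src)
    rw [AProc.src_subst, AProc.src_subst]
    have h0 : Val.subst (abs2 x (co x)) (.var x) = .var 0 := by simp [Val.subst, abs2]
    have h1 : Val.subst (abs2 x (co x)) (.var (co x)) = .var 1 := by
      simp [Val.subst, abs2, co_ne hb]
    refine .struct (.res (.subst _ (.trans (cong_parM_cons _ _)
      (.par (.refl _) (cong_parM_cons _ _))))) ?_
      (.res (.subst (P := .par (persist q (AProc.choice q q₁ w (.var x) n l a P).src (P i).src)
        (.par (persist q' (AProc.choice q' q₁' w' (.var (co x)) n' l' a' P').src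
          ((P' j).subst (inst v)).src) (parM C).src)) _ (.symm ?_)))
    · simp only [Proc.subst, persist_subst, AProc.src, h0, h1, AProc.src_subst]
      rw [Proc.subst_subst, scomp_inst, ← Proc.subst_subst]
      have h := Red.com (q := q) (q' := q') (a := fun i => (a i).subst (abs2 x (co x)))
        (a' := fun i => (a' i).subst (abs2 x (co x)))
        (P := fun i => (P i).src.subst ((a i).under (abs2 x (co x))))
        (P' := fun i => (P' i).src.subst ((a' i).under (abs2 x (co x))))
        ((parM C).src.subst (abs2 x (co x))) i j (v.subst (abs2 x (co x)))
        (by simp [hi, Act.subst]) (by simp [hj, Act.subst]) hl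
      simpa only [hi, hj, Act.under] using h
    · rw [← add_cons]; exact (parM_pers _ _ _ _).trans (.par (.refl _) (parM_pers _ _ _ _))

end Mix

/-! ## States of the translation

A state is a multiset of components. Each of them represents processes of the source
configuration, and the threads of the target that implement them. Restrictions of the source have
endpoints with an even index, those that the translation adds have an odd one. -/

namespace Encoding

open CMV CMV.Proc

section

variable {n : ℕ} (l : Fin (n + 1) → ℕ) (a : Fin (n + 1) → Act) (E : Fin (n + 1) → CMV.Proc)

theorem wkAct_subst_eq {k : ℕ} {τ : ℕ → Val} (h : scomp τ (wk k) = Val.var) :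
    (fun i => (wkAct a k i).subst τ) = a := by
  funext i; rw [wkAct, Act.subst_subst, h, Act.subst_var]

theorem wkCont_subst_eq {k : ℕ} {τ : ℕ → Val} (h : scomp τ (wk k) = Val.var) :
    (fun i => (wkCont a E k i).subst ((wkAct a k i).under τ)) = E := by
  funext i; have : (wkAct a k i).under τ = (a i).under τ := by unfold wkAct; cases a i <;> rfl
  rw [wkCont, this, CMV.Proc.subst_subst, ← Act.under_scomp, h, Act.under_var, CMV.Proc.subst_var]

theorem duplicates_wk_subst {k : ℕ} {τ : ℕ → Val} (h : scomp τ (wk k) = Val.var) (f : Pol → Pol)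
    (b : Label) (c : Val) :
    (duplicates l (wkAct a k) (wkCont a E k) f b c).subst τ = duplicates l a E f b (c.subst τ) := by
  rw [duplicates_subst, wkAct_subst_eq a h, wkCont_subst_eq a E h]

theorem extLin_wk_subst {k : ℕ} {τ : ℕ → Val} (h : scomp τ (wk k) = Val.var) (c : Val) :
    (extLin l (wkAct a k) (wkCont a E k) c).subst τ = extLin l a E (c.subst τ) := by
  rw [extLin_subst, wkAct_subst_eq a h, wkCont_subst_eq a E h]

/-- The name `u` in the continuation of a branch. -/
def nameIn (u : ℕ) : Act → Val
  | .send _ => .var u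
  | .recv => .var (u + 1)

theorem openWith_loop (x : Val) (u : ℕ) :
    CMV.openWith u (par (out (.var 0) .unit inact) (inp .un (.var 1)
      (intUn l (wkAct a 3) (fun i => par (wkCont a E 3 i) (out (loopName (a i)) .unit inact))
        (x.subst (wk 3))))) =
    par (out (.var u) .unit inact) (inp .un (.var (co u))
      ((intUn l a (fun i => par (E i) (out (nameIn u (a i)) .unit inact)) x).subst (wk 1))) := by
  have h : scomp (up (cons2 u (co u) Val.var)) (wk 3) = wk 1 := by funext n; rfl
  simp only [CMV.openWith, CMV.Proc.subst, intUn_subst, Val.subst_subst, h]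
  congr 3
  · funext i; rw [wkAct, Act.subst_subst, h]
  · funext i
    have : (wkAct a 3 i).under (up (cons2 u (co u) Val.var)) =
        (a i).under (up (cons2 u (co u) Val.var)) := by unfold wkAct; cases a i <;> rfl
    rw [this, wkCont, CMV.Proc.subst_subst, ← Act.under_scomp, h]
    congr 2
    cases a i <;> rfl

theorem openWith_intUn (x : Val) (k : Label) {e : ℕ} (he : Bnd e) :
    CMV.openWith (co e) (out (x.subst (wk 2)) (.var 0)
      (sel (.var 1) k (duplicates l (wkAct a 2) (wkCont a E 2) id k (.var 1)))) =
    out x (.var (co e)) (sel (.var e) k (duplicates l a E id k (.var e))) := by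
  have h := scomp_cons2_wk (co e) (co (co e)) Val.var
  simp only [CMV.openWith, CMV.Proc.subst, duplicates_wk_subst l a E h, Val.subst_subst, h,
    Val.subst_var]
  simp only [Val.subst, cons2, co_co he]

theorem extUn_inst (v : Val) :
    (extLin l (wkAct a 1) (wkCont a E 1) (.var 0)).subst (inst v) = extLin l a E v :=
  extLin_wk_subst l a E (scomp_inst_wk v) _

/-- One side of a session: the choice among the branches with the label `k`, or the branch
chosen. -/
noncomputable def side (f : Pol → Pol) (k : Label) (e : ℕ) : Option (Fin (n + 1)) → CMV.Proc
  | none => duplicates l a E f k (.var e)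
  | some i => prefixOn (.var e) (E i) (a i)

end

end Encoding

namespace Mix

open Calculus (nu nuL parM parL)
open Encoding
open CMV (Label ConfG GStep)

/-- Choices on names. -/
structure Ch : Type where
  q : Qual
  q' : Qual
  w : View
  x : ℕ
  n : ℕ
  l : Fin (n + 1) → ℕ
  a : Fin (n + 1) → Act
  P : Fin (n + 1) → AProc

namespace Ch

def proc (A : Ch) : AProc := .choice A.q A.q' A.w (.var A.x) A.n A.l A.a A.P

/-- The continuation of a branch; with a name `u`, it also restarts the loop of this name. -/
noncomputable def cont (A : Ch) : Option ℕ → Fin (A.n + 1) → CMV.Proc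
  | none, i => (A.P i).enc
  | some u, i => .par (A.P i).enc (.out (nameIn u (A.a i)) .unit .inact)

/-- The internal choice `A`. -/
noncomputable def int (A : Ch) (uo : Option ℕ) : CMV.Proc :=
  match A.q' with
  | .lin => intLin A.l A.a (A.cont uo) (.var A.x)
  | .un => intUn A.l A.a (A.cont uo) (.var A.x)

/-- The external choice `B`. -/
noncomputable def ext (B : Ch) : CMV.Proc :=
  match B.q' with
  | .lin => extLin B.l B.a (B.cont none) (.var B.x)
  | .un => extUn B.l B.a (B.cont none) B.q (.var B.x)

/-- The loop of an unrestricted internal choice. -/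
noncomputable def server (A : Ch) (u : ℕ) : CMV.Proc :=
  .inp .un (.var (co u)) ((intUn A.l A.a (A.cont (some u)) (.var A.x)).subst (wk 1))

noncomputable def servers (A : Ch) : Option ℕ → Multiset CMV.Proc
  | none => 0
  | some u => {A.server u}

/-- The selection of `k` on the endpoint `e`. -/
noncomputable def select (A : Ch) (uo : Option ℕ) (k : Label) (e : ℕ) : CMV.Proc :=
  .sel (.var e) k (duplicates A.l A.a (A.cont uo) id k (.var e))

/-- The internal choice `A` after it has chosen the label `k`. -/
noncomputable def request (A : Ch) (uo : Option ℕ) (k : Label) (e : ℕ) : CMV.Proc :=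
  match A.q' with
  | .lin => A.select uo k e
  | .un => .out (.var A.x) (.var (co e)) (A.select uo k e)

/-- The labels of an internal choice. -/
def intLabels (A : Ch) : Finset Label := labels A.l A.a id

/-- The labels of an external choice. -/
def extLabels (A : Ch) : Finset Label := labels A.l A.a Pol.dual

end Ch

/-- Components: a process, a conditional, an external choice; a waiting loop; an internal choice, one
that has chosen the label `k`, one that has contacted the external choice `B`, and one that
communicates with `B`, where some of the two have chosen a branch. -/
inductive Comp : Type
  | idle (p : AProc)
  | cond (v : Val) (p r : AProc)
  | ext (B : Ch)
  | token (A : Ch) (u : ℕ)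
  | int (A : Ch) (uo : Option ℕ)
  | pend (A : Ch) (uo : Option ℕ) (k : Label) (e : ℕ)
  | contact (A : Ch) (uo : Option ℕ) (B : Ch) (k : Label) (e : ℕ)
  | flight (A : Ch) (uo : Option ℕ) (B : Ch) (k : Label) (e : ℕ) (i : Option (Fin (A.n + 1)))
      (j : Option (Fin (B.n + 1)))

/-- The threads of a component. -/
noncomputable def Comp.thr : Comp → Multiset CMV.Proc
  | idle p => {p.enc}
  | cond v p r => {.ite v p.enc r.enc}
  | ext B => {B.ext}
  | token A u => .out (.var u) .unit .inact ::ₘ {A.server u}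
  | int A uo => A.int uo ::ₘ A.servers uo
  | pend A uo k e => A.request uo k e ::ₘ A.servers uo
  | contact A uo B k e =>
      A.select uo k e ::ₘ extLin B.l B.a (B.cont none) (.var (co e)) ::ₘ A.servers uo
  | flight A uo B k e i j => side A.l A.a (A.cont uo) id k e i ::ₘ
      side B.l B.a (B.cont none) Pol.dual k (co e) j ::ₘ A.servers uo

/-- The external choice `B` remains if it is unrestricted. -/
def extPers (B : Ch) : Multiset Comp :=
  match B.q with
  | .lin => 0
  | .un => {.ext B}

/-- The loop is ready again. -/
def again (A : Ch) : Option ℕ → Multiset Comp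
  | none => 0
  | some u => {.token A u}

/-- Private endpoints. -/
def Priv (e : ℕ) : Prop := Bnd e ∧ pid e % 2 = 1

/-- `LStep V ds N V' ds'`: the threads of `ds` reduce to `N`, which are the threads of `ds'`;
the lists are the private endpoints. -/
inductive LStep (V : List ℕ) : Multiset Comp → Multiset CMV.Proc → List ℕ → Multiset Comp → Prop
  | condT (p r) : LStep V {.cond .tt p r} {p.enc} V {.idle p}
  | condF (p r) : LStep V {.cond .ff p r} {r.enc} V {.idle r}
  | trig (A : Ch) {u} : A.q' = .un → Bnd u →
      LStep V {.token A u} (.inact ::ₘ {.par (A.int (some u)) (A.server u)}) V {.int A (some u)}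
  | pickL (A : Ch) (uo) {k} : A.q' = .lin → k ∈ A.intLabels →
      LStep V {.int A uo} (A.select uo k A.x ::ₘ A.servers uo) V {.pend A uo k A.x}
  | pickU (A : Ch) (uo) {k e} : A.q' = .un → k ∈ A.intLabels → Priv e → ¬ Hit V e →
      LStep V {.int A uo} (.res (.out ((Val.var A.x).subst (wk 2)) (.var 0)
        (.sel (.var 1) k (duplicates A.l (wkAct A.a 2) (wkCont A.a (A.cont uo) 2) id k (.var 1))))
          ::ₘ A.servers uo) (e :: V) {.pend A uo k e}
  | meetL (A : Ch) (uo) (B : Ch) {k} : A.q' = .lin → B.q' = .lin → B.q = .lin → Bnd A.x → B.x = co A.x →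
      k ∈ B.extLabels → LStep V (.pend A uo k A.x ::ₘ {.ext B})
        (duplicates A.l A.a (A.cont uo) id k (.var A.x) ::ₘ
          duplicates B.l B.a (B.cont none) Pol.dual k (.var B.x) ::ₘ A.servers uo) V
        {.flight A uo B k A.x none none}
  | meetU (A : Ch) (uo) (B : Ch) {k e} : A.q' = .un → B.q' = .un → Bnd A.x → B.x = co A.x →
      LStep V (.pend A uo k e ::ₘ {.ext B})
        (A.select uo k e ::ₘ CMV.persist B.q B.ext (extLin B.l B.a (B.cont none) (.var (co e))) ::ₘ
          A.servers uo) V (.contact A uo B k e ::ₘ extPers B)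
  | enter (A : Ch) (uo) (B : Ch) {k e} : Bnd e → k ∈ B.extLabels →
      LStep V {.contact A uo B k e}
        (duplicates A.l A.a (A.cont uo) id k (.var e) ::ₘ
          duplicates B.l B.a (B.cont none) Pol.dual k (.var (co e)) ::ₘ A.servers uo) V
        {.flight A uo B k e none none}
  | left (A : Ch) (uo) (B : Ch) {k e i} (j) : Label.tag (A.l i) (A.a i).pol = k →
      LStep V {.flight A uo B k e none j} (.flight A uo B k e (some i) j : Comp).thr V
        {.flight A uo B k e (some i) j}
  | right (A : Ch) (uo) (B : Ch) {k e j} (i) : Label.tag (B.l j) (B.a j).pol.dual = k →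
      LStep V {.flight A uo B k e i none} (.flight A uo B k e i (some j) : Comp).thr V
        {.flight A uo B k e i (some j)}
  | comL (A : Ch) (uo) (B : Ch) {k e i j v} : Bnd e → A.a i = .send v → B.a j = .recv →
      LStep V {.flight A uo B k e (some i) (some j)}
        (A.cont uo i ::ₘ (B.P j).enc.subst (inst v) ::ₘ A.servers uo) V
        (.idle (A.P i) ::ₘ .idle ((B.P j).subst (inst v)) ::ₘ again A uo)
  | comR (A : Ch) (uo) (B : Ch) {k e i j v} : Bnd e → A.a i = .recv → B.a j = .send v →
      LStep V {.flight A uo B k e (some i) (some j)}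
        ((A.cont uo i).subst (inst v) ::ₘ (B.P j).enc ::ₘ A.servers uo) V
        (.idle ((A.P i).subst (inst v)) ::ₘ .idle (B.P j) ::ₘ again A uo)

/-- The threads of a multiset of components. -/
noncomputable def thr (D : Multiset Comp) : Multiset CMV.Proc := D.bind Comp.thr

theorem thr_add (D E : Multiset Comp) : thr (D + E) = thr D + thr E := Multiset.add_bind _ _ _

theorem thr_cons (d : Comp) (D : Multiset Comp) : thr (d ::ₘ D) = d.thr + thr D :=
  Multiset.cons_bind _ _ _

theorem thr_zero : thr 0 = 0 := rfl

theorem thr_singleton (d : Comp) : thr {d} = d.thr := Multiset.singleton_bind _ _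

theorem int_lin {A : Ch} (h : A.q' = .lin) (uo : Option ℕ) :
    A.int uo = ndc A.intLabels fun k => A.select uo k A.x := by
  unfold Ch.int; rw [h]; rfl

theorem int_un {A : Ch} (h : A.q' = .un) (uo : Option ℕ) :
    A.int uo = intUn A.l A.a (A.cont uo) (.var A.x) := by
  unfold Ch.int; rw [h]

theorem ext_lin {A : Ch} (h : A.q' = .lin) :
    A.ext = extLin A.l A.a (A.cont none) (.var A.x) := by
  unfold Ch.ext; rw [h]

theorem ext_un {A : Ch} (h : A.q' = .un) :
    A.ext = extUn A.l A.a (A.cont none) A.q (.var A.x) := by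
  unfold Ch.ext; rw [h]

theorem request_lin {A : Ch} (h : A.q' = .lin) (uo : Option ℕ) (k : Label) (e : ℕ) :
    A.request uo k e = A.select uo k e := by
  unfold Ch.request; rw [h]

theorem request_un {A : Ch} (h : A.q' = .un) (uo : Option ℕ) (k : Label) (e : ℕ) :
    A.request uo k e = .out (.var A.x) (.var (co e)) (A.select uo k e) := by
  unfold Ch.request; rw [h]

theorem server_inst {A : Ch} (h : A.q' = .un) (u : ℕ) :
    ((intUn A.l A.a (A.cont (some u)) (.var A.x)).subst (wk 1)).subst (inst .unit) =
      A.int (some u) := by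
  rw [CMV.Proc.subst_subst, scomp_inst_wk, CMV.Proc.subst_var, int_un h]

theorem _root_.CMV.GStep.add {M N : Multiset CMV.Proc} (h : GStep M N) (R : Multiset CMV.Proc) :
    GStep (M + R) (N + R) := by
  cases h with
  | pre h => exact .pre (h.add R)
  | ndc P S hl => simp only [cons_add]; exact .ndc _ _ hl

theorem side_step {n : ℕ} (l : Fin (n + 1) → ℕ) (a : Fin (n + 1) → Act)
    (E : Fin (n + 1) → CMV.Proc) (f : Pol → Pol) {k : Label} (e : ℕ) {i : Fin (n + 1)}
    (h : Label.tag (l i) (f (a i).pol) = k) (R : Multiset CMV.Proc) :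
    GStep (side l a E f k e none ::ₘ R) (side l a E f k e (some i) ::ₘ R) := by
  have h1 : Label.idx i.1 ∈ (Finset.univ.filter fun i => Label.tag (l i) (f (a i).pol) = k).image
      fun i => Label.idx i.1 :=
    Finset.mem_image_of_mem _ (Finset.mem_filter.mpr ⟨Finset.mem_univ _, h⟩)
  have h2 := GStep.ndc (fun
      | .idx j => prefixOn (.var e) (E (Fin.ofNat (n + 1) j)) (a (Fin.ofNat (n + 1) j))
      | .tag _ _ => .inact) R h1
  have h3 : Fin.ofNat (n + 1) i.1 = i := by ext; simp [Fin.ofNat, Nat.mod_eq_of_lt i.2]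
  simp only [h3] at h2; exact h2

theorem LStep.gstep {V V' : List ℕ} {ds ds' : Multiset Comp} {N : Multiset CMV.Proc}
    (h : LStep V ds N V' ds') : GStep (thr ds) N := by
  cases h with
  | condT p r => rw [thr_singleton]; exact .pre (.iteTrue _ _ 0)
  | condF p r => rw [thr_singleton]; exact .pre (.iteFalse _ _ 0)
  | trig A h hb => rw [thr_singleton, ← server_inst h]; exact .pre (.com .un .unit .inact _ 0 hb)
  | pickL A uo h hk =>
    rw [thr_singleton, Comp.thr, int_lin h]; exact .ndc (fun k => A.select uo k A.x) _ hk
  | @pickU A uo k _ h hk _ _ =>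
    rw [thr_singleton, Comp.thr, int_un h]
    exact .ndc (fun k => .res (.out ((Val.var A.x).subst (wk 2)) (.var 0)
        (.sel (.var 1) k (duplicates A.l (wkAct A.a 2) (wkCont A.a (A.cont uo) 2) id k (.var 1)))))
       _ hk
  | @meetL A uo B k h h' _ hb hx hk =>
    rw [thr_cons, thr_singleton, Comp.thr, Comp.thr, request_lin h, ext_lin h', hx,
      cons_add, add_comm, singleton_add]
    exact .pre (.case _ _ _ ⟨k, hk⟩ hb)
  | @meetU A uo B k e h h' hb hx =>
    rw [thr_cons, thr_singleton, Comp.thr, Comp.thr, request_un h, ext_un h', hx,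
      cons_add, add_comm, singleton_add, ← extUn_inst]
    exact .pre (.com _ _ _ _ _ hb)
  | @enter A uo B k e hb hk => rw [thr_singleton]; exact .pre (.case _ _ _ ⟨k, hk⟩ hb)
  | left A uo B j hk => rw [thr_singleton]; exact side_step _ _ _ _ _ hk _
  | right A uo B i hk =>
    rw [thr_singleton, Comp.thr, Comp.thr, cons_swap, cons_swap (side A.l _ _ _ _ _ _)]
    exact side_step _ _ _ _ _ hk _
  | comL A uo B hb hi hj =>
    rw [thr_singleton]; simp only [Comp.thr, side, hi, hj, prefixOn]
    exact .pre (.com .lin _ _ _ _ hb)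
  | @comR A uo B k e i j v hb hi hj =>
    rw [thr_singleton]; simp only [Comp.thr, side, hi, hj, prefixOn]
    rw [cons_swap, cons_swap (CMV.Proc.subst _ _)]
    have h := CMV.Pre.com (a := co e) .lin v (B.P j).enc (A.cont uo i) (A.servers uo) (bnd_co hb)
    rw [co_co hb] at h; exact .pre h

/-! ### Normalization of threads -/

theorem _root_.CMV.confG_par {T P Q : CMV.Proc} {Z M} (h : ConfG T Z (.par P Q ::ₘ M)) :
    ConfG T Z (P ::ₘ Q ::ₘ M) := by
  obtain ⟨G, hG, h⟩ := h; refine ⟨G, hG, ?_⟩; simp only [cons_add] at h ⊢; exact CMV.conf_par.mp h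

theorem _root_.CMV.confG_inact {T : CMV.Proc} {Z M} (h : ConfG T Z (.inact ::ₘ M)) :
    ConfG T Z M := by
  obtain ⟨G, hG, h⟩ := h; refine ⟨G, hG, ?_⟩; simp only [cons_add] at h; exact CMV.conf_inact.mp h

theorem _root_.CMV.ConfG.open {T P : CMV.Proc} {Z M} (h : ConfG T Z (.res P ::ₘ M)) {a : ℕ}
    (ha : Bnd a) (hZ : ¬ Hit Z a) : ConfG T (a :: Z) (CMV.openWith a P ::ₘ M) := by
  obtain ⟨G, hG, h⟩ := h; refine ⟨G, hG, ?_⟩; simp only [cons_add] at h ⊢; exact h.open ha hZ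

theorem _root_.CMV.ConfG.relist {T : CMV.Proc} {Z Z' M} (h : ConfG T Z M) (hZ : Good Z')
    (hh : ∀ n, Hit Z n → Hit Z' n) : ConfG T Z' M := by
  obtain ⟨G, hG, h⟩ := h; exact ⟨G, hG, h.relist hZ fun _ _ n _ => hh n⟩

theorem _root_.CMV.ConfG.good {T : CMV.Proc} {Z M} (h : ConfG T Z M) : Good Z := by
  obtain ⟨G, hG, h⟩ := h; exact h.1

theorem good_middle {X V : List ℕ} {e : ℕ} (h : Good (X ++ V)) (he : Bnd e)
    (hX : ¬ Hit X e) (hV : ¬ Hit V e) : Good (X ++ e :: V) := by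
  refine Good.perm (X := e :: (X ++ V)) List.perm_middle.symm (good_cons.mpr ⟨he, fun hm => ?_, h⟩)
  rw [List.map_append, List.mem_append] at hm
  exact hm.elim (fun hm => hX ⟨he, hm⟩) fun hm => hV ⟨he, hm⟩

theorem _root_.CMV.ConfG.open_middle {T P : CMV.Proc} {X V M} (h : ConfG T (X ++ V) (.res P ::ₘ M))
    {e a : ℕ} (he : Bnd e) (ha : a = e ∨ a = co e) (hX : ¬ Hit X e) (hV : ¬ Hit V e) :
    ConfG T (X ++ e :: V) (CMV.openWith a P ::ₘ M) := by
  have hb : Bnd a := by rcases ha with rfl | rfl; exacts [he, bnd_co he]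
  have hZ : ¬ Hit (X ++ V) e := by rw [hit_append]; grind
  have hZa : ¬ Hit (X ++ V) a := by
    rcases ha with rfl | rfl
    · exact hZ
    · rwa [hit_co_iff he]
  refine (h.open hb hZa).relist (good_middle h.good he hX hV) fun n hn => ?_
  rw [hit_perm (List.perm_middle (l₁ := X) (l₂ := V) (a := e)), hit_cons he]
  rcases (hit_cons hb).mp hn with rfl | rfl | hn
  · grind
  · rcases ha with rfl | rfl
    · grind
    · exact .inl (co_co he)
  grind

theorem LStep.norm {V V' : List ℕ} {ds ds' : Multiset Comp} {N : Multiset CMV.Proc}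
    (h : LStep V ds N V' ds') {X : List ℕ} (hX : ∀ a ∈ X, pid a % 2 = 0) {T : CMV.Proc}
    {R : Multiset CMV.Proc} (hc : ConfG T (X ++ V) (N + R)) : ConfG T (X ++ V') (thr ds' + R) := by
  have fin : ∀ {p : AProc} {A : Ch} {uo : Option ℕ} {c m : CMV.Proc} {R : Multiset CMV.Proc},
      (uo = none → c = p.enc) →
      (∀ u, uo = some u → c = .par p.enc (.out (.var u) .unit .inact)) →
      ConfG T (X ++ V) (c ::ₘ m ::ₘ (A.servers uo + R)) →
      ConfG T (X ++ V) (p.enc ::ₘ m ::ₘ (thr (again A uo) + R)) := by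
    intro p A uo c m R h1 h2 hc
    cases uo with
    | none => rw [← h1 rfl]; exact hc
    | some u =>
      rw [h2 u rfl] at hc; have hc := CMV.confG_par hc; rw [cons_swap (CMV.Proc.out _ _ _)] at hc
      simpa [again, thr_singleton, Comp.thr, Ch.servers] using hc
  cases h with
  | trig A h hb =>
    rw [thr_singleton]; simp only [cons_add, singleton_add] at hc
    have := CMV.confG_par (CMV.confG_inact hc); simpa [Comp.thr, Ch.servers] using this
  | pickL A uo h hk => rwa [thr_singleton, Comp.thr, request_lin h]
  | @pickU A uo k e h hk hp hV =>
    have hXe : ¬ Hit X e := fun hh => by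
      obtain ⟨b, hb, e1⟩ := List.mem_map.mp hh.2; have := hX b hb; have := hp.2; omega
    rw [thr_singleton, Comp.thr, request_un h]; rw [cons_add] at hc ⊢
    have := hc.open_middle hp.1 (.inr rfl) hXe hV; rwa [openWith_intUn _ _ _ _ _ hp.1] at this
  | meetL A uo B h h' _ hb hx hk => rw [thr_singleton, Comp.thr]; rwa [hx] at hc
  | @meetU A uo B k e h h' hb hx =>
    rw [thr_cons]; simp only [Comp.thr, extPers, cons_add] at hc ⊢
    cases hq : B.q with
    | lin => rw [hq] at hc; simpa [thr_zero, CMV.persist] using hc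
    | un =>
      rw [hq] at hc; rw [cons_swap] at hc; have hc := CMV.confG_par hc; convert hc using 1
      simp only [thr_singleton, Comp.thr]
      rw [add_assoc, singleton_add, add_cons, cons_swap B.ext, cons_swap]
  | comL A uo B hb hi hj =>
    rw [thr_cons, thr_cons]; simp only [Comp.thr, singleton_add, AProc.enc_subst, cons_add] at hc ⊢
    refine fin (fun h => by rw [h]; rfl) (fun u h => ?_) hc; rw [h, Ch.cont, hi, nameIn]
  | comR A uo B hb hi hj =>
    rw [thr_cons, thr_cons]; simp only [Comp.thr, singleton_add, cons_add] at hc ⊢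
    refine fin (fun h => by rw [h, AProc.enc_subst]; rfl) (fun u h => ?_) hc
    rw [h, Ch.cont, hi, nameIn, AProc.enc_subst]; rfl
  | _ => rwa [thr_singleton]

/-! ### Choices in well-typed configurations -/

theorem Typing.ch_inv {Γ : Ctx} {A : Ch} (h : Typing Γ A.proc) :
    ∃ T K pay cont, Γ A.x = some T ∧ Sub T (.choice A.q' A.w K pay cont) ∧
      (A.q = .un → UnCtx Γ) ∧ (∀ k, k ∈ K ↔ ∃ i, (A.l i, (A.a i).pol) = k) := by
  obtain ⟨y, T, K, pay, cont, e, h1, h2, h3, h4, -⟩ := h.choice_inv; grind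

theorem Sub.un_choice {T : Ty} {q w K pay cont} (h : Sub T (.choice q w K pay cont)) :
    Un T ↔ q = .un := by
  rw [h.un_iff, un_iff_of_unf (.choice q w K pay cont)]; simp

theorem wt_hit {Γ : Ctx} {X : List ℕ} {C : Multiset AProc} (h : WT Γ X C) {A : Ch}
    (hA : A.proc ∈ C) (hb : Bnd A.x) : Hit X A.x := by
  obtain ⟨R, rfl⟩ := exists_cons_of_mem hA; obtain ⟨Ξ, hc, ht⟩ := h
  have .par hs h1 h2 := typing_parM_cons.mp ht; obtain ⟨T, _, _, _, e, _⟩ := h1.ch_inv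
  exact hc.dom _ hb (by rw [hs.left e]; simp)

theorem wt_lin {Γ : Ctx} {X : List ℕ} {C : Multiset AProc} (h : WT Γ X C) {A : Ch}
    (hA : A.proc ∈ C) (hq : A.q' = .lin) : A.q = .lin := by
  obtain ⟨R, rfl⟩ := exists_cons_of_mem hA; obtain ⟨Ξ, hc, ht⟩ := h
  have .par hs h1 h2 := typing_parM_cons.mp ht; obtain ⟨T, K, pay, cont, e, h3, h4, _⟩ := h1.ch_inv
  cases hq' : A.q with
  | lin => rfl
  | un => have := h3.un_choice.mp (h4 hq' _ _ e); grind

theorem wt_unique {Γ : Ctx} {X : List ℕ} {A B : Ch} {R : Multiset AProc}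
    (h : WT Γ X (A.proc ::ₘ B.proc ::ₘ R)) (hx : B.x = A.x) : A.q' = .un := by
  obtain ⟨Ξ, hc, ht⟩ := h; have .par hs h1 h2 := typing_parM_cons_cons.mp ht
  have .par hs' h2 h3 := h2; obtain ⟨T, K, pay, cont, e, h3, _⟩ := h1.ch_inv
  obtain ⟨T', K', pay', cont', e', _⟩ := h2.ch_inv; rw [← h3.un_choice]; by_contra hn
  have := hs.right_none e hn; rw [← hx, hs'.left e'] at this; grind

theorem wt_pair {Γ : Ctx} {X : List ℕ} {A B : Ch} {R : Multiset AProc}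
    (h : WT Γ X (A.proc ::ₘ B.proc ::ₘ R)) (hb : Bnd A.x) (hx : B.x = co A.x) :
    B.q' = A.q' ∧ B.w = A.w.dual ∧ (A.w = .int → A.intLabels ⊆ B.extLabels) := by
  have hh := wt_hit h (mem_cons_self _ _) hb; obtain ⟨Ξ, hc, ht⟩ := h
  obtain ⟨T₀, U₀, e1, e2, hd⟩ := hc.dual _ hh; have .par hs h1 h2 := typing_parM_cons_cons.mp ht
  have .par hs' h2 h3 := h2; obtain ⟨T, K, pay, cont, e, h3, _, hK⟩ := h1.ch_inv
  obtain ⟨T', K', pay', cont', e', h3', _, hK'⟩ := h2.ch_inv; rw [hs.left e] at e1; cases e1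
  rw [← hx, hs.right (hs'.left e')] at e2; cases e2; obtain ⟨c1, c2, c3, -⟩ := hd.choices h3 h3'
  refine ⟨c1, c2, fun hw k hk => ?_⟩; obtain ⟨i, -, rfl⟩ := Finset.mem_image.mp hk
  obtain ⟨j, hj⟩ := (hK' _).mp (c3 hw _ _ ((hK _).mpr ⟨i, rfl⟩))
  refine Finset.mem_image.mpr ⟨j, Finset.mem_univ _, ?_⟩; simp only [Prod.mk.injEq] at hj
  rw [hj.1, hj.2]; cases (A.a i).pol <;> rfl

/-! ### Invariants of states -/

/-- The processes that a component represents. -/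
def Comp.src : Comp → Multiset AProc
  | idle p => {p}
  | cond v p r => {.ite v p r}
  | ext B => {B.proc}
  | token A _ => {A.proc}
  | int A _ => {A.proc}
  | pend A _ _ _ => {A.proc}
  | contact A _ B _ _ => A.proc ::ₘ (match B.q with | .lin => {B.proc} | .un => 0)
  | flight A _ B _ _ _ _ => A.proc ::ₘ (match B.q with | .lin => {B.proc} | .un => 0)

def src (D : Multiset Comp) : Multiset AProc := D.bind Comp.src

theorem src_add (D E : Multiset Comp) : src (D + E) = src D + src E := Multiset.add_bind _ _ _

theorem src_cons (d : Comp) (D : Multiset Comp) : src (d ::ₘ D) = d.src + src D :=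
  Multiset.cons_bind _ _ _

theorem src_singleton (d : Comp) : src {d} = d.src := Multiset.singleton_bind _ _

def loopPriv : Option ℕ → Multiset ℕ
  | none => 0
  | some u => {pid u}

def Ch.endPriv (A : Ch) (e : ℕ) : Multiset ℕ :=
  match A.q' with
  | .lin => 0
  | .un => {pid e}

/-- The indices of the private restrictions of a component. -/
def Comp.priv : Comp → Multiset ℕ
  | idle _ => 0
  | cond _ _ _ => 0
  | ext _ => 0
  | token _ u => {pid u}
  | int _ uo => loopPriv uo
  | pend A uo _ e => A.endPriv e + loopPriv uo
  | contact A uo _ _ e => A.endPriv e + loopPriv uo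
  | flight A uo _ _ e _ _ => A.endPriv e + loopPriv uo

def priv (D : Multiset Comp) : Multiset ℕ := D.bind Comp.priv

theorem priv_add (D E : Multiset Comp) : priv (D + E) = priv D + priv E := Multiset.add_bind _ _ _

theorem priv_cons (d : Comp) (D : Multiset Comp) : priv (d ::ₘ D) = d.priv + priv D :=
  Multiset.cons_bind _ _ _

theorem priv_singleton (d : Comp) : priv {d} = d.priv := Multiset.singleton_bind _ _

/-- `A` is an internal choice, and a loop with the name `uo` if it is unrestricted. -/
def IntOK (A : Ch) (uo : Option ℕ) : Prop :=
  A.w = .int ∧ ((uo = none ∧ A.q = .lin) ∨ ∃ u, uo = some u ∧ A.q = .un ∧ A.q' = .un ∧ Priv u)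

/-- `e` is an endpoint for the session of `A`. -/
def EndOK (A : Ch) (e : ℕ) : Prop := (A.q' = .lin ∧ e = A.x) ∨ (A.q' = .un ∧ Priv e)

structure SessOK (A : Ch) (uo : Option ℕ) (B : Ch) (k : Label) (e : ℕ) : Prop where
  int : IntOK A uo
  endp : EndOK A e
  lab : k ∈ A.intLabels
  view : B.w = .ext
  qual : B.q' = A.q'
  subj : B.x = co A.x
  bnd : Bnd A.x
  lin : A.q' = .lin → B.q = .lin

def Comp.ok : Comp → Prop
  | idle _ => True
  | cond _ _ _ => True
  | ext B => B.w = .ext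
  | token A u => IntOK A (some u)
  | int A uo => IntOK A uo
  | pend A uo k e => IntOK A uo ∧ EndOK A e ∧ k ∈ A.intLabels
  | contact A uo B k e => SessOK A uo B k e ∧ A.q' = .un
  | flight A uo B k e i j => SessOK A uo B k e ∧
      (∀ i', i = some i' → Label.tag (A.l i') (A.a i').pol = k) ∧
      (∀ j', j = some j' → Label.tag (B.l j') (B.a j').pol.dual = k)

/-- The external choice that a component communicates with. -/
def Comp.Uses (B : Ch) : Comp → Prop
  | contact _ _ B' _ _ => B' = B
  | flight _ _ B' _ _ _ _ => B' = B
  | _ => False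

/-- Well-formed states. -/
structure Inv (Γ : Ctx) (X V : List ℕ) (D : Multiset Comp) : Prop where
  wt : WT Γ X (src D)
  even : ∀ a ∈ X, pid a % 2 = 0
  odd : ∀ a ∈ V, pid a % 2 = 1
  ok : ∀ d ∈ D, d.ok
  nodup : (priv D).Nodup
  priv : ∀ n ∈ priv D, n ∈ V.map pid
  used : ∀ d ∈ D, ∀ B, d.Uses B → B.q = .un → Comp.ext B ∈ D

/-! ### Shapes of threads -/

theorem EndOK.bnd {A : Ch} {e : ℕ} (h : EndOK A e) (hA : Bnd A.x) : Bnd e := by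
  rcases h with ⟨-, rfl⟩ | ⟨-, h⟩
  · exact hA
  · exact h.1

/-- The linear choices of a session that the component has started. -/
def Comp.Lone (y : ℕ) (d : Comp) : Prop :=
  ∃ A B : Ch, d.src = A.proc ::ₘ {B.proc} ∧ A.q' = .lin ∧ B.q' = .lin ∧ Bnd A.x ∧ B.x = co A.x ∧
    (y = A.x ∨ y = B.x)

theorem SessOK.owns {A B : Ch} {uo k e} (h : SessOK A uo B k e) {i j} {y : ℕ}
    (hy : y = e ∨ y = co e) :
    pid y ∈ (Comp.flight A uo B k e i j).priv ∨ (Comp.flight A uo B k e i j).Lone y := by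
  rcases h.endp with ⟨hq, rfl⟩ | ⟨hq, hp⟩
  · refine .inr ⟨A, B, ?_, hq, h.qual.trans hq, h.bnd, h.subj, by rwa [h.subj]⟩
    simp only [Comp.src, h.lin hq]
  · refine .inl ?_; simp only [Comp.priv, Ch.endPriv, hq]; rcases hy with rfl | rfl
    · simp
    · simp [pid_co hp.1]

theorem servers_mem {A : Ch} {uo : Option ℕ} {m : CMV.Proc} (h : m ∈ A.servers uo) :
    ∃ u, uo = some u ∧ m = A.server u := by
  cases uo with
  | none => simp [Ch.servers] at h
  | some u => exact ⟨u, rfl, by simpa [Ch.servers] using h⟩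

theorem side_out {n : ℕ} {l : Fin (n + 1) → ℕ} {a : Fin (n + 1) → Act}
    {E : Fin (n + 1) → CMV.Proc} {f k e i x v P} (h : .out x v P = side l a E f k e i) :
    ∃ i', i = some i' ∧ a i' = .send v ∧ x = .var e ∧ P = E i' := by
  cases i with
  | none => simp [side, duplicates, ndc] at h
  | some i =>
    simp only [side] at h
    cases ha : a i with
    | send v => rw [ha] at h; simp only [prefixOn, CMV.Proc.out.injEq] at h; grind
    | recv => rw [ha] at h; cases h

theorem side_inp {n : ℕ} {l : Fin (n + 1) → ℕ} {a : Fin (n + 1) → Act}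
    {E : Fin (n + 1) → CMV.Proc} {f k e i q x P} (h : .inp q x P = side l a E f k e i) :
    ∃ i', i = some i' ∧ a i' = .recv ∧ q = .lin ∧ x = .var e ∧ P = E i' := by
  cases i with
  | none => simp [side, duplicates, ndc] at h
  | some i =>
    simp only [side] at h
    cases ha : a i with
    | send v => rw [ha] at h; cases h
    | recv => rw [ha] at h; simp only [prefixOn, CMV.Proc.inp.injEq] at h; grind

theorem side_ne {n : ℕ} {l : Fin (n + 1) → ℕ} {a : Fin (n + 1) → Act}
    {E : Fin (n + 1) → CMV.Proc} {f k e i} :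
    (∀ x b P, .sel x b P ≠ side l a E f k e i) ∧ (∀ x L P, .bran x L P ≠ side l a E f k e i) ∧
      (∀ v P Q, .ite v P Q ≠ side l a E f k e i) := by
  cases i with
  | none => simp [side, duplicates, ndc]
  | some i => simp only [side]; cases a i <;> simp [prefixOn]

theorem int_eq (A : Ch) (uo : Option ℕ) : ∃ P, A.int uo = .res P := by
  cases h : A.q' with
  | lin => rw [int_lin h]; exact ⟨_, rfl⟩
  | un => rw [int_un h]; exact ⟨_, rfl⟩

theorem ext_eq (B : Ch) : (B.q' = .lin ∧ B.ext = extLin B.l B.a (B.cont none) (.var B.x)) ∨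
    (B.q' = .un ∧ B.ext = extUn B.l B.a (B.cont none) B.q (.var B.x)) := by
  cases h : B.q' with
  | lin => exact .inl ⟨rfl, ext_lin h⟩
  | un => exact .inr ⟨rfl, ext_un h⟩

theorem request_eq (A : Ch) (uo k e) : (A.q' = .lin ∧ A.request uo k e = A.select uo k e) ∨
    (A.q' = .un ∧ A.request uo k e = .out (.var A.x) (.var (co e)) (A.select uo k e)) := by
  cases h : A.q' with
  | lin => exact .inl ⟨rfl, request_lin h _ _ _⟩
  | un => exact .inr ⟨rfl, request_un h _ _ _⟩

theorem mem_priv_server {A : Ch} {uo : Option ℕ} {q x P} (h : .inp q x P ∈ A.servers uo)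
    (hok : IntOK A uo) {y : ℕ} (hx : x = .var y) : pid y ∈ loopPriv uo := by
  obtain ⟨u, rfl, e⟩ := servers_mem h; obtain ⟨_, h | ⟨u', e', _, _, hp⟩⟩ := hok
  · grind
  · cases e'; simp only [Ch.server, CMV.Proc.inp.injEq] at e; rw [hx, Val.var.injEq] at e
    rw [e.2.1, pid_co hp.1]; simp [loopPriv]

theorem ite_cases {d : Comp} (hf : ∀ p, d ≠ .idle p) {v P Q} (h : .ite v P Q ∈ d.thr) :
    ∃ p r, d = .cond v p r ∧ P = p.enc ∧ Q = r.enc := by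
  cases d with
  | idle p => grind
  | cond v p r => simp only [Comp.thr, mem_singleton, CMV.Proc.ite.injEq] at h; grind
  | ext B => rcases ext_eq B with ⟨_, e⟩ | ⟨_, e⟩ <;> simp [Comp.thr, e, extLin, extUn] at h
  | token A u => simp [Comp.thr, Ch.server] at h
  | int A uo =>
    rcases mem_cons.mp h with h | h
    · obtain ⟨P, e⟩ := int_eq A uo; grind
    · obtain ⟨u, -, e⟩ := servers_mem h; cases e
  | pend A uo k e =>
    rcases mem_cons.mp h with h | h
    · rcases request_eq A uo k e with ⟨_, e⟩ | ⟨_, e⟩ <;> rw [e] at h <;> cases h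
    · obtain ⟨u, -, e⟩ := servers_mem h; cases e
  | contact A uo B k e =>
    rcases mem_cons.mp h with h | h
    · cases h
    rcases mem_cons.mp h with h | h
    · cases h
    · obtain ⟨u, -, e⟩ := servers_mem h; cases e
  | flight A uo B k e i j =>
    rcases mem_cons.mp h with h | h
    · exact (side_ne.2.2 _ _ _ h).elim
    rcases mem_cons.mp h with h | h
    · exact (side_ne.2.2 _ _ _ h).elim
    · obtain ⟨u, -, e⟩ := servers_mem h; cases e

theorem out_cases {d : Comp} (hf : ∀ p, d ≠ .idle p) (hok : d.ok) {y v P}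
    (h : .out (.var y) v P ∈ d.thr) :
    pid y ∈ d.priv ∨ d.Lone y ∨ ∃ A uo k e, d = .pend A uo k e ∧ A.q' = .un ∧ y = A.x ∧
      .out (.var y) v P = A.request uo k e := by
  cases d with
  | idle p => grind
  | cond v p r => simp [Comp.thr] at h
  | ext B => rcases ext_eq B with ⟨_, e⟩ | ⟨_, e⟩ <;> simp [Comp.thr, e, extLin, extUn] at h
  | token A u =>
    simp only [Comp.thr, Ch.server, mem_cons, CMV.Proc.out.injEq, Val.var.injEq,
      mem_singleton, reduceCtorEq, or_false] at h
    rw [h.1]; simp [Comp.priv]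
  | int A uo =>
    rcases mem_cons.mp h with h | h
    · obtain ⟨P, e⟩ := int_eq A uo; grind
    · obtain ⟨u, -, e⟩ := servers_mem h; cases e
  | pend A uo k e =>
    rcases mem_cons.mp h with h | h
    · rcases request_eq A uo k e with ⟨hq, e'⟩ | ⟨hq, e'⟩
      · rw [e'] at h; cases h
      grind
    · obtain ⟨u, -, e⟩ := servers_mem h; cases e
  | contact A uo B k e =>
    rcases mem_cons.mp h with h | h
    · cases h
    rcases mem_cons.mp h with h | h
    · cases h
    · obtain ⟨u, -, e⟩ := servers_mem h; cases e
  | flight A uo B k e i j =>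
    rcases mem_cons.mp h with h | h
    · obtain ⟨_, _, _, e1, _⟩ := side_out h; cases e1
      exact (hok.1.owns (.inl rfl)).elim .inl fun h => .inr (.inl h)
    rcases mem_cons.mp h with h | h
    · obtain ⟨_, _, _, e1, _⟩ := side_out h; cases e1
      exact (hok.1.owns (.inr rfl)).elim .inl fun h => .inr (.inl h)
    · obtain ⟨u, -, e⟩ := servers_mem h; cases e

theorem inp_cases {d : Comp} (hf : ∀ p, d ≠ .idle p) (hok : d.ok) {q y P}
    (h : .inp q (.var y) P ∈ d.thr) :
    pid y ∈ d.priv ∨ d.Lone y ∨ ∃ B, d = .ext B ∧ B.q' = .un ∧ y = B.x ∧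
      .inp q (.var y) P = B.ext := by
  cases d with
  | idle p => grind
  | cond v p r => simp [Comp.thr] at h
  | ext B =>
    have h := mem_singleton.mp h; rcases ext_eq B with ⟨_, e⟩ | ⟨hq, e⟩
    · rw [e] at h; cases h
    · refine .inr (.inr ⟨B, rfl, hq, ?_, h⟩); rw [e, extUn, CMV.Proc.inp.injEq, Val.var.injEq] at h
      grind
  | token A u =>
    rw [Comp.thr] at h; rcases mem_cons.mp h with h | h
    · cases h
    · exact .inl (mem_priv_server (uo := some u) h hok rfl)
  | int A uo =>
    rcases mem_cons.mp h with h | h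
    · obtain ⟨P, e⟩ := int_eq A uo; grind
    · exact .inl (mem_priv_server h hok rfl)
  | pend A uo k e =>
    rcases mem_cons.mp h with h | h
    · rcases request_eq A uo k e with ⟨_, e⟩ | ⟨_, e⟩ <;> rw [e] at h <;> cases h
    · exact .inl (mem_add.mpr (.inr (mem_priv_server h hok.1 rfl)))
  | contact A uo B k e =>
    rcases mem_cons.mp h with h | h
    · cases h
    rcases mem_cons.mp h with h | h
    · cases h
    · exact .inl (mem_add.mpr (.inr (mem_priv_server h hok.1.int rfl)))
  | flight A uo B k e i j =>
    rcases mem_cons.mp h with h | h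
    · obtain ⟨_, _, _, _, e1, _⟩ := side_inp h; cases e1
      exact (hok.1.owns (.inl rfl)).elim .inl fun h => .inr (.inl h)
    rcases mem_cons.mp h with h | h
    · obtain ⟨_, _, _, _, e1, _⟩ := side_inp h; cases e1
      exact (hok.1.owns (.inr rfl)).elim .inl fun h => .inr (.inl h)
    · exact .inl (mem_add.mpr (.inr (mem_priv_server h hok.1.int rfl)))

theorem sel_cases {d : Comp} (hf : ∀ p, d ≠ .idle p) (hok : d.ok) {y b P}
    (h : .sel (.var y) b P ∈ d.thr) :
    pid y ∈ d.priv ∨ ∃ A uo k, d = .pend A uo k A.x ∧ A.q' = .lin ∧ y = A.x ∧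
      .sel (.var y) b P = A.request uo k A.x := by
  cases d with
  | idle p => grind
  | cond v p r => simp [Comp.thr] at h
  | ext B => rcases ext_eq B with ⟨_, e⟩ | ⟨_, e⟩ <;> simp [Comp.thr, e, extLin, extUn] at h
  | token A u => simp [Comp.thr, Ch.server] at h
  | int A uo =>
    rcases mem_cons.mp h with h | h
    · obtain ⟨P, e⟩ := int_eq A uo; grind
    · obtain ⟨u, -, e⟩ := servers_mem h; cases e
  | pend A uo k e =>
    rcases mem_cons.mp h with h | h
    · rcases request_eq A uo k e with ⟨hq, e'⟩ | ⟨_, e'⟩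
      · rcases hok.2.1 with ⟨_, rfl⟩ | ⟨hq', _⟩
        · refine .inr ⟨A, uo, k, rfl, hq, ?_, h⟩
          rw [e', Ch.select, CMV.Proc.sel.injEq, Val.var.injEq] at h; grind
        grind
      grind
    · obtain ⟨u, -, e⟩ := servers_mem h; cases e
  | contact A uo B k e =>
    rcases mem_cons.mp h with h | h
    · simp only [Ch.select, CMV.Proc.sel.injEq, Val.var.injEq] at h; rw [h.1]
      simp [Comp.priv, Ch.endPriv, hok.2]
    rcases mem_cons.mp h with h | h
    · cases h
    · obtain ⟨u, -, e⟩ := servers_mem h; cases e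
  | flight A uo B k e i j =>
    rcases mem_cons.mp h with h | h
    · exact (side_ne.1 _ _ _ h).elim
    rcases mem_cons.mp h with h | h
    · exact (side_ne.1 _ _ _ h).elim
    · obtain ⟨u, -, e⟩ := servers_mem h; cases e

theorem bran_cases {d : Comp} (hf : ∀ p, d ≠ .idle p) (hok : d.ok) {y L P}
    (h : .bran (.var y) L P ∈ d.thr) :
    pid y ∈ d.priv ∨ ∃ B, d = .ext B ∧ B.q' = .lin ∧ y = B.x ∧ .bran (.var y) L P = B.ext := by
  cases d with
  | idle p => grind
  | cond v p r => simp [Comp.thr] at h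
  | ext B =>
    have h := mem_singleton.mp h; rcases ext_eq B with ⟨hq, e⟩ | ⟨hq, e⟩
    · refine .inr ⟨B, rfl, hq, ?_, h⟩; rw [e, extLin, CMV.Proc.bran.injEq, Val.var.injEq] at h
      grind
    · rw [e] at h; cases h
  | token A u => simp [Comp.thr, Ch.server] at h
  | int A uo =>
    rcases mem_cons.mp h with h | h
    · obtain ⟨P, e⟩ := int_eq A uo; grind
    · obtain ⟨u, -, e⟩ := servers_mem h; cases e
  | pend A uo k e =>
    rcases mem_cons.mp h with h | h
    · rcases request_eq A uo k e with ⟨_, e⟩ | ⟨_, e⟩ <;> rw [e] at h <;> cases h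
    · obtain ⟨u, -, e⟩ := servers_mem h; cases e
  | contact A uo B k e =>
    rcases mem_cons.mp h with h | h
    · cases h
    rcases mem_cons.mp h with h | h
    · simp only [extLin, CMV.Proc.bran.injEq, Val.var.injEq] at h
      rcases hok.1.endp with ⟨hq, _⟩ | ⟨_, hp⟩
      · rw [hok.2] at hq; cases hq
      · rw [h.1, pid_co hp.1]; simp [Comp.priv, Ch.endPriv, hok.2]
    · obtain ⟨u, -, e⟩ := servers_mem h; cases e
  | flight A uo B k e i j =>
    rcases mem_cons.mp h with h | h
    · exact (side_ne.2.1 _ _ _ h).elim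
    rcases mem_cons.mp h with h | h
    · exact (side_ne.2.1 _ _ _ h).elim
    · obtain ⟨u, -, e⟩ := servers_mem h; cases e

/-! ### Reductions of the threads of a state -/

theorem _root_.Encoding.ndc_inj {L L' : Finset Label} {P P' : Label → CMV.Proc}
    (h : ndc L P = ndc L' P') : L = L' ∧ ∀ l ∈ L, P l = P' l := by
  unfold ndc at h
  simp only [CMV.Proc.res.injEq, CMV.Proc.par.injEq, CMV.Proc.bran.injEq, true_and] at h
  obtain ⟨⟨rfl, h⟩, -⟩ := h; refine ⟨rfl, fun l hl => ?_⟩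
  have h1 := congrArg (CMV.Proc.subst (cons2 0 1 Val.var)) (congrFun (eq_of_heq h) ⟨l, hl⟩)
  simpa only [CMV.Proc.subst_subst, scomp_cons2_wk, CMV.Proc.subst_var] using h1

theorem res_cases {d : Comp} (hf : ∀ p, d ≠ .idle p) {P} (h : .res P ∈ d.thr) :
    (∃ A uo, d = .int A uo ∧ .res P = A.int uo) ∨
    (∃ A uo B k e j, d = .flight A uo B k e none j ∧
      .res P = side A.l A.a (A.cont uo) id k e none) ∨
    (∃ A uo B k e i, d = .flight A uo B k e i none ∧
      .res P = side B.l B.a (B.cont none) Pol.dual k (co e) none) := by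
  have hs : ∀ {n : ℕ} {l : Fin (n + 1) → ℕ} {a : Fin (n + 1) → Act}
      {E : Fin (n + 1) → CMV.Proc} {f k e i}, .res P = side l a E f k e i → i = none := by
    intro n l a E f k e i h
    cases i with
    | none => rfl
    | some i => simp only [side] at h; cases ha : a i <;> rw [ha] at h <;> cases h
  cases d with
  | idle p => grind
  | cond v p r => simp [Comp.thr] at h
  | ext B => rcases ext_eq B with ⟨_, e⟩ | ⟨_, e⟩ <;> simp [Comp.thr, e, extLin, extUn] at h
  | token A u => simp [Comp.thr, Ch.server] at h
  | int A uo =>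
    rcases mem_cons.mp h with h | h
    · grind
    · obtain ⟨u, -, e⟩ := servers_mem h; cases e
  | pend A uo k e =>
    rcases mem_cons.mp h with h | h
    · rcases request_eq A uo k e with ⟨_, e⟩ | ⟨_, e⟩ <;> rw [e] at h <;> cases h
    · obtain ⟨u, -, e⟩ := servers_mem h; cases e
  | contact A uo B k e =>
    rcases mem_cons.mp h with h | h
    · cases h
    rcases mem_cons.mp h with h | h
    · cases h
    · obtain ⟨u, -, e⟩ := servers_mem h; cases e
  | flight A uo B k e i j =>
    rcases mem_cons.mp h with h | h
    · grind
    rcases mem_cons.mp h with h | h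
    · grind
    · obtain ⟨u, -, e⟩ := servers_mem h; cases e

theorem thr_eq_cons {m : CMV.Proc} {R : Multiset CMV.Proc} {D : Multiset Comp}
    (h : thr D = m ::ₘ R) : ∃ d D' S, D = d ::ₘ D' ∧ d.thr = m ::ₘ S ∧ R = S + thr D' := by
  have hm : m ∈ thr D := by grind
  obtain ⟨d, hd, hmd⟩ := mem_bind.mp hm; obtain ⟨D', rfl⟩ := exists_cons_of_mem hd
  obtain ⟨S, hS⟩ := exists_cons_of_mem hmd; refine ⟨d, D', S, rfl, hS, ?_⟩
  rw [thr_cons, hS, cons_add, cons_inj_right] at h; grind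

/-- Two threads of a state belong to one component or to two. -/
theorem thr_eq_cons_cons {m m' : CMV.Proc} {R : Multiset CMV.Proc} {D : Multiset Comp}
    (h : thr D = m ::ₘ m' ::ₘ R) :
    (∃ d D' S, D = d ::ₘ D' ∧ d.thr = m ::ₘ m' ::ₘ S ∧ R = S + thr D') ∨
    ∃ d d' D' S S', D = d ::ₘ d' ::ₘ D' ∧ d.thr = m ::ₘ S ∧ d'.thr = m' ::ₘ S' ∧
      R = S + (S' + thr D') := by
  obtain ⟨d, D', S, rfl, h1, h2⟩ := thr_eq_cons h
  rcases CMV.cons_eq_add h2 with ⟨S', rfl, h3⟩ | ⟨M, h3, rfl⟩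
  · grind
  · obtain ⟨d', D'', S', rfl, h4, rfl⟩ := thr_eq_cons h3; grind

def Comp.SessAt (y : ℕ) (d : Comp) : Prop := ∃ A : Ch, A.proc ∈ d.src ∧ A.x = y

theorem Comp.Lone.sessAt {d : Comp} {y : ℕ} (h : d.Lone y) : d.SessAt y := by
  obtain ⟨A, B, hs, -, -, -, -, rfl | rfl⟩ := h
  · exact ⟨A, by grind, rfl⟩
  · exact ⟨B, by simp [hs], rfl⟩

theorem wt_unique' {Γ : Ctx} {X : List ℕ} {C : Multiset AProc} (h : WT Γ X C) {A B : Ch}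
    (hle : A.proc ::ₘ {B.proc} ≤ C) (hx : B.x = A.x) : A.q' = .un := by
  obtain ⟨R, rfl⟩ := Multiset.le_iff_exists_add.mp hle; rw [cons_add, singleton_add] at h
  exact wt_unique h hx

section

variable {Γ : Ctx} {X V : List ℕ} {D : Multiset Comp}

theorem Inv.even_sess (hI : Inv Γ X V D) {d : Comp} (hd : d ∈ D) {y : ℕ} (h : d.SessAt y)
    (hb : Bnd y) : pid y % 2 = 0 := by
  obtain ⟨A, hA, rfl⟩ := h; have hm : A.proc ∈ src D := mem_bind.mpr ⟨d, hd, hA⟩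
  obtain ⟨b, h1, h2⟩ := List.mem_map.mp (wt_hit hI.wt hm hb).2; rw [← h2]; exact hI.even b h1

theorem Inv.odd_priv (hI : Inv Γ X V D) {d : Comp} (hd : d ∈ D) {n : ℕ} (h : n ∈ d.priv) :
    n % 2 = 1 := by
  have hm : n ∈ Mix.priv D := mem_bind.mpr ⟨d, hd, h⟩
  obtain ⟨b, h1, h2⟩ := List.mem_map.mp (hI.priv _ hm); rw [← h2]; exact hI.odd b h1

theorem Inv.not_priv_of_sess (hI : Inv Γ X V D) {d d' : Comp} (hd : d ∈ D) (hd' : d' ∈ D) {y : ℕ}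
    (hb : Bnd y) (h : pid y ∈ d.priv) (h' : d'.SessAt (co y)) : False := by
  have h1 := hI.odd_priv hd h; have h2 := hI.even_sess hd' h' (bnd_co hb); rw [pid_co hb] at h2
  omega

theorem Inv.not_lone {d d' : Comp} (hI : Inv Γ X V (d ::ₘ d' ::ₘ D)) {y : ℕ} (hb : Bnd y)
    (h : d.Lone y) (h' : d'.SessAt (co y)) : False := by
  obtain ⟨A, B, hs, hA, hB, hA', hB', hy⟩ := h; obtain ⟨E, hE, hx⟩ := h'
  have hle : ∀ F : Ch, F = A ∨ F = B → F.proc ::ₘ {E.proc} ≤ src (d ::ₘ d' ::ₘ D) := by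
    intro F hF; rw [src_cons, src_cons, ← singleton_add, ← add_assoc]
    refine le_trans (add_le_add ?_ ?_) (Multiset.le_add_right _ _)
    · rw [hs, Multiset.singleton_le]; rcases hF with rfl | rfl <;> simp
    · rwa [Multiset.singleton_le]
  rcases hy with rfl | rfl
  · have := wt_unique' hI.wt (hle B (.inr rfl)) (by grind); grind
  · have := wt_unique' hI.wt (hle A (.inl rfl)) (by rw [hx, hB', co_co hA']); grind

theorem Inv.not_priv_priv {d d' : Comp} (hI : Inv Γ X V (d ::ₘ d' ::ₘ D)) {n : ℕ}
    (h : n ∈ d.priv) (h' : n ∈ d'.priv) : False := by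
  have := hI.nodup; rw [priv_cons, priv_cons] at this
  exact Multiset.disjoint_left.mp (nodup_add.mp this).2.2 h (mem_add.mpr (.inl h'))

theorem Inv.not_server {A B : Ch} {uo k e i j} {q P}
    (hI : Inv Γ X V (.flight A uo B k e i j ::ₘ D)) {y : ℕ} (hb : Bnd y) (hy : y = e ∨ y = co e)
    (h : .inp q (.var (co y)) P ∈ A.servers uo) : False := by
  have hm := mem_cons_self (Comp.flight A uo B k e i j) D; have hok := (hI.ok _ hm).1
  have h1 := mem_priv_server h hok.int rfl; rw [pid_co hb] at h1
  have h1' : pid y ∈ (Comp.flight A uo B k e i j).priv := mem_add.mpr (.inr h1)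
  rcases hok.endp with ⟨hq, rfl⟩ | ⟨hq, hp⟩
  · rcases hok.owns (i := i) (j := j) hy with h2 | h2
    · simp only [Comp.priv, Ch.endPriv, hq, zero_add] at h2; have := hI.odd_priv hm h1'
      have h3 := hI.even_sess (y := A.x) hm ⟨A, by simp [Comp.src], rfl⟩ hok.bnd
      rcases hy with rfl | rfl
      · omega
      · rw [pid_co hok.bnd] at this; omega
    · have := hI.odd_priv hm h1'; have h3 := hI.even_sess hm h2.sessAt hb; omega
  · have := hI.nodup; rw [priv_cons] at this; have := (nodup_add.mp this).1
    have h2 : pid y ∉ loopPriv uo := by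
      refine Multiset.disjoint_left.mp (nodup_add.mp this).2.2 ?_; simp only [Ch.endPriv, hq]
      rcases hy with rfl | rfl
      · simp
      · simp [pid_co hp.1]
    grind

theorem com_local {d : Comp} (hI : Inv Γ X V (d ::ₘ D)) (hf : ∀ p, d ≠ .idle p) {y v P q Q S}
    (hb : Bnd y) (h : d.thr = .out (.var y) v P ::ₘ .inp q (.var (co y)) Q ::ₘ S) :
    ∃ ds', LStep V {d} (P ::ₘ CMV.persist q (.inp q (.var (co y)) Q) (Q.subst (inst v)) ::ₘ S)
      V ds' := by
  have hm := mem_cons_self d D; have hok := hI.ok _ hm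
  have h1 : .out (.var y) v P ∈ d.thr := by simp [h]
  have h2 : .inp q (.var (co y)) Q ∈ d.thr := by simp [h]
  cases d with
  | idle p => grind
  | cond v p r => simp [Comp.thr] at h1
  | ext B => rcases ext_eq B with ⟨_, e⟩ | ⟨_, e⟩ <;> simp [Comp.thr, e, extLin, extUn] at h1
  | token A u =>
    rw [Comp.thr] at h h1 h2; rcases mem_cons.mp h1 with h1 | h1
    · rcases mem_cons.mp h2 with h2 | h2
      · cases h2
      have h2 := mem_singleton.mp h2; rw [h1, h2, cons_inj_right, ← cons_zero, cons_inj_right] at h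
      cases h1; obtain ⟨_, ⟨h3, _⟩ | ⟨_, _, _, hq, _⟩⟩ := hok
      · cases h3
      refine ⟨{.int A (some y)}, ?_⟩; have := LStep.trig (V := V) A hq hb
      simp only [Ch.server, CMV.Proc.inp.injEq] at h2; obtain ⟨rfl, -, rfl⟩ := h2
      rw [server_inst hq, ← h]; exact this
    · have h1 := mem_singleton.mp h1; cases h1
  | int A uo =>
    rcases mem_cons.mp h1 with h | h
    · obtain ⟨P, e⟩ := int_eq A uo; grind
    · obtain ⟨u, -, e⟩ := servers_mem h; cases e
  | pend A uo k e =>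
    rcases out_cases hf hok h1 with h3 | ⟨_, _, hs, _⟩ | ⟨A', uo', k', e', h4, hq, hy, -⟩
    · rcases mem_cons.mp h1 with h1 | h1
      · rcases request_eq A uo k e with ⟨hq, e'⟩ | ⟨hq, e'⟩
        · rw [e'] at h1; cases h1
        · rw [e'] at h1; cases h1
          exact (hI.not_priv_of_sess (y := co A.x) hm hm (bnd_co hb) (by rwa [pid_co hb])
            ⟨A, by simp [Comp.src], (co_co hb).symm⟩).elim
      · obtain ⟨u, -, e⟩ := servers_mem h1; cases e
    · exact absurd (congrArg Multiset.card hs) (by simp [Comp.src])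
    · cases h4; rcases mem_cons.mp h2 with h2 | h2
      · rw [request_un hq] at h2; cases h2
      · have h3 := mem_priv_server h2 hok.1 rfl
        exact (hI.not_priv_of_sess (y := co y) hm hm (bnd_co hb) (mem_add.mpr (.inr h3))
          ⟨A, by simp [Comp.src], by rw [co_co hb, hy]⟩).elim
  | contact A uo B k e =>
    rcases mem_cons.mp h1 with h | h
    · cases h
    rcases mem_cons.mp h with h | h
    · cases h
    · obtain ⟨u, -, e⟩ := servers_mem h; cases e
  | flight A uo B k e i j =>
    have he := hok.1.endp.bnd hok.1.bnd; rcases mem_cons.mp h1 with g1 | h1'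
    · obtain ⟨i, rfl, hi, e1, rfl⟩ := side_out g1; rcases mem_cons.mp h2 with g2 | h2'
      · grind
      rcases mem_cons.mp h2' with g2 | g2
      · obtain ⟨j, rfl, hj, rfl, -, rfl⟩ := side_inp g2
        rw [g1, g2, Comp.thr, cons_inj_right, cons_inj_right] at h; rw [← h]
        exact ⟨_, .comL A uo B he hi hj⟩
      · rw [Val.var.injEq] at e1; exact (hI.not_server hb (.inl e1) g2).elim
    rcases mem_cons.mp h1' with g1 | g1
    · obtain ⟨j, rfl, hj, e1, rfl⟩ := side_out g1; rcases mem_cons.mp h2 with g2 | h2'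
      · obtain ⟨i, rfl, hi, rfl, -, rfl⟩ := side_inp g2
        rw [g1, g2, Comp.thr, cons_swap, cons_inj_right, cons_inj_right] at h
        rw [← h, cons_swap]; exact ⟨_, .comR A uo B he hi hj⟩
      rcases mem_cons.mp h2' with g2 | g2
      · grind
      · rw [Val.var.injEq] at e1; exact (hI.not_server hb (.inr e1) g2).elim
    · obtain ⟨u, -, e⟩ := servers_mem g1; cases e

theorem case_local {d : Comp} (hf : ∀ p, d ≠ .idle p) (hok : d.ok) {y P S} {L : Finset Label}
    {Q : {l // l ∈ L} → CMV.Proc} {l : {l // l ∈ L}} (hb : Bnd y)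
    (h : d.thr = .sel (.var y) l.1 P ::ₘ .bran (.var (co y)) L Q ::ₘ S) :
    ∃ ds', LStep V {d} (P ::ₘ Q l ::ₘ S) V ds' := by
  have h1 : .sel (.var y) l.1 P ∈ d.thr := by simp [h]
  have h2 : .bran (.var (co y)) L Q ∈ d.thr := by simp [h]
  have hc := congrArg Multiset.card h
  cases d with
  | idle p => grind
  | cond v p r => simp [Comp.thr] at hc
  | ext B => simp [Comp.thr] at hc
  | token A u => simp [Comp.thr, Ch.server] at h1
  | int A uo =>
    rcases mem_cons.mp h1 with h | h
    · obtain ⟨P, e⟩ := int_eq A uo; grind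
    · obtain ⟨u, -, e⟩ := servers_mem h; cases e
  | pend A uo k e =>
    rcases mem_cons.mp h2 with h | h
    · rcases request_eq A uo k e with ⟨_, e⟩ | ⟨_, e⟩ <;> rw [e] at h <;> cases h
    · obtain ⟨u, -, e⟩ := servers_mem h; cases e
  | contact A uo B k e =>
    rcases mem_cons.mp h1 with g1 | h1'
    · rcases mem_cons.mp h2 with g2 | h2'
      · cases g2
      rcases mem_cons.mp h2' with g2 | g2
      · rw [g1, g2, Comp.thr, cons_inj_right, cons_inj_right] at h; rw [← h]
        simp only [Ch.select, CMV.Proc.sel.injEq, Val.var.injEq] at g1; obtain ⟨rfl, rfl, rfl⟩ := g1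
        simp only [extLin, CMV.Proc.bran.injEq, true_and] at g2; obtain ⟨rfl, g2⟩ := g2
        cases eq_of_heq g2; exact ⟨_, .enter A uo B hb l.2⟩
      · obtain ⟨u, -, e⟩ := servers_mem g2; cases e
    rcases mem_cons.mp h1' with g1 | g1
    · cases g1
    · obtain ⟨u, -, e⟩ := servers_mem g1; cases e
  | flight A uo B k e i j =>
    rcases mem_cons.mp h1 with h | h
    · exact (side_ne.1 _ _ _ h).elim
    rcases mem_cons.mp h with h | h
    · exact (side_ne.1 _ _ _ h).elim
    · obtain ⟨u, -, e⟩ := servers_mem h; cases e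

/-- Every reduction of the threads of a state without processes is a step of the state. -/
theorem Inv.analysis (hI : Inv Γ X V D) (hf : ∀ p, Comp.idle p ∉ D) {N : Multiset CMV.Proc}
    (h : GStep (thr D) N) :
    ∃ ds R N₀ V' ds', D = ds + R ∧ LStep V ds N₀ V' ds' ∧ N = N₀ + thr R := by
  have hfd : ∀ {d}, d ∈ D → ∀ p, d ≠ .idle p := fun hd p e => hf p (e ▸ hd)
  generalize hM : thr D = M at h
  cases h with
  | ndc P R hl =>
    obtain ⟨d, D', S, rfl, h1, rfl⟩ := thr_eq_cons hM; have hd := mem_cons_self d D'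
    rcases res_cases (hfd hd) (by rw [h1]; exact mem_cons_self _ _) with
      ⟨A, uo, rfl, e⟩ | ⟨A, uo, B, k, e', j, rfl, e⟩ | ⟨A, uo, B, k, e', i, rfl, e⟩
    · change ndc _ P = _ at e; rw [Comp.thr, e, cons_inj_right] at h1; rw [← h1, ← cons_add]
      cases hq : A.q' with
      | lin =>
        rw [int_lin hq] at e; obtain ⟨rfl, hP⟩ := ndc_inj e
        refine ⟨_, _, _, _, _, rfl, .pickL A uo hq hl, ?_⟩; grind
      | un =>
        rw [int_un hq] at e; obtain ⟨hL, hP⟩ := ndc_inj e; obtain ⟨N, hN⟩ := CMV.exists_pid_bound V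
        have hp : Priv (6 * N + 4) := by unfold Priv Bnd pid; omega
        refine ⟨_, _, _, _, _, rfl, .pickU A uo hq (by rw [Ch.intLabels, ← hL]; exact hl) hp
          (fun hh => ?_), by grind⟩
        obtain ⟨b, hb, e⟩ := List.mem_map.mp hh.2; have := hN b hb; unfold pid at e this; omega
    · change ndc _ P = _ at e; rw [Comp.thr, e, cons_inj_right] at h1; rw [← h1, ← cons_add]
      rw [side, duplicates] at e; obtain ⟨rfl, hP⟩ := ndc_inj e
      obtain ⟨i, hi, rfl⟩ := Finset.mem_image.mp hl
      refine ⟨_, _, _, _, _, rfl, .left A uo B j (Finset.mem_filter.mp hi).2, ?_⟩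
      rw [hP _ hl, Comp.thr]
      have h3 : Fin.ofNat (A.n + 1) i.1 = i := by ext; simp [Fin.ofNat, Nat.mod_eq_of_lt i.2]
      simp only [h3, side]
    · change ndc _ P = _ at e; rw [Comp.thr, e, cons_swap, cons_inj_right] at h1
      rw [← h1, ← cons_add]; rw [side, duplicates] at e; obtain ⟨rfl, hP⟩ := ndc_inj e
      obtain ⟨j, hj, rfl⟩ := Finset.mem_image.mp hl
      refine ⟨_, _, _, _, _, rfl, .right A uo B i (Finset.mem_filter.mp hj).2, ?_⟩
      rw [hP _ hl, Comp.thr, cons_swap]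
      have h3 : Fin.ofNat (B.n + 1) j.1 = j := by ext; simp [Fin.ofNat, Nat.mod_eq_of_lt j.2]
      simp only [h3, side]
  | pre h =>
    cases h with
    | iteTrue P Q R =>
      obtain ⟨d, D', S, rfl, h1, rfl⟩ := thr_eq_cons hM
      obtain ⟨p, r, rfl, rfl, rfl⟩ := ite_cases (hfd (mem_cons_self d D'))
        (by rw [h1]; exact mem_cons_self _ _)
      rw [Comp.thr, ← cons_zero, cons_inj_right] at h1; rw [← h1, zero_add]
      exact ⟨_, _, _, _, _, rfl, .condT p r, rfl⟩
    | iteFalse P Q R =>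
      obtain ⟨d, D', S, rfl, h1, rfl⟩ := thr_eq_cons hM
      obtain ⟨p, r, rfl, rfl, rfl⟩ := ite_cases (hfd (mem_cons_self d D'))
        (by rw [h1]; exact mem_cons_self _ _)
      rw [Comp.thr, ← cons_zero, cons_inj_right] at h1; rw [← h1, zero_add]
      exact ⟨_, _, _, _, _, rfl, .condF p r, rfl⟩
    | @com y q v P Q R hb =>
      rcases thr_eq_cons_cons hM with ⟨d, D', S, rfl, h1, rfl⟩ | ⟨d, d', D', S, S', rfl, h1, h2, rfl⟩
      · obtain ⟨ds', h⟩ := com_local hI (hfd (mem_cons_self d D')) hb h1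
        exact ⟨_, _, _, _, _, rfl, h, by simp only [cons_add]⟩
      · have hd : d ∈ d ::ₘ d' ::ₘ D' := mem_cons_self _ _
        have hd' : d' ∈ d ::ₘ d' ::ₘ D' := mem_cons_of_mem (mem_cons_self _ _)
        have hI' : Inv Γ X V (d' ::ₘ d ::ₘ D') := by rwa [cons_swap]
        have c1 := out_cases (hfd hd) (hI.ok _ hd) (by rw [h1]; exact mem_cons_self _ _)
        have c2 := inp_cases (hfd hd') (hI.ok _ hd') (by rw [h2]; exact mem_cons_self _ _)
        rw [pid_co hb] at c2
        have s1 : pid y ∈ d.priv ∨ d.SessAt y := by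
          rcases c1 with c | c | ⟨A, uo, k, e, rfl, _, rfl, _⟩
          · grind
          · exact .inr c.sessAt
          · exact .inr ⟨A, by simp [Comp.src], rfl⟩
        have s2 : pid y ∈ d'.priv ∨ d'.SessAt (co y) := by
          rcases c2 with c | c | ⟨B, rfl, _, hx, _⟩
          · grind
          · exact .inr c.sessAt
          · exact .inr ⟨B, by simp [Comp.src], hx.symm⟩
        have s1' : pid y ∉ d.priv := by
          intro c; rcases s2 with s2 | s2
          · exact hI.not_priv_priv c s2
          · exact hI.not_priv_of_sess hd hd' hb c s2
        have s1 := s1.resolve_left s1'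
        have s2' : pid y ∉ d'.priv := fun c =>
          hI.not_priv_of_sess (y := co y) hd' hd (bnd_co hb) (by rwa [pid_co hb])
            (by rwa [co_co hb])
        have s2 := s2.resolve_left s2'
        rcases c1.resolve_left s1' with c | ⟨A, uo, k, e, rfl, hq, hx, e1⟩
        · exact (hI.not_lone hb c s2).elim
        rcases c2.resolve_left s2' with c | ⟨B, rfl, hq', hx', e2⟩
        · exact (hI'.not_lone (bnd_co hb) c (by rwa [co_co hb])).elim
        rw [e1, Comp.thr, cons_inj_right] at h1
        rw [e2, Comp.thr, ← cons_zero, cons_inj_right] at h2; subst hx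
        refine ⟨_, D', _, _, _, (by rw [cons_add, singleton_add]),
          .meetU A uo B hq hq' hb hx'.symm, ?_⟩
        rw [request_un hq, CMV.Proc.out.injEq] at e1; obtain ⟨-, rfl, rfl⟩ := e1; rw [e2]
        rw [ext_un hq', extUn, CMV.Proc.inp.injEq] at e2; obtain ⟨rfl, -, rfl⟩ := e2
        rw [extUn_inst, ← h1, ← h2, zero_add]; simp only [cons_add]
    | @case y P L Q R l hb =>
      rcases thr_eq_cons_cons hM with ⟨d, D', S, rfl, h1, rfl⟩ | ⟨d, d', D', S, S', rfl, h1, h2, rfl⟩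
      · obtain ⟨ds', h⟩ := case_local (V := V) (hfd (mem_cons_self d D'))
          (hI.ok _ (mem_cons_self d D')) hb h1
        exact ⟨_, _, _, _, _, rfl, h, by simp only [cons_add]⟩
      · have hd : d ∈ d ::ₘ d' ::ₘ D' := mem_cons_self _ _
        have hd' : d' ∈ d ::ₘ d' ::ₘ D' := mem_cons_of_mem (mem_cons_self _ _)
        have c1 := sel_cases (hfd hd) (hI.ok _ hd) (by rw [h1]; exact mem_cons_self _ _)
        have c2 := bran_cases (hfd hd') (hI.ok _ hd') (by rw [h2]; exact mem_cons_self _ _)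
        rw [pid_co hb] at c2; rcases c1 with c1 | ⟨A, uo, k, rfl, hq, hx, e1⟩
        · rcases c2 with c2 | ⟨B, rfl, hq', hx', e2⟩
          · exact (hI.not_priv_priv c1 c2).elim
          · exact (hI.not_priv_of_sess hd hd' hb c1 ⟨B, by simp [Comp.src], hx'.symm⟩).elim
        rcases c2 with c2 | ⟨B, rfl, hq', hx', e2⟩
        · exact (hI.not_priv_of_sess (y := co y) hd' hd (bnd_co hb) (by rwa [pid_co hb])
            ⟨A, by simp [Comp.src], by rw [co_co hb, hx]⟩).elim
        rw [e1, Comp.thr, cons_inj_right] at h1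
        rw [e2, Comp.thr, ← cons_zero, cons_inj_right] at h2; subst hx
        rw [request_lin hq, Ch.select, CMV.Proc.sel.injEq] at e1; obtain ⟨-, rfl, rfl⟩ := e1
        rw [ext_lin hq', extLin, CMV.Proc.bran.injEq] at e2; obtain ⟨-, rfl, e2⟩ := e2
        cases eq_of_heq e2
        refine ⟨_, D', _, _, _, (by rw [cons_add, singleton_add]),
          .meetL A uo B hq hq' (wt_lin hI.wt (mem_bind.mpr ⟨_, hd', by simp [Comp.src]⟩) hq') hb hx'.symm l.2, ?_⟩
        rw [← h1, ← h2, zero_add]; simp only [cons_add]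

end

/-! ### Steps of states and of the source -/

/-- An upper bound for the number of steps of `p` that are no steps of the source. -/
def AProc.weight : AProc → ℕ
  | .choice _ _ _ _ _ _ _ _ => 6
  | .par p r => p.weight + r.weight
  | .res p => p.weight
  | .ite _ _ _ => 0
  | .inact => 0

theorem AProc.weight_subst (p : AProc) (σ : ℕ → Val) : (p.subst σ).weight = p.weight := by
  induction p generalizing σ with
  | par p r h1 h2 => simp [AProc.subst, AProc.weight, h1, h2]
  | res p ih => simp [AProc.subst, AProc.weight, ih]
  | _ => rfl

def Comp.weight : Comp → ℕ
  | idle p => p.weight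
  | cond _ _ _ => 0
  | ext _ => 0
  | token _ _ => 6
  | int _ _ => 5
  | pend _ _ _ _ => 4
  | contact _ _ _ _ _ => 3
  | flight _ _ _ _ _ i j => (if i.isNone then 1 else 0) + (if j.isNone then 1 else 0)

def weight (D : Multiset Comp) : ℕ := (D.map Comp.weight).sum

theorem weight_add (D E : Multiset Comp) : weight (D + E) = weight D + weight E := by simp [weight]

theorem weight_cons (d : Comp) (D : Multiset Comp) : weight (d ::ₘ D) = d.weight + weight D := by
  simp [weight]

theorem weight_singleton (d : Comp) : weight {d} = d.weight := by simp [weight]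

theorem CAct.com' {A B : Ch} (hb : Bnd A.x) (hx : B.x = co A.x) {i j v} (hi : A.a i = .send v)
    (hj : B.a j = .recv) (hl : A.l i = B.l j) (C : Multiset AProc) :
    CAct (A.proc ::ₘ B.proc ::ₘ C)
      (A.P i ::ₘ (B.P j).subst (inst v) ::ₘ (pers A.q A.proc + (pers B.q B.proc + C))) := by
  unfold Ch.proc; rw [hx]; exact .com C hb hi hj hl

theorem src_again {A : Ch} {uo : Option ℕ} (h : IntOK A uo) :
    src (again A uo) = pers A.q A.proc := by
  obtain ⟨_, ⟨rfl, hq⟩ | ⟨u, rfl, hq, _⟩⟩ := h <;> rw [hq]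
  · rfl
  · simp [again, src_singleton, Comp.src, pers]

theorem src_flight {A B : Ch} {uo k e i j} {R : Multiset Comp}
    (hu : B.q = .un → Comp.ext B ∈ R) :
    ∃ C, src ({.flight A uo B k e i j} + R) = A.proc ::ₘ B.proc ::ₘ C ∧
      src R = pers B.q B.proc + C := by
  rw [src_add, src_singleton]
  cases hq : B.q with
  | lin => exact ⟨src R, by simp [Comp.src, hq], by simp [pers]⟩
  | un =>
    obtain ⟨R', rfl⟩ := exists_cons_of_mem (hu hq)
    exact ⟨src R', by simp [Comp.src, hq, src_cons, cons_swap B.proc], by simp [pers, src_cons, Comp.src]⟩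

theorem LStep.src {V V' : List ℕ} {ds ds' : Multiset Comp} {N : Multiset CMV.Proc}
    (h : LStep V ds N V' ds') (hok : ∀ d ∈ ds, d.ok) {R : Multiset Comp}
    (hu : ∀ d ∈ ds, ∀ B, d.Uses B → B.q = .un → Comp.ext B ∈ R) :
    (src ds' = src ds ∧ weight ds' < weight ds) ∨ CAct (src (ds + R)) (src (ds' + R)) := by
  cases h with
  | condT p r => refine .inr ?_; simp only [singleton_add, src_cons, Comp.src]; exact .iteTrue _ _ _
  | condF p r =>
    refine .inr ?_; simp only [singleton_add, src_cons, Comp.src]; exact .iteFalse _ _ _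
  | meetL A uo B _ _ hq _ _ _ =>
    exact .inl (by simp [src_singleton, src_cons, Comp.src, hq, weight_singleton, weight_cons,
      Comp.weight])
  | meetU A uo B _ _ _ _ =>
    refine .inl ?_
    cases hq : B.q <;>
      simp [Comp.src, hq, Comp.weight, extPers, Mix.src, weight]
  | @comL A uo B k e i j v hb hi hj =>
    refine .inr ?_; have ho := hok _ (mem_singleton_self _)
    obtain ⟨C, h1, h2⟩ := src_flight (A := A) (uo := uo) (k := k) (e := e) (i := some i)
      (j := some j) (hu _ (mem_singleton_self _) B rfl)
    have e1 := ho.2.1 i rfl; have e2 := ho.2.2 j rfl; rw [← e2, Label.tag.injEq] at e1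
    rw [h1, src_add, src_cons, src_cons, src_again ho.1.int, h2]
    have h := CAct.com' ho.1.bnd ho.1.subj hi hj e1.1 C
    simpa only [Comp.src, singleton_add, cons_add] using h
  | @comR A uo B k e i j v hb hi hj =>
    refine .inr ?_; have ho := hok _ (mem_singleton_self _)
    obtain ⟨C, h1, h2⟩ := src_flight (A := A) (uo := uo) (k := k) (e := e) (i := some i)
      (j := some j) (hu _ (mem_singleton_self _) B rfl)
    have e1 := ho.2.1 i rfl; have e2 := ho.2.2 j rfl; rw [← e2, Label.tag.injEq] at e1
    rw [h1, src_add, src_cons, src_cons, src_again ho.1.int, h2, cons_swap]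
    have h := CAct.com' (A := B) (B := A) (by rw [ho.1.subj]; exact bnd_co ho.1.bnd)
      (by rw [ho.1.subj, co_co ho.1.bnd]) hj hi e1.1.symm C
    rw [cons_swap (B.P j), add_left_comm] at h
    simpa only [Comp.src, singleton_add, cons_add] using h
  | _ => exact .inl (by simp [src_singleton, Comp.src, weight_singleton, Comp.weight])

section

variable {Γ : Ctx} {X V V' : List ℕ} {D : Multiset Comp}

theorem Inv.uses {ds R : Multiset Comp} (hI : Inv Γ X V (ds + R)) (hne : ∀ B, Comp.ext B ∈ ds →
    ∀ d ∈ ds, ∀ B, ¬ d.Uses B) :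
    ∀ d ∈ ds, ∀ B, d.Uses B → B.q = .un → Comp.ext B ∈ R := by
  intro d hd B hu hq; rcases mem_add.mp (hI.used d (mem_add.mpr (.inl hd)) B hu hq) with h | h
  · grind
  grind

theorem LStep.not_uses {ds ds' : Multiset Comp} {N : Multiset CMV.Proc} (h : LStep V ds N V' ds')
    (B : Ch) (hB : Comp.ext B ∈ ds) : ∀ d ∈ ds, ∀ B, ¬ d.Uses B := by
  cases h <;> simp_all [Comp.Uses]

theorem LStep.ext_mem {ds ds' : Multiset Comp} {N : Multiset CMV.Proc} (h : LStep V ds N V' ds')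
    {B : Ch} (hB : Comp.ext B ∈ ds) (hq : B.q = .un) : Comp.ext B ∈ ds' := by
  cases h with
  | meetL A uo B' h1 h2 h3 =>
    simp only [mem_cons, reduceCtorEq, mem_singleton, Comp.ext.injEq, false_or] at hB; grind
  | meetU A uo B' =>
    simp only [mem_cons, reduceCtorEq, mem_singleton, Comp.ext.injEq, false_or] at hB
    subst hB; simp [extPers, hq]
  | _ => simp at hB

theorem LStep.ok {ds ds' : Multiset Comp} {N : Multiset CMV.Proc} (h : LStep V ds N V' ds')
    (hok : ∀ d ∈ ds, d.ok) : ∀ d ∈ ds', d.ok := by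
  have ha : ∀ {A : Ch} {uo}, IntOK A uo → ∀ d ∈ again A uo, d.ok := by
    intro A uo h d hd
    cases uo with
    | none => simp [again] at hd
    | some u => rw [again, mem_singleton] at hd; rw [hd]; exact h
  have hself : ∀ {d : Comp}, d.ok → ∀ d' ∈ ({d} : Multiset Comp), d'.ok := by
    intro d h d' hd'; rwa [mem_singleton.mp hd']
  have fin : ∀ {p r : AProc} {A : Ch} {uo}, IntOK A uo →
      ∀ d ∈ (.idle p ::ₘ .idle r ::ₘ again A uo : Multiset Comp), d.ok := by
    intro p r A uo h d hd; rcases mem_cons.mp hd with rfl | hd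
    · trivial
    rcases mem_cons.mp hd with rfl | hd
    · trivial
    grind
  cases h with
  | condT p r => exact hself trivial
  | condF p r => exact hself trivial
  | @trig A u h hb =>
    have h : IntOK A (some u) := hok (.token A u) (mem_singleton_self _); exact hself h
  | pickL A uo h hk => exact hself ⟨hok _ (mem_singleton_self _), .inl ⟨h, rfl⟩, hk⟩
  | pickU A uo h hk hp _ => exact hself ⟨hok _ (mem_singleton_self _), .inr ⟨h, hp⟩, hk⟩
  | meetL A uo B h h' hq hb hx hk =>
    obtain ⟨o1, o2, o3⟩ := hok _ (mem_cons_self _ _); have o4 := hok (.ext B) (by simp)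
    exact hself ⟨⟨o1, o2, o3, o4, h'.trans h.symm, hx, hb, fun _ => hq⟩, by simp, by simp⟩
  | meetU A uo B h h' hb hx =>
    obtain ⟨o1, o2, o3⟩ := hok _ (mem_cons_self _ _); have o4 := hok (.ext B) (by simp); intro d hd
    rcases mem_cons.mp hd with rfl | hd
    · exact ⟨⟨o1, o2, o3, o4, h'.trans h.symm, hx, hb, fun hl => by grind⟩, h⟩
    · cases hq : B.q with
      | lin => simp [extPers, hq] at hd
      | un => simp only [extPers, hq, mem_singleton] at hd; grind
  | enter A uo B hb hk => exact hself ⟨(hok _ (mem_singleton_self _)).1, by simp, by simp⟩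
  | left A uo B j hk =>
    obtain ⟨o1, o2, o3⟩ := hok _ (mem_singleton_self _); exact hself ⟨o1, by grind, o3⟩
  | right A uo B i hk =>
    obtain ⟨o1, o2, o3⟩ := hok _ (mem_singleton_self _); exact hself ⟨o1, o2, by grind⟩
  | comL A uo B hb hi hj => exact fin (hok _ (mem_singleton_self _)).1.int
  | comR A uo B hb hi hj => exact fin (hok _ (mem_singleton_self _)).1.int

theorem LStep.used {ds ds' : Multiset Comp} {N : Multiset CMV.Proc} (h : LStep V ds N V' ds')
    {d : Comp} (hd : d ∈ ds') {B : Ch} (hu : d.Uses B) (hq : B.q = .un) :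
    Comp.ext B ∈ ds' ∨ ∃ d₀ ∈ ds, d₀.Uses B := by
  have ha : ∀ {A : Ch} {uo}, d ∈ again A uo → False := by
    intro A uo hd
    cases uo with
    | none => simp [again] at hd
    | some u => rw [again, mem_singleton] at hd; rw [hd] at hu; exact hu
  cases h with
  | meetL A uo B' h1 h2 h3 => rw [mem_singleton] at hd; subst hd; cases hu; grind
  | meetU A uo B' =>
    rcases mem_cons.mp hd with rfl | hd
    · cases hu; exact .inl (by simp [extPers, hq])
    · cases hq' : B'.q with
      | lin => simp [extPers, hq'] at hd
      | un => simp only [extPers, hq', mem_singleton] at hd; subst hd; cases hu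
  | comL A uo B' =>
    simp only [mem_cons] at hd; rcases hd with rfl | rfl | hd
    · cases hu
    · cases hu
    grind
  | comR A uo B' =>
    simp only [mem_cons] at hd; rcases hd with rfl | rfl | hd
    · cases hu
    · cases hu
    grind
  | _ =>
    rw [mem_singleton] at hd; subst hd
    first
    | exact hu.elim
    | exact .inr ⟨_, mem_singleton_self _, hu⟩

theorem LStep.priv {ds ds' : Multiset Comp} {N : Multiset CMV.Proc} (h : LStep V ds N V' ds') :
    (V' = V ∧ priv ds' ≤ priv ds) ∨
      ∃ e, V' = e :: V ∧ Priv e ∧ ¬ Hit V e ∧ priv ds' = pid e ::ₘ priv ds := by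
  have ha : ∀ {A : Ch} {uo}, Mix.priv (again A uo) = loopPriv uo := by
    intro A uo; cases uo <;> simp [again, Comp.priv, loopPriv, Mix.priv]
  cases h with
  | pickU A uo h hk hp hV =>
    exact .inr ⟨_, rfl, hp, hV, by simp [priv_singleton, Comp.priv, Ch.endPriv, h]⟩
  | meetU A uo B h h' =>
    refine .inl ⟨rfl, ?_⟩; cases hq : B.q <;> simp [Comp.priv, extPers, hq, Mix.priv]
  | comL A uo B => exact .inl ⟨rfl, by simp [priv_cons, priv_singleton, Comp.priv, ha]⟩
  | comR A uo B => exact .inl ⟨rfl, by simp [priv_cons, priv_singleton, Comp.priv, ha]⟩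
  | pickL A uo h => exact .inl ⟨rfl, by simp [priv_singleton, Comp.priv, Ch.endPriv, h]⟩
  | _ => exact .inl ⟨rfl, by simp [priv_cons, priv_singleton, Comp.priv, loopPriv]⟩

theorem LStep.inv {ds ds' R : Multiset Comp} {N : Multiset CMV.Proc} (h : LStep V ds N V' ds')
    (hI : Inv Γ X V (ds + R)) : Inv Γ X V' (ds' + R) := by
  have hok : ∀ d ∈ ds, d.ok := fun d hd => hI.ok d (mem_add.mpr (.inl hd))
  refine ⟨?_, hI.even, ?_, fun d hd => ?_, ?_, ?_, fun d hd B hu hq => ?_⟩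
  · rcases h.src hok (hI.uses h.not_uses) with ⟨e, _⟩ | hc
    · have := hI.wt; rw [src_add, ← e, ← src_add] at this; grind
    · exact hc.wt hI.wt
  · rcases h.priv with ⟨rfl, _⟩ | ⟨e, rfl, hp, _, _⟩
    · exact hI.odd
    · intro a ha; rcases List.mem_cons.mp ha with rfl | ha
      · exact hp.2
      · exact hI.odd a ha
  · rcases mem_add.mp hd with hd | hd
    · exact h.ok hok d hd
    · exact hI.ok d (mem_add.mpr (.inr hd))
  · have hn := hI.nodup; rw [priv_add] at hn ⊢; rcases h.priv with ⟨rfl, hle⟩ | ⟨e, rfl, hp, hV, e1⟩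
    · exact Multiset.nodup_of_le (add_le_add hle le_rfl) hn
    · rw [e1, cons_add, Multiset.nodup_cons]; refine ⟨fun hm => hV ⟨hp.1, hI.priv _ ?_⟩, hn⟩
      rwa [priv_add]
  · intro n hn; rw [priv_add] at hn; rcases h.priv with ⟨rfl, hle⟩ | ⟨e, rfl, hp, hV, e1⟩
    · exact hI.priv n (by rw [priv_add]; exact Multiset.mem_of_le (add_le_add hle le_rfl) hn)
    · rw [e1, cons_add, mem_cons] at hn; rw [List.map_cons, List.mem_cons]
      exact hn.imp id fun hn => hI.priv n (by rwa [priv_add])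
  · have keep : Comp.ext B ∈ ds + R → Comp.ext B ∈ ds' + R := by
      intro hm; rcases mem_add.mp hm with hm | hm
      · exact mem_add.mpr (.inl (h.ext_mem hm hq))
      grind
    rcases mem_add.mp hd with hd | hd
    · rcases h.used hd hu hq with h1 | ⟨d₀, h1, h2⟩
      · grind
      · exact keep (hI.used d₀ (mem_add.mpr (.inl h1)) B h2 hq)
    · exact keep (hI.used d (mem_add.mpr (.inr hd)) B hu hq)

end

/-! ### Decomposition of processes -/

/-- `FStep X V p X' V' ds`: the process `p` consists of the components `ds`. -/
inductive FStep : List ℕ → List ℕ → AProc → List ℕ → List ℕ → Multiset Comp → Prop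
  | par {X V} (p r) : FStep X V (.par p r) X V (.idle p ::ₘ {.idle r})
  | inact {X V} : FStep X V .inact X V 0
  | res {X V a} (p) : Bnd a → pid a % 2 = 0 → ¬ Hit X a →
      FStep X V (.res p) (a :: X) V {.idle (openWith a p)}
  | cond {X V} (v p r) : FStep X V (.ite v p r) X V {.cond v p r}
  | ext {X V} (B : Ch) : B.w = .ext → FStep X V B.proc X V {.ext B}
  | int {X V} (A : Ch) : A.w = .int → A.q = .lin → FStep X V A.proc X V {.int A none}
  | loop {X V} (A : Ch) {u} : A.w = .int → A.q = .un → A.q' = .un → Priv u → ¬ Hit V u →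
      FStep X V A.proc X (u :: V) {.token A u}

theorem enc_ext {B : Ch} (h : B.w = .ext) : B.proc.enc = B.ext := by
  obtain ⟨q, q', w, x, n, l, a, P⟩ := B; cases h; cases q' <;> rfl

theorem enc_int {A : Ch} (h : A.w = .int) (hq : A.q = .lin) : A.proc.enc = A.int none := by
  obtain ⟨q, q', w, x, n, l, a, P⟩ := A; cases h; cases hq; cases q' <;> rfl

theorem enc_loop {A : Ch} (h : A.w = .int) (hq : A.q = .un) (hq' : A.q' = .un) :
    A.proc.enc = loop A.l A.a (fun i => (A.P i).enc) (.var A.x) := by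
  obtain ⟨q, q', w, x, n, l, a, P⟩ := A; cases h; cases hq; cases hq'; rfl

theorem openWith_enc_loop (A : Ch) (u : ℕ) :
    CMV.openWith u (.par (.out (.var 0) .unit .inact) (.inp .un (.var 1)
      (intUn A.l (wkAct A.a 3) (fun i => .par (wkCont A.a (fun i => (A.P i).enc) 3 i)
        (.out (loopName (A.a i)) .unit .inact)) ((Val.var A.x).subst (wk 3))))) =
    .par (.out (.var u) .unit .inact) (A.server u) :=
  openWith_loop _ _ _ _ _

theorem not_hit_of_parity {Z : List ℕ} {c n : ℕ} (hZ : ∀ a ∈ Z, pid a % 2 = c)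
    (hn : pid n % 2 ≠ c) : ¬ Hit Z n := by
  intro h; obtain ⟨b, hb, e⟩ := List.mem_map.mp h.2; grind

theorem FStep.conf {X V X' V' : List ℕ} {p : AProc} {ds : Multiset Comp}
    (h : FStep X V p X' V' ds) (hX : ∀ a ∈ X, pid a % 2 = 0) (hV : ∀ a ∈ V, pid a % 2 = 1)
    {T : CMV.Proc} {R : Multiset CMV.Proc} (hc : ConfG T (X ++ V) (p.enc ::ₘ R)) :
    ConfG T (X' ++ V') (thr ds + R) := by
  cases h with
  | par p r => have := CMV.confG_par hc; simpa [thr_cons, thr_singleton, Comp.thr] using this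
  | inact => rw [thr_zero, zero_add]; exact CMV.confG_inact hc
  | @res a p hb he ha =>
    rw [thr_singleton, Comp.thr, singleton_add]
    have hV' : ¬ Hit V a := not_hit_of_parity hV (by omega)
    have := hc.open hb (by rw [hit_append]; grind); rw [openWith, AProc.enc_subst]; exact this
  | cond v p r => rwa [thr_singleton, Comp.thr, singleton_add]
  | ext B hw => rwa [thr_singleton, Comp.thr, singleton_add, ← enc_ext hw]
  | int A hw hq =>
    rwa [thr_singleton, Comp.thr, Ch.servers, cons_zero, singleton_add, ← enc_int hw hq]
  | loop A hw hq hq' hp hu =>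
    rw [enc_loop hw hq hq'] at hc
    have := hc.open_middle hp.1 (.inl rfl) (not_hit_of_parity hX (by have := hp.2; omega)) hu
    rw [openWith_enc_loop] at this; have := CMV.confG_par this
    simpa [thr_singleton, Comp.thr] using this

theorem FStep.src {X V X' V' : List ℕ} {p : AProc} {ds : Multiset Comp}
    (h : FStep X V p X' V' ds) :
    (X' = X ∧ src ds = {p}) ∨ ∀ R, CFlat X (p ::ₘ R) X' (src ds + R) := by
  cases h with
  | par p r =>
    refine .inr fun R => ?_; simp only [src_cons, src_singleton, Comp.src, singleton_add, cons_add]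
    exact .par _ _ _ _
  | inact => refine .inr fun R => ?_; change CFlat _ _ _ (0 + R); rw [zero_add]; exact .inact _ _
  | res p hb he ha =>
    refine .inr fun R => ?_; simp only [src_singleton, Comp.src, singleton_add]
    exact .res _ _ hb he ha
  | _ => exact .inl ⟨rfl, src_singleton _⟩

theorem FStep.weight {X V X' V' : List ℕ} {p : AProc} {ds : Multiset Comp}
    (h : FStep X V p X' V' ds) : weight ds ≤ p.weight := by
  cases h with
  | par p r => simp [weight_cons, weight_singleton, Comp.weight, AProc.weight]
  | inact => simp [Mix.weight]
  | res p => simp [weight_singleton, Comp.weight, AProc.weight, openWith, AProc.weight_subst]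
  | _ => simp [weight_singleton, Comp.weight, AProc.weight, Ch.proc]

theorem FStep.priv {X V X' V' : List ℕ} {p : AProc} {ds : Multiset Comp}
    (h : FStep X V p X' V' ds) : (V' = V ∧ priv ds = 0) ∨
      ∃ e, V' = e :: V ∧ Priv e ∧ ¬ Hit V e ∧ priv ds = {pid e} := by
  cases h with
  | loop A hw hq hq' hp hu => exact .inr ⟨_, rfl, hp, hu, by simp [priv_singleton, Comp.priv]⟩
  | _ => exact .inl ⟨rfl, by simp [Comp.priv, loopPriv, Mix.priv]⟩

theorem FStep.ok {X V X' V' : List ℕ} {p : AProc} {ds : Multiset Comp}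
    (h : FStep X V p X' V' ds) : ∀ d ∈ ds, d.ok ∧ ∀ B, ¬ d.Uses B := by
  have hs : ∀ {d : Comp}, d.ok → (∀ B, ¬ d.Uses B) →
      ∀ d' ∈ ({d} : Multiset Comp), d'.ok ∧ ∀ B, ¬ d'.Uses B := by
    intro d h1 h2 d' hd'; rw [mem_singleton.mp hd']; grind
  cases h with
  | par p r =>
    intro d hd; simp only [mem_cons, mem_singleton] at hd
    rcases hd with rfl | rfl <;> exact ⟨trivial, fun _ h => h⟩
  | inact => grind
  | res p => exact hs trivial fun _ h => h
  | cond v p r => exact hs trivial fun _ h => h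
  | ext B hw => exact hs hw fun _ h => h
  | int A hw hq => exact hs ⟨hw, .inl ⟨rfl, hq⟩⟩ fun _ h => h
  | @loop A u hw hq hq' hp hu =>
    have h : IntOK A (some u) := ⟨hw, .inr ⟨u, rfl, hq, hq', hp⟩⟩; exact hs h fun _ h => h

theorem FStep.inv {Γ : Ctx} {X V X' V' : List ℕ} {p : AProc} {ds R : Multiset Comp}
    (h : FStep X V p X' V' ds) (hI : Inv Γ X V (.idle p ::ₘ R)) : Inv Γ X' V' (ds + R) := by
  refine ⟨?_, ?_, ?_, fun d hd => ?_, ?_, ?_, fun d hd B hu hq => ?_⟩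
  · have hw := hI.wt; rw [src_cons, Comp.src, singleton_add] at hw; rw [src_add]
    rcases h.src with ⟨rfl, e⟩ | hc
    · rwa [e, singleton_add]
    · exact (hc _).wt hw
  · have := hI.even
    cases h with
    | res p hb he ha => grind
    | _ => grind
  · rcases h.priv with ⟨rfl, _⟩ | ⟨e, rfl, hp, _⟩
    · exact hI.odd
    · intro a ha; rcases List.mem_cons.mp ha with rfl | ha
      · exact hp.2
      · exact hI.odd a ha
  · rcases mem_add.mp hd with hd | hd
    · exact (h.ok d hd).1
    · exact hI.ok d (mem_cons_of_mem hd)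
  · have hn := hI.nodup; rw [priv_cons, Comp.priv, zero_add] at hn; rw [priv_add]
    rcases h.priv with ⟨rfl, e⟩ | ⟨u, rfl, hp, hV, e⟩ <;> rw [e]
    · grind
    · rw [singleton_add, Multiset.nodup_cons]; refine ⟨fun hm => hV ⟨hp.1, hI.priv _ ?_⟩, hn⟩
      rwa [priv_cons, Comp.priv, zero_add]
  · have hn := hI.priv; rw [priv_cons, Comp.priv, zero_add] at hn; intro n hm; rw [priv_add] at hm
    rcases h.priv with ⟨rfl, e⟩ | ⟨u, rfl, hp, hV, e⟩ <;> rw [e] at hm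
    · grind
    · rw [singleton_add, mem_cons] at hm; grind
  · rcases mem_add.mp hd with hd | hd
    · exact ((h.ok d hd).2 B hu).elim
    · have := hI.used d (mem_cons_of_mem hd) B hu hq; grind

/-- The size of the part of `p` that is not guarded. -/
def AProc.size : AProc → ℕ
  | .par p r => p.size + r.size + 1
  | .res p => p.size + 1
  | _ => 1

theorem AProc.size_subst (p : AProc) (σ : ℕ → Val) : (p.subst σ).size = p.size := by
  induction p generalizing σ with
  | par p r h1 h2 => simp [AProc.subst, AProc.size, h1, h2]
  | res p ih => simp [AProc.subst, AProc.size, ih]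
  | _ => rfl

def Comp.size : Comp → ℕ
  | idle p => p.size
  | _ => 0

def size (D : Multiset Comp) : ℕ := (D.map Comp.size).sum

theorem exists_priv (V : List ℕ) : ∃ u, Priv u ∧ ¬ Hit V u := by
  obtain ⟨N, hN⟩ := CMV.exists_pid_bound V
  refine ⟨6 * N + 4, by unfold Priv Bnd pid; omega, fun hh => ?_⟩
  obtain ⟨b, hb, e⟩ := List.mem_map.mp hh.2; have := hN b hb; unfold pid at e this; omega

theorem exists_sess (X : List ℕ) : ∃ a, Bnd a ∧ pid a % 2 = 0 ∧ ¬ Hit X a := by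
  obtain ⟨N, hN⟩ := CMV.exists_pid_bound X
  refine ⟨6 * N + 1, by unfold Bnd; omega, by unfold pid; omega, fun hh => ?_⟩
  obtain ⟨b, hb, e⟩ := List.mem_map.mp hh.2; have := hN b hb; unfold pid at e this; omega

theorem wt_choice {Γ : Ctx} {X : List ℕ} {q q' w x n l a P} {C : Multiset AProc}
    (h : WT Γ X (.choice q q' w x n l a P ::ₘ C)) :
    ∃ A : Ch, AProc.choice q q' w x n l a P = A.proc := by
  obtain ⟨Ξ, hc, ht⟩ := h; have .par hs h1 h2 := typing_parM_cons.mp ht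
  obtain ⟨y, _, _, _, _, rfl, _⟩ := h1.choice_inv; exact ⟨⟨q, q', w, y, n, l, a, P⟩, rfl⟩

theorem exists_fstep {Γ : Ctx} {X V : List ℕ} {p : AProc} {R : Multiset Comp}
    (hI : Inv Γ X V (.idle p ::ₘ R)) : ∃ X' V' ds, FStep X V p X' V' ds ∧ size ds < p.size := by
  have hw := hI.wt; rw [src_cons, Comp.src, singleton_add] at hw
  cases p with
  | par p r => exact ⟨_, _, _, .par p r, by simp [size, Comp.size, AProc.size]⟩
  | inact => exact ⟨_, _, _, .inact, by simp [size, AProc.size]⟩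
  | res p =>
    obtain ⟨a, h1, h2, h3⟩ := exists_sess X
    exact ⟨_, _, _, .res p h1 h2 h3, by
      simp [size, Comp.size, AProc.size, openWith, AProc.size_subst]⟩
  | ite v p r => exact ⟨_, _, _, .cond v p r, by simp [size, Comp.size, AProc.size]⟩
  | choice q q' w x n l a P =>
    obtain ⟨A, hA⟩ := wt_choice hw; rw [hA] at hw ⊢
    have hs : 0 < A.proc.size := by simp [Ch.proc, AProc.size]
    cases hw' : A.w with
    | ext => exact ⟨_, _, _, .ext A hw', by simpa [size, Comp.size] using hs⟩
    | int =>
      cases hq : A.q with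
      | lin => exact ⟨_, _, _, .int A hw' hq, by simpa [size, Comp.size] using hs⟩
      | un =>
        have hq' : A.q' = .un := by
          cases hq' : A.q' with
          | un => rfl
          | lin => have := wt_lin hw (mem_cons_self _ _) hq'; grind
        obtain ⟨u, h1, h2⟩ := exists_priv V
        exact ⟨_, _, _, .loop A hw' hq hq' h1 h2, by simpa [size, Comp.size] using hs⟩

/-- Decomposition of the processes of a state. -/
inductive FRun : List ℕ → List ℕ → Multiset Comp → List ℕ → List ℕ → Multiset Comp → Prop
  | refl (X V D) : FRun X V D X V D
  | step {X V p X' V' ds R X'' V'' D} : FStep X V p X' V' ds → FRun X' V' (ds + R) X'' V'' D →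
      FRun X V (.idle p ::ₘ R) X'' V'' D

theorem exists_flat {Γ : Ctx} {X V : List ℕ} {F D : Multiset Comp} (hI : Inv Γ X V (F + D)) :
    ∃ X' V' D', FRun X V D X' V' D' ∧ ∀ p, Comp.idle p ∉ D' := by
  induction hn : size D using Nat.strong_induction_on generalizing X V D with
  | _ n ih =>
    by_cases h : ∃ p, Comp.idle p ∈ D
    · obtain ⟨p, hp⟩ := h; obtain ⟨R, rfl⟩ := exists_cons_of_mem hp; rw [add_cons] at hI
      obtain ⟨X', V', ds, hs, hlt⟩ := exists_fstep hI; have hI' := hs.inv hI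
      rw [add_left_comm] at hI'
      obtain ⟨X'', V'', D', h1, h2⟩ := ih (size (ds + R))
        (by rw [← hn]; simp only [size, Multiset.map_add, Multiset.sum_add, Multiset.map_cons,
          Multiset.sum_cons] at hlt ⊢; simpa [Comp.size] using hlt) hI' rfl
      exact ⟨X'', V'', D', .step hs h1, h2⟩
    · exact ⟨X, V, D, .refl _ _ _, not_exists.mp h⟩

theorem FRun.inv {Γ : Ctx} {X V X' V' : List ℕ} {D D' : Multiset Comp} (h : FRun X V D X' V' D')
    {F : Multiset Comp} (hI : Inv Γ X V (F + D)) : Inv Γ X' V' (F + D') := by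
  induction h with
  | refl => exact hI
  | step hs _ ih => rw [add_cons] at hI; have := hs.inv hI; grind

theorem FRun.conf {Γ : Ctx} {X V X' V' : List ℕ} {D D' : Multiset Comp} (h : FRun X V D X' V' D')
    {F : Multiset Comp} (hI : Inv Γ X V (F + D)) {T : CMV.Proc}
    (hc : ConfG T (X ++ V) (thr (F + D))) : ConfG T (X' ++ V') (thr (F + D')) := by
  induction h with
  | refl => exact hc
  | step hs _ ih =>
    rw [add_cons] at hI hc; have hI' := hs.inv hI; rw [thr_cons, Comp.thr, singleton_add] at hc
    have hc' := hs.conf hI.even hI.odd hc; rw [← thr_add] at hc'; grind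

theorem FRun.weight {X V X' V' : List ℕ} {D D' : Multiset Comp} (h : FRun X V D X' V' D') :
    weight D' ≤ weight D := by
  induction h with
  | refl => grind
  | step hs _ ih =>
    rw [weight_cons]; rw [weight_add] at ih; have := hs.weight; simp only [Comp.weight]; omega

/-! ### Runs of the source -/

theorem Cong.red_star {P Q R : Proc} (h : Cong P Q) (hr : ReflTransGen Red Q R) :
    ∃ R', ReflTransGen Red P R' ∧ Cong R' R := by
  rcases ReflTransGen.cases_head hr with rfl | ⟨Q', h1, h2⟩
  · grind
  · exact ⟨R, .head (.struct h h1 (.refl _)) h2, .refl _⟩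

/-- Reduction up to structural congruence. -/
def SRed (P Q : Proc) : Prop := ∃ P', ReflTransGen Red P P' ∧ Cong P' Q

theorem SRed.of_cong {P Q : Proc} (h : Cong P Q) : SRed P Q := ⟨P, .refl, h⟩

theorem SRed.of_red {P Q : Proc} (h : Red P Q) : SRed P Q := ⟨Q, .single h, .refl _⟩

theorem SRed.trans {P Q R : Proc} (h : SRed P Q) (h' : SRed Q R) : SRed P R := by
  obtain ⟨P', h1, h2⟩ := h; obtain ⟨Q', h3, h4⟩ := h'; obtain ⟨R', h5, h6⟩ := h2.red_star h3
  exact ⟨R', h1.trans h5, h6.trans h4⟩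

/-- Steps of configurations. -/
def CStep (c c' : List ℕ × Multiset AProc) : Prop :=
  CFlat c.1 c.2 c'.1 c'.2 ∨ (c'.1 = c.1 ∧ CAct c.2 c'.2)

theorem CFlat.frame {X X' : List ℕ} {C C' : Multiset AProc} (h : CFlat X C X' C')
    (F : Multiset AProc) : CFlat X (C + F) X' (C' + F) := by
  cases h with
  | par p r C => simp only [cons_add]; exact .par _ _ _ _
  | inact => simp only [cons_add]; exact .inact _ _
  | res p C hb he ha => simp only [cons_add]; exact .res _ _ hb he ha

theorem CAct.frame {C C' : Multiset AProc} (h : CAct C C') (F : Multiset AProc) :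
    CAct (C + F) (C' + F) := by
  cases h with
  | iteTrue p r C => simp only [cons_add]; exact .iteTrue _ _ _
  | iteFalse p r C => simp only [cons_add]; exact .iteFalse _ _ _
  | com C hb hi hj hl => simp only [cons_add, add_assoc]; exact .com _ hb hi hj hl

/-- Runs of configurations. -/
def CRun : List ℕ × Multiset AProc → List ℕ × Multiset AProc → Prop := ReflTransGen CStep

theorem CRun.frame {c c' : List ℕ × Multiset AProc} (h : CRun c c') (F : Multiset AProc) :
    CRun (c.1, c.2 + F) (c'.1, c'.2 + F) := by
  induction h with
  | refl => exact .refl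
  | tail _ h ih =>
    refine ih.tail ?_; rcases h with h | ⟨h1, h2⟩
    · exact .inl (h.frame F)
    · exact .inr ⟨h1, h2.frame F⟩

theorem CRun.sred {Γ : Ctx} {c c' : List ℕ × Multiset AProc} (h : CRun c c')
    (hw : WT Γ c.1 c.2) : SRed (term c.1 c.2).src (term c'.1 c'.2).src ∧ WT Γ c'.1 c'.2 := by
  induction h with
  | refl => exact ⟨.of_cong (.refl _), hw⟩
  | tail _ h ih =>
    obtain ⟨h1, h2⟩ := ih; rcases h with h | ⟨e, h⟩
    · exact ⟨h1.trans (.of_cong (h.cong h2)), h.wt h2⟩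
    · rw [e]; exact ⟨h1.trans (.of_red (h.red h2)), h.wt h2⟩

theorem FRun.crun {X V X' V' : List ℕ} {D D' : Multiset Comp} (h : FRun X V D X' V' D') :
    CRun (X, src D) (X', src D') := by
  induction h with
  | refl => exact .refl
  | step hs _ ih =>
    rw [src_cons, Comp.src, singleton_add]; rw [src_add] at ih; rcases hs.src with ⟨rfl, e⟩ | hc
    · rwa [e, singleton_add] at ih
    · exact .head (.inl (hc _)) ih

/-! ### Runs of the target -/

/-- The process `T` is in a well-formed state. -/
structure At (Γ : Ctx) (T : CMV.Proc) (X V : List ℕ) (D : Multiset Comp) : Prop where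
  inv : Inv Γ X V D
  conf : ConfG T (X ++ V) (thr D)

section

variable {Γ : Ctx} {T T' : CMV.Proc} {X V X' V' : List ℕ} {D D' F : Multiset Comp}

theorem At.frun (h : At Γ T X V (F + D)) (hr : FRun X V D X' V' D') : At Γ T X' V' (F + D') :=
  ⟨hr.inv h.inv, hr.conf h.inv h.conf⟩

theorem At.fstep {p : AProc} {ds R : Multiset Comp} (h : At Γ T X V (.idle p ::ₘ R))
    (hs : FStep X V p X' V' ds) : At Γ T X' V' (ds + R) := by
  refine ⟨hs.inv h.inv, ?_⟩; have hc := h.conf; rw [thr_cons, Comp.thr, singleton_add] at hc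
  rw [thr_add]; exact hs.conf h.inv.even h.inv.odd hc

theorem At.lstep {ds ds' R : Multiset Comp} {N : Multiset CMV.Proc} (h : At Γ T X V (ds + R))
    (hs : LStep V ds N V' ds') : ∃ T', CMV.Red T T' ∧ At Γ T' X V' (ds' + R) := by
  have hc := h.conf; rw [thr_add] at hc; obtain ⟨T', h1, h2⟩ := hc.step (hs.gstep.add (thr R))
  refine ⟨T', h1, hs.inv h.inv, ?_⟩; rw [thr_add]; exact hs.norm h.inv.even h2

theorem isItem_thr (hf : ∀ p, Comp.idle p ∉ D) : ∀ m ∈ thr D, CMV.IsItem m := by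
  intro m hm; obtain ⟨d, hd, hm⟩ := mem_bind.mp hm
  have hside : ∀ {n : ℕ} {l : Fin (n + 1) → ℕ} {a : Fin (n + 1) → Act}
      {E : Fin (n + 1) → CMV.Proc} {f k e i}, CMV.IsItem (side l a E f k e i) := by
    intro n l a E f k e i
    cases i with
    | none => rw [side, duplicates]; exact .inr ⟨_, _, rfl⟩
    | some i => refine .inl ?_; simp only [side]; cases a i <;> trivial
  have hserv : ∀ {A : Ch} {uo m}, m ∈ A.servers uo → CMV.IsItem m := by
    intro A uo m hm; obtain ⟨u, -, rfl⟩ := servers_mem hm; exact .inl trivial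
  cases d with
  | idle p => grind
  | cond v p r => rw [mem_singleton.mp hm]; exact .inl trivial
  | ext B =>
    rw [mem_singleton.mp hm]; rcases ext_eq B with ⟨_, e⟩ | ⟨_, e⟩ <;> rw [e] <;> exact .inl trivial
  | token A u =>
    simp only [Comp.thr, mem_cons, mem_singleton] at hm
    rcases hm with rfl | rfl <;> exact .inl trivial
  | int A uo =>
    rcases mem_cons.mp hm with rfl | hm
    · cases hq : A.q' with
      | lin => rw [int_lin hq]; exact .inr ⟨_, _, rfl⟩
      | un => rw [int_un hq]; exact .inr ⟨_, _, rfl⟩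
    grind
  | pend A uo k e =>
    rcases mem_cons.mp hm with rfl | hm
    · rcases request_eq A uo k e with ⟨_, e⟩ | ⟨_, e⟩ <;> rw [e] <;> exact .inl trivial
    grind
  | contact A uo B k e =>
    rcases mem_cons.mp hm with rfl | hm
    · exact .inl trivial
    rcases mem_cons.mp hm with rfl | hm
    · exact .inl trivial
    grind
  | flight A uo B k e i j => rcases mem_cons.mp hm with rfl | hm <;> grind

theorem At.red (h : At Γ T X V D) (hf : ∀ p, Comp.idle p ∉ D) (hr : CMV.Red T T') :
    ∃ ds R N V' ds', D = ds + R ∧ LStep V ds N V' ds' ∧ At Γ T' X V' (ds' + R) := by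
  obtain ⟨N, h1, h2⟩ := h.conf.red (isItem_thr hf) hr
  obtain ⟨ds, R, N₀, V', ds', rfl, hs, rfl⟩ := h.inv.analysis hf h1
  refine ⟨ds, R, N₀, V', ds', rfl, hs, hs.inv h.inv, ?_⟩; rw [thr_add]; exact hs.norm h.inv.even h2

theorem At.flat (h : At Γ T X V D) : ∃ X' V' D', FRun X V D X' V' D' ∧ At Γ T X' V' D' ∧
    ∀ p, Comp.idle p ∉ D' := by
  have hI : At Γ T X V (0 + D) := by grind
  obtain ⟨X', V', D', h1, h2⟩ := exists_flat hI.inv; have := hI.frun h1; grind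

/-- A step of the target makes the state lighter or is a step of the source. -/
theorem At.step (h : At Γ T X V D) (hr : CMV.Red T T') :
    ∃ X' V' D', At Γ T' X' V' D' ∧
      ((Cong (term X (src D)).src (term X' (src D')).src ∧ weight D' < weight D) ∨
        Red (term X (src D)).src (term X' (src D')).src) := by
  obtain ⟨X', V₁, D₁, hrun, h1, hf⟩ := h.flat
  obtain ⟨ds, R, N, V', ds', rfl, hs, h2⟩ := h1.red hf hr
  have hc : Cong (term X (src D)).src (term X' (src (ds + R))).src := by
    have : ∀ {X V D X' V' D'}, FRun X V D X' V' D' → WT Γ X (src D) →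
        Cong (term X (src D)).src (term X' (src D')).src := by
      intro X V D X' V' D' h hw
      induction h with
      | refl => exact .refl _
      | step hs _ ih =>
        rw [src_cons, Comp.src, singleton_add] at hw ⊢; rw [src_add] at ih
        rcases hs.src with ⟨rfl, e⟩ | hc
        · rw [e, singleton_add] at ih; grind
        · exact ((hc _).cong hw).trans (ih ((hc _).wt hw))
    exact this hrun h.inv.wt
  refine ⟨X', V', ds' + R, h2, ?_⟩
  rcases hs.src (fun d hd => h1.inv.ok d (mem_add.mpr (.inl hd)))
    (h1.inv.uses hs.not_uses) with ⟨e, hlt⟩ | hc'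
  · refine .inl ⟨?_, ?_⟩
    · rw [src_add, e, ← src_add]; exact hc
    · have := hrun.weight; rw [weight_add] at this ⊢; omega
  · exact .inr (.struct hc (hc'.red h1.inv.wt) (.refl _))

/-- An infinite run of the target gives one of the source. -/
theorem At.diverges (h : At Γ T X V D) (hd : Diverges CMV.Red T) :
    Diverges Red (term X (src D)).src := by
  obtain ⟨f, rfl, hf⟩ := hd
  let Q : Proc → Prop := fun P => ∃ n X V D, At Γ (f n) X V D ∧ Cong P (term X (src D)).src
  have step : ∀ P, Q P → ∃ P', Red P P' ∧ Q P' := by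
    rintro P ⟨n, X, V, D, h, hc⟩
    induction hw : weight D using Nat.strong_induction_on generalizing n X V D with
    | _ m ih =>
      obtain ⟨X', V', D', h', ⟨hc', hlt⟩ | hr⟩ := h.step (hf n)
      · exact ih _ (hw ▸ hlt) (n + 1) X' V' D' h' (hc.trans hc') rfl
      · exact ⟨_, .struct hc hr (.refl _), n + 1, X', V', D', h', .refl _⟩
  choose! g hg using step
  refine ⟨fun n => g^[n] _, rfl, fun n => ?_⟩
  have hQ : ∀ n, Q (g^[n] (term X (src D)).src) := by
    intro n
    induction n with
    | zero => exact ⟨0, X, V, D, h, .refl _⟩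
    | succ n ih => rw [Function.iterate_succ_apply']; exact (hg _ ih).2
  dsimp only; rw [Function.iterate_succ_apply']; grind

theorem At.star (h : At Γ T X V D) (hr : ReflTransGen CMV.Red T T') :
    ∃ X' V' D', At Γ T' X' V' D' ∧ SRed (term X (src D)).src (term X' (src D')).src := by
  induction hr with
  | refl => exact ⟨X, V, D, h, .of_cong (.refl _)⟩
  | tail _ hr ih =>
    obtain ⟨X', V', D', h', hs⟩ := ih; obtain ⟨X'', V'', D'', h'', ⟨hc, _⟩ | hr'⟩ := h'.step hr
    · exact ⟨X'', V'', D'', h'', hs.trans (.of_cong hc)⟩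
    · exact ⟨X'', V'', D'', h'', hs.trans (.of_red hr')⟩

end

/-! ### Initial states -/

theorem At.start {Γ : Ctx} {p : AProc} (h : Typing Γ p) :
    At Γ p.enc [] [] {.idle (p.subst (ren (3 * ·)))} := by
  refine ⟨⟨?_, by simp, by simp, ?_, by simp [priv_singleton, Comp.priv],
    by simp [priv_singleton, Comp.priv], ?_⟩, 0, by simp, good_nil, ?_⟩
  · rw [src_singleton]; exact .start h
  · intro d hd; rw [mem_singleton.mp hd]; trivial
  · intro d hd; rw [mem_singleton.mp hd]; exact fun _ h => h.elim
  · rw [thr_singleton, Comp.thr, add_zero, AProc.enc_subst]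
    exact CMV.Cong.symm (Calculus.parM_singleton (P := CMV.Proc) _)

theorem term_init {p : AProc} : Cong (term [] {p.subst (ren (3 * ·))}).src p.src := by
  have h : Cong _ _ := Calculus.cong_subst (P := AProc) (ren (· / 3))
    (Calculus.parM_singleton (p.subst (ren (3 * ·))))
  refine h.trans ?_; change Cong (AProc.subst _ _).src _; rw [AProc.subst_subst, scomp_ren]
  have : (fun n => 3 * n / 3) = fun n : ℕ => n := by grind
  rw [this, ren_id, AProc.subst_var]; exact .refl _

theorem diverges_of_cong {P Q : Proc} (h : Cong P Q) (hd : Diverges Red Q) : Diverges Red P := by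
  obtain ⟨f, rfl, hf⟩ := hd
  refine ⟨fun n => match n with | 0 => P | n + 1 => f (n + 1), rfl, fun n => ?_⟩
  cases n with
  | zero => exact .struct h (hf 0) (.refl _)
  | succ n => grind

theorem enc_divergence {Γ : Ctx} {p : AProc} (h : Typing Γ p) (hd : Diverges CMV.Red p.enc) :
    Diverges Red p.src := by
  have := (At.start h).diverges hd; rw [src_singleton] at this
  exact diverges_of_cong (.symm term_init) this

/-! ### Combined runs of source and target -/

/-- A run from the state of `T` to the state of `T'`. -/
structure Go (Γ : Ctx) (T : CMV.Proc) (X V : List ℕ) (D : Multiset Comp) (T' : CMV.Proc)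
    (X' V' : List ℕ) (D' : Multiset Comp) : Prop where
  red : ReflTransGen CMV.Red T T'
  crun : CRun (X, src D) (X', src D')
  end' : At Γ T' X' V' D'

/-- `d` implements the process `p` and has not begun to execute it. -/
inductive Impl : AProc → Comp → Prop
  | idle (p) : Impl p (.idle p)
  | cond (v p r) : Impl (.ite v p r) (.cond v p r)
  | ext (B : Ch) : Impl B.proc (.ext B)
  | token (A : Ch) (u) : Impl A.proc (.token A u)
  | int (A : Ch) : Impl A.proc (.int A none)

/-- `d` is an internal choice `A` without a partner. -/
inductive Req : Ch → Comp → Prop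
  | token (A u) : Req A (.token A u)
  | int (A uo) : Req A (.int A uo)
  | pend (A uo k e) : Req A (.pend A uo k e)

theorem src_of_impl {C : Multiset AProc} {D : Multiset Comp} (h : Rel Impl C D) : src D = C := by
  induction h with
  | zero => rfl
  | @cons p d C D h _ ih => rw [src_cons, ih]; cases h <;> rfl

theorem src_of_req {N : Multiset Ch} {F : Multiset Comp} (h : Rel Req N F) :
    src F = N.map Ch.proc := by
  induction h with
  | zero => rfl
  | @cons A d N F h _ ih => rw [src_cons, ih, Multiset.map_cons]; cases h <;> rfl

theorem impl_again {A : Ch} {uo : Option ℕ} (h : IntOK A uo) :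
    Rel Impl (pers A.q A.proc) (again A uo) := by
  obtain ⟨_, ⟨rfl, hq⟩ | ⟨u, rfl, hq, _⟩⟩ := h <;> rw [hq]
  · exact .zero
  · exact .cons (.token A u) .zero

theorem impl_extPers (B : Ch) : Rel Impl (pers B.q B.proc) (extPers B) := by
  unfold extPers; cases B.q
  · exact .zero
  · exact .cons (.ext B) .zero

section

variable {Γ : Ctx} {T T' T'' : CMV.Proc} {X X' X'' V V' V'' : List ℕ} {D D' D'' R : Multiset Comp}
  {A B : Ch}

theorem Go.trans (h : Go Γ T X V D T' X' V' D') (h' : Go Γ T' X' V' D' T'' X'' V'' D'') :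
    Go Γ T X V D T'' X'' V'' D'' :=
  ⟨h.red.trans h'.red, ReflTransGen.trans h.crun h'.crun, h'.end'⟩

theorem At.go (h : At Γ T X V D) : Go Γ T X V D T X V D := ⟨.refl, .refl, h⟩

theorem LStep.crun {ds ds' : Multiset Comp} {N : Multiset CMV.Proc} (hs : LStep V ds N V' ds')
    (hok : ∀ d ∈ ds, d.ok) (hu : ∀ d ∈ ds, ∀ B, d.Uses B → B.q = .un → Comp.ext B ∈ R) (X : List ℕ) :
    CRun (X, Mix.src (ds + R)) (X, Mix.src (ds' + R)) := by
  rcases hs.src hok hu with ⟨e, -⟩ | hc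
  · rw [src_add, src_add, e]; exact .refl
  · exact .single (.inr ⟨rfl, hc⟩)

theorem At.go_lstep {ds ds' : Multiset Comp} {N : Multiset CMV.Proc} (h : At Γ T X V (ds + R))
    (hs : LStep V ds N V' ds') : ∃ T', Go Γ T X V (ds + R) T' X V' (ds' + R) := by
  obtain ⟨T', h1, h2⟩ := h.lstep hs
  exact ⟨T', .single h1, hs.crun (fun d hd => h.inv.ok d (mem_add.mpr (.inl hd)))
    (h.inv.uses hs.not_uses) X, h2⟩

theorem At.go_int {uo : Option ℕ} {k : Label} (h : At Γ T X V (.int A uo ::ₘ R))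
    (hk : k ∈ A.intLabels) :
    ∃ T' V' e, Go Γ T X V (.int A uo ::ₘ R) T' X V' (.pend A uo k e ::ₘ R) := by
  rw [← singleton_add] at h; simp only [← singleton_add]
  cases hq : A.q' with
  | lin => obtain ⟨T', h'⟩ := h.go_lstep (.pickL A uo hq hk); grind
  | un =>
    obtain ⟨e, h1, h2⟩ := exists_priv V; obtain ⟨T', h'⟩ := h.go_lstep (.pickU A uo hq hk h1 h2)
    grind

theorem At.go_token {u : ℕ} (h : At Γ T X V (.token A u ::ₘ R)) :
    ∃ T', Go Γ T X V (.token A u ::ₘ R) T' X V (.int A (some u) ::ₘ R) := by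
  rw [← singleton_add] at h; simp only [← singleton_add]
  obtain ⟨-, ⟨e, -⟩ | ⟨u', e, -, hq, hp⟩⟩ := h.inv.ok (.token A u) (by simp)
  · cases e
  · cases e; exact h.go_lstep (.trig A hq hp.1)

theorem Ch.label_mem (A : Ch) (i : Fin (A.n + 1)) : Label.tag (A.l i) (A.a i).pol ∈ A.intLabels :=
  Finset.mem_image_of_mem _ (Finset.mem_univ i)

theorem At.go_req {d : Comp} (h : At Γ T X V (d ::ₘ R)) (hd : Req A d) :
    ∃ T' V' uo k e, Go Γ T X V (d ::ₘ R) T' X V' (.pend A uo k e ::ₘ R) := by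
  have hInt : ∀ {T V uo}, At Γ T X V (.int A uo ::ₘ R) →
      ∃ T' V' uo' k e, Go Γ T X V (.int A uo ::ₘ R) T' X V' (.pend A uo' k e ::ₘ R) := by
    intro T V uo h; obtain ⟨T', V', e, h'⟩ := h.go_int (A.label_mem 0); grind
  cases hd with
  | token u =>
    obtain ⟨T', h1⟩ := h.go_token; obtain ⟨T'', V'', uo, k, e, h2⟩ := hInt h1.end'
    exact ⟨T'', V'', uo, k, e, h1.trans h2⟩
  | int uo => grind
  | pend uo k e => exact ⟨T, V, uo, k, e, h.go⟩

theorem At.go_enter {uo : Option ℕ} {k : Label} {e : ℕ} (h : At Γ T X V (.contact A uo B k e ::ₘ R)) :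
    ∃ T', Go Γ T X V (.contact A uo B k e ::ₘ R) T' X V (.flight A uo B k e none none ::ₘ R) := by
  rw [← singleton_add] at h; simp only [← singleton_add]
  obtain ⟨ho, -⟩ := h.inv.ok (.contact A uo B k e) (by simp)
  obtain ⟨C, h1, -⟩ := src_flight (A := A) (uo := uo) (k := k) (e := e) (i := none) (j := none)
    (h.inv.uses (by simp) _ (mem_singleton_self _) B rfl)
  have hw : WT Γ X (A.proc ::ₘ B.proc ::ₘ C) := by
    rw [← h1, src_add, src_singleton]; have := h.inv.wt; rwa [src_add, src_singleton] at this
  exact h.go_lstep (.enter A uo B (ho.endp.bnd ho.bnd) ((wt_pair hw ho.bnd ho.subj).2.2 ho.int.1 ho.lab))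

theorem At.go_meet {uo : Option ℕ} {k : Label} {e : ℕ} (h : At Γ T X V (.pend A uo k e ::ₘ .ext B ::ₘ R))
    (hb : Bnd A.x) (hx : B.x = co A.x) :
    ∃ T', Go Γ T X V (.pend A uo k e ::ₘ .ext B ::ₘ R) T' X V
      (.flight A uo B k e none none ::ₘ (extPers B + R)) := by
  have hw : WT Γ X (A.proc ::ₘ B.proc ::ₘ src R) := by
    have := h.inv.wt; simpa only [src_cons, Comp.src, singleton_add] using this
  obtain ⟨h1, -, h3⟩ := wt_pair hw hb hx; obtain ⟨ho, he, hk⟩ := h.inv.ok (.pend A uo k e) (by simp)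
  have hr : Comp.pend A uo k e ::ₘ .ext B ::ₘ R = (.pend A uo k e ::ₘ {.ext B}) + R := by simp
  rw [hr] at h ⊢; rcases he with ⟨hq, rfl⟩ | ⟨hq, hp⟩
  · have hq' := h1.trans hq; have hl := wt_lin hw (by simp) hq'
    obtain ⟨T', h'⟩ := h.go_lstep (.meetL A uo B hq hq' hl hb hx (h3 ho.1 hk)); refine ⟨T', ?_⟩
    have e0 : extPers B = 0 := by unfold extPers; rw [hl]
    rwa [e0, zero_add, ← singleton_add]
  · obtain ⟨T', h'⟩ := h.go_lstep (.meetU A uo B hq (h1.trans hq) hb hx)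
    rw [cons_add (Comp.contact A uo B k e)] at h'; obtain ⟨T'', h''⟩ := h'.end'.go_enter
    exact ⟨T'', h'.trans h''⟩

theorem At.go_flight {uo : Option ℕ} {k : Label} {e : ℕ} {i j}
    (h : At Γ T X V (.flight A uo B k e i j ::ₘ R)) {i' : Fin (A.n + 1)} {j' : Fin (B.n + 1)}
    (hi : ∀ m, i = some m → m = i') (hj : ∀ m, j = some m → m = j')
    (hki : Label.tag (A.l i') (A.a i').pol = k) (hkj : Label.tag (B.l j') (B.a j').pol.dual = k) :
    ∃ T' D', Go Γ T X V (.flight A uo B k e i j ::ₘ R) T' X V (D' + R) ∧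
      (∀ v, A.a i' = .send v →
        Rel Impl (A.P i' ::ₘ (B.P j').subst (inst v) ::ₘ pers A.q A.proc) D') ∧
      (∀ v, B.a j' = .send v →
        Rel Impl ((A.P i').subst (inst v) ::ₘ B.P j' ::ₘ pers A.q A.proc) D') := by
  have ho := (h.inv.ok (.flight A uo B k e i j) (by simp)).1; have hb := ho.endp.bnd ho.bnd
  have hL : ∃ T', Go Γ T X V (.flight A uo B k e i j ::ₘ R) T' X V
      (.flight A uo B k e (some i') j ::ₘ R) := by
    cases i with
    | none =>
      rw [← singleton_add] at h; simp only [← singleton_add]; exact h.go_lstep (.left A uo B j hki)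
    | some m => rw [← hi m rfl]; exact ⟨T, h.go⟩
  obtain ⟨T₁, h1⟩ := hL
  have hR : ∃ T', Go Γ T₁ X V (.flight A uo B k e (some i') j ::ₘ R) T' X V
      (.flight A uo B k e (some i') (some j') ::ₘ R) := by
    cases j with
    | none =>
      have := h1.end'; rw [← singleton_add] at this; simp only [← singleton_add]
      exact this.go_lstep (.right A uo B _ hkj)
    | some m => rw [← hj m rfl]; exact ⟨T₁, h1.end'.go⟩
  obtain ⟨T₂, h2⟩ := hR; have h12 := h1.trans h2; have h3 := h2.end'
  rw [← hkj, Label.tag.injEq] at hki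
  cases hA : A.a i' with
  | send v =>
    cases hB : B.a j' with
    | send v' => rw [hA, hB] at hki; cases hki.2
    | recv =>
      rw [← singleton_add] at h3; obtain ⟨T', h'⟩ := h3.go_lstep (.comL A uo B hb hA hB)
      rw [singleton_add] at h'; refine ⟨T', _, h12.trans h', fun v' e => ?_, fun v' e => by cases e⟩
      cases e; exact .cons (.idle _) (.cons (.idle _) (impl_again ho.int))
  | recv =>
    cases hB : B.a j' with
    | recv => rw [hA, hB] at hki; cases hki.2
    | send v =>
      rw [← singleton_add] at h3; obtain ⟨T', h'⟩ := h3.go_lstep (.comR A uo B hb hA hB)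
      rw [singleton_add] at h'
      refine ⟨T', _, h12.trans h', (fun v' e => by cases e), fun v' e => ?_⟩; cases e
      exact .cons (.idle _) (.cons (.idle _) (impl_again ho.int))

/-- Every communication in progress can be finished. -/
theorem At.finish {uo : Option ℕ} {k : Label} {e : ℕ} {i j}
    (h : At Γ T X V (.flight A uo B k e i j ::ₘ R)) :
    ∃ T' C' D', Go Γ T X V (.flight A uo B k e i j ::ₘ R) T' X V (D' + R) ∧ Rel Impl C' D' := by
  obtain ⟨ho, hi, hj⟩ := h.inv.ok (.flight A uo B k e i j) (by simp)
  have hi' : ∃ i', (∀ m, i = some m → m = i') ∧ Label.tag (A.l i') (A.a i').pol = k := by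
    cases i with
    | some m => grind
    | none => obtain ⟨i', -, e⟩ := Finset.mem_image.mp ho.lab; grind
  have hj' : ∃ j', (∀ m, j = some m → m = j') ∧ Label.tag (B.l j') (B.a j').pol.dual = k := by
    cases j with
    | some m => grind
    | none =>
      rw [← singleton_add] at h
      obtain ⟨C, h1, -⟩ := src_flight (A := A) (uo := uo) (k := k) (e := e) (i := i) (j := none)
        (h.inv.uses (by simp) _ (mem_singleton_self _) B rfl)
      have hw : WT Γ X (A.proc ::ₘ B.proc ::ₘ C) := by rw [← h1]; exact h.inv.wt
      obtain ⟨j', -, e⟩ := Finset.mem_image.mp ((wt_pair hw ho.bnd ho.subj).2.2 ho.int.1 ho.lab)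
      grind
  obtain ⟨i', e1, e2⟩ := hi'; obtain ⟨j', e3, e4⟩ := hj'
  obtain ⟨T', D', h1, h2, h3⟩ := h.go_flight e1 e3 e2 e4; rw [← e4, Label.tag.injEq] at e2
  cases hA : A.a i' with
  | send v => grind
  | recv =>
    cases hB : B.a j' with
    | recv => rw [hA, hB] at e2; cases e2.2
    | send v => grind

theorem At.go_com {d : Comp} (h : At Γ T X V (d ::ₘ .ext B ::ₘ R)) (hd : Impl A.proc d)
    (hn : ∀ p, d ≠ .idle p) (hw : A.w = .int)
    (hb : Bnd A.x) (hx : B.x = co A.x) {i : Fin (A.n + 1)} {j : Fin (B.n + 1)}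
    (hl : Label.tag (A.l i) (A.a i).pol = Label.tag (B.l j) (B.a j).pol.dual) :
    ∃ T' V' D', Go Γ T X V (d ::ₘ .ext B ::ₘ R) T' X V' (D' + R) ∧
      (∀ v, A.a i = .send v → Rel Impl (A.P i ::ₘ (B.P j).subst (inst v) ::ₘ
        (pers A.q A.proc + pers B.q B.proc)) D') ∧
      (∀ v, B.a j = .send v → Rel Impl ((A.P i).subst (inst v) ::ₘ B.P j ::ₘ
        (pers A.q A.proc + pers B.q B.proc)) D') := by
  have hp : ∃ T' V' uo e, Go Γ T X V (d ::ₘ .ext B ::ₘ R) T' X V'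
      (.pend A uo (.tag (A.l i) (A.a i).pol) e ::ₘ .ext B ::ₘ R) := by
    generalize hp : A.proc = p at hd; obtain ⟨q, q', w, x, n, l, a, P⟩ := A
    cases hd with
    | idle => grind
    | cond => cases hp
    | ext => cases hp; cases hw.symm.trans (h.inv.ok (.ext _) (by simp))
    | token A u =>
      cases hp; obtain ⟨T', h1⟩ := h.go_token
      obtain ⟨T'', V'', e, h2⟩ := h1.end'.go_int (Ch.label_mem _ i)
      exact ⟨T'', V'', _, e, h1.trans h2⟩
    | int A =>
      cases hp; obtain ⟨T', V', e, h1⟩ := h.go_int (Ch.label_mem _ i); exact ⟨T', V', _, e, h1⟩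
  obtain ⟨T₁, V₁, uo, e, h1⟩ := hp; obtain ⟨T₂, h2⟩ := h1.end'.go_meet hb hx
  obtain ⟨T₃, D', h3, h4, h5⟩ := h2.end'.go_flight (i' := i) (j' := j) (by simp) (by simp) rfl hl.symm
  rw [← add_assoc] at h3
  refine ⟨T₃, V₁, D' + extPers B, (h1.trans h2).trans h3, fun v hv => ?_, fun v hv => ?_⟩
  · simpa only [cons_add] using (h4 v hv).add (impl_extPers B)
  · simpa only [cons_add] using (h5 v hv).add (impl_extPers B)

end

/-! ### The target follows the source -/

theorem Ch.proc_inj {A B : Ch} (h : A.proc = B.proc) : A = B := by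
  obtain ⟨q, q', w, x, n, l, a, P⟩ := A; obtain ⟨r, r', w', x', n', l', a', P'⟩ := B
  simp only [Ch.proc, AProc.choice.injEq, Val.var.injEq] at h; grind

section

variable {Γ : Ctx} {T : CMV.Proc} {X X' V : List ℕ} {C C' : Multiset AProc} {D F R : Multiset Comp}

theorem At.activate {A : Ch} {d : Comp} (h : At Γ T X V (d ::ₘ R)) (hd : Impl A.proc d) :
    ∃ V' d', At Γ T X V' (d' ::ₘ R) ∧ Impl A.proc d' ∧ (∀ p, d' ≠ .idle p) ∧
      (A.w = .ext → d' = .ext A) := by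
  generalize hp : A.proc = p at hd
  cases hd with
  | idle =>
    obtain ⟨X', V', ds, hs, -⟩ := exists_fstep h.inv; have h' := h.fstep hs
    cases hs with
    | ext B hw => cases Ch.proc_inj hp; exact ⟨V, _, h', .ext _, by simp, fun _ => rfl⟩
    | int B hw => cases Ch.proc_inj hp; exact ⟨V, _, h', .int _, by simp, fun e => by grind⟩
    | loop B hw => cases Ch.proc_inj hp; exact ⟨_, _, h', .token _ _, by simp, fun e => by grind⟩
    | _ => cases hp
  | cond => cases hp
  | ext B => cases Ch.proc_inj hp; exact ⟨V, _, h, .ext _, by simp, fun _ => rfl⟩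
  | token B u =>
    cases Ch.proc_inj hp; refine ⟨V, _, h, .token _ _, by simp, fun e => ?_⟩
    cases e.symm.trans (h.inv.ok (.token A u) (by simp)).1
  | int B =>
    cases Ch.proc_inj hp; refine ⟨V, _, h, .int _, by simp, fun e => ?_⟩
    cases e.symm.trans (h.inv.ok (.int A none) (by simp)).1

theorem At.run_com {A B : Ch} {i j v} (h : At Γ T X V (F + D))
    (hC : Rel Impl (A.proc ::ₘ B.proc ::ₘ C) D) (hb : Bnd A.x) (hx : B.x = co A.x)
    (hi : A.a i = .send v) (hj : B.a j = .recv) (hl : A.l i = B.l j) :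
    ∃ T' V' D', ReflTransGen CMV.Red T T' ∧ At Γ T' X V' (F + D') ∧
      Rel Impl (A.P i ::ₘ (B.P j).subst (inst v) ::ₘ (pers A.q A.proc + (pers B.q B.proc + C))) D' := by
  obtain ⟨d, D, hd, hC₁, rfl⟩ := rel_cons_left.mp hC
  obtain ⟨d', D, hd', hC₂, rfl⟩ := rel_cons_left.mp hC₁; simp only [add_cons] at h
  obtain ⟨V₁, d₁, h, hd, hn, he⟩ := h.activate hd; rw [cons_swap] at h
  obtain ⟨V₂, d₂, h, hd', hn', he'⟩ := h.activate hd'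
  have hw : WT Γ X (A.proc ::ₘ B.proc ::ₘ src (F + D)) := by
    have := h.inv.wt; have e : ∀ {p d}, Impl p d → d.src = {p} := by intro p d h; cases h <;> rfl
    rwa [src_cons, src_cons, e hd, e hd', singleton_add, singleton_add, cons_swap] at this
  have hdual := (wt_pair hw hb hx).2.1
  cases hv : A.w with
  | int =>
    rw [hv] at hdual; rw [he' hdual, cons_swap] at h
    obtain ⟨T', V', D', h1, h2, -⟩ := h.go_com hd hn hv hb hx (i := i) (j := j)
      (by rw [hi, hj, hl]; rfl)
    refine ⟨T', V', D' + D, h1.red, by rw [add_left_comm]; exact h1.end', ?_⟩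
    simpa only [cons_add, add_assoc] using (h2 v hi).add hC₂
  | ext =>
    rw [hv] at hdual; rw [he hv] at h
    obtain ⟨T', V', D', h1, -, h2⟩ := h.go_com hd' hn' hdual (by rw [hx]; exact bnd_co hb)
      (by rw [hx, co_co hb]) (i := j) (j := i) (by rw [hi, hj, hl]; rfl)
    refine ⟨T', V', D' + D, h1.red, by rw [add_left_comm]; exact h1.end', ?_⟩
    have := (h2 v hi).add hC₂; rw [cons_swap, add_comm (pers B.q _)] at this
    simpa only [cons_add, add_assoc] using this

theorem At.run_step (h : At Γ T X V (F + D)) (hC : Rel Impl C D) (hs : CStep (X, C) (X', C')) :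
    ∃ T' V' D', ReflTransGen CMV.Red T T' ∧ At Γ T' X' V' (F + D') ∧ Rel Impl C' D' := by
  have hite : ∀ {v p r r' C D}, At Γ T X V (F + D) → Rel Impl (.ite v p r ::ₘ C) D →
      (∀ V R, At Γ T X V (.cond v p r ::ₘ R) → ∃ T', CMV.Red T T' ∧ At Γ T' X V (.idle r' ::ₘ R)) →
      ∃ T' V' D', ReflTransGen CMV.Red T T' ∧ At Γ T' X V' (F + D') ∧ Rel Impl (r' ::ₘ C) D' := by
    intro v p r r' C D h hC hk; obtain ⟨d, D, hd, hC₁, rfl⟩ := rel_cons_left.mp hC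
    rw [add_cons] at h
    have h' : At Γ T X V (.cond v p r ::ₘ (F + D)) := by
      cases hd with
      | idle => exact h.fstep (.cond v p r)
      | cond => exact h
    obtain ⟨T', h1, h2⟩ := hk _ _ h'
    exact ⟨T', V, .idle r' ::ₘ D, .single h1, by rwa [add_cons], .cons (.idle _) hC₁⟩
  rcases hs with hs | ⟨rfl, hs⟩
  · cases hs with
    | par p r C =>
      obtain ⟨d, D, hd, hC₁, rfl⟩ := rel_cons_left.mp hC; cases hd; rw [add_cons] at h
      refine ⟨T, V, .idle p ::ₘ .idle r ::ₘ D, .refl, ?_, .cons (.idle _) (.cons (.idle _) hC₁)⟩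
      simpa only [add_cons, cons_add, singleton_add] using
        h.fstep (.par p r)
    | inact =>
      obtain ⟨d, D, hd, hC₁, rfl⟩ := rel_cons_left.mp hC; cases hd; rw [add_cons] at h
      refine ⟨T, V, D, .refl, ?_, hC₁⟩; simpa only [zero_add] using h.fstep .inact
    | res p C hb he ha =>
      obtain ⟨d, D, hd, hC₁, rfl⟩ := rel_cons_left.mp hC; cases hd; rw [add_cons] at h
      refine ⟨T, V, .idle _ ::ₘ D, .refl, ?_, .cons (.idle _) hC₁⟩
      simpa only [add_cons, singleton_add] using h.fstep (.res p hb he ha)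
  · cases hs with
    | iteTrue p r C =>
      refine hite h hC fun V R h => ?_; rw [← singleton_add] at h ⊢; exact h.lstep (.condT p r)
    | iteFalse p r C =>
      refine hite h hC fun V R h => ?_; rw [← singleton_add] at h ⊢; exact h.lstep (.condF p r)
    | @com x q q₁ w n l a P q' q₁' w' n' l' a' P' i j v C hb hi hj hl =>
      exact h.run_com (A := ⟨q, q₁, w, x, n, l, a, P⟩) (B := ⟨q', q₁', w', co x, n', l', a', P'⟩)
        hC hb rfl hi hj hl

theorem At.run (h : At Γ T X V (F + D)) (hC : Rel Impl C D) (hs : CRun (X, C) (X', C')) :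
    ∃ T' V' D', ReflTransGen CMV.Red T T' ∧ At Γ T' X' V' (F + D') ∧ Rel Impl C' D' := by
  generalize hc : (X, C) = c at hs; generalize hc' : (X', C') = c' at hs
  induction hs using ReflTransGen.head_induction_on generalizing T X V C D with
  | refl => grind
  | @head c c₁ hs _ ih =>
    subst hc; obtain ⟨T₁, V₁, D₁, h1, h2, h3⟩ := h.run_step hC (C' := c₁.2) (X' := c₁.1) hs
    obtain ⟨T₂, V₂, D₂, h4, h5, h6⟩ := ih h2 h3 rfl; exact ⟨T₂, V₂, D₂, h1.trans h4, h5, h6⟩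

end

/-! ### The translation of a configuration -/

section

variable {g : AProc → CMV.Proc}

theorem map_nuL (hr : ∀ p, g (.res p) = .res (g p)) (hs : ∀ p σ, g (p.subst σ) = (g p).subst σ)
    (X : List ℕ) (p : AProc) : g (nuL X p) = nuL X (g p) := by
  induction X with
  | nil => rfl
  | cons a X ih => change g (.res (AProc.subst _ _)) = .res (CMV.Proc.subst _ _); grind

theorem map_parM (hp : ∀ p r, g (.par p r) = .par (g p) (g r)) (h0 : g .inact = .inact)
    (C : Multiset AProc) : CMV.Cong (g (parM C)) (parM (C.map g)) := by
  have hl : ∀ l : List AProc, g (parL l) = parL (l.map g) := by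
    intro l
    induction l with
    | nil => exact h0
    | cons p l ih => exact (hp _ _).trans (congrArg (CMV.Proc.par (g p)) ih)
  have := Calculus.parM_coe (C.toList.map g); rw [← Multiset.map_coe, coe_toList] at this
  rw [parM, hl]; exact CMV.Cong.symm this

end

theorem conf_term {Γ : Ctx} {X : List ℕ} {C : Multiset AProc} (h : WT Γ X C) :
    CMV.Conf (term X C).enc X (C.map AProc.enc) := by
  obtain ⟨Γ', h1, h2, -⟩ := h.typing_nuL; obtain ⟨Ξ, hc, -⟩ := h; refine ⟨hc.good, ?_⟩
  rw [← AProc.enc_subst, term, AProc.subst_subst, h1.subst_congr (τ := Val.var), AProc.subst_var,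
    map_nuL (fun _ => rfl) AProc.enc_subst]
  · exact Calculus.nuL_cong (P := CMV.Proc) X (map_parM (fun _ _ => rfl) rfl C)
  · intro x hx; obtain ⟨V, hV⟩ := exists_some hx; rw [scomp_ren, ren, ← (h2 x V hV).1]

theorem conf_impl {U : CMV.Proc} {X : List ℕ} (hX : ∀ a ∈ X, pid a % 2 = 0) {C : Multiset AProc}
    {D : Multiset Comp} (h : Rel Impl C D) {W : List ℕ} {M : Multiset CMV.Proc}
    (hok : ∀ d ∈ D, d.ok) (hW : ∀ a ∈ W, pid a % 2 = 1) (hn : (priv D).Nodup)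
    (hd : ∀ n ∈ priv D, n ∉ W.map pid) (hc : ConfG U (X ++ W) (C.map AProc.enc + M)) :
    ∃ W', (∀ a ∈ W', pid a % 2 = 1) ∧ (∀ n ∈ W'.map pid, n ∈ W.map pid ∨ n ∈ priv D) ∧
      ConfG U (X ++ W') (thr D + M) := by
  induction h generalizing M with
  | zero => exact ⟨W, hW, fun n hn => .inl hn, hc⟩
  | @cons p d C D h _ ih =>
    rw [priv_cons] at hn hd; rw [Multiset.map_cons, cons_add, ← add_cons] at hc
    obtain ⟨W', h1, h2, h3⟩ := ih (fun d hd => hok d (mem_cons_of_mem hd))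
      (nodup_add.mp hn).2.1 (fun n hn => hd n (mem_add.mpr (.inr hn))) hc
    rw [add_cons] at h3; rw [thr_cons, add_assoc, priv_cons]
    have hf : ∀ {W''}, FStep X W' p X W'' {d} → ∃ W', (∀ a ∈ W', pid a % 2 = 1) ∧
        (∀ n ∈ W'.map pid, n ∈ W.map pid ∨ n ∈ d.priv + priv D) ∧
        ConfG U (X ++ W') (d.thr + (thr D + M)) := by
      intro W'' hs; have hc' := hs.conf hX h1 h3; rw [thr_singleton] at hc'
      refine ⟨W'', ?_, fun n hn => ?_, hc'⟩
      · rcases hs.priv with ⟨rfl, -⟩ | ⟨e, rfl, hp, -⟩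
        · exact h1
        · exact List.forall_mem_cons.mpr ⟨hp.2, h1⟩
      · rw [mem_add]; rcases hs.priv with ⟨rfl, -⟩ | ⟨e, rfl, hp, -, he⟩
        · grind
        · rw [List.map_cons, List.mem_cons] at hn; rcases hn with rfl | hn
          · rw [← priv_singleton, he]; exact .inr (.inl (by simp))
          grind
    have ho := hok d (mem_cons_self _ _)
    cases h with
    | idle => exact ⟨W', h1, fun n hn => (h2 n hn).imp_right fun h => mem_add.mpr (.inr h),
        by rwa [Comp.thr, singleton_add]⟩
    | cond v p r => exact hf (.cond v p r)
    | ext B => exact hf (.ext B ho)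
    | token A u =>
      obtain ⟨hw, ⟨e, -⟩ | ⟨u', e, hq, hq', hp⟩⟩ := ho
      · cases e
      · cases e; refine hf (.loop A hw hq hq' hp fun hh => ?_); rcases h2 _ hh.2 with h | h
        · exact hd (pid u) (by simp [Comp.priv]) h
        · exact Multiset.disjoint_left.mp (nodup_add.mp hn).2.2
            (by simp [Comp.priv] : pid u ∈ (Comp.token A u).priv) h
    | int A =>
      obtain ⟨hw, ⟨-, hq⟩ | ⟨u', e, -⟩⟩ := ho
      · exact hf (.int A hw hq)
      grind

theorem Inv.at_term {Γ : Ctx} {X V : List ℕ} {C : Multiset AProc} {D : Multiset Comp}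
    (h : Inv Γ X V D) (hg : Good (X ++ V)) (hC : Rel Impl C D) : At Γ (term X C).enc X V D := by
  refine ⟨h, ?_⟩; have hw := h.wt; rw [src_of_impl hC] at hw
  obtain ⟨W, h1, h2, h3⟩ := conf_impl (U := (term X C).enc) h.even hC (W := []) (M := 0) h.ok
    (by simp) h.nodup (by simp)
    ⟨0, by simp, by simpa using conf_term hw⟩
  rw [add_zero] at h3; refine h3.relist hg fun n hn => ?_; rw [hit_append] at hn ⊢
  refine hn.imp_right fun hn => ⟨hn.1, ?_⟩; rcases h2 _ hn.2 with hm | hm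
  · grind
  · exact h.priv _ hm

/-! ### Barbs -/

theorem _root_.CMV.not_barb_ndc {L : Finset Label} {P : Label → CMV.Proc} {n : ℕ} :
    ¬ CMV.Barb (ndc L P) n := by
  rw [ndc, CMV.barb_res, CMV.barb_par, CMV.barb_bran]; rintro (h | h)
  · grind
  · exact CMV.not_barb_garbage (ls := L.toList) (CMV.barb_res.mpr h)

theorem bnd_ne {e : ℕ} (h : Bnd e) (y : ℕ) : e ≠ 3 * y ∧ co e ≠ 3 * y :=
  ⟨fun he => h (by omega), fun he => bnd_co h (by omega)⟩

theorem not_barb_server {A : Ch} {uo : Option ℕ} (h : IntOK A uo) {m : CMV.Proc}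
    (hm : m ∈ A.servers uo) {y : ℕ} : ¬ CMV.Barb m (3 * y) := by
  obtain ⟨u, rfl, rfl⟩ := servers_mem hm; obtain ⟨-, ⟨e, -⟩ | ⟨u', e, -, -, hp⟩⟩ := h
  · cases e
  · cases e; rw [Ch.server, CMV.barb_inp, Val.var.injEq]; exact (bnd_ne hp.1 y).2

/-- The barbs of a component are barbs of the processes that it represents. -/
theorem Comp.barb {d : Comp} (hok : d.ok) (hn : ∀ p, d ≠ .idle p) {m : CMV.Proc} (hm : m ∈ d.thr)
    {y : ℕ} (hb : CMV.Barb m (3 * y)) : ∃ A : Ch, A.proc ∈ d.src ∧ A.x = 3 * y := by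
  have hside : ∀ {n : ℕ} {l : Fin (n + 1) → ℕ} {a : Fin (n + 1) → Act}
      {E : Fin (n + 1) → CMV.Proc} {f k e i}, e ≠ 3 * y → ¬ CMV.Barb (side l a E f k e i) (3 * y) := by
    intro n l a E f k e i he hb
    cases i with
    | none => rw [side, duplicates] at hb; exact CMV.not_barb_ndc hb
    | some i => rw [side] at hb; cases ha : a i <;> rw [ha] at hb <;> cases hb <;> grind
  cases d with
  | idle p => grind
  | cond v p r => rw [mem_singleton.mp hm] at hb; exact (CMV.not_barb_ite hb).elim
  | ext B =>
    rw [mem_singleton.mp hm] at hb; refine ⟨B, by simp [Comp.src], ?_⟩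
    rcases ext_eq B with ⟨_, e⟩ | ⟨_, e⟩ <;> rw [e] at hb
    · simpa [extLin, CMV.barb_bran] using hb
    · simpa [extUn, CMV.barb_inp] using hb
  | token A u =>
    rw [Comp.thr, mem_cons] at hm; rcases hm with rfl | hm
    · obtain ⟨-, ⟨e, -⟩ | ⟨u', e, -, -, hp⟩⟩ := hok
      · cases e
      · cases e; rw [CMV.barb_out, Val.var.injEq] at hb; exact ((bnd_ne hp.1 y).1 hb).elim
    · exact (not_barb_server (uo := some u) hok hm hb).elim
  | int A uo =>
    rcases mem_cons.mp hm with rfl | hm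
    · cases hq : A.q' with
      | lin => rw [int_lin hq] at hb; exact (CMV.not_barb_ndc hb).elim
      | un => rw [int_un hq] at hb; exact (CMV.not_barb_ndc hb).elim
    · exact (not_barb_server hok hm hb).elim
  | pend A uo k e =>
    rcases mem_cons.mp hm with rfl | hm
    · refine ⟨A, by simp [Comp.src], ?_⟩
      rcases request_eq A uo k e with ⟨hq, e'⟩ | ⟨_, e'⟩ <;> rw [e'] at hb
      · obtain ⟨-, ⟨-, rfl⟩ | ⟨hq', -⟩, -⟩ := hok
        · simpa [Ch.select, CMV.barb_sel] using hb
        grind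
      · simpa [CMV.barb_out] using hb
    · exact (not_barb_server hok.1 hm hb).elim
  | contact A uo B k e =>
    have he := bnd_ne (hok.1.endp.bnd hok.1.bnd) y; rcases mem_cons.mp hm with rfl | hm
    · rw [Ch.select, CMV.barb_sel, Val.var.injEq] at hb; grind
    rcases mem_cons.mp hm with rfl | hm
    · rw [extLin, CMV.barb_bran, Val.var.injEq] at hb; grind
    · exact (not_barb_server hok.1.int hm hb).elim
  | flight A uo B k e i j =>
    have he := bnd_ne (hok.1.endp.bnd hok.1.bnd) y; rcases mem_cons.mp hm with rfl | hm
    · grind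
    rcases mem_cons.mp hm with rfl | hm
    · grind
    · exact (not_barb_server hok.1.int hm hb).elim

section

variable {Γ : Ctx} {T : CMV.Proc} {X V : List ℕ} {R : Multiset Comp}

theorem At.barb_ext {B : Ch} (h : At Γ T X V (.ext B ::ₘ R)) {y : ℕ} (hy : B.x = 3 * y) :
    CMV.Barb T y := by
  refine (h.conf.barb y).mpr ⟨B.ext, by simp [thr_cons, Comp.thr], ?_⟩
  rcases ext_eq B with ⟨_, e⟩ | ⟨_, e⟩ <;> rw [e, hy] <;> constructor

theorem At.barb_req {A : Ch} {d : Comp} (h : At Γ T X V (d ::ₘ R)) (hd : Req A d) {y : ℕ}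
    (hy : A.x = 3 * y) : WeakBarb CMV.Red CMV.Barb T y := by
  obtain ⟨T', V', uo, k, e, hg⟩ := h.go_req hd
  refine ⟨T', hg.red, (hg.end'.conf.barb y).mpr ⟨A.request uo k e, by simp [thr_cons, Comp.thr], ?_⟩⟩
  obtain ⟨-, he, -⟩ := hg.end'.inv.ok (.pend A uo k e) (by simp); rcases he with ⟨hq, rfl⟩ | ⟨hq, -⟩
  · rw [request_lin hq, ← hy]; constructor
  · rw [request_un hq, hy]; constructor

end

/-- Barbs of the source are weak barbs of the target. -/
theorem enc_barb {p : AProc} {Γ : Ctx} (hp : Typing Γ p) {y : ℕ} (hb : Barb p.src y) :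
    WeakBarb CMV.Red CMV.Barb p.enc y := by
  induction p generalizing Γ y with
  | choice q q' w x n l a P _ =>
    have hx : x = .var y := by rw [AProc.src] at hb; cases hb; rfl
    subst hx; have h := At.start hp
    let A : Ch := ⟨q, q', w, 3 * y, n, l, fun i => (a i).subst (ren (3 * ·)),
      fun i => (P i).subst ((a i).under (ren (3 * ·)))⟩
    have hA : (AProc.choice q q' w (.var y) n l a P).subst (ren (3 * ·)) = A.proc := rfl
    rw [hA] at h; obtain ⟨V, d, h1, h2, h3, h4⟩ := h.activate (A := A) (R := 0) (.idle _)
    cases hw : A.w with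
    | ext => rw [h4 hw] at h1; exact ⟨_, .refl, h1.barb_ext rfl⟩
    | int =>
      refine h1.barb_req (A := A) ?_ rfl; generalize hp : A.proc = p at h2
      cases h2 with
      | idle => grind
      | cond => cases hp
      | ext B => cases Ch.proc_inj hp; cases hw.symm.trans (h1.inv.ok (.ext A) (by simp))
      | token B u => cases Ch.proc_inj hp; exact .token _ _
      | int B => cases Ch.proc_inj hp; exact .int _ _
  | par p r ih1 ih2 =>
    have .par hs h1 h2 := hp; rw [AProc.src] at hb
    cases hb with
    | parL _ hb =>
      obtain ⟨T, h3, h4⟩ := ih1 h1 hb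
      exact ⟨.par T r.enc, h3.lift (CMV.Proc.par · r.enc) fun _ _ => .par _, .parL _ h4⟩
    | parR _ hb =>
      obtain ⟨T, h3, h4⟩ := ih2 h2 hb
      refine ⟨.par p.enc T, h3.lift (CMV.Proc.par p.enc) fun _ _ h => ?_, .parR _ h4⟩
      exact .struct (.parComm _ _) (.par _ h) (.parComm _ _)
  | res p ih =>
    have .res _ _ hd h1 := hp; rw [AProc.src] at hb; have .res hb := hb
    obtain ⟨T, h3, h4⟩ := ih h1 hb; exact ⟨.res T, h3.lift CMV.Proc.res fun _ _ => .res, .res h4⟩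
  | ite => rw [AProc.src] at hb; cases hb
  | inact => rw [AProc.src] at hb; cases hb

/-- The barbs of a process, as a process of the target. -/
def Proc.skel : Proc → CMV.Proc
  | .choice _ x _ _ _ _ => .sel x (.idx 0) .inact
  | .par P Q => .par P.skel Q.skel
  | .res P => .res P.skel
  | .ite _ _ _ => .inact
  | .inact => .inact

theorem Proc.skel_subst (P : Proc) (σ : ℕ → Val) : (P.subst σ).skel = P.skel.subst σ := by
  induction P generalizing σ with
  | par P Q h1 h2 => simp only [Proc.subst, Proc.skel, CMV.Proc.subst, h1, h2]
  | res P ih => simp only [Proc.subst, Proc.skel, CMV.Proc.subst, ih]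
  | _ => rfl

theorem Cong.skel {P Q : Proc} (h : Cong P Q) : CMV.Cong P.skel Q.skel := by
  induction h with
  | refl => exact .refl _
  | symm _ ih => exact ih.symm
  | trans _ _ ih1 ih2 => exact ih1.trans ih2
  | choice => exact .refl _
  | par _ _ ih1 ih2 => exact .par ih1 ih2
  | res _ ih => exact .res ih
  | ite => exact .refl _
  | resInact => exact .resInact
  | resRes P => simp only [Proc.skel, Proc.skel_subst]; exact .resRes _
  | resPar P Q => simp only [Proc.skel, Proc.skel_subst]; exact .resPar _ _
  | resSwap P => simp only [Proc.skel, Proc.skel_subst]; exact .resSwap _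
  | parInact P => exact .parInact _
  | parComm P Q => exact .parComm _ _
  | parAssoc P Q R => exact .parAssoc _ _ _

theorem barb_skel {P : Proc} {y : ℕ} : CMV.Barb P.skel y ↔ Barb P y := by
  constructor
  · intro h
    induction P generalizing y with
    | choice => cases h; constructor
    | par P Q h1 h2 =>
      cases h with
      | parL _ h => exact .parL _ (h1 h)
      | parR _ h => exact .parR _ (h2 h)
    | res P ih => cases h with | res h => exact .res (ih h)
    | _ => cases h
  · intro h
    induction h with
    | choice => constructor
    | parL _ _ ih => exact .parL _ ih
    | parR _ _ ih => exact .parR _ ih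
    | res _ ih => exact .res ih

theorem barb_term {Γ : Ctx} {X : List ℕ} {C : Multiset AProc} (h : WT Γ X C) {A : Ch}
    (hA : A.proc ∈ C) {y : ℕ} (hy : A.x = 3 * y) : Barb (term X C).src y := by
  obtain ⟨Ξ, hc, -⟩ := h; rw [← barb_skel, term, AProc.src_subst, Proc.skel_subst, CMV.barb_subst]
  refine ⟨3 * y, ?_, by simp [ren]⟩
  rw [map_nuL (g := fun p => p.src.skel) (fun _ => rfl)
      fun p σ => by rw [AProc.src_subst, Proc.skel_subst],
    CMV.barb_nuL hc.good.2 (by unfold Bnd; omega),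
    (map_parM (g := fun p => p.src.skel) (fun _ _ => rfl) rfl C).barb, CMV.barb_parM]
  refine ⟨_, Multiset.mem_map_of_mem _ hA, ?_⟩; rw [barb_skel, ← hy]; exact .choice _ _ _ _ _ _

/-- Barbs of the target are weak barbs of the source. -/
theorem barb_enc {p : AProc} {Γ : Ctx} (hp : Typing Γ p) {y : ℕ}
    (hb : WeakBarb CMV.Red CMV.Barb p.enc y) : WeakBarb Red Barb p.src y := by
  obtain ⟨T, hr, hb⟩ := hb; obtain ⟨X, V, D, h, hs⟩ := (At.start hp).star hr
  obtain ⟨X', V', D', hrun, h', hf⟩ := h.flat; obtain ⟨m, hm, hb⟩ := (h'.conf.barb y).mp hb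
  obtain ⟨d, hd, hm⟩ := mem_bind.mp hm
  obtain ⟨A, hA, hy⟩ := Comp.barb (h'.inv.ok d hd) (fun p e => hf p (e ▸ hd)) hm hb
  have hbt := barb_term h'.inv.wt (mem_bind.mpr ⟨d, hd, hA⟩) hy
  have hs' := (hrun.crun.sred h.inv.wt).1; rw [src_singleton] at hs
  obtain ⟨P, h1, h2⟩ := ((SRed.of_cong term_init.symm).trans hs).trans hs'
  exact ⟨P, h1, barb_skel.mp ((h2.skel.barb y).mpr (barb_skel.mpr hbt))⟩

/-! ### States that differ in blocked internal choices -/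

/-- No run provides a partner for the internal choices in `N`. -/
def Blocked (X : List ℕ) (C : Multiset AProc) (N : Multiset Ch) : Prop :=
  ∀ A ∈ N, ∀ X' C' (B : Ch), CRun (X, C) (X', C') → B.proc ∈ C' → B.w = .ext → Bnd A.x →
    B.x ≠ co A.x

theorem Blocked.run {X X' : List ℕ} {C C' : Multiset AProc} {N : Multiset Ch} (h : Blocked X C N)
    (hr : CRun (X, C) (X', C')) : Blocked X' C' N :=
  fun A hA X'' C'' B hr' => h A hA X'' C'' B (ReflTransGen.trans hr hr')

/-- `T` and `U` are in states that differ only in the progress of blocked internal choices. -/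
def Twin (T U : CMV.Proc) : Prop :=
  ∃ Γ X V D N F₁ F₂, At Γ T X V (F₁ + D) ∧ At Γ U X V (F₂ + D) ∧ Rel Req N F₁ ∧ Rel Req N F₂ ∧
    Blocked X (src D) N

theorem At.weaken {Γ : Ctx} {T : CMV.Proc} {X V V' : List ℕ} {D : Multiset Comp}
    (h : At Γ T X V D) (hV : ∀ n ∈ V.map pid, n ∈ V'.map pid) (ho : ∀ a ∈ V', pid a % 2 = 1)
    (hg : Good (X ++ V')) : At Γ T X V' D := by
  refine ⟨⟨h.inv.wt, h.inv.even, ho, h.inv.ok, h.inv.nodup, fun n hn => hV n (h.inv.priv n hn),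
    h.inv.used⟩, h.conf.relist hg fun n hn => ?_⟩
  rw [hit_append] at hn ⊢; exact hn.imp_right fun hn => ⟨hn.1, hV _ hn.2⟩

theorem not_mem_of_req {N : Multiset Ch} {F : Multiset Comp} (h : Rel Req N F) {d : Comp}
    (hd : ∀ A, ¬ Req A d) : d ∉ F := by
  intro hm; obtain ⟨F', rfl⟩ := exists_cons_of_mem hm; obtain ⟨A, N', hA, -⟩ := rel_cons_right.mp h
  grind

theorem Twin.step {T U T' : CMV.Proc} (h : Twin T U) (hr : CMV.Red T T') :
    ∃ U', ReflTransGen CMV.Red U U' ∧ Twin T' U' := by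
  obtain ⟨Γ, X₀, V₀, D₀, N, F₁, F₂, h1, h2, hF₁, hF₂, hbl⟩ := h
  obtain ⟨X, V, D, hrun, hf⟩ := exists_flat h1.inv; replace h1 := h1.frun hrun
  replace h2 := h2.frun hrun; replace hbl := hbl.run hrun.crun; clear hrun D₀ V₀ X₀
  have hext : ∀ B, Comp.ext B ∉ F₁ := fun B => not_mem_of_req hF₁ fun A h => by cases h
  obtain ⟨ds, R, M, V', ds', he, hs, h3⟩ := h1.red (fun p hp => by
    rcases mem_add.mp hp with hp | hp
    · exact not_mem_of_req hF₁ (fun A h => by cases h) hp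
    grind) hr
  by_cases hd : ∃ d ∈ ds, d ∈ F₁
  · obtain ⟨d, hd, hd₁⟩ := hd; obtain ⟨F, rfl⟩ := exists_cons_of_mem hd₁
    obtain ⟨A, N', hA, hN', rfl⟩ := rel_cons_right.mp hF₁
    have hone : ∀ {d'}, ds = {d} → ds' = {d'} → Req A d' →
        ∃ U', ReflTransGen CMV.Red U U' ∧ Twin T' U' := by
      rintro d' rfl rfl hA'; rw [singleton_add, cons_add, cons_inj_right] at he
      rw [← he, singleton_add] at h3
      refine ⟨U, .refl, Γ, X, V', D, A ::ₘ N', d' ::ₘ F, F₂, by rwa [cons_add],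
        h2.weaken (fun n hn => ?_) h3.inv.odd h3.conf.good, .cons hA' hN', hF₂, hbl⟩
      rcases hs.priv with ⟨rfl, -⟩ | ⟨e, rfl, -⟩
      · exact hn
      grind
    have hmeet : ∀ {A' uo k e B}, ds = .pend A' uo k e ::ₘ {.ext B} → Bnd A'.x → B.x = co A'.x →
        ∃ U', ReflTransGen CMV.Red U U' ∧ Twin T' U' := by
      rintro A' uo k e B rfl hb hx
      have hB : Comp.ext B ∈ D := by
        have : Comp.ext B ∈ (d ::ₘ F) + D := by rw [he]; simp
        grind
      rw [mem_cons, mem_singleton] at hd; rcases hd with rfl | rfl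
      · cases hA
        exact (hbl _ (mem_cons_self _ _) X (src D) B .refl
          (mem_bind.mpr ⟨_, hB, by simp [Comp.src]⟩)
          (h1.inv.ok (.ext B) (mem_add.mpr (.inr hB))) hb hx).elim
      grind
    have hno : ∀ {d'}, ds = {d'} → (∀ A, ¬ Req A d') →
        ∃ U', ReflTransGen CMV.Red U U' ∧ Twin T' U' := by
      rintro d' rfl hn; rw [mem_singleton.mp hd] at hA; grind
    cases hs with
    | condT | condF | enter | left | right | comL | comR => exact hno rfl fun A h => by cases h
    | trig A' => rw [mem_singleton] at hd; subst hd; cases hA; exact hone rfl rfl (.int _ _)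
    | pickL A' => rw [mem_singleton] at hd; subst hd; cases hA; exact hone rfl rfl (.pend _ _ _ _)
    | pickU A' => rw [mem_singleton] at hd; subst hd; cases hA; exact hone rfl rfl (.pend _ _ _ _)
    | meetL A' uo B _ _ _ hb hx => grind
    | meetU A' uo B _ _ hb hx => grind
  · have hle : ds ≤ D := by
      classical
      rw [Multiset.le_iff_count]; intro d
      by_cases hm : d ∈ ds
      · have h0 : Multiset.count d F₁ = 0 := Multiset.count_eq_zero.mpr fun h => hd ⟨d, hm, h⟩
        have := congrArg (Multiset.count d) he; rw [Multiset.count_add, Multiset.count_add] at this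
        omega
      · rw [Multiset.count_eq_zero.mpr hm]; grind
    obtain ⟨R', rfl⟩ := Multiset.le_iff_exists_add.mp hle; rw [add_left_comm] at he h1 h2
    have hR := add_left_cancel he; subst hR; rw [add_left_comm] at h3
    obtain ⟨U', h4, h5⟩ := h2.lstep hs; rw [add_left_comm] at h5
    refine ⟨U', .single h4, Γ, X, V', ds' + R', N, F₁, F₂, h3, h5, hF₁, hF₂, hbl.run ?_⟩
    refine hs.crun (fun d hd => h1.inv.ok d (mem_add.mpr (.inl hd))) (fun d hd B hu hq => ?_) X
    exact (mem_add.mp (h1.inv.uses hs.not_uses d hd B hu hq)).resolve_left (hext B)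

theorem Twin.barb {T U : CMV.Proc} (h : Twin T U) {y : ℕ} (hb : CMV.Barb T y) :
    WeakBarb CMV.Red CMV.Barb U y := by
  obtain ⟨Γ, X, V, D, N, F₁, F₂, h1, h2, hF₁, hF₂, -⟩ := h
  obtain ⟨m, hm, hb⟩ := (h1.conf.barb y).mp hb; rw [thr_add, mem_add] at hm; rcases hm with hm | hm
  · obtain ⟨d, hd, hm⟩ := mem_bind.mp hm
    obtain ⟨A', hA', hy⟩ := Comp.barb (h1.inv.ok d (mem_add.mpr (.inl hd))) (fun p e =>
      not_mem_of_req hF₁ (fun A h => by cases h) (e ▸ hd)) hm hb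
    have hA : A'.proc ∈ src F₁ := mem_bind.mpr ⟨d, hd, hA'⟩; rw [src_of_req hF₁] at hA
    obtain ⟨A, hA, e⟩ := Multiset.mem_map.mp hA; cases Ch.proc_inj e
    obtain ⟨d', hd', hr⟩ := Multiset.exists_mem_of_rel_of_mem hF₂ hA
    obtain ⟨F, rfl⟩ := exists_cons_of_mem hd'; rw [cons_add] at h2; exact h2.barb_req hr hy
  · refine ⟨U, .refl, (h2.conf.barb y).mpr ⟨m, ?_, hb⟩⟩; rw [thr_add, mem_add]; grind

theorem Twin.bisim {T U : CMV.Proc} (h : Twin T U) : CMV.Bisim T U := by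
  refine ⟨Twin, isBisimulation_of_step ?_ (fun _ _ _ h hr => h.step hr) fun _ _ _ h hb => h.barb hb, h⟩
  rintro T U ⟨Γ, X, V, D, N, F₁, F₂, h1, h2, h3, h4, h5⟩
  exact ⟨Γ, X, V, D, N, F₂, F₁, h2, h1, h4, h3, h5⟩

theorem At.bisim {Γ : Ctx} {T U : CMV.Proc} {X V : List ℕ} {D : Multiset Comp}
    (h : At Γ T X V D) (h' : At Γ U X V D) : CMV.Bisim T U := by
  refine Twin.bisim ⟨Γ, X, V, D, 0, 0, 0, ?_, ?_, .zero, .zero, fun A hA => ?_⟩ <;> grind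

theorem _root_.CMV.Cong.bisim {T U : CMV.Proc} (h : CMV.Cong T U) : CMV.Bisim T U := by
  refine ⟨CMV.Cong, isBisimulation_of_step (fun _ _ h => h.symm) (fun P Q P' h hr => ?_)
    (fun P Q y h hb => ⟨Q, .refl, (h.barb y).mp hb⟩), h⟩
  exact ⟨P', .single (.struct h.symm hr (.refl _)), .refl _⟩

/-! ### Operational soundness -/

section

variable {Γ : Ctx} {T : CMV.Proc} {X V : List ℕ} {D E F : Multiset Comp} {C : Multiset AProc}
  {N : Multiset Ch}

/-- All communications in progress can be finished. -/
theorem At.settle (h : At Γ T X V (E + (F + D))) (hN : Rel Req N F) (hC : Rel Impl C D) :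
    ∃ T' N' F' C' D', Go Γ T X V (E + (F + D)) T' X V (F' + D') ∧ Rel Req N' F' ∧ Rel Impl C' D' := by
  induction E using Multiset.induction generalizing T F D N C with
  | empty => rw [zero_add] at h ⊢; exact ⟨T, N, F, C, D, h.go, hN, hC⟩
  | cons d E ih =>
    have himpl : ∀ {p}, Impl p d → ∃ T' N' F' C' D', Go Γ T X V ((d ::ₘ E) + (F + D)) T' X V (F' + D') ∧
        Rel Req N' F' ∧ Rel Impl C' D' := by
      intro p hp; rw [cons_add, ← add_cons, ← add_cons] at h ⊢; exact ih h hN (.cons hp hC)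
    have hreq : ∀ {A}, Req A d → ∃ T' N' F' C' D', Go Γ T X V ((d ::ₘ E) + (F + D)) T' X V (F' + D') ∧
        Rel Req N' F' ∧ Rel Impl C' D' := by
      intro A hA; rw [cons_add, ← add_cons, ← cons_add] at h ⊢; exact ih h (.cons hA hN) hC
    have hfl : ∀ {T A uo B k e i j}, At Γ T X V (.flight A uo B k e i j ::ₘ (E + (F + D))) →
        ∃ T' N' F' C' D', Go Γ T X V (.flight A uo B k e i j ::ₘ (E + (F + D))) T' X V (F' + D') ∧
        Rel Req N' F' ∧ Rel Impl C' D' := by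
      intro T A uo B k e i j h; obtain ⟨T₁, C₁, D₁, h1, h2⟩ := h.finish
      rw [show D₁ + (E + (F + D)) = E + (F + (D₁ + D)) by abel] at h1
      obtain ⟨T', N', F', C', D', h3, h4⟩ := ih h1.end' hN (h2.add hC)
      exact ⟨T', N', F', C', D', h1.trans h3, h4⟩
    cases d with
    | idle p => exact himpl (.idle p)
    | cond v p r => exact himpl (.cond v p r)
    | ext B => exact himpl (.ext B)
    | token A u => exact himpl (.token A u)
    | int A uo => exact hreq (.int A uo)
    | pend A uo k e => exact hreq (.pend A uo k e)
    | contact A uo B k e =>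
      rw [cons_add] at h ⊢; obtain ⟨T₁, h1⟩ := h.go_enter
      obtain ⟨T', N', F', C', D', h3, h4⟩ := hfl h1.end'
      exact ⟨T', N', F', C', D', h1.trans h3, h4⟩
    | flight A uo B k e i j => rw [cons_add] at h ⊢; grind

/-- The internal choices that have a partner can communicate. -/
theorem At.serve (h : At Γ T X V (F + D)) (hN : Rel Req N F) (hC : Rel Impl C D) :
    ∃ T' X' V' N' F' C' D', Go Γ T X V (F + D) T' X' V' (F' + D') ∧ Rel Req N' F' ∧
      Rel Impl C' D' ∧ Blocked X' C' N' := by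
  induction hn : N.card generalizing T X V F D N C with
  | zero =>
    rw [Multiset.card_eq_zero] at hn
    exact ⟨T, X, V, N, F, C, D, h.go, hN, hC, by subst hn; intro A hA; grind⟩
  | succ n ih =>
    by_cases hb : Blocked X C N
    · exact ⟨T, X, V, N, F, C, D, h.go, hN, hC, hb⟩
    unfold Blocked at hb
    push Not at hb
    obtain ⟨A, hA, X', C', B, hr, hB, hw, hb, hx⟩ := hb
    obtain ⟨T₁, V₁, D₁, h1, h2, h3⟩ := h.run hC hr; have hrun := hr.frame (src F); simp only at hrun
    obtain ⟨N', rfl⟩ := exists_cons_of_mem hA; obtain ⟨C₁, rfl⟩ := exists_cons_of_mem hB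
    obtain ⟨d, F', hd, hN', rfl⟩ := rel_cons_left.mp hN
    obtain ⟨b, D₂, hB', hC', rfl⟩ := rel_cons_left.mp h3; rw [add_cons] at h2
    obtain ⟨V₂, b', h4, -, -, he⟩ := h2.activate hB'; rw [he hw, cons_add, cons_swap] at h4
    obtain ⟨T₂, V₃, uo, k, e, h5⟩ := h4.go_req hd; obtain ⟨T₃, h6⟩ := h5.end'.go_meet hb hx
    obtain ⟨T₄, C₃, D₃, h7, h8⟩ := h6.end'.finish
    rw [show D₃ + (extPers B + (F' + D₂)) = F' + (D₃ + (extPers B + D₂)) by abel] at h7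
    have h9 := h7.end'
    obtain ⟨T', X'', V', N'', F'', C'', D'', h10, h11⟩ := ih h9 hN' (h8.add ((impl_extPers B).add hC'))
      (by rw [Multiset.card_cons] at hn; omega)
    have h12 := ((h5.trans h6).trans h7).trans h10
    refine ⟨T', X'', V', N'', F'', C'', D'', ⟨h1.trans h12.red, ?_, h12.end'⟩, h11⟩
    refine ReflTransGen.trans (b := (X', src (d ::ₘ .ext B ::ₘ (F' + D₂)))) ?_ h12.crun
    have e1 : src (d ::ₘ F' + D) = C + src (d ::ₘ F') := by rw [src_add, src_of_impl hC, add_comm]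
    have e2 : src (d ::ₘ .ext B ::ₘ (F' + D₂)) = B.proc ::ₘ C₁ + src (d ::ₘ F') := by
      rw [src_cons, src_cons, src_add, src_of_impl hC', src_cons, Comp.src, ← singleton_add]
      abel
    rw [e1, e2]; exact hrun

theorem exists_impl (hN : Rel Req N F) (hok : ∀ d ∈ F, d.ok) :
    ∃ F', Rel Req N F' ∧ Rel Impl (N.map Ch.proc) F' ∧ (∀ d ∈ F', d.ok) ∧ priv F' ≤ priv F := by
  induction hN with
  | zero => exact ⟨0, .zero, .zero, by simp, le_rfl⟩
  | @cons A d N F hA _ ih =>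
    obtain ⟨F', h1, h2, h3, h4⟩ := ih fun d hd => hok d (mem_cons_of_mem hd)
    have key : ∀ {uo}, IntOK A uo → loopPriv uo ≤ d.priv →
        ∃ F', Rel Req (A ::ₘ N) F' ∧ Rel Impl ((A ::ₘ N).map Ch.proc) F' ∧ (∀ d ∈ F', d.ok) ∧
          priv F' ≤ priv (d ::ₘ F) := by
      intro uo ho hp
      have : ∃ d', Req A d' ∧ Impl A.proc d' ∧ d'.ok ∧ d'.priv = loopPriv uo := by
        cases uo with
        | none => exact ⟨_, .int A none, .int A, ho, rfl⟩
        | some u => exact ⟨_, .token A u, .token A u, ho, rfl⟩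
      obtain ⟨d', r1, r2, r3, r4⟩ := this
      refine ⟨d' ::ₘ F', .cons r1 h1, by rw [Multiset.map_cons]; exact .cons r2 h2, ?_, ?_⟩
      · grind
      · rw [priv_cons, priv_cons, r4]; exact add_le_add hp h4
    have ho := hok d (mem_cons_self _ _)
    cases hA with
    | token u => exact key (uo := some u) ho le_rfl
    | int uo => exact key ho le_rfl
    | pend uo k e => exact key ho.1 (Multiset.le_add_left _ _)

theorem At.exists_term (h : At Γ T X V (F + D)) (hN : Rel Req N F) (hC : Rel Impl C D)
    (hb : Blocked X C N) : CMV.Bisim T (term X (src (F + D))).enc := by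
  obtain ⟨F', h1, h2, h3, h4⟩ := exists_impl hN fun d hd => h.inv.ok d (mem_add.mpr (.inl hd))
  have e : src (F + D) = N.map Ch.proc + C := by rw [src_add, src_of_req hN, src_of_impl hC]
  have e' : src (F' + D) = N.map Ch.proc + C := by rw [src_add, src_of_req h1, src_of_impl hC]
  have hle : priv (F' + D) ≤ priv (F + D) := by rw [priv_add, priv_add]; exact add_le_add_left h4 _
  have hI : Inv Γ X V (F' + D) := by
    refine ⟨by rw [e', ← e]; exact h.inv.wt, h.inv.even, h.inv.odd, fun d hd => ?_,
      Multiset.nodup_of_le hle h.inv.nodup, fun n hn => h.inv.priv n (Multiset.mem_of_le hle hn),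
      fun d hd B hu => ?_⟩
    · rcases mem_add.mp hd with hd | hd
      · grind
      · exact h.inv.ok d (mem_add.mpr (.inr hd))
    · obtain ⟨R, hR⟩ := exists_cons_of_mem hd; have hr := h2.add hC; rw [hR] at hr
      obtain ⟨p, _, hp, -⟩ := rel_cons_right.mp hr; cases hp <;> exact hu.elim
  have hU := hI.at_term h.conf.good (h2.add hC); rw [e]
  refine Twin.bisim ⟨Γ, X, V, D, N, F, F', h, hU, hN, h1, ?_⟩; rwa [src_of_impl hC]

end

theorem enc_sound {Γ : Ctx} {p : AProc} (hp : Typing Γ p) {T : CMV.Proc}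
    (hr : ReflTransGen CMV.Red p.enc T) :
    ∃ p' T', Typing Γ p' ∧ ReflTransGen Red p.src p'.src ∧ ReflTransGen CMV.Red T T' ∧
      CMV.Bisim T' p'.enc := by
  obtain ⟨X, V, D, h, hs⟩ := (At.start hp).star hr; have h' : At Γ T X V (D + (0 + 0)) := by grind
  obtain ⟨T₁, N₁, F₁, C₁, D₁, h1, h2, h3⟩ := h'.settle .zero .zero
  obtain ⟨T₂, X₂, V₂, N₂, F₂, C₂, D₂, h4, h5, h6, h7⟩ := h1.end'.serve h2 h3
  have hc := (h1.trans h4).crun; rw [add_zero, add_zero] at hc; rw [src_singleton] at hs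
  obtain ⟨P, h8, h9⟩ := ((SRed.of_cong term_init.symm).trans hs).trans (hc.sred h.inv.wt).1
  obtain ⟨p', rfl, h10, h11⟩ := h9.lifts.2 Γ _ rfl h4.end'.inv.wt.typing
  exact ⟨p', T₂, h10, h8, h1.red.trans h4.red,
    bisimilar_equivalence.trans (h4.end'.exists_term h5 h6 h7) h11.bisim⟩

end Mix

namespace CMV

open Calculus (nuL parM)

/-- `T` and `U` are congruent up to inert processes. -/
def UpToGarbage (T U : Proc) : Prop :=
  ∃ G G' : Multiset Proc, (∀ m ∈ G + G', ∃ ls, m = garbage ls) ∧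
    Cong (.par T (parM G)) (.par U (parM G'))

theorem UpToGarbage.cong {T T' U U' : Proc} (h : UpToGarbage T U) (hT : Cong T' T) (hU : Cong U U') :
    UpToGarbage T' U' := by
  obtain ⟨G, G', hG, h⟩ := h
  exact ⟨G, G', hG, (Cong.par hT (.refl _)).trans (h.trans (.par hU (.refl _)))⟩

theorem UpToGarbage.par {T U : Proc} (h : UpToGarbage T U) (R : Proc) :
    UpToGarbage (.par T R) (.par U R) := by
  obtain ⟨G, G', hG, h⟩ := h
  have hs : ∀ T P : Proc, Cong (.par (.par T R) P) (.par (.par T P) R) := fun T P =>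
    ((Cong.parAssoc _ _ _).symm.trans (.par (.refl _) (.parComm _ _))).trans (.parAssoc _ _ _)
  exact ⟨G, G', hG, (hs _ _).trans ((Cong.par h (.refl _)).trans (hs _ _).symm)⟩

theorem UpToGarbage.res {T U : Proc} (h : UpToGarbage T U) : UpToGarbage (.res T) (.res U) := by
  obtain ⟨G, G', hG, h⟩ := h
  have hs : ∀ (T : Proc) (G : Multiset Proc), (∀ m ∈ G, ∃ ls, m = garbage ls) →
      Cong (.par (.res T) (parM G)) (.res (.par T (parM G))) := by
    intro T G hG
    have e : (parM G : Proc).subst (wk 2) = parM G := by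
      rw [Proc.subst_congr _ (τ := Val.var), Proc.subst_var]; intro n hn
      obtain ⟨m, hm, ho⟩ := occ_parM.mp hn; obtain ⟨ls, rfl⟩ := hG m hm
      exact (not_occ_garbage ls n ho).elim
    have := Cong.resPar (parM G) T; rw [e] at this
    exact (Cong.parComm _ _).trans (this.trans (.res (.parComm _ _)))
  exact ⟨G, G', hG, (hs _ _ fun m hm => hG m (mem_add.mpr (.inl hm))).trans
    ((Cong.res h).trans (hs _ _ fun m hm => hG m (mem_add.mpr (.inr hm))).symm)⟩

theorem Conf.par_garbage {T : Proc} {Z M} (h : Conf T Z M) {G : Multiset Proc}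
    (hG : ∀ m ∈ G, ∃ ls, m = garbage ls) : Conf (.par T (parM G)) Z (M + G) := by
  refine ⟨h.1, ?_⟩
  have hn : ∀ n, ¬ (parM G : Proc).Occ n := fun n hn => by
    obtain ⟨m, hm, ho⟩ := occ_parM.mp hn; obtain ⟨ls, rfl⟩ := hG m hm; exact not_occ_garbage ls n ho
  have e : (parM G : Proc).subst (ren (3 * ·)) = parM G := by
    rw [Proc.subst_congr _ (τ := Val.var) fun n ho => (hn n ho).elim, Proc.subst_var]
  change Cong (.par (T.subst _) ((parM G : Proc).subst _)) _; rw [e]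
  exact (Cong.par h.2 (.refl _)).trans (.trans (.parComm _ _) ((par_nuL h.1.2 (fun n _ => hn n) _).trans
    (cong_nuL _ (.trans (.parComm _ _) (Cong.symm (Calculus.parM_add (P := Proc) M G))))))

theorem ConfG.par_garbage {T : Proc} {Z M} (h : ConfG T Z M) {G : Multiset Proc}
    (hG : ∀ m ∈ G, ∃ ls, m = garbage ls) : ConfG (.par T (parM G)) Z M := by
  obtain ⟨G', hG', hc⟩ := h; refine ⟨G' + G, fun m hm => (mem_add.mp hm).elim (hG' m) (hG m), ?_⟩
  rw [← add_assoc]; exact hc.par_garbage hG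

theorem ConfG.upToGarbage {T U : Proc} {Z M} (h : ConfG T Z M) (h' : ConfG U Z M) :
    UpToGarbage T U := by
  obtain ⟨G, hG, hc⟩ := h; obtain ⟨G', hG', hc'⟩ := h'
  refine ⟨G', G, fun m hm => (mem_add.mp hm).elim (hG' m) (hG m), ?_⟩
  have h1 := (hc.par_garbage hG').2; have h2 := (hc'.par_garbage hG).2; rw [add_right_comm] at h2
  have h3 := (h1.trans h2.symm).subst (ren (· / 3))
  have e : ∀ P : Proc, (P.subst (ren (3 * ·))).subst (ren (· / 3)) = P := by
    intro P; rw [Proc.subst_subst, scomp_ren]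
    have : (fun n => 3 * n / 3) = fun n : ℕ => n := by grind
    rw [this, ren_id, Proc.subst_var]
  grind

end CMV

namespace Mix

open Calculus (nu nuL parM parL)
open Encoding
open CMV (Label ConfG GStep UpToGarbage)

/-! ### Operational completeness -/

theorem At.upToGarbage {Γ : Ctx} {T U : CMV.Proc} {X V X' V' : List ℕ} {D D' : Multiset Comp}
    (h : At Γ T X V D) (h' : At Γ U X' V' D') (hg : UpToGarbage T U) : CMV.Bisim T U := by
  obtain ⟨G, G', hG, hc⟩ := hg
  have h1 : At Γ (.par T (parM G)) X V D :=
    ⟨h.inv, h.conf.par_garbage fun m hm => hG m (mem_add.mpr (.inl hm))⟩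
  have h2 : At Γ (.par U (parM G')) X' V' D' :=
    ⟨h'.inv, h'.conf.par_garbage fun m hm => hG m (mem_add.mpr (.inr hm))⟩
  have tr := fun {P Q R} => (bisimilar_equivalence (step := CMV.Red) (barb := CMV.Barb)).trans
    (x := P) (y := Q) (z := R)
  exact tr (h.bisim h1) (tr hc.bisim (h2.bisim h'))

/-- The target can follow a step of the source. -/
def Simulates (P P' : Proc) : Prop :=
  ∀ Γ p, p.src = P → Typing Γ p → ∃ p' T, p'.src = P' ∧ Typing Γ p' ∧
    ReflTransGen CMV.Red p.enc T ∧ UpToGarbage T p'.enc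

theorem CRun.simulates {p : AProc} {X : List ℕ} {C : Multiset AProc} {P' : Proc}
    (hr : CRun ([], {p.subst (ren (3 * ·))}) (X, C)) (hc : Cong (term X C).src P') {Γ : Ctx}
    (hp : Typing Γ p) : ∃ p' T, p'.src = P' ∧ Typing Γ p' ∧
    ReflTransGen CMV.Red p.enc T ∧ UpToGarbage T p'.enc := by
  have h0 := At.start hp; rw [← zero_add {_}] at h0
  obtain ⟨T, V, D, h1, h2, h3⟩ := h0.run (.cons (.idle _) .zero) hr; rw [zero_add] at h2
  have h4 := h2.inv.at_term h2.conf.good h3; have hw := h2.inv.wt; rw [src_of_impl h3] at hw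
  obtain ⟨p', e, h5, h6⟩ := hc.lifts.1 Γ _ rfl hw.typing
  exact ⟨p', T, e, h5, h1, (h2.conf.upToGarbage h4.conf).cong (.refl _) h6⟩

theorem term_one (C : Multiset AProc) :
    Cong (term [1] (C.map (AProc.subst (cons2 1 2 (ren (3 * ·)))))).src (Proc.res (parM C).src) := by
  have h1 : Calculus.Cong (P := AProc) (nuL [1] (parM (C.map (AProc.subst (cons2 1 2 (ren (3 * ·)))))))
      (nuL [1] ((parM C).subst (cons2 1 2 (ren (3 * ·))))) :=
    Calculus.nuL_cong [1] (Calculus.symm (Calculus.parM_subst (P := AProc) _ C))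
  have h2 : Cong _ _ := Calculus.cong_subst (P := AProc) (ren (· / 3)) h1; refine h2.trans ?_
  change Cong (Proc.res ((((parM C).subst _).subst (abs2 1 (co 1))).subst (up (up (ren (· / 3))))).src) _
  rw [AProc.subst_subst, AProc.subst_subst]
  have e : scomp (scomp (up (up (ren (· / 3)))) (abs2 1 (co 1))) (cons2 1 2 (ren (3 * ·))) =
      Val.var := by
    funext n
    match n with
    | 0 => rfl
    | 1 => rfl
    | n + 2 =>
      have h1 : 3 * n ≠ 1 := by omega
      have h2 : 3 * n ≠ 2 := by omega
      have h3 : 3 * n / 3 = n := by omega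
      simp [scomp, cons2, ren, Val.subst, abs2, co, h1, h2, up, h3]
  rw [e, AProc.subst_var]; exact .refl _

theorem Red.simulates {P P' : Proc} (h : Red P P') : Simulates P P' := by
  induction h with
  | iteTrue P Q =>
    intro Γ p e hp; obtain ⟨p₁, p₂, rfl, rfl, rfl⟩ := AProc.src_eq_ite e
    exact CRun.simulates (p := .ite .tt p₁ p₂) (X := []) (C := {p₁.subst _})
      (.single (.inr ⟨rfl, .iteTrue _ _ 0⟩)) term_init hp
  | iteFalse P Q =>
    intro Γ p e hp; obtain ⟨p₁, p₂, rfl, rfl, rfl⟩ := AProc.src_eq_ite e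
    exact CRun.simulates (p := .ite .ff p₁ p₂) (X := []) (C := {p₂.subst _})
      (.single (.inr ⟨rfl, .iteFalse _ _ 0⟩)) term_init hp
  | @com q n l a P q' n' l' a' P' R i j v hi hj hl =>
    intro Γ p e hp; obtain ⟨p₀, rfl, e₀⟩ := AProc.src_eq_res e
    obtain ⟨p₁, p₂, rfl, e₁, e₂⟩ := AProc.src_eq_par e₀
    obtain ⟨q₁, w, P₁, rfl, e₃⟩ := AProc.src_eq_choice e₁
    obtain ⟨p₃, r, rfl, e₄, rfl⟩ := AProc.src_eq_par e₂
    obtain ⟨q₁', w', P₁', rfl, e₅⟩ := AProc.src_eq_choice e₄; obtain rfl := funext e₃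
    obtain rfl := funext e₅
    let A := AProc.choice q q₁ w (.var 0) n l a P₁
    let B := AProc.choice q' q₁' w' (.var 1) n' l' a' P₁'
    let τ := cons2 1 2 (ren (3 * ·))
    have hper : ∀ (q : Qual) (p : AProc), (pers q p).map (AProc.subst τ) = pers q (p.subst τ) := by
      intro q p; cases q <;> rfl
    refine CRun.simulates (p := .res (.par A (.par B r))) (X := [1]) (C := Multiset.map (AProc.subst τ)
      (P₁ i ::ₘ (P₁' j).subst (inst v) ::ₘ (pers q A + (pers q' B + {r})))) ?_ ?_ hp
    · have ho : openWith 1 ((AProc.par A (.par B r)).subst (up (up (ren (3 * ·))))) =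
          .par (A.subst τ) (.par (B.subst τ) (r.subst τ)) := by
        rw [openWith, AProc.subst_subst, scomp_cons2_upup]; rfl
      refine .head (b := ([1], AProc.par (A.subst τ) (.par (B.subst τ) (r.subst τ)) ::ₘ 0))
        (.inl (ho ▸ .res _ 0 (by unfold Bnd; omega) rfl not_hit_nil)) ?_
      refine .head (b := ([1], A.subst τ ::ₘ .par (B.subst τ) (r.subst τ) ::ₘ 0))
        (.inl (.par [1] (A.subst τ) (.par (B.subst τ) (r.subst τ)) 0)) ?_
      refine .head (b := ([1], B.subst τ ::ₘ r.subst τ ::ₘ A.subst τ ::ₘ 0)) (.inl ?_) (.single (.inr ⟨rfl, ?_⟩))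
      · rw [cons_swap]; exact .par [1] (B.subst τ) (r.subst τ) (A.subst τ ::ₘ 0)
      · dsimp only; rw [cons_swap (r.subst τ), cons_swap]
        simp only [Multiset.map_cons, Multiset.map_add, hper, Multiset.map_singleton]
        have h := CAct.com (q := q) (q₁ := q₁) (w := w) (l := l) (q' := q') (q₁' := q₁') (w' := w')
          (l' := l') (a := fun i => (a i).subst τ) (a' := fun i => (a' i).subst τ)
          (P := fun i => (P₁ i).subst ((a i).under τ)) (P' := fun i => (P₁' i).subst ((a' i).under τ))
          (i := i) (j := j) (v := v.subst τ) {r.subst τ} (x := 1) (by unfold Bnd; omega)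
          (by rw [hi]; rfl) (by rw [hj]; rfl) hl
        simp only [hi, hj, Act.under] at h
        rw [AProc.subst_subst, ← scomp_inst, ← AProc.subst_subst] at h; exact h
    · refine (term_one _).trans (.res ?_); rw [← add_cons]
      refine (parM_pers _ _ _ _).trans (.par (.refl _) ((parM_pers _ _ _ _).trans ?_))
      rw [AProc.src_subst]; exact .par (.refl _) (Calculus.parM_singleton (P := AProc) r)
  | par Q _ ih =>
    intro Γ p e hp; obtain ⟨p₁, p₂, rfl, rfl, rfl⟩ := AProc.src_eq_par e; have .par hs h1 h2 := hp
    obtain ⟨p', T, e, h3, h4, h5⟩ := ih _ _ rfl h1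
    exact ⟨.par p' p₂, .par T p₂.enc, by rw [AProc.src, e], .par hs h3 h2,
      h4.lift (CMV.Proc.par · p₂.enc) fun _ _ => .par _, h5.par _⟩
  | res _ ih =>
    intro Γ p e hp; obtain ⟨p, rfl, rfl⟩ := AProc.src_eq_res e; have .res _ _ hd h1 := hp
    obtain ⟨p', T, e, h3, h4, h5⟩ := ih _ _ rfl h1
    exact ⟨.res p', .res T, by rw [AProc.src, e], .res _ _ hd h3,
      h4.lift CMV.Proc.res fun _ _ => .res, h5.res⟩
  | struct h1 _ h2 ih =>
    intro Γ p e hp; obtain ⟨p₁, e1, hp1, hc1⟩ := h1.lifts.1 Γ p e hp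
    obtain ⟨p₂, T, e2, hp2, hr, hg⟩ := ih _ _ e1 hp1
    obtain ⟨p₃, e3, hp3, hc3⟩ := h2.lifts.1 Γ p₂ e2 hp2
    rcases ReflTransGen.cases_head hr with rfl | ⟨T₁, h3, h4⟩
    · exact ⟨p₃, p.enc, e3, hp3, .refl, hg.cong hc1 hc3⟩
    · exact ⟨p₃, T, e3, hp3, .head (.struct hc1 h3 (.refl _)) h4, hg.cong (.refl _) hc3⟩

theorem enc_complete {Γ : Ctx} {p : AProc} (hp : Typing Γ p) {S : Proc}
    (hr : ReflTransGen Red p.src S) :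
    ∃ p' T, p'.src = S ∧ Typing Γ p' ∧ ReflTransGen CMV.Red p.enc T ∧ CMV.Bisim T p'.enc := by
  induction hr with
  | refl => exact ⟨p, p.enc, rfl, hp, .refl, bisimilar_equivalence.refl _⟩
  | tail _ hs ih =>
    obtain ⟨p₁, T₁, e, hp1, h1, h2⟩ := ih
    obtain ⟨p₂, T₂, e2, hp2, h3, h4⟩ := hs.simulates _ _ e hp1
    obtain ⟨X, V, D, h5, -⟩ := (At.start hp1).star h3
    obtain ⟨T₃, h6, h7⟩ := (bisimilar_isBisimulation T₁ p₁.enc h2).2.1 T₂ h3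
    exact ⟨p₂, T₃, e2, hp2, h1.trans h6,
      bisimilar_equivalence.trans h7 (h5.upToGarbage (At.start hp2) h4)⟩

end Mix

/-! ## The encoding is good -/

theorem mainTheorem7 :
    GoodEncoding Encoding.enc CMV.Bisim ∧
    ∀ {Γ : Mix.Ctx} {S : Mix.Proc} (d : Mix.Deriv Γ S),
      CoupledSimilar SumRed SumBarb (Sum.inl S) (Sum.inr (Encoding.enc d)) := by
  have hgood : GoodEncoding Encoding.enc CMV.Bisim := by
    refine ⟨bisimilar_equivalence, bisimilar_isBisimulation, ⟨_, Mix.enc_eq_fill⟩, ?_, ?_, ?_, ?_, ?_, ?_⟩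
    · intro Γ S d σ Δ h; obtain ⟨p, rfl, hp, e⟩ := Mix.exists_annotation d
      have hd := (hp.subst h.respSub).exists_deriv; rw [Mix.AProc.src_subst] at hd
      obtain ⟨d', e'⟩ := hd; refine ⟨d', ?_⟩; rw [e', ← e, ← Mix.AProc.enc_subst]
      exact bisimilar_equivalence.refl _
    · intro Γ S d S' hr; obtain ⟨p, rfl, hp, e⟩ := Mix.exists_annotation d
      obtain ⟨p', T, rfl, hp', h1, h2⟩ := Mix.enc_complete hp hr
      obtain ⟨d', e'⟩ := hp'.exists_deriv; grind
    · intro Γ S d T hr; obtain ⟨p, rfl, hp, e⟩ := Mix.exists_annotation d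
      obtain ⟨p', T', hp', h1, h2, h3⟩ := Mix.enc_sound hp (e ▸ hr)
      obtain ⟨d', e'⟩ := hp'.exists_deriv; grind
    · intro Γ S d hd; obtain ⟨p, rfl, hp, e⟩ := Mix.exists_annotation d
      exact Mix.enc_divergence hp (e ▸ hd)
    · intro Γ S d y; obtain ⟨p, rfl, hp, e⟩ := Mix.exists_annotation d; rw [← e]
      refine ⟨fun ⟨S', hr, hb⟩ => ?_, Mix.barb_enc hp⟩
      obtain ⟨p', T, rfl, hp', h1, h2⟩ := Mix.enc_complete hp hr
      obtain ⟨T', h3, h4⟩ := ((bisimilar_isBisimulation T p'.enc h2).2.2 y).mpr (Mix.enc_barb hp' hb)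
      exact ⟨T', h1.trans h3, h4⟩
    · intro Γ S d n Ss h; obtain ⟨p, rfl, hp, e⟩ := Mix.exists_annotation d
      obtain ⟨Δ, ps, h1, h2⟩ := Mix.Distributable.enc hp h
      have hd : ∀ i, ∃ d : Mix.Deriv (Δ i) (Ss i), Encoding.enc d = (ps i).enc := fun i => by
        rw [← (h1 i).1]; exact (h1 i).2.exists_deriv
      choose ds hds using hd
      refine ⟨Δ, ds, _, e ▸ h2, fun i => ?_⟩; rw [hds]; exact bisimilar_equivalence.refl _
  exact ⟨hgood, fun d => hgood.coupledSimilar d⟩
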